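/- **Conventions.** Let $\Bbbk$ be a commutative ring and $n\in\mathbb N$. $S_n$ is the symmetric group ($S_0$ trivial), $S_{n-1}\subset S_n$ is the stabiliser of the last point, $s_i\in S_n$ is the transposition of $i$ and $i+1$, $\mathbf 1_n=\Bbbk$ is the trivial $S_n$-module, and $V=\Bbbk^n$ is the permutation module with basis $v_1,\dots,v_n$. All morphisms in diagrammatic categories are read from bottom to top. **The partition category.** For $t\in\Bbbk$, $\mathrm{Par}(t)$ is the strict $\Bbbk$-linear monoidal category with objects $k\in\mathbb N$, whose morphisms $k\to l$ are the $\Bbbk$-linear combinations of partitions of $\{1,\dots,k\}\sqcup\{1',\dots,l'\}$ (drawn with the $k$ vertices in the bottom row and the $l$ vertices in the top row). Composition is bilinear with $E\circ D=t^{\alpha(E,D)}\,E\star D$, where $E\star D$ is obtained by stacking $E$ on top of $D$ and $\alpha(E,D)$ is the number of components lying entirely in the middle row. The tensor product is addition on objects and horizontal juxtaposition on diagrams. Let $\mu:2\to1$, $\delta:1\to2$, $\eta:0\to1$, $\varepsilon:1\to0$ be the diagrams with a single block, and $s:2\to2$ the crossing. **The functor $\Phi_n$.** $\Phi_n:\mathrm{Par}(n)\to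 S_n\text{-mod}$ is the $\Bbbk$-linear strong monoidal functor with $\Phi_n(k)=V^{\otimes k}$ (the coherence isomorphisms being the canonical identifications $V^{\otimes k}\otimes V^{\otimes l}=V^{\otimes(k+l)}$, $V^{\otimes0}=\mathbf 1_n$) and $$\mu\mapsto (v_i\otimes v_j\mapsto\delta_{ij}v_i),\quad \eta\mapsto\Bigl(1\mapsto\sum_i v_i\Bigr),\quad \delta\mapsto(v_i\mapsto v_i\otimes v_i),\quad \varepsilon\mapsto(v_i\mapsto1),\quad s\mapsto(v_i\otimes v_j\mapsto v_j\otimes v_i).$$ **The Heisenberg category.** $\mathcal Heis$ is the strict $\Bbbk$-linear monoidal category generated by objects $\uparrow,\downarrow$ and morphisms $x:\uparrow\uparrow\to\uparrow\uparrow$, $c:1\to\downarrow\uparrow$, $d:\uparrow\downarrow\to1$, $c':1\to\uparrow\downarrow$, $d':\downarrow\uparrow\to1$, subject to the following relations (identity morphisms of $\uparrow,\downarrow$ are denoted by the same arrows). * $x^2=1$ and the braid relation for $x$ on $\uparrow\uparrow\uparrow$. * The four zigzag relations $(d\uparrow)(\uparrow c)=1_\uparrow$, $(\downarrow d)(c\downarrow)=1_\downarrow$,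 $(\uparrow d')(c'\uparrow)=1_\uparrow$, $(d'\downarrow)(\downarrow c')=1_\downarrow$. * $l\,r=1_{\uparrow\downarrow}$, $\ r\,l=1_{\downarrow\uparrow}-c\,d'$, $\ (d'\uparrow)(\downarrow x)(c\uparrow)=0$, $\ d'c=1_1$, where $r=(\downarrow\uparrow d)(\downarrow x\downarrow)(c\uparrow\downarrow):\uparrow\downarrow\to\downarrow\uparrow$ and $l=(d'\uparrow\downarrow)(\downarrow x\downarrow)(\downarrow\uparrow c'):\downarrow\uparrow\to\uparrow\downarrow$ are the right and left crossings. The downward crossing is $x_\downarrow=(d'\downarrow\downarrow)(\downarrow l\downarrow)(\downarrow\downarrow c')$. **The category $\mathcal Peis(t)$.** It is the quotient of the full monoidal subcategory of $\mathcal Heis$ on the objects $(\uparrow\downarrow)^k$, $k\in\mathbb N$, by the tensor ideal generated by $d\,c'-t\cdot1_1$ (that is, the clockwise bubble is set equal to $t$). **The functor $\Psi_n$.** $\Psi_n:\mathrm{Par}(n)\to\mathcal Peis(n)$ is the strict $\Bbbk$-linear monoidal functor with $\Psi_n(k)=(\uparrow\downarrow)^k$ and $$\mu\mapsto\uparrow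 d'\downarrow,\quad \delta\mapsto\uparrow c\downarrow,\quad \eta\mapsto c',\quad \varepsilon\mapsto d,\quad s\mapsto(\uparrow r\downarrow)(x\,x_\downarrow)(\uparrow l\downarrow)+\uparrow(c\,d')\downarrow.$$ **The functor $\Omega_n$.** $\mathcal Heis$ acts on families $(M_m)_{m\in\mathbb N}$ of $S_m$-modules: $\uparrow$ sends $(M_m)$ to the family $(\Bbbk S_m\otimes_{m-1}M_{m-1})_m$ (zero in degree $0$), $\downarrow$ sends it to $(\mathrm{Res}\,M_{m+1})_m$, where $\otimes_m$ is the tensor product over $\Bbbk S_m$; words act by composites of functors, and morphisms by natural transformations, monoidally and $\Bbbk$-linearly, with $$\begin{aligned} x&:\ g\otimes h\otimes y\mapsto g h s_{m-1}\otimes1\otimes y &&(g\in S_m,\ h\in S_{m-1},\ y\in M_{m-2},\ m\ge2),\\ c&:\ y\mapsto 1\otimes y &&(y\in M_m,\ 1\in S_{m+1}),\\ d&:\ g\otimes y\mapsto gy &&(g\in S_m,\ y\in M_m,\ m\ge1),\\ c'&:\ y\mapsto\textstyle\sum_{i=1}^m g_i\otimes g_i^{-1}y &&(y\in M_m,\ m\ge1),\\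 d'&:\ g\otimes y\mapsto gy\ \text{ if } g\in S_m,\quad 0\ \text{ if } g\in S_{m+1}\setminus S_m &&(y\in M_m), \end{aligned}$$ where $g_i=s_is_{i+1}\cdots s_{m-1}\in S_m$ for $1\le i\le m$. Evaluating this action at the trivial modules in degree $n$ gives $\Omega_n:\mathcal Peis(n)\to S_n\text{-mod}$. Thus, for $n\ge1$ and $B=\Bbbk S_n$ viewed as an $(S_n,S_{n-1})$-bimodule or as an $S_{n-1}$-bimodule as needed, $$\Omega_n((\uparrow\downarrow)^k)=\underbrace{B\otimes_{n-1}\cdots\otimes_{n-1}B}_{k}\otimes_{n-1}\mathbf 1_{n-1}\ (k\ge1),\qquad \Omega_n(1)=\mathbf 1_n .$$ (The last factor is the restriction of $\mathbf 1_n$ to $S_{n-1}$.) For $n=0$ the module $\Omega_0((\uparrow\downarrow)^k)$ is $0$ when $k\ge1$. **Theorem.** The functors $\Phi_n$ and $\Psi_n$, the action of $\mathcal Heis$, and the induced functor $\Omega_n$ exist and are uniquely determined by the data above. The formula $$\beta_k(v_{i_k}\otimes\cdots\otimes v_{i_1})=g_{i_k}\otimes g_{i_k}^{-1}g_{i_{k-1}}\otimes\cdots\otimes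 g_{i_2}^{-1}g_{i_1}\otimes1\qquad(1\le i_1,\dots,i_k\le n)$$ (with $\beta_0(1)=1$) defines, for every $k\in\mathbb N$, an isomorphism of $S_n$-modules $\beta_k:\Phi_n(k)=V^{\otimes k}\to\Omega_n(\Psi_n(k))$, and the $\beta_k$, $k\in\mathbb N$, form a natural isomorphism of functors $\Phi_n\cong\Omega_n\circ\Psi_n$. -/

import Mathlib

open CategoryTheory

universe u

namespace PartHeis

/-! ### Partition diagrams -/

section Diagrams

variable {A B C D : Type}

/-- One step of adjacency in the three-row diagram obtained by stacking a diagram `E` with rows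
`B` (bottom) and `C` (top) on top of a diagram `D` with rows `A` (bottom) and `B` (top). -/
inductive StackStep (D : Setoid (A ⊕ B)) (E : Setoid (B ⊕ C)) : A ⊕ B ⊕ C → A ⊕ B ⊕ C → Prop
  | lower {x y : A ⊕ B} : D x y → StackStep D E (Sum.map id Sum.inl x) (Sum.map id Sum.inl y)
  | upper {x y : B ⊕ C} : E x y → StackStep D E (Sum.inr x) (Sum.inr y)

/-- The connected components of the three-row diagram: `E` stacked on top of `D`. -/
@[reducible] def stack (D : Setoid (A ⊕ B)) (E : Setoid (B ⊕ C)) : Setoid (A ⊕ B ⊕ C) :=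
  Relation.EqvGen.setoid (StackStep D E)

/-- `E ⋆ D`: the components of the stacked diagram, seen on the bottom and the top row only. -/
@[reducible] def star (D : Setoid (A ⊕ B)) (E : Setoid (B ⊕ C)) : Setoid (A ⊕ C) :=
  (stack D E).comap (Sum.map id Sum.inr)

/-- The components of the stacked diagram that contain only vertices of the middle row. -/
def Floating (D : Setoid (A ⊕ B)) (E : Setoid (B ⊕ C)) : Type :=
  {q : Quotient (stack D E) // ∀ x, Quotient.mk _ x = q → ∃ b : B, x = Sum.inr (Sum.inl b)}

/-- The number `α(E, D)` of components with vertices in the middle row only. -/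
noncomputable def floatingCard (D : Setoid (A ⊕ B)) (E : Setoid (B ⊕ C)) : ℕ :=
  Nat.card (Floating D E)

/-- The identity diagram: each bottom vertex is joined to the top vertex above it. -/
@[reducible] def idDiagram (A : Type) : Setoid (A ⊕ A) := Setoid.ker (Sum.elim id id)

/-- A two-colouring of the vertices is compatible with a diagram if it is constant on blocks.
Two-colourings are used below only to prove that composition of diagrams is associative. -/
def Compat (D : Setoid (A ⊕ B)) (a : A → Bool) (b : B → Bool) : Prop :=
  ∀ x y, D x y → Sum.elim a b x = Sum.elim a b y

theorem compat_stack (D : Setoid (A ⊕ B)) (E : Setoid (B ⊕ C)) (a : A → Bool) (b : B → Bool)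
    (c : C → Bool) (h1 : Compat D a b) (h2 : Compat E b c) (x y : A ⊕ B ⊕ C)
    (h : stack D E x y) : Sum.elim a (Sum.elim b c) x = Sum.elim a (Sum.elim b c) y := by
  induction h with
  | rel x y h =>
    cases h with
    | lower h =>
      rename_i x y
      have := h1 x y h
      rcases x with x | x <;> rcases y with y | y <;> simpa using this
    | upper h => exact h2 _ _ h
  | refl => rfl
  | symm _ _ _ ih => exact ih.symm
  | trans _ _ _ _ _ ih1 ih2 => exact ih1.trans ih2

theorem compat_star (D : Setoid (A ⊕ B)) (E : Setoid (B ⊕ C)) (a : A → Bool) (b : B → Bool)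
    (c : C → Bool) (h1 : Compat D a b) (h2 : Compat E b c) : Compat (star D E) a c := by
  intro x y h
  have := compat_stack D E a b c h1 h2 _ _ h
  rcases x with x | x <;> rcases y with y | y <;> simpa using this

open Classical in
/-- Extend a colouring of the floating components and of the outer rows to the middle row. -/
noncomputable def extendColouring (D : Setoid (A ⊕ B)) (E : Setoid (B ⊕ C)) (a : A → Bool)
    (c : C → Bool) (f : Floating D E → Bool) (q : Quotient (stack D E)) : Bool :=
  if h : ∃ x : A ⊕ C, Quotient.mk (stack D E) (Sum.map id Sum.inr x) = q then
    Sum.elim a c h.choose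
  else f ⟨q, fun x hx => by
    rcases x with x | x | x
    · exact (h ⟨Sum.inl x, hx⟩).elim
    · exact ⟨x, rfl⟩
    · exact (h ⟨Sum.inr x, hx⟩).elim⟩

theorem extendColouring_outer (D : Setoid (A ⊕ B)) (E : Setoid (B ⊕ C)) (a : A → Bool)
    (c : C → Bool) (f : Floating D E → Bool) (hs : Compat (star D E) a c) (x : A ⊕ C) :
    extendColouring D E a c f (Quotient.mk _ (Sum.map id Sum.inr x)) = Sum.elim a c x := by
  have h : ∃ y : A ⊕ C, Quotient.mk (stack D E) (Sum.map id Sum.inr y) =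
    Quotient.mk (stack D E) (Sum.map id Sum.inr x) := ⟨x, rfl⟩
  rw [extendColouring, dif_pos h]
  have h' : stack D E (Sum.map id Sum.inr h.choose) (Sum.map id Sum.inr x) :=
    Quotient.exact h.choose_spec
  exact hs _ _ h'

theorem extendColouring_floating (D : Setoid (A ⊕ B)) (E : Setoid (B ⊕ C)) (a : A → Bool)
    (c : C → Bool) (f : Floating D E → Bool) (q : Floating D E) :
    extendColouring D E a c f q.1 = f q := by
  have h : ¬ ∃ x : A ⊕ C, Quotient.mk (stack D E) (Sum.map id Sum.inr x) = q.1 := by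
    rintro ⟨x, hx⟩
    obtain ⟨b, hb⟩ := q.2 _ hx
    rcases x with x | x <;> simp at hb
  rw [extendColouring, dif_neg h]
  rfl

open Classical in
/-- Colourings of the middle row compatible with given colourings of the outer rows correspond to
arbitrary colourings of the floating components. -/
noncomputable def middleEquiv (D : Setoid (A ⊕ B)) (E : Setoid (B ⊕ C)) (a : A → Bool)
    (c : C → Bool) (hs : Compat (star D E) a c) :
    {b : B → Bool // Compat D a b ∧ Compat E b c} ≃ (Floating D E → Bool) where
  toFun b q := Quotient.lift (Sum.elim a (Sum.elim b.1 c))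
    (fun x y h => compat_stack D E a b.1 c b.2.1 b.2.2 x y h) q.1
  invFun f := ⟨fun b => extendColouring D E a c f (Quotient.mk _ (Sum.inr (Sum.inl b))), by
    have ha : ∀ x, a x = extendColouring D E a c f (Quotient.mk _ (Sum.inl x)) := fun x =>
      (extendColouring_outer D E a c f hs (Sum.inl x)).symm
    have hc : ∀ x, c x = extendColouring D E a c f (Quotient.mk _ (Sum.inr (Sum.inr x))) :=
      fun x => (extendColouring_outer D E a c f hs (Sum.inr x)).symm
    constructor
    · intro x y h
      have h' : stack D E (Sum.map id Sum.inl x) (Sum.map id Sum.inl y) :=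
        Relation.EqvGen.rel _ _ (StackStep.lower h)
      have h'' := congrArg (extendColouring D E a c f) (Quotient.sound h')
      rcases x with x | x <;> rcases y with y | y <;> simpa [ha] using h''
    · intro x y h
      have h' : stack D E (Sum.inr x) (Sum.inr y) := Relation.EqvGen.rel _ _ (StackStep.upper h)
      have h'' := congrArg (extendColouring D E a c f) (Quotient.sound h')
      rcases x with x | x <;> rcases y with y | y <;> simpa [hc] using h''⟩
  left_inv b := by
    apply Subtype.ext
    funext x
    by_cases h : ∃ y : A ⊕ C, Quotient.mk (stack D E) (Sum.map id Sum.inr y) =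
        Quotient.mk (stack D E) (Sum.inr (Sum.inl x))
    · obtain ⟨y, hy⟩ := h
      have h1 := compat_stack D E a b.1 c b.2.1 b.2.2 _ _ (Quotient.exact hy)
      simp only
      rw [← hy, extendColouring_outer D E a c _ hs]
      rcases y with y | y <;> simpa using h1
    · simp only [extendColouring]
      rw [dif_neg h]
      rfl
  right_inv f := by
    funext q
    obtain ⟨q, hq⟩ := q
    induction q using Quotient.inductionOn with
    | h x =>
      obtain ⟨b, rfl⟩ := hq x rfl
      exact extendColouring_floating D E a c f ⟨_, hq⟩

theorem card_middle [Finite A] [Finite B] [Finite C] (D : Setoid (A ⊕ B)) (E : Setoid (B ⊕ C))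
    (a : A → Bool) (c : C → Bool) (hs : Compat (star D E) a c) :
    Nat.card {b : B → Bool // Compat D a b ∧ Compat E b c} = 2 ^ floatingCard D E := by
  have : Finite (Floating D E) := Subtype.finite
  rw [Nat.card_congr (middleEquiv D E a c hs), Nat.card_fun, floatingCard, Nat.card_eq_fintype_card,
    Fintype.card_bool]

theorem compat_const (D : Setoid (A ⊕ B)) : Compat D (fun _ => true) (fun _ => true) := by
  rintro (x | x) (y | y) _ <;> rfl

open Classical in
theorem setoid_ext_of_compat {D E : Setoid (A ⊕ B)} (h : ∀ a b, Compat D a b ↔ Compat E a b) :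
    D = E := by
  have key : ∀ D E : Setoid (A ⊕ B), (∀ a b, Compat D a b → Compat E a b) →
      ∀ x y, E x y → D x y := by
    intro D E h x y hxy
    have h1 : Compat D (fun z => decide (D x (Sum.inl z))) (fun z => decide (D x (Sum.inr z))) := by
      intro u v huv
      have h2 : D x u ↔ D x v := ⟨fun h => D.trans h huv, fun h => D.trans h (D.symm huv)⟩
      rcases u with u | u <;> rcases v with v | v <;> simp [h2]
    have h3 := h _ _ h1 x y hxy
    have hx : D x x := D.refl x
    rcases x with x | x <;> rcases y with y | y <;> simpa [hx] using h3
  ext x y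
  exact ⟨key E D (fun a b => (h a b).2) x y, key D E (fun a b => (h a b).1) x y⟩

theorem compat_id (a b : A → Bool) : Compat (idDiagram A) a b ↔ a = b := by
  constructor
  · intro h
    funext x
    exact h (Sum.inl x) (Sum.inr x) rfl
  · rintro rfl (x | x) (y | y) h <;> exact congrArg a h

theorem count_iff [Finite A] [Finite B] [Finite C] (D : Setoid (A ⊕ B)) (E : Setoid (B ⊕ C))
    (a : A → Bool) (c : C → Bool) :
    Nat.card {b : B → Bool // Compat D a b ∧ Compat E b c} ≠ 0 ↔ Compat (star D E) a c := by
  constructor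
  · intro h
    obtain ⟨b, h1, h2⟩ := (Nat.card_ne_zero.1 h).1
    exact compat_star D E a b c h1 h2
  · intro h
    rw [card_middle D E a c h]
    positivity

theorem id_star [Finite A] [Finite B] (D : Setoid (A ⊕ B)) :
    star (idDiagram A) D = D ∧ floatingCard (idDiagram A) D = 0 := by
  have key : ∀ a c, Compat D a c →
      Nat.card {b : A → Bool // Compat (idDiagram A) a b ∧ Compat D b c} = 1 := by
    intro a c h
    rw [Nat.card_eq_one_iff_unique]
    exact ⟨⟨fun x y => Subtype.ext (((compat_id _ _).1 x.2.1).symm.trans ((compat_id _ _).1 y.2.1))⟩,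
      ⟨a, (compat_id _ _).2 rfl, h⟩⟩
  constructor
  · apply setoid_ext_of_compat
    intro a c
    constructor
    · intro h
      obtain ⟨b, h1, h2⟩ := (Nat.card_ne_zero.1 ((count_iff _ _ a c).2 h)).1
      rwa [(compat_id _ _).1 h1]
    · intro h
      rw [← count_iff, key a c h]
      exact one_ne_zero
  · have h := key _ _ (compat_const D)
    rw [card_middle _ _ _ _ (compat_const _)] at h
    simpa using h

theorem star_id [Finite A] [Finite B] (D : Setoid (A ⊕ B)) :
    star D (idDiagram B) = D ∧ floatingCard D (idDiagram B) = 0 := by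
  have key : ∀ a c, Compat D a c →
      Nat.card {b : B → Bool // Compat D a b ∧ Compat (idDiagram B) b c} = 1 := by
    intro a c h
    rw [Nat.card_eq_one_iff_unique]
    exact ⟨⟨fun x y => Subtype.ext (((compat_id _ _).1 x.2.2).trans ((compat_id _ _).1 y.2.2).symm)⟩,
      ⟨c, h, (compat_id _ _).2 rfl⟩⟩
  constructor
  · apply setoid_ext_of_compat
    intro a c
    constructor
    · intro h
      obtain ⟨b, h1, h2⟩ := (Nat.card_ne_zero.1 ((count_iff _ _ a c).2 h)).1
      rwa [← (compat_id _ _).1 h2]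
    · intro h
      rw [← count_iff, key a c h]
      exact one_ne_zero
  · have h := key _ _ (compat_const D)
    rw [card_middle _ _ _ _ (compat_const _)] at h
    simpa using h

/-- Colourings of both middle rows of three stacked diagrams. -/
abbrev DoubleMiddle (F : Setoid (A ⊕ B)) (G : Setoid (B ⊕ C)) (H : Setoid (C ⊕ D))
    (a : A → Bool) (d : D → Bool) : Type :=
  {p : (B → Bool) × (C → Bool) // Compat F a p.1 ∧ Compat G p.1 p.2 ∧ Compat H p.2 d}

/-- Group the colourings of both middle rows by the colouring of the upper one. -/
def doubleEquivLeft (F : Setoid (A ⊕ B)) (G : Setoid (B ⊕ C)) (H : Setoid (C ⊕ D))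
    (a : A → Bool) (d : D → Bool) : DoubleMiddle F G H a d ≃
      Σ c : {c : C → Bool // Compat (star F G) a c ∧ Compat H c d},
        {b : B → Bool // Compat F a b ∧ Compat G b c.1} where
  toFun p := ⟨⟨p.1.2, compat_star _ _ _ _ _ p.2.1 p.2.2.1, p.2.2.2⟩, ⟨p.1.1, p.2.1, p.2.2.1⟩⟩
  invFun q := ⟨(q.2.1, q.1.1), q.2.2.1, q.2.2.2, q.1.2.2⟩
  left_inv _ := rfl
  right_inv _ := rfl

/-- Group the colourings of both middle rows by the colouring of the lower one. -/
def doubleEquivRight (F : Setoid (A ⊕ B)) (G : Setoid (B ⊕ C)) (H : Setoid (C ⊕ D))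
    (a : A → Bool) (d : D → Bool) : DoubleMiddle F G H a d ≃
      Σ b : {b : B → Bool // Compat F a b ∧ Compat (star G H) b d},
        {c : C → Bool // Compat G b.1 c ∧ Compat H c d} where
  toFun p := ⟨⟨p.1.1, p.2.1, compat_star _ _ _ _ _ p.2.2.1 p.2.2.2⟩, ⟨p.1.2, p.2.2.1, p.2.2.2⟩⟩
  invFun q := ⟨(q.1.1, q.2.1), q.1.2.1, q.2.2.1, q.2.2.2⟩
  left_inv _ := rfl
  right_inv _ := rfl

theorem card_double_left [Finite A] [Finite B] [Finite C] [Finite D] (F : Setoid (A ⊕ B))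
    (G : Setoid (B ⊕ C)) (H : Setoid (C ⊕ D)) (a : A → Bool) (d : D → Bool) :
    Nat.card (DoubleMiddle F G H a d) =
      Nat.card {c : C → Bool // Compat (star F G) a c ∧ Compat H c d} * 2 ^ floatingCard F G := by
  classical
  have := Fintype.ofFinite {c : C → Bool // Compat (star F G) a c ∧ Compat H c d}
  rw [Nat.card_congr (doubleEquivLeft F G H a d), Nat.card_sigma,
    Finset.sum_congr rfl (fun c _ => card_middle F G a c.1 c.2.1), Finset.sum_const,
    Finset.card_univ, Nat.card_eq_fintype_card, smul_eq_mul]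

theorem card_double_right [Finite A] [Finite B] [Finite C] [Finite D] (F : Setoid (A ⊕ B))
    (G : Setoid (B ⊕ C)) (H : Setoid (C ⊕ D)) (a : A → Bool) (d : D → Bool) :
    Nat.card (DoubleMiddle F G H a d) =
      Nat.card {b : B → Bool // Compat F a b ∧ Compat (star G H) b d} * 2 ^ floatingCard G H := by
  classical
  have := Fintype.ofFinite {b : B → Bool // Compat F a b ∧ Compat (star G H) b d}
  rw [Nat.card_congr (doubleEquivRight F G H a d), Nat.card_sigma,
    Finset.sum_congr rfl (fun b _ => card_middle G H b.1 d b.2.2), Finset.sum_const,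
    Finset.card_univ, Nat.card_eq_fintype_card, smul_eq_mul]

theorem star_assoc [Finite A] [Finite B] [Finite C] [Finite D] (F : Setoid (A ⊕ B))
    (G : Setoid (B ⊕ C)) (H : Setoid (C ⊕ D)) :
    star (star F G) H = star F (star G H) ∧
      floatingCard F G + floatingCard (star F G) H =
        floatingCard G H + floatingCard F (star G H) := by
  constructor
  · apply setoid_ext_of_compat
    intro a d
    rw [← count_iff, ← count_iff]
    have h := (card_double_left F G H a d).symm.trans (card_double_right F G H a d)
    constructor <;> intro h' h0
    · rw [h0, zero_mul] at h
      exact h' ((mul_eq_zero.1 h).resolve_right (by positivity))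
    · rw [h0, zero_mul] at h
      exact h' ((mul_eq_zero.1 h.symm).resolve_right (by positivity))
  · have h := (card_double_left F G H _ _).symm.trans
      (card_double_right F G H (fun _ => true) (fun _ => true))
    rw [card_middle _ _ _ _ (compat_const _), card_middle _ _ _ _ (compat_const _), ← pow_add,
      ← pow_add] at h
    have := Nat.pow_right_injective (le_refl 2) h
    omega

end Diagrams


/-! ### The partition category -/

/-- The partition category `Par(t)` over `𝕜`: its objects are the natural numbers. -/
structure Par (𝕜 : Type u) (t : 𝕜) where
  /-- the natural number underlying an object -/
  size : ℕ

section ParCategory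

variable {𝕜 : Type u} [CommRing 𝕜] {t : 𝕜}

/-- Partition diagrams `m → l`: partitions of `{1, …, m} ⊔ {1', …, l'}` (as equivalence
relations), with `m` vertices in the bottom row and `l` vertices in the top row. Both rows are
indexed from left to right. -/
abbrev Diagram (m l : ℕ) : Type := Setoid (Fin m ⊕ Fin l)

/-- Morphisms of `Par(t)`: `𝕜`-linear combinations of partition diagrams. -/
abbrev ParHom (𝕜 : Type u) [CommRing 𝕜] (m l : ℕ) : Type u := Diagram m l →₀ 𝕜

/-- Vertical composition: `E ∘ D = t ^ α(E, D) • (E ⋆ D)`, extended bilinearly. The first argument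
is the lower diagram. -/
noncomputable def parComp (t : 𝕜) {m l k : ℕ} (f : ParHom 𝕜 m l) (g : ParHom 𝕜 l k) :
    ParHom 𝕜 m k :=
  f.sum fun D a => g.sum fun E b => Finsupp.single (star D E) (a * b * t ^ floatingCard D E)

theorem parComp_single (t : 𝕜) {m l k : ℕ} (D : Diagram m l) (E : Diagram l k) (a b : 𝕜) :
    parComp t (Finsupp.single D a) (Finsupp.single E b) =
      Finsupp.single (star D E) (a * b * t ^ floatingCard D E) := by
  simp [parComp]

theorem parComp_add_left (t : 𝕜) {m l k : ℕ} (f f' : ParHom 𝕜 m l) (g : ParHom 𝕜 l k) :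
    parComp t (f + f') g = parComp t f g + parComp t f' g := by
  classical
  rw [parComp, Finsupp.sum_add_index']
  · rfl
  · simp
  · intro D a b
    simp [add_mul, Finsupp.sum_add]

theorem parComp_add_right (t : 𝕜) {m l k : ℕ} (f : ParHom 𝕜 m l) (g g' : ParHom 𝕜 l k) :
    parComp t f (g + g') = parComp t f g + parComp t f g' := by
  classical
  simp only [parComp]
  rw [← Finsupp.sum_add]
  refine Finsupp.sum_congr fun D _ => ?_
  rw [Finsupp.sum_add_index']
  · simp
  · intro E a b
    simp [mul_add, add_mul]

theorem parComp_smul_left (t : 𝕜) {m l k : ℕ} (r : 𝕜) (f : ParHom 𝕜 m l) (g : ParHom 𝕜 l k) :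
    parComp t (r • f) g = r • parComp t f g := by
  classical
  rw [parComp, Finsupp.sum_smul_index (by simp), parComp, Finsupp.smul_sum]
  refine Finsupp.sum_congr fun D _ => ?_
  rw [Finsupp.smul_sum]
  refine Finsupp.sum_congr fun E _ => ?_
  simp only [Finsupp.smul_single, smul_eq_mul, mul_assoc]

theorem parComp_smul_right (t : 𝕜) {m l k : ℕ} (r : 𝕜) (f : ParHom 𝕜 m l) (g : ParHom 𝕜 l k) :
    parComp t f (r • g) = r • parComp t f g := by
  classical
  rw [parComp, parComp, Finsupp.smul_sum]
  refine Finsupp.sum_congr fun D _ => ?_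
  rw [Finsupp.sum_smul_index (by simp), Finsupp.smul_sum]
  refine Finsupp.sum_congr fun E _ => ?_
  simp only [Finsupp.smul_single, smul_eq_mul]
  congr 1
  ring

theorem parComp_zero_left (t : 𝕜) {m l k : ℕ} (g : ParHom 𝕜 l k) :
    parComp t (0 : ParHom 𝕜 m l) g = 0 := by
  simp [parComp]

theorem parComp_zero_right (t : 𝕜) {m l k : ℕ} (f : ParHom 𝕜 m l) :
    parComp t f (0 : ParHom 𝕜 l k) = 0 := by
  simp [parComp]

/-- The identity morphism of `m` in the partition category. -/
noncomputable def parId (𝕜 : Type u) [CommRing 𝕜] (m : ℕ) : ParHom 𝕜 m m :=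
  Finsupp.single (idDiagram (Fin m)) 1

theorem parId_comp (t : 𝕜) {m l : ℕ} (f : ParHom 𝕜 m l) : parComp t (parId 𝕜 m) f = f := by
  induction f using Finsupp.induction_linear with
  | zero => exact parComp_zero_right t _
  | add f g hf hg => rw [parComp_add_right, hf, hg]
  | single D a => rw [parId, parComp_single, (id_star D).1, (id_star D).2]; simp

theorem parComp_id (t : 𝕜) {m l : ℕ} (f : ParHom 𝕜 m l) : parComp t f (parId 𝕜 l) = f := by
  induction f using Finsupp.induction_linear with
  | zero => exact parComp_zero_left t _
  | add f g hf hg => rw [parComp_add_left, hf, hg]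
  | single D a => rw [parId, parComp_single, (star_id D).1, (star_id D).2]; simp

theorem parComp_assoc (t : 𝕜) {m l k j : ℕ} (f : ParHom 𝕜 m l) (g : ParHom 𝕜 l k)
    (h : ParHom 𝕜 k j) : parComp t (parComp t f g) h = parComp t f (parComp t g h) := by
  induction f using Finsupp.induction_linear with
  | zero => simp only [parComp_zero_left]
  | add f f' hf hf' => simp only [parComp_add_left, hf, hf']
  | single D a =>
    induction g using Finsupp.induction_linear with
    | zero => simp only [parComp_zero_left, parComp_zero_right]
    | add g g' hg hg' => simp only [parComp_add_left, parComp_add_right, hg, hg']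
    | single E b =>
      induction h using Finsupp.induction_linear with
      | zero => simp only [parComp_zero_right]
      | add h h' hh hh' => simp only [parComp_add_right, hh, hh']
      | single F c =>
        simp only [parComp_single]
        rw [(star_assoc D E F).1]
        congr 1
        have h1 := congrArg (fun e => a * b * c * t ^ e) (star_assoc D E F).2
        simp only [pow_add] at h1
        linear_combination h1

noncomputable instance : Category (Par 𝕜 t) where
  Hom X Y := ParHom 𝕜 X.size Y.size
  id X := parId 𝕜 X.size
  comp f g := parComp t f g
  id_comp f := parId_comp t f
  comp_id f := parComp_id t f
  assoc f g h := parComp_assoc t f g h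

noncomputable instance : Preadditive (Par 𝕜 t) where
  homGroup X Y := inferInstanceAs (AddCommGroup (ParHom 𝕜 X.size Y.size))
  add_comp _ _ _ f f' g := parComp_add_left t f f' g
  comp_add _ _ _ f g g' := parComp_add_right t f g g'

noncomputable instance : Linear 𝕜 (Par 𝕜 t) where
  homModule X Y := inferInstanceAs (Module 𝕜 (ParHom 𝕜 X.size Y.size))
  smul_comp _ _ _ r f g := parComp_smul_left t r f g
  comp_smul _ _ _ f r g := parComp_smul_right t r f g

/-- The disjoint union of two partitions. -/
@[reducible] def sumSetoid {X Y : Type} (D : Setoid X) (E : Setoid Y) : Setoid (X ⊕ Y) where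
  r := Sum.LiftRel D E
  iseqv := by
    refine ⟨fun x => ?_, fun {x y} h => ?_, fun {x y z} h h' => ?_⟩
    · rcases x with x | x
      · exact Sum.LiftRel.inl (D.refl x)
      · exact Sum.LiftRel.inr (E.refl x)
    · cases h with
      | inl h => exact Sum.LiftRel.inl (D.symm h)
      | inr h => exact Sum.LiftRel.inr (E.symm h)
    · cases h with
      | inl h => cases h' with
        | inl h' => exact Sum.LiftRel.inl (D.trans h h')
      | inr h => cases h' with
        | inr h' => exact Sum.LiftRel.inr (E.trans h h')

/-- Split the vertices of a diagram of type `m + m' → l + l'` into the vertices among the first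
`m` (resp. `l`) positions of each row and the remaining ones. -/
def splitVertices (m l m' l' : ℕ) :
    Fin (m + m') ⊕ Fin (l + l') ≃ (Fin m ⊕ Fin l) ⊕ (Fin m' ⊕ Fin l') :=
  (Equiv.sumCongr finSumFinEquiv.symm finSumFinEquiv.symm).trans (Equiv.sumSumSumComm _ _ _ _)

/-- Horizontal juxtaposition of diagrams: `D` on the left of `E`. -/
@[reducible] def juxtapose {m l m' l' : ℕ} (D : Diagram m l) (E : Diagram m' l') :
    Diagram (m + m') (l + l') :=
  (sumSetoid D E).comap (splitVertices m l m' l')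

/-- The tensor product of morphisms of the partition category, extended bilinearly from
horizontal juxtaposition of diagrams. -/
noncomputable def parTensor {m l m' l' : ℕ} (f : ParHom 𝕜 m l) (g : ParHom 𝕜 m' l') :
    ParHom 𝕜 (m + m') (l + l') :=
  f.sum fun D a => g.sum fun E b => Finsupp.single (juxtapose D E) (a * b)

variable (𝕜)

/-- The generator `μ : 2 → 1`: all vertices in one block. -/
noncomputable def parMul : ParHom 𝕜 2 1 := Finsupp.single ⊤ 1

/-- The generator `δ : 1 → 2`: all vertices in one block. -/
noncomputable def parComul : ParHom 𝕜 1 2 := Finsupp.single ⊤ 1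

/-- The generator `η : 0 → 1`: the unique diagram of this type. -/
noncomputable def parUnit : ParHom 𝕜 0 1 := Finsupp.single ⊤ 1

/-- The generator `ε : 1 → 0`: the unique diagram of this type. -/
noncomputable def parCounit : ParHom 𝕜 1 0 := Finsupp.single ⊤ 1

/-- The generator `s : 2 → 2`: each bottom vertex is joined to the opposite top vertex. -/
noncomputable def parSwap : ParHom 𝕜 2 2 := Finsupp.single (Setoid.ker (Sum.elim id Fin.rev)) 1

end ParCategory


/-! ### The Heisenberg category -/

/-- The two generating objects `↑` and `↓` of the Heisenberg category. -/
inductive Arrow : Type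
  | up
  | down

/-- The objects of the Heisenberg category: words in `↑` and `↓`. -/
abbrev Word : Type := List Arrow

open Arrow

/-- Expressions for morphisms of the Heisenberg category. The constructors `cross b`, …, `capL b`
stand for `x ⊗ 1_b` for a generating morphism `x`, and `cons c f` stands for `1_c ⊗ f` for a
generating object `c`. In `comp f g` the morphism `f` is applied first, so that it is drawn below
`g`. Words are read from left to right. -/
inductive HeisTerm (𝕜 : Type u) : Word → Word → Type u
  | id (w : Word) : HeisTerm 𝕜 w w
  | comp {u v w : Word} : HeisTerm 𝕜 u v → HeisTerm 𝕜 v w → HeisTerm 𝕜 u w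
  /-- the upward crossing `↑↑ → ↑↑` -/
  | cross (b : Word) : HeisTerm 𝕜 (up :: up :: b) (up :: up :: b)
  /-- the cup `1 → ↓↑` -/
  | cupR (b : Word) : HeisTerm 𝕜 b (down :: up :: b)
  /-- the cap `↑↓ → 1` -/
  | capR (b : Word) : HeisTerm 𝕜 (up :: down :: b) b
  /-- the cup `1 → ↑↓` -/
  | cupL (b : Word) : HeisTerm 𝕜 b (up :: down :: b)
  /-- the cap `↓↑ → 1` -/
  | capL (b : Word) : HeisTerm 𝕜 (down :: up :: b) b
  | cons (c : Arrow) {u v : Word} : HeisTerm 𝕜 u v → HeisTerm 𝕜 (c :: u) (c :: v)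
  | zero (u v : Word) : HeisTerm 𝕜 u v
  | add {u v : Word} : HeisTerm 𝕜 u v → HeisTerm 𝕜 u v → HeisTerm 𝕜 u v
  | smul {u v : Word} : 𝕜 → HeisTerm 𝕜 u v → HeisTerm 𝕜 u v

namespace HeisTerm

variable {𝕜 : Type u}

/-- The right crossing `↑↓ → ↓↑` (tensored with `1_b` on the right). -/
def rightCross (b : Word) : HeisTerm 𝕜 (up :: down :: b) (down :: up :: b) :=
  comp (cupR (up :: down :: b))
    (comp (cons down (cross (down :: b))) (cons down (cons up (capR b))))

/-- The left crossing `↓↑ → ↑↓` (tensored with `1_b` on the right). -/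
def leftCross (b : Word) : HeisTerm 𝕜 (down :: up :: b) (up :: down :: b) :=
  comp (cons down (cons up (cupL b)))
    (comp (cons down (cross (down :: b))) (capL (up :: down :: b)))

/-- The downward crossing `↓↓ → ↓↓` (tensored with `1_b` on the right). -/
def downCross (b : Word) : HeisTerm 𝕜 (down :: down :: b) (down :: down :: b) :=
  comp (cons down (cons down (cupL b)))
    (comp (cons down (leftCross (down :: b))) (capL (down :: down :: b)))

/-- Right whiskering `f ⊗ 1_c`. -/
def whiskerRight (c : Word) : {u v : Word} → HeisTerm 𝕜 u v → HeisTerm 𝕜 (u ++ c) (v ++ c)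
  | _, _, id w => id (w ++ c)
  | _, _, comp f g => comp (whiskerRight c f) (whiskerRight c g)
  | _, _, cross b => cross (b ++ c)
  | _, _, cupR b => cupR (b ++ c)
  | _, _, capR b => capR (b ++ c)
  | _, _, cupL b => cupL (b ++ c)
  | _, _, capL b => capL (b ++ c)
  | _, _, cons a f => cons a (whiskerRight c f)
  | _, _, zero u v => zero (u ++ c) (v ++ c)
  | _, _, add f g => add (whiskerRight c f) (whiskerRight c g)
  | _, _, smul r f => smul r (whiskerRight c f)

end HeisTerm

open HeisTerm in
/-- The relations of the Heisenberg category: the smallest congruence on expressions that contains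
the axioms of a strict `𝕜`-linear monoidal category and the defining relations. -/
inductive HeisRel (𝕜 : Type u) [CommRing 𝕜] :
    {u v : Word} → HeisTerm 𝕜 u v → HeisTerm 𝕜 u v → Prop
  -- congruence
  | refl {u v : Word} (f : HeisTerm 𝕜 u v) : HeisRel 𝕜 f f
  | symm {u v : Word} {f g : HeisTerm 𝕜 u v} : HeisRel 𝕜 f g → HeisRel 𝕜 g f
  | trans {u v : Word} {f g h : HeisTerm 𝕜 u v} : HeisRel 𝕜 f g → HeisRel 𝕜 g h → HeisRel 𝕜 f h
  | comp_congr {u v w : Word} {f f' : HeisTerm 𝕜 u v} {g g' : HeisTerm 𝕜 v w} :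
      HeisRel 𝕜 f f' → HeisRel 𝕜 g g' → HeisRel 𝕜 (comp f g) (comp f' g')
  | cons_congr (c : Arrow) {u v : Word} {f f' : HeisTerm 𝕜 u v} :
      HeisRel 𝕜 f f' → HeisRel 𝕜 (cons c f) (cons c f')
  | add_congr {u v : Word} {f f' g g' : HeisTerm 𝕜 u v} :
      HeisRel 𝕜 f f' → HeisRel 𝕜 g g' → HeisRel 𝕜 (add f g) (add f' g')
  | smul_congr (r : 𝕜) {u v : Word} {f f' : HeisTerm 𝕜 u v} :
      HeisRel 𝕜 f f' → HeisRel 𝕜 (smul r f) (smul r f')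
  -- category axioms
  | id_comp {u v : Word} (f : HeisTerm 𝕜 u v) : HeisRel 𝕜 (comp (id u) f) f
  | comp_id {u v : Word} (f : HeisTerm 𝕜 u v) : HeisRel 𝕜 (comp f (id v)) f
  | assoc {u v w x : Word} (f : HeisTerm 𝕜 u v) (g : HeisTerm 𝕜 v w) (h : HeisTerm 𝕜 w x) :
      HeisRel 𝕜 (comp (comp f g) h) (comp f (comp g h))
  -- morphism spaces are modules
  | add_assoc {u v : Word} (f g h : HeisTerm 𝕜 u v) :
      HeisRel 𝕜 (add (add f g) h) (add f (add g h))
  | add_comm {u v : Word} (f g : HeisTerm 𝕜 u v) : HeisRel 𝕜 (add f g) (add g f)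
  | zero_add {u v : Word} (f : HeisTerm 𝕜 u v) : HeisRel 𝕜 (add (zero u v) f) f
  | add_neg {u v : Word} (f : HeisTerm 𝕜 u v) : HeisRel 𝕜 (add f (smul (-1) f)) (zero u v)
  | smul_add (r : 𝕜) {u v : Word} (f g : HeisTerm 𝕜 u v) :
      HeisRel 𝕜 (smul r (add f g)) (add (smul r f) (smul r g))
  | add_smul (r r' : 𝕜) {u v : Word} (f : HeisTerm 𝕜 u v) :
      HeisRel 𝕜 (smul (r + r') f) (add (smul r f) (smul r' f))
  | mul_smul (r r' : 𝕜) {u v : Word} (f : HeisTerm 𝕜 u v) :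
      HeisRel 𝕜 (smul (r * r') f) (smul r (smul r' f))
  | one_smul {u v : Word} (f : HeisTerm 𝕜 u v) : HeisRel 𝕜 (smul 1 f) f
  -- composition is bilinear
  | add_comp {u v w : Word} (f f' : HeisTerm 𝕜 u v) (g : HeisTerm 𝕜 v w) :
      HeisRel 𝕜 (comp (add f f') g) (add (comp f g) (comp f' g))
  | comp_add {u v w : Word} (f : HeisTerm 𝕜 u v) (g g' : HeisTerm 𝕜 v w) :
      HeisRel 𝕜 (comp f (add g g')) (add (comp f g) (comp f g'))
  | smul_comp (r : 𝕜) {u v w : Word} (f : HeisTerm 𝕜 u v) (g : HeisTerm 𝕜 v w) :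
      HeisRel 𝕜 (comp (smul r f) g) (smul r (comp f g))
  | comp_smul (r : 𝕜) {u v w : Word} (f : HeisTerm 𝕜 u v) (g : HeisTerm 𝕜 v w) :
      HeisRel 𝕜 (comp f (smul r g)) (smul r (comp f g))
  -- `1_c ⊗ -` is a linear functor
  | cons_id (c : Arrow) (w : Word) : HeisRel 𝕜 (cons c (id w)) (id (c :: w))
  | cons_comp (c : Arrow) {u v w : Word} (f : HeisTerm 𝕜 u v) (g : HeisTerm 𝕜 v w) :
      HeisRel 𝕜 (cons c (comp f g)) (comp (cons c f) (cons c g))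
  | cons_add (c : Arrow) {u v : Word} (f g : HeisTerm 𝕜 u v) :
      HeisRel 𝕜 (cons c (add f g)) (add (cons c f) (cons c g))
  | cons_smul (c : Arrow) (r : 𝕜) {u v : Word} (f : HeisTerm 𝕜 u v) :
      HeisRel 𝕜 (cons c (smul r f)) (smul r (cons c f))
  -- the interchange law `(1 ⊗ f) ∘ (x ⊗ 1) = (x ⊗ 1) ∘ (1 ⊗ f)`, for `x` a generating morphism
  | cross_naturality {b b' : Word} (f : HeisTerm 𝕜 b b') :
      HeisRel 𝕜 (comp (cross b) (cons up (cons up f))) (comp (cons up (cons up f)) (cross b'))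
  | cupR_naturality {b b' : Word} (f : HeisTerm 𝕜 b b') :
      HeisRel 𝕜 (comp (cupR b) (cons down (cons up f))) (comp f (cupR b'))
  | capR_naturality {b b' : Word} (f : HeisTerm 𝕜 b b') :
      HeisRel 𝕜 (comp (capR b) f) (comp (cons up (cons down f)) (capR b'))
  | cupL_naturality {b b' : Word} (f : HeisTerm 𝕜 b b') :
      HeisRel 𝕜 (comp (cupL b) (cons up (cons down f))) (comp f (cupL b'))
  | capL_naturality {b b' : Word} (f : HeisTerm 𝕜 b b') :
      HeisRel 𝕜 (comp (capL b) f) (comp (cons down (cons up f)) (capL b'))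
  -- the relations of the symmetric group for upward crossings
  | cross_cross (b : Word) : HeisRel 𝕜 (comp (cross b) (cross b)) (id (up :: up :: b))
  | braid (b : Word) :
      HeisRel 𝕜 (comp (cross (up :: b)) (comp (cons up (cross b)) (cross (up :: b))))
        (comp (cons up (cross b)) (comp (cross (up :: b)) (cons up (cross b))))
  -- isotopy: the four ways of straightening a zigzag
  | zigzag_upR (b : Word) :
      HeisRel 𝕜 (comp (cons up (cupR b)) (capR (up :: b))) (id (up :: b))
  | zigzag_downR (b : Word) :
      HeisRel 𝕜 (comp (cupR (down :: b)) (cons down (capR b))) (id (down :: b))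
  | zigzag_upL (b : Word) :
      HeisRel 𝕜 (comp (cupL (up :: b)) (cons up (capL b))) (id (up :: b))
  | zigzag_downL (b : Word) :
      HeisRel 𝕜 (comp (cons down (cupL b)) (capL (down :: b))) (id (down :: b))
  -- the Heisenberg relations
  | right_left (b : Word) :
      HeisRel 𝕜 (comp (rightCross b) (leftCross b)) (id (up :: down :: b))
  | left_right (b : Word) :
      HeisRel 𝕜 (comp (leftCross b) (rightCross b))
        (add (id (down :: up :: b)) (smul (-1) (comp (capL b) (cupR b))))
  | left_curl (b : Word) :
      HeisRel 𝕜 (comp (cupR (up :: b)) (comp (cons down (cross b)) (capL (up :: b))))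
        (zero (up :: b) (up :: b))
  | bubble (b : Word) : HeisRel 𝕜 (comp (cupR b) (capL b)) (id b)

section Heisenberg

variable {𝕜 : Type u} [CommRing 𝕜]

theorem HeisRel.whiskerRight (c : Word) {u v : Word} {f g : HeisTerm 𝕜 u v}
    (h : HeisRel 𝕜 f g) : HeisRel 𝕜 (f.whiskerRight c) (g.whiskerRight c) := by
  induction h with
  | refl f => exact .refl _
  | symm _ ih => exact .symm ih
  | trans _ _ ih ih' => exact .trans ih ih'
  | comp_congr _ _ ih ih' => exact .comp_congr ih ih'
  | cons_congr a _ ih => exact .cons_congr a ih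
  | add_congr _ _ ih ih' => exact .add_congr ih ih'
  | smul_congr r _ ih => exact .smul_congr r ih
  | id_comp f => exact .id_comp _
  | comp_id f => exact .comp_id _
  | assoc f g h => exact .assoc _ _ _
  | add_assoc f g h => exact .add_assoc _ _ _
  | add_comm f g => exact .add_comm _ _
  | zero_add f => exact .zero_add _
  | add_neg f => exact .add_neg _
  | smul_add r f g => exact .smul_add _ _ _
  | add_smul r r' f => exact .add_smul _ _ _
  | mul_smul r r' f => exact .mul_smul _ _ _
  | one_smul f => exact .one_smul _
  | add_comp f f' g => exact .add_comp _ _ _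
  | comp_add f g g' => exact .comp_add _ _ _
  | smul_comp r f g => exact .smul_comp _ _ _
  | comp_smul r f g => exact .comp_smul _ _ _
  | cons_id a w => exact .cons_id a _
  | cons_comp a f g => exact .cons_comp a _ _
  | cons_add a f g => exact .cons_add a _ _
  | cons_smul a r f => exact .cons_smul a r _
  | cross_naturality f => exact .cross_naturality _
  | cupR_naturality f => exact .cupR_naturality _
  | capR_naturality f => exact .capR_naturality _
  | cupL_naturality f => exact .cupL_naturality _
  | capL_naturality f => exact .capL_naturality _
  | cross_cross b => exact .cross_cross _
  | braid b => exact .braid _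
  | zigzag_upR b => exact .zigzag_upR _
  | zigzag_downR b => exact .zigzag_downR _
  | zigzag_upL b => exact .zigzag_upL _
  | zigzag_downL b => exact .zigzag_downL _
  | right_left b => exact .right_left _
  | left_right b => exact .left_right _
  | left_curl b => exact .left_curl _
  | bubble b => exact .bubble _

/-- The congruence on expressions, as a setoid. -/
@[reducible] def heisSetoid (𝕜 : Type u) [CommRing 𝕜] (u v : Word) : Setoid (HeisTerm 𝕜 u v) where
  r f g := HeisRel 𝕜 f g
  iseqv := ⟨.refl, .symm, .trans⟩

/-- Morphisms of the Heisenberg category. -/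
def HeisHom (𝕜 : Type u) [CommRing 𝕜] (u v : Word) : Type u := Quotient (heisSetoid 𝕜 u v)

namespace HeisHom

/-- The morphism denoted by an expression. -/
def mk {u v : Word} (f : HeisTerm 𝕜 u v) : HeisHom 𝕜 u v := Quotient.mk (heisSetoid 𝕜 u v) f

/-- The identity morphism. -/
def id (w : Word) : HeisHom 𝕜 w w := mk (.id w)

/-- Composition; the first argument is the lower morphism. -/
def comp {u v w : Word} (f : HeisHom 𝕜 u v) (g : HeisHom 𝕜 v w) : HeisHom 𝕜 u w :=
  Quotient.map₂ HeisTerm.comp (fun _ _ h _ _ h' => HeisRel.comp_congr h h') f g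

/-- The functor `1_c ⊗ -` on morphisms, for a generating object `c`. -/
def cons (c : Arrow) {u v : Word} (f : HeisHom 𝕜 u v) : HeisHom 𝕜 (c :: u) (c :: v) :=
  Quotient.map (HeisTerm.cons c) (fun _ _ h => HeisRel.cons_congr c h) f

/-- Left whiskering `1_w ⊗ f`. -/
def whiskerLeft : (w : Word) → {u v : Word} → HeisHom 𝕜 u v → HeisHom 𝕜 (w ++ u) (w ++ v)
  | [], _, _, f => f
  | c :: w, _, _, f => cons c (whiskerLeft w f)

/-- Right whiskering `f ⊗ 1_c`. -/
def whiskerRight (c : Word) {u v : Word} (f : HeisHom 𝕜 u v) : HeisHom 𝕜 (u ++ c) (v ++ c) :=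
  Quotient.map (HeisTerm.whiskerRight c) (fun _ _ h => HeisRel.whiskerRight c h) f

/-- The tensor product `f ⊗ g` of morphisms. -/
def tensor {u v u' v' : Word} (f : HeisHom 𝕜 u v) (g : HeisHom 𝕜 u' v') :
    HeisHom 𝕜 (u ++ u') (v ++ v') :=
  comp (whiskerRight u' f) (whiskerLeft v g)

instance (u v : Word) : Zero (HeisHom 𝕜 u v) := ⟨mk (.zero u v)⟩

instance (u v : Word) : Add (HeisHom 𝕜 u v) :=
  ⟨Quotient.map₂ HeisTerm.add (fun _ _ h _ _ h' => HeisRel.add_congr h h')⟩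

instance (u v : Word) : SMul 𝕜 (HeisHom 𝕜 u v) :=
  ⟨fun r => Quotient.map (HeisTerm.smul r) (fun _ _ h => HeisRel.smul_congr r h)⟩

instance (u v : Word) : Neg (HeisHom 𝕜 u v) := ⟨fun f => (-1 : 𝕜) • f⟩

variable {u v w x : Word}

protected theorem ind {p : HeisHom 𝕜 u v → Prop} (h : ∀ f, p (mk f)) (f : HeisHom 𝕜 u v) : p f :=
  Quotient.ind h f

protected theorem sound {f g : HeisTerm 𝕜 u v} (h : HeisRel 𝕜 f g) : mk f = mk g :=
  Quotient.sound h

protected theorem add_assoc (f g h : HeisHom 𝕜 u v) : f + g + h = f + (g + h) := by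
  induction f using HeisHom.ind; induction g using HeisHom.ind; induction h using HeisHom.ind
  exact HeisHom.sound (.add_assoc _ _ _)

protected theorem add_comm (f g : HeisHom 𝕜 u v) : f + g = g + f := by
  induction f using HeisHom.ind; induction g using HeisHom.ind
  exact HeisHom.sound (.add_comm _ _)

protected theorem zero_add (f : HeisHom 𝕜 u v) : 0 + f = f := by
  induction f using HeisHom.ind
  exact HeisHom.sound (.zero_add _)

protected theorem add_neg (f : HeisHom 𝕜 u v) : f + -f = 0 := by
  induction f using HeisHom.ind
  exact HeisHom.sound (.add_neg _)

instance : AddCommGroup (HeisHom 𝕜 u v) where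
  add_assoc := HeisHom.add_assoc
  zero_add := HeisHom.zero_add
  add_zero f := (HeisHom.add_comm f 0).trans (HeisHom.zero_add f)
  add_comm := HeisHom.add_comm
  neg_add_cancel f := (HeisHom.add_comm (-f) f).trans (HeisHom.add_neg f)
  nsmul := nsmulRec
  zsmul := zsmulRec

protected theorem smul_add (r : 𝕜) (f g : HeisHom 𝕜 u v) : r • (f + g) = r • f + r • g := by
  induction f using HeisHom.ind; induction g using HeisHom.ind
  exact HeisHom.sound (.smul_add _ _ _)

protected theorem add_smul (r r' : 𝕜) (f : HeisHom 𝕜 u v) : (r + r') • f = r • f + r' • f := by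
  induction f using HeisHom.ind
  exact HeisHom.sound (.add_smul _ _ _)

instance : Module 𝕜 (HeisHom 𝕜 u v) where
  one_smul f := by
    induction f using HeisHom.ind
    exact HeisHom.sound (.one_smul _)
  mul_smul r r' f := by
    induction f using HeisHom.ind
    exact HeisHom.sound (.mul_smul _ _ _)
  smul_add := HeisHom.smul_add
  smul_zero r := by
    have h := HeisHom.smul_add r (0 : HeisHom 𝕜 u v) 0
    rw [add_zero] at h
    exact left_eq_add.1 h
  add_smul := HeisHom.add_smul
  zero_smul f := by
    have h := HeisHom.add_smul (0 : 𝕜) 0 f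
    rw [add_zero] at h
    exact left_eq_add.1 h

theorem comp_assoc (f : HeisHom 𝕜 u v) (g : HeisHom 𝕜 v w) (h : HeisHom 𝕜 w x) :
    comp (comp f g) h = comp f (comp g h) := by
  induction f using HeisHom.ind; induction g using HeisHom.ind; induction h using HeisHom.ind
  exact HeisHom.sound (.assoc _ _ _)

theorem id_comp (f : HeisHom 𝕜 u v) : comp (id u) f = f := by
  induction f using HeisHom.ind
  exact HeisHom.sound (.id_comp _)

theorem comp_id (f : HeisHom 𝕜 u v) : comp f (id v) = f := by
  induction f using HeisHom.ind
  exact HeisHom.sound (.comp_id _)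

theorem add_comp (f f' : HeisHom 𝕜 u v) (g : HeisHom 𝕜 v w) :
    comp (f + f') g = comp f g + comp f' g := by
  induction f using HeisHom.ind; induction f' using HeisHom.ind; induction g using HeisHom.ind
  exact HeisHom.sound (.add_comp _ _ _)

theorem comp_add (f : HeisHom 𝕜 u v) (g g' : HeisHom 𝕜 v w) :
    comp f (g + g') = comp f g + comp f g' := by
  induction f using HeisHom.ind; induction g using HeisHom.ind; induction g' using HeisHom.ind
  exact HeisHom.sound (.comp_add _ _ _)

theorem smul_comp (r : 𝕜) (f : HeisHom 𝕜 u v) (g : HeisHom 𝕜 v w) :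
    comp (r • f) g = r • comp f g := by
  induction f using HeisHom.ind; induction g using HeisHom.ind
  exact HeisHom.sound (.smul_comp _ _ _)

theorem comp_smul (r : 𝕜) (f : HeisHom 𝕜 u v) (g : HeisHom 𝕜 v w) :
    comp f (r • g) = r • comp f g := by
  induction f using HeisHom.ind; induction g using HeisHom.ind
  exact HeisHom.sound (.comp_smul _ _ _)

theorem cons_add (c : Arrow) (f g : HeisHom 𝕜 u v) : cons c (f + g) = cons c f + cons c g := by
  induction f using HeisHom.ind; induction g using HeisHom.ind
  exact HeisHom.sound (.cons_add c _ _)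

theorem whiskerLeft_add (w : Word) (f g : HeisHom 𝕜 u v) :
    whiskerLeft w (f + g) = whiskerLeft w f + whiskerLeft w g := by
  induction w with
  | nil => rfl
  | cons c w ih => rw [whiskerLeft, ih, cons_add]; rfl

theorem whiskerRight_add (c : Word) (f g : HeisHom 𝕜 u v) :
    whiskerRight c (f + g) = whiskerRight c f + whiskerRight c g := by
  induction f using HeisHom.ind; induction g using HeisHom.ind
  rfl

theorem tensor_add_left {u' v' : Word} (f f' : HeisHom 𝕜 u v) (g : HeisHom 𝕜 u' v') :
    tensor (f + f') g = tensor f g + tensor f' g := by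
  rw [tensor, whiskerRight_add, add_comp]; rfl

theorem tensor_add_right {u' v' : Word} (f : HeisHom 𝕜 u v) (g g' : HeisHom 𝕜 u' v') :
    tensor f (g + g') = tensor f g + tensor f g' := by
  rw [tensor, whiskerLeft_add, comp_add]; rfl

/-- Transport of a morphism along equalities of words. -/
def cast {u' v' : Word} (hu : u = u') (hv : v = v') (f : HeisHom 𝕜 u v) : HeisHom 𝕜 u' v' :=
  hu ▸ hv ▸ f

theorem cast_add {u' v' : Word} (hu : u = u') (hv : v = v') (f g : HeisHom 𝕜 u v) :
    cast hu hv (f + g) = cast hu hv f + cast hu hv g := by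
  subst hu hv; rfl

end HeisHom

end Heisenberg

/-- The Heisenberg category. -/
structure Heis (𝕜 : Type u) where
  /-- the word underlying an object -/
  word : Word

section HeisCategory

variable {𝕜 : Type u} [CommRing 𝕜]

instance : Category (Heis 𝕜) where
  Hom X Y := HeisHom 𝕜 X.word Y.word
  id X := HeisHom.id X.word
  comp f g := HeisHom.comp f g
  id_comp f := HeisHom.id_comp f
  comp_id f := HeisHom.comp_id f
  assoc f g h := HeisHom.comp_assoc f g h

instance : Preadditive (Heis 𝕜) where
  homGroup X Y := inferInstanceAs (AddCommGroup (HeisHom 𝕜 X.word Y.word))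
  add_comp _ _ _ f f' g := HeisHom.add_comp f f' g
  comp_add _ _ _ f g g' := HeisHom.comp_add f g g'

instance : Linear 𝕜 (Heis 𝕜) where
  homModule X Y := inferInstanceAs (Module 𝕜 (HeisHom 𝕜 X.word Y.word))
  smul_comp _ _ _ r f g := HeisHom.smul_comp r f g
  comp_smul _ _ _ f r g := HeisHom.comp_smul r f g

end HeisCategory

/-! ### The category `Peis(t)` -/

/-- The word `(↑↓)^k`. -/
def upDown : ℕ → Word
  | 0 => []
  | k + 1 => up :: down :: upDown k

theorem upDown_add (k l : ℕ) : upDown k ++ upDown l = upDown (k + l) := by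
  induction k with
  | zero => rw [Nat.zero_add]; rfl
  | succ k ih => rw [Nat.succ_add]; exact congrArg (fun w => up :: down :: w) ih

/-- The category `Peis(t)`: its object of size `k` is `(↑↓)^k`. -/
structure Peis (𝕜 : Type u) (t : 𝕜) where
  /-- the number of factors `↑↓` of an object -/
  size : ℕ

section PeisCategory

variable {𝕜 : Type u} [CommRing 𝕜]

/-- The tensor product of morphisms of `Heis` between powers of `↑↓`, with
`(↑↓)^k ⊗ (↑↓)^k'` written as `(↑↓)^(k + k')`. -/
def upDownTensor {k l k' l' : ℕ} (f : HeisHom 𝕜 (upDown k) (upDown l))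
    (g : HeisHom 𝕜 (upDown k') (upDown l')) :
    HeisHom 𝕜 (upDown (k + k')) (upDown (l + l')) :=
  HeisHom.cast (upDown_add k k') (upDown_add l l') (HeisHom.tensor f g)

theorem upDownTensor_add_left {k l k' l' : ℕ} (f f' : HeisHom 𝕜 (upDown k) (upDown l))
    (g : HeisHom 𝕜 (upDown k') (upDown l')) :
    upDownTensor (f + f') g = upDownTensor f g + upDownTensor f' g := by
  rw [upDownTensor, HeisHom.tensor_add_left, HeisHom.cast_add]; rfl

theorem upDownTensor_add_right {k l k' l' : ℕ} (f : HeisHom 𝕜 (upDown k) (upDown l))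
    (g g' : HeisHom 𝕜 (upDown k') (upDown l')) :
    upDownTensor f (g + g') = upDownTensor f g + upDownTensor f g' := by
  rw [upDownTensor, HeisHom.tensor_add_right, HeisHom.cast_add]; rfl

/-- The clockwise bubble. -/
def clockwiseBubble (𝕜 : Type u) [CommRing 𝕜] : HeisHom 𝕜 (upDown 0) (upDown 0) :=
  HeisHom.comp (HeisHom.mk (.cupL [])) (HeisHom.mk (.capR []))

/-- The tensor ideal generated by `clockwise bubble - t` in the full monoidal subcategory of
`Heis` on the objects `(↑↓)^k`. -/
inductive InBubbleIdeal (t : 𝕜) : {k l : ℕ} → HeisHom 𝕜 (upDown k) (upDown l) → Prop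
  | bubble : InBubbleIdeal t (k := 0) (l := 0) (clockwiseBubble 𝕜 - t • HeisHom.id (upDown 0))
  | zero (k l : ℕ) : InBubbleIdeal t (0 : HeisHom 𝕜 (upDown k) (upDown l))
  | add {k l : ℕ} {f g : HeisHom 𝕜 (upDown k) (upDown l)} :
      InBubbleIdeal t f → InBubbleIdeal t g → InBubbleIdeal t (f + g)
  | smul {k l : ℕ} (r : 𝕜) {f : HeisHom 𝕜 (upDown k) (upDown l)} :
      InBubbleIdeal t f → InBubbleIdeal t (r • f)
  | comp_left {k l j : ℕ} {f : HeisHom 𝕜 (upDown k) (upDown l)}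
      (g : HeisHom 𝕜 (upDown l) (upDown j)) : InBubbleIdeal t f → InBubbleIdeal t (f.comp g)
  | comp_right {k l j : ℕ} (f : HeisHom 𝕜 (upDown k) (upDown l))
      {g : HeisHom 𝕜 (upDown l) (upDown j)} : InBubbleIdeal t g → InBubbleIdeal t (f.comp g)
  | tensor_left {k l k' l' : ℕ} {f : HeisHom 𝕜 (upDown k) (upDown l)}
      (g : HeisHom 𝕜 (upDown k') (upDown l')) :
      InBubbleIdeal t f → InBubbleIdeal t (upDownTensor f g)
  | tensor_right {k l k' l' : ℕ} (f : HeisHom 𝕜 (upDown k) (upDown l))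
      {g : HeisHom 𝕜 (upDown k') (upDown l')} :
      InBubbleIdeal t g → InBubbleIdeal t (upDownTensor f g)

/-- The tensor ideal as a family of submodules. -/
def bubbleIdeal (t : 𝕜) (k l : ℕ) : Submodule 𝕜 (HeisHom 𝕜 (upDown k) (upDown l)) where
  carrier := {f | InBubbleIdeal t f}
  add_mem' := .add
  zero_mem' := .zero k l
  smul_mem' r _ h := .smul r h

/-- Morphisms `(↑↓)^k → (↑↓)^l` of `Peis(t)`. -/
abbrev PeisHom (t : 𝕜) (k l : ℕ) : Type u :=
  HeisHom 𝕜 (upDown k) (upDown l) ⧸ bubbleIdeal t k l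

namespace PeisHom

variable {t : 𝕜}

/-- The class in `Peis(t)` of a morphism of `Heis`. -/
def mk (t : 𝕜) {k l : ℕ} (f : HeisHom 𝕜 (upDown k) (upDown l)) : PeisHom t k l :=
  Submodule.Quotient.mk f

/-- Composition; the first argument is the lower morphism. -/
def comp {k l j : ℕ} (f : PeisHom t k l) (g : PeisHom t l j) : PeisHom t k j :=
  Quotient.map₂ HeisHom.comp (fun f f' h g g' h' => by
    have h1 := (Submodule.quotientRel_def _).1 h
    have h2 := (Submodule.quotientRel_def _).1 h'
    refine (Submodule.quotientRel_def _).2 ?_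
    have h3 : f.comp g - f'.comp g' = (f - f').comp g + f'.comp (g - g') := by
      have e1 := HeisHom.add_comp (f - f') f' g
      have e2 := HeisHom.comp_add f' (g - g') g'
      rw [sub_add_cancel] at e1 e2
      rw [e1, e2, ← add_assoc, add_sub_cancel_right]
    rw [h3]
    exact .add (.comp_left g h1) (.comp_right f' h2)) f g

/-- The tensor product of morphisms. -/
def tensor {k l k' l' : ℕ} (f : PeisHom t k l) (g : PeisHom t k' l') :
    PeisHom t (k + k') (l + l') :=
  Quotient.map₂ upDownTensor (fun f f' h g g' h' => by
    have h1 := (Submodule.quotientRel_def _).1 h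
    have h2 := (Submodule.quotientRel_def _).1 h'
    refine (Submodule.quotientRel_def _).2 ?_
    have h3 : upDownTensor f g - upDownTensor f' g' =
        upDownTensor (f - f') g + upDownTensor f' (g - g') := by
      have e1 := upDownTensor_add_left (f - f') f' g
      have e2 := upDownTensor_add_right f' (g - g') g'
      rw [sub_add_cancel] at e1 e2
      rw [e1, e2, ← add_assoc, add_sub_cancel_right]
    rw [h3]
    exact .add (.tensor_left g h1) (.tensor_right f' h2)) f g

end PeisHom

instance (t : 𝕜) : Category (Peis 𝕜 t) where
  Hom X Y := PeisHom t X.size Y.size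
  id X := PeisHom.mk t (HeisHom.id (upDown X.size))
  comp f g := PeisHom.comp f g
  id_comp := by
    rintro ⟨k⟩ ⟨l⟩ ⟨f⟩
    exact congrArg (PeisHom.mk t) (HeisHom.id_comp f)
  comp_id := by
    rintro ⟨k⟩ ⟨l⟩ ⟨f⟩
    exact congrArg (PeisHom.mk t) (HeisHom.comp_id f)
  assoc := by
    rintro ⟨k⟩ ⟨l⟩ ⟨m⟩ ⟨n⟩ ⟨f⟩ ⟨g⟩ ⟨h⟩
    exact congrArg (PeisHom.mk t) (HeisHom.comp_assoc f g h)

instance (t : 𝕜) : Preadditive (Peis 𝕜 t) where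
  homGroup X Y := inferInstanceAs (AddCommGroup (PeisHom t X.size Y.size))
  add_comp := by
    rintro ⟨k⟩ ⟨l⟩ ⟨m⟩ ⟨f⟩ ⟨f'⟩ ⟨g⟩
    exact congrArg (PeisHom.mk t) (HeisHom.add_comp f f' g)
  comp_add := by
    rintro ⟨k⟩ ⟨l⟩ ⟨m⟩ ⟨f⟩ ⟨g⟩ ⟨g'⟩
    exact congrArg (PeisHom.mk t) (HeisHom.comp_add f g g')

instance (t : 𝕜) : Linear 𝕜 (Peis 𝕜 t) where
  homModule X Y := inferInstanceAs (Module 𝕜 (PeisHom t X.size Y.size))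
  smul_comp := by
    rintro ⟨k⟩ ⟨l⟩ ⟨m⟩ r ⟨f⟩ ⟨g⟩
    exact congrArg (PeisHom.mk t) (HeisHom.smul_comp r f g)
  comp_smul := by
    rintro ⟨k⟩ ⟨l⟩ ⟨m⟩ ⟨f⟩ r ⟨g⟩
    exact congrArg (PeisHom.mk t) (HeisHom.comp_smul r f g)

end PeisCategory

/-! ### The functor `Φ_n` -/

section Phi

open scoped TensorProduct

variable (𝕜 : Type u) [CommRing 𝕜] (n : ℕ)

/-- The permutation module `V = 𝕜^n` of `S_n`. -/
noncomputable abbrev permRep : Rep.{u} 𝕜 (Equiv.Perm (Fin n)) :=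
  Rep.of (Representation.ofMulAction 𝕜 (Equiv.Perm (Fin n)) (Fin n))

/-- The basis vector `v_i` of `V`. -/
noncomputable def basisVec (i : Fin n) : permRep 𝕜 n := MonoidAlgebra.single i 1

/-- The tensor power `V^{⊗k}` with the diagonal action of `S_n`. -/
noncomputable abbrev tensorPowerRep (k : ℕ) : Rep.{u} 𝕜 (Equiv.Perm (Fin n)) :=
  Rep.of (X := ⨂[𝕜]^k (permRep 𝕜 n)) (PiTensorProduct.mapMonoidHom.comp
    (MonoidHom.pi fun _ : Fin k => (permRep 𝕜 n).ρ))

/-- The pure tensor `v_{i_1} ⊗ ⋯ ⊗ v_{i_k}` (read from left to right). -/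
noncomputable def basisTensor {k : ℕ} (i : Fin k → Fin n) : tensorPowerRep 𝕜 n k :=
  PiTensorProduct.tprod 𝕜 fun j => basisVec 𝕜 n (i j)

/-- A `𝕜`-linear strong monoidal functor `Par(n) → S_n-mod`, `k ↦ V^{⊗k}` (with respect to the
canonical isomorphisms `V^{⊗k} ⊗ V^{⊗k'} ≅ V^{⊗(k+k')}`), with the prescribed values on the
generating morphisms. -/
@[ext]
structure Phi where
  /-- the action on morphisms -/
  map (k l : ℕ) : ParHom 𝕜 k l →ₗ[𝕜] (tensorPowerRep 𝕜 n k ⟶ tensorPowerRep 𝕜 n l)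
  map_id (k : ℕ) : map k k (parId 𝕜 k) = 𝟙 _
  map_comp {k l m : ℕ} (f : ParHom 𝕜 k l) (g : ParHom 𝕜 l m) :
    map k m (parComp (n : 𝕜) f g) = map k l f ≫ map l m g
  map_tensor {k l k' l' : ℕ} (f : ParHom 𝕜 k l) (g : ParHom 𝕜 k' l')
    (x : tensorPowerRep 𝕜 n k) (y : tensorPowerRep 𝕜 n k') :
    (map _ _ (parTensor f g)).hom (TensorPower.mulEquiv (x ⊗ₜ[𝕜] y)) =
      TensorPower.mulEquiv ((map k l f).hom x ⊗ₜ[𝕜] (map k' l' g).hom y)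
  map_mul (i j : Fin n) :
    (map 2 1 (parMul 𝕜)).hom (basisTensor 𝕜 n ![i, j]) =
      if i = j then basisTensor 𝕜 n ![i] else 0
  map_unit :
    (map 0 1 (parUnit 𝕜)).hom (basisTensor 𝕜 n ![]) = ∑ i : Fin n, basisTensor 𝕜 n ![i]
  map_comul (i : Fin n) :
    (map 1 2 (parComul 𝕜)).hom (basisTensor 𝕜 n ![i]) = basisTensor 𝕜 n ![i, i]
  map_counit (i : Fin n) :
    (map 1 0 (parCounit 𝕜)).hom (basisTensor 𝕜 n ![i]) = basisTensor 𝕜 n ![]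
  map_swap (i j : Fin n) :
    (map 2 2 (parSwap 𝕜)).hom (basisTensor 𝕜 n ![i, j]) = basisTensor 𝕜 n ![j, i]

variable {𝕜 n}

/-- The functor given by `Phi`. -/
noncomputable def Phi.functor (Φ : Phi 𝕜 n) :
    Par 𝕜 (n : 𝕜) ⥤ Rep.{u} 𝕜 (Equiv.Perm (Fin n)) where
  obj X := tensorPowerRep 𝕜 n X.size
  map {X Y} f := Φ.map X.size Y.size f
  map_id X := Φ.map_id X.size
  map_comp f g := Φ.map_comp f g

end Phi

/-! ### The functor `Ψ_t` -/

section Psi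

open HeisTerm

variable {𝕜 : Type u} [CommRing 𝕜]

/-- The summand of the image of `s` in which the two strands `↑↓` cross the two others: the
composite of three layers. -/
def psiSwapCross : HeisTerm 𝕜 (upDown 2) (upDown 2) :=
  comp (cons up (leftCross [down]))
    (comp (comp (cross [down, down]) (cons up (cons up (downCross []))))
      (cons up (rightCross [down])))

/-- The summand of the image of `s` consisting of a cap below a cup, between two vertical
strands. -/
def psiSwapCapCup : HeisTerm 𝕜 (upDown 2) (upDown 2) :=
  cons up (comp (capL [down]) (cupR [down]))

variable (t : 𝕜)

/-- A strict `𝕜`-linear monoidal functor `Par(t) → Peis(t)`, `k ↦ (↑↓)^k`, with the prescribed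
values on the generating morphisms. -/
@[ext]
structure Psi where
  /-- the action on morphisms -/
  map (k l : ℕ) : ParHom 𝕜 k l →ₗ[𝕜] PeisHom t k l
  map_id (k : ℕ) : map k k (parId 𝕜 k) = PeisHom.mk t (HeisHom.id (upDown k))
  map_comp {k l m : ℕ} (f : ParHom 𝕜 k l) (g : ParHom 𝕜 l m) :
    map k m (parComp t f g) = PeisHom.comp (map k l f) (map l m g)
  map_tensor {k l k' l' : ℕ} (f : ParHom 𝕜 k l) (g : ParHom 𝕜 k' l') :
    map _ _ (parTensor f g) = PeisHom.tensor (map k l f) (map k' l' g)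
  map_mul : map 2 1 (parMul 𝕜) = PeisHom.mk t (HeisHom.mk (cons up (capL [down])))
  map_comul : map 1 2 (parComul 𝕜) = PeisHom.mk t (HeisHom.mk (cons up (cupR [down])))
  map_swap : map 2 2 (parSwap 𝕜) =
    PeisHom.mk t (HeisHom.mk psiSwapCross) + PeisHom.mk t (HeisHom.mk psiSwapCapCup)
  map_unit : map 0 1 (parUnit 𝕜) = PeisHom.mk t (HeisHom.mk (cupL []))
  map_counit : map 1 0 (parCounit 𝕜) = PeisHom.mk t (HeisHom.mk (capR []))

variable {t}

/-- The functor given by `Psi`. -/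
noncomputable def Psi.functor (Ψ : Psi t) : Par 𝕜 t ⥤ Peis 𝕜 t where
  obj X := ⟨X.size⟩
  map {X Y} f := Ψ.map X.size Y.size f
  map_id X := Ψ.map_id X.size
  map_comp f g := Ψ.map_comp f g

end Psi

/-! ### The action of the Heisenberg category on modules over symmetric groups -/

section Action

variable (𝕜 : Type u) [CommRing 𝕜]

/-- Families `(M_n)` of `S_n`-modules, one for each `n ∈ ℕ`. -/
abbrev Family : Type (u + 1) := ∀ n : ℕ, Rep.{u} 𝕜 (Equiv.Perm (Fin n))

noncomputable instance : Preadditive (Family 𝕜) where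
  homGroup M N := inferInstanceAs (AddCommGroup (∀ n, M n ⟶ N n))
  add_comp _ _ _ f f' g := funext fun n => Preadditive.add_comp _ _ _ (f n) (f' n) (g n)
  comp_add _ _ _ f g g' := funext fun n => Preadditive.comp_add _ _ _ (f n) (g n) (g' n)

noncomputable instance : Linear 𝕜 (Family 𝕜) where
  homModule M N := inferInstanceAs (Module 𝕜 (∀ n, M n ⟶ N n))
  smul_comp _ _ _ r f g := funext fun n => Linear.smul_comp _ _ _ r (f n) (g n)
  comp_smul _ _ _ f r g := funext fun n => Linear.comp_smul _ _ _ (f n) r (g n)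

/-- The standard embedding `S_n → S_{n+1}`, onto the permutations that fix the last point. -/
noncomputable def permEmb (n : ℕ) : Equiv.Perm (Fin n) →* Equiv.Perm (Fin (n + 1)) :=
  Equiv.Perm.viaEmbeddingHom Fin.castSuccEmb

/-- The simple transposition of the last two points, in `S_{n+2}`. -/
def lastSwap (n : ℕ) : Equiv.Perm (Fin (n + 2)) :=
  Equiv.swap (Fin.last n).castSucc (Fin.last (n + 1))

/-- The coset representative `g_i = s_i s_{i+1} ⋯ s_{n-1}` of `S_{n-1}` in `S_n`, with `n = m + 1`
and with the points numbered from zero. -/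
def cosetRep {m : ℕ} (i : Fin (m + 1)) : Equiv.Perm (Fin (m + 1)) :=
  (((List.finRange m).filter fun j => i ≤ j.castSucc).map
    fun j => Equiv.swap j.castSucc j.succ).prod

/-- The element `g ⊗ x` of `Ind M = 𝕜S_{n+1} ⊗_{𝕜S_n} M`. The inverse is there because Mathlib
constructs `Ind M` as a quotient of `𝕜S_{n+1} ⊗ M` in which the class of `h ⊗ x` equals that of
`a h ⊗ a x` for `a` in `S_n`, and on which `S_{n+1}` acts by `g • (h ⊗ x) = h g⁻¹ ⊗ x`. -/
noncomputable def indTmul {𝕜 : Type u} [CommRing 𝕜] {n : ℕ}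
    {M : Rep.{u} 𝕜 (Equiv.Perm (Fin n))} (g : Equiv.Perm (Fin (n + 1))) (x : M) :
    Rep.ind (permEmb n) M :=
  Representation.IndV.mk (permEmb n) M.ρ g⁻¹ x

/-- Tensoring with the bimodules `𝕜S_n` over `(S_n, S_{n-1})`, `n ≥ 1`: the family with induced
modules `Ind M_{n-1}` in degrees `n ≥ 1`, and zero in degree `0`. -/
noncomputable def indFam : Family 𝕜 ⥤ Family 𝕜 :=
  Functor.pi' fun n => match n with
    | 0 => (Functor.const _).obj (Rep.trivial 𝕜 (Equiv.Perm (Fin 0)) PUnit)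
    | n + 1 => Pi.eval _ n ⋙ Rep.indFunctor 𝕜 (permEmb n)

/-- Tensoring with the bimodules `𝕜S_n` over `(S_{n-1}, S_n)`, `n ≥ 1`: the family of restricted
modules `Res M_{n+1}`. -/
noncomputable def resFam : Family 𝕜 ⥤ Family 𝕜 :=
  Functor.pi' fun n => Pi.eval _ (n + 1) ⋙ Rep.resFunctor (permEmb n)

/-- The action of the generating objects: `↑` acts by induction, `↓` by restriction. -/
noncomputable def letter : Arrow → Family 𝕜 ⥤ Family 𝕜
  | up => indFam 𝕜
  | down => resFam 𝕜

/-- The action of a word: the composite of the actions of its letters. -/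
noncomputable def act : Word → Family 𝕜 ⥤ Family 𝕜
  | [] => 𝟭 _
  | c :: w => act w ⋙ letter 𝕜 c

/-- Khovanov's action of the Heisenberg category on modules over symmetric groups: the words act
by the functors `act`, composition and linear combinations of morphisms by those of natural
transformations, `1_c ⊗ f` by applying the functor of `c` to the natural transformation of `f`,
and `x ⊗ 1_b` by the natural transformation of the generating morphism `x`, at the module to
which `b` has been applied. -/
@[ext]
structure Theta where
  /-- the action on morphisms -/
  map (u v : Word) : HeisHom 𝕜 u v →ₗ[𝕜] (act 𝕜 u ⟶ act 𝕜 v)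
  map_id (w : Word) : map w w (HeisHom.id w) = 𝟙 _
  map_comp {u v w : Word} (f : HeisHom 𝕜 u v) (g : HeisHom 𝕜 v w) :
    map u w (f.comp g) = map u v f ≫ map v w g
  map_cons (c : Arrow) {u v : Word} (f : HeisHom 𝕜 u v) :
    map (c :: u) (c :: v) (f.cons c) = Functor.whiskerRight (map u v f) (letter 𝕜 c)
  map_cross (b : Word) (M : Family 𝕜) (n : ℕ) (g : Equiv.Perm (Fin (n + 2)))
    (h : Equiv.Perm (Fin (n + 1))) (x : ((act 𝕜 b).obj M n)) :
    ((map _ _ (HeisHom.mk (.cross b))).app M (n + 2)).hom (indTmul g (indTmul h x)) =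
      indTmul (g * permEmb (n + 1) h * lastSwap n) (indTmul 1 x)
  map_cupR (b : Word) (M : Family 𝕜) (n : ℕ) (x : (act 𝕜 b).obj M n) :
    ((map _ _ (HeisHom.mk (.cupR b))).app M n).hom x = indTmul 1 x
  map_capR (b : Word) (M : Family 𝕜) (n : ℕ) (g : Equiv.Perm (Fin (n + 1)))
    (x : (act 𝕜 b).obj M (n + 1)) :
    ((map _ _ (HeisHom.mk (.capR b))).app M (n + 1)).hom
      (indTmul (M := Rep.res (permEmb n) ((act 𝕜 b).obj M (n + 1))) g x) =
        ((act 𝕜 b).obj M (n + 1)).ρ g x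
  map_cupL (b : Word) (M : Family 𝕜) (n : ℕ) (x : (act 𝕜 b).obj M (n + 1)) :
    ((map _ _ (HeisHom.mk (.cupL b))).app M (n + 1)).hom x =
      ∑ i : Fin (n + 1), indTmul (M := Rep.res (permEmb n) ((act 𝕜 b).obj M (n + 1)))
        (cosetRep i) (((act 𝕜 b).obj M (n + 1)).ρ (cosetRep i)⁻¹ x)
  map_capL_of_mem (b : Word) (M : Family 𝕜) (n : ℕ) (g : Equiv.Perm (Fin n))
    (x : (act 𝕜 b).obj M n) :
    ((map _ _ (HeisHom.mk (.capL b))).app M n).hom (indTmul (permEmb n g) x) =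
      ((act 𝕜 b).obj M n).ρ g x
  map_capL_of_notMem (b : Word) (M : Family 𝕜) (n : ℕ) (g : Equiv.Perm (Fin (n + 1)))
    (hg : g ∉ (permEmb n).range) (x : (act 𝕜 b).obj M n) :
    ((map _ _ (HeisHom.mk (.capL b))).app M n).hom (indTmul g x) = 0

/-- The family of trivial one-dimensional modules. -/
noncomputable def trivFam : Family 𝕜 := fun n => Rep.trivial 𝕜 (Equiv.Perm (Fin n)) 𝕜

/-- The `S_n`-module `(↑↓)^k · 1_n`, that is, `B^k ⊗_{n-1} 1_{n-1}` for `k, n ≥ 1`. Its definition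
only involves the trivial module of `S_n`, since `↑↓` preserves degrees. -/
noncomputable abbrev actTriv (n k : ℕ) : Rep.{u} 𝕜 (Equiv.Perm (Fin n)) :=
  (act 𝕜 (upDown k)).obj (trivFam 𝕜) n

variable {𝕜}

/-- The functor `Peis(n) → S_n-mod` induced by the action on `1_n`. -/
@[ext]
structure Omega (Θ : Theta 𝕜) (n : ℕ) where
  /-- the action on morphisms -/
  map (k l : ℕ) : PeisHom (n : 𝕜) k l →ₗ[𝕜] (actTriv 𝕜 n k ⟶ actTriv 𝕜 n l)
  map_mk {k l : ℕ} (f : HeisHom 𝕜 (upDown k) (upDown l)) :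
    map k l (PeisHom.mk (n : 𝕜) f) = (Θ.map (upDown k) (upDown l) f).app (trivFam 𝕜) n

/-- The functor given by `Omega`. -/
noncomputable def Omega.functor {Θ : Theta 𝕜} {n : ℕ} (Ω : Omega Θ n) :
    Peis 𝕜 (n : 𝕜) ⥤ Rep.{u} 𝕜 (Equiv.Perm (Fin n)) where
  obj X := actTriv 𝕜 n X.size
  map {X Y} f := Ω.map X.size Y.size f
  map_id X := by
    refine (Ω.map_mk _).trans ?_
    rw [Θ.map_id]
    rfl
  map_comp := by
    rintro ⟨k⟩ ⟨l⟩ ⟨m⟩ ⟨f⟩ ⟨g⟩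
    refine (Ω.map_mk (f.comp g)).trans ?_
    rw [Θ.map_comp]
    exact congrArg₂ (· ≫ ·) (Ω.map_mk f).symm (Ω.map_mk g).symm

/-- The element `p⁻¹ g_{i_1} ⊗ g_{i_1}⁻¹ g_{i_2} ⊗ ⋯ ⊗ g_{i_{k-1}}⁻¹ g_{i_k} ⊗ 1` of
`B^k ⊗_{n-1} 1_{n-1}`. -/
noncomputable def betaAux : (n k : ℕ) → Equiv.Perm (Fin n) → (Fin k → Fin n) → actTriv 𝕜 n k
  | _, 0, _, _ => (1 : 𝕜)
  | 0, _ + 1, _, i => (i 0).elim0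
  | m + 1, k + 1, p, i =>
    indTmul (M := Rep.res (permEmb m) (actTriv 𝕜 (m + 1) k)) (p⁻¹ * cosetRep (i 0))
      (betaAux (m + 1) k (cosetRep (i 0)) (Fin.tail i))

/-- The image `g_{i_1} ⊗ g_{i_1}⁻¹ g_{i_2} ⊗ ⋯ ⊗ g_{i_{k-1}}⁻¹ g_{i_k} ⊗ 1` of
`v_{i_1} ⊗ ⋯ ⊗ v_{i_k}` under `β_k`. -/
noncomputable def beta (n k : ℕ) (i : Fin k → Fin n) : actTriv 𝕜 n k := betaAux n k 1 i

end Action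

end PartHeis

/-! In degree n, `↑↓` sends a module B to Ind Res B, and Ind Res B is V ⊗ B with the diagonal
action. The vector g_i ⊗ g_i⁻¹ y (`cosetTmul`) plays the role of v_i ⊗ y, because g_i maps the last
point to i and so represents the coset belonging to i. That S_n permutes the indices and acts on y
at the same time is `rho_cosetTmul`. The map β_k is the k-fold iteration of v_i ⊗ y ↦ `cosetTmul i
y` (`beta_cons`), hence an isomorphism. Naturality needs to be tested only on the generators
tensored with strands (`par_induction`), and there the action of the Heisenberg morphisms, written
in the vectors `cosetTmul`, is literally the formula that defines Φ_n: see `mulHom_cosetTmul`,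
`comulHom_cosetTmul`, `cupLHom_eq_sum`, `capRHom_cosetTmul` and `omega_swap_apply`.

Most of the work is the existence of the functors.

For Ψ, no presentation of the partition category is presupposed. In any special commutative
Frobenius algebra (`FrobeniusTower`) a function of finite sets can be used to multiply factors
together (`push`) or to copy them (`pull`). A diagram is sent to the composite that multiplies its
lower vertices into its blocks and then copies the blocks to the upper vertices (`diagramMap`).
Composition holds by base change along pushouts (`exists_pushout`, `diagramMap_comp`): the pushout
of the two block sets over the middle row is the set of components of the stacked diagram, and each
floating component contributes unit followed by counit, that is t. It remains to see that `↑↓` is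
such an algebra. The relations with the symmetry (`mul_swap`, `swap_braid`) come from factoring it
into two half-braidings, one past `↑` and one past `↓` (`swap_eq`).

The functor Φ_n is defined on all diagrams at once, by summing over the colourings of the upper row
compatible with that of the lower row (`colourSum`). Composition counts the colourings of the middle
row, which gives n to the number of floating components (`card_middle_colours`).

For the action, every Heisenberg relation is checked on vectors g ⊗ x. The essential one is Mackey's
decomposition of Res Ind B into B and Ind Res B (`rightCrossHom_leftCrossHom`,
`leftCrossHom_rightCrossHom`). The action descends to Ω_n since the clockwise bubble is the sum over
n cosets of the identity (`cupLHom_capRHom`).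

Uniqueness holds because the prescribed values determine everything on generators:
`par_tensor_induction` for Φ and Ψ, induction on expressions (`Theta.map_mk`) for the action. -/

namespace PartHeis

/-! ### Calculus in the Heisenberg category -/

section HeisenbergCalculus

open Arrow

namespace HeisTerm

variable {𝕜 : Type u}

/-- Reflection of an expression in a horizontal line. -/
def flip : {u v : Word} → HeisTerm 𝕜 u v → HeisTerm 𝕜 v u
  | _, _, id w => id w
  | _, _, comp f g => comp (flip g) (flip f)
  | _, _, cross b => cross b
  | _, _, cupR b => capL b
  | _, _, capR b => cupL b
  | _, _, cupL b => capR b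
  | _, _, capL b => cupR b
  | _, _, cons a f => cons a (flip f)
  | _, _, zero u v => zero v u
  | _, _, add f g => add (flip f) (flip g)
  | _, _, smul r f => smul r (flip f)

end HeisTerm

namespace HeisHom

variable {𝕜 : Type u} [CommRing 𝕜]

local infixr:80 " ⬝ " => HeisHom.comp

variable {u v w : Word}

/-- Long composites are kept bracketed to the right. This applies a relation between two factors at
the head of a longer composite; `comp_reassoc₃` does so for three factors. -/
theorem comp_reassoc {f : HeisHom 𝕜 u v} {g : HeisHom 𝕜 v w} {k : HeisHom 𝕜 u w}
    (h : f ⬝ g = k) {x : Word} (e : HeisHom 𝕜 w x) : f ⬝ g ⬝ e = k ⬝ e := by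
  rw [← comp_assoc, h]

theorem comp_reassoc₃ {x y : Word} {f : HeisHom 𝕜 u v} {g : HeisHom 𝕜 v w} {g' : HeisHom 𝕜 w x}
    {k : HeisHom 𝕜 u x} (h : f ⬝ g ⬝ g' = k) (e : HeisHom 𝕜 x y) :
    f ⬝ g ⬝ g' ⬝ e = k ⬝ e := by
  rw [← h, comp_assoc, comp_assoc]

theorem cons_id (c : Arrow) (w : Word) :
    cons c (HeisHom.id w : HeisHom 𝕜 w w) = HeisHom.id (c :: w) :=
  HeisHom.sound (.cons_id c w)

theorem cons_comp (c : Arrow) (f : HeisHom 𝕜 u v) (g : HeisHom 𝕜 v w) :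
    cons c (f ⬝ g) = cons c f ⬝ cons c g := by
  induction f using HeisHom.ind; induction g using HeisHom.ind
  exact HeisHom.sound (.cons_comp c _ _)

theorem cons_smul (c : Arrow) (r : 𝕜) (f : HeisHom 𝕜 u v) : cons c (r • f) = r • cons c f := by
  induction f using HeisHom.ind
  exact HeisHom.sound (.cons_smul c r _)

/-- `1_c ⊗ -` as a linear map. -/
def consLin (c : Arrow) : HeisHom 𝕜 u v →ₗ[𝕜] HeisHom 𝕜 (c :: u) (c :: v) where
  toFun := cons c
  map_add' := cons_add c
  map_smul' := cons_smul c

theorem cons_zero (c : Arrow) : cons c (0 : HeisHom 𝕜 u v) = 0 := map_zero (consLin c)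

theorem cons_sub (c : Arrow) (f g : HeisHom 𝕜 u v) : cons c (f - g) = cons c f - cons c g :=
  map_sub (consLin c) f g

/-- Composition as a bilinear map. -/
def compLin : HeisHom 𝕜 u v →ₗ[𝕜] HeisHom 𝕜 v w →ₗ[𝕜] HeisHom 𝕜 u w :=
  LinearMap.mk₂ 𝕜 comp add_comp smul_comp comp_add (fun r f g => HeisHom.comp_smul r f g)

theorem zero_comp (g : HeisHom 𝕜 v w) : (0 : HeisHom 𝕜 u v) ⬝ g = 0 :=
  LinearMap.map_zero₂ compLin g

theorem comp_zero (f : HeisHom 𝕜 u v) : f ⬝ (0 : HeisHom 𝕜 v w) = 0 := map_zero (compLin f)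

theorem sub_comp (f f' : HeisHom 𝕜 u v) (g : HeisHom 𝕜 v w) : (f - f') ⬝ g = f ⬝ g - f' ⬝ g :=
  LinearMap.map_sub₂ compLin f f' g

theorem comp_sub (f : HeisHom 𝕜 u v) (g g' : HeisHom 𝕜 v w) : f ⬝ (g - g') = f ⬝ g - f ⬝ g' :=
  map_sub (compLin f) g g'

/-- The upward crossing. -/
def X (b : Word) : HeisHom 𝕜 (up :: up :: b) (up :: up :: b) := mk (.cross b)
/-- The right cup. -/
def cR (b : Word) : HeisHom 𝕜 b (down :: up :: b) := mk (.cupR b)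
/-- The right cap. -/
def dR (b : Word) : HeisHom 𝕜 (up :: down :: b) b := mk (.capR b)
/-- The left cup. -/
def cL (b : Word) : HeisHom 𝕜 b (up :: down :: b) := mk (.cupL b)
/-- The left cap. -/
def dL (b : Word) : HeisHom 𝕜 (down :: up :: b) b := mk (.capL b)
/-- The right crossing. -/
def R (b : Word) : HeisHom 𝕜 (up :: down :: b) (down :: up :: b) := mk (.rightCross b)
/-- The left crossing. -/
def L (b : Word) : HeisHom 𝕜 (down :: up :: b) (up :: down :: b) := mk (.leftCross b)
/-- The downward crossing. -/
def Y (b : Word) : HeisHom 𝕜 (down :: down :: b) (down :: down :: b) := mk (.downCross b)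

local notation "U" => HeisHom.cons up
local notation "D" => HeisHom.cons down

theorem R_eq (b : Word) :
    (R b : HeisHom 𝕜 _ _) = cR (up :: down :: b) ⬝ D (X (down :: b)) ⬝ D (U (dR b)) := rfl

theorem L_eq (b : Word) :
    (L b : HeisHom 𝕜 _ _) = D (U (cL b)) ⬝ D (X (down :: b)) ⬝ dL (up :: down :: b) := rfl

theorem Y_eq (b : Word) :
    (Y b : HeisHom 𝕜 _ _) = D (D (cL b)) ⬝ D (L (down :: b)) ⬝ dL (down :: down :: b) := rfl

section Naturality

variable {b b' : Word} (f : HeisHom 𝕜 b b')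

theorem X_nat : X b ⬝ U (U f) = U (U f) ⬝ X b' := by
  induction f using HeisHom.ind
  exact HeisHom.sound (.cross_naturality _)

theorem cR_nat : cR b ⬝ D (U f) = f ⬝ cR b' := by
  induction f using HeisHom.ind
  exact HeisHom.sound (.cupR_naturality _)

theorem dR_nat : dR b ⬝ f = U (D f) ⬝ dR b' := by
  induction f using HeisHom.ind
  exact HeisHom.sound (.capR_naturality _)

theorem cL_nat : cL b ⬝ U (D f) = f ⬝ cL b' := by
  induction f using HeisHom.ind
  exact HeisHom.sound (.cupL_naturality _)

theorem dL_nat : dL b ⬝ f = D (U f) ⬝ dL b' := by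
  induction f using HeisHom.ind
  exact HeisHom.sound (.capL_naturality _)

theorem R_nat : R b ⬝ D (U f) = U (D f) ⬝ R b' := by
  rw [R_eq, R_eq, comp_assoc, comp_assoc, ← cons_comp down (U (dR b)), ← cons_comp up (dR b),
    dR_nat, cons_comp, cons_comp, comp_reassoc (((cons_comp _ _ _).symm.trans
      (congrArg D (X_nat (D f)))).trans (cons_comp _ _ _)), comp_assoc,
    comp_reassoc (cR_nat (U (D f))), comp_assoc]

theorem L_nat : L b ⬝ U (D f) = D (U f) ⬝ L b' := by
  rw [L_eq, L_eq, comp_assoc, comp_assoc, dL_nat, comp_reassoc (((cons_comp _ _ _).symm.trans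
      (congrArg D (X_nat (D f)))).trans (cons_comp _ _ _)), comp_assoc,
    ← comp_assoc (D (U (cL b))), ← cons_comp, ← cons_comp, cL_nat, cons_comp, cons_comp,
    comp_assoc]

theorem Y_nat : Y b ⬝ D (D f) = D (D f) ⬝ Y b' := by
  rw [Y_eq, Y_eq, comp_assoc, comp_assoc, dL_nat, comp_reassoc (((cons_comp _ _ _).symm.trans
      (congrArg D (L_nat (D f)))).trans (cons_comp _ _ _)), comp_assoc,
    ← comp_assoc (D (D (cL b))), ← cons_comp, ← cons_comp, cL_nat, cons_comp, cons_comp,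
    comp_assoc]

end Naturality

section Flip

/-- The list of relations is stable under reflection: it exchanges left and right zigzags, and the
naturality of cups with that of caps. Each identity proved below therefore yields its mirror image
at no cost. -/
theorem _root_.PartHeis.HeisRel.flip {f g : HeisTerm 𝕜 u v}
    (h : HeisRel 𝕜 f g) : HeisRel 𝕜 f.flip g.flip := by
  induction h with
  | refl f => exact .refl _
  | symm _ ih => exact .symm ih
  | trans _ _ ih ih' => exact .trans ih ih'
  | comp_congr _ _ ih ih' => exact .comp_congr ih' ih
  | cons_congr a _ ih => exact .cons_congr a ih
  | add_congr _ _ ih ih' => exact .add_congr ih ih'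
  | smul_congr r _ ih => exact .smul_congr r ih
  | id_comp f => exact .comp_id _
  | comp_id f => exact .id_comp _
  | assoc f g h => exact .symm (.assoc _ _ _)
  | add_assoc f g h => exact .add_assoc _ _ _
  | add_comm f g => exact .add_comm _ _
  | zero_add f => exact .zero_add _
  | add_neg f => exact .add_neg _
  | smul_add r f g => exact .smul_add _ _ _
  | add_smul r r' f => exact .add_smul _ _ _
  | mul_smul r r' f => exact .mul_smul _ _ _
  | one_smul f => exact .one_smul _
  | add_comp f f' g => exact .comp_add _ _ _
  | comp_add f g g' => exact .add_comp _ _ _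
  | smul_comp r f g => exact .comp_smul _ _ _
  | comp_smul r f g => exact .smul_comp _ _ _
  | cons_id a w => exact .cons_id a _
  | cons_comp a f g => exact .cons_comp a _ _
  | cons_add a f g => exact .cons_add a _ _
  | cons_smul a r f => exact .cons_smul a r _
  | cross_naturality f => exact .symm (.cross_naturality _)
  | cupR_naturality f => exact .symm (.capL_naturality _)
  | capR_naturality f => exact .symm (.cupL_naturality _)
  | cupL_naturality f => exact .symm (.capR_naturality _)
  | capL_naturality f => exact .symm (.cupR_naturality _)
  | cross_cross b => exact .cross_cross _
  | braid b => exact .trans (.assoc _ _ _) (.trans (.braid _) (.symm (.assoc _ _ _)))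
  | zigzag_upR b => exact .zigzag_upL _
  | zigzag_downR b => exact .zigzag_downL _
  | zigzag_upL b => exact .zigzag_upR _
  | zigzag_downL b => exact .zigzag_downR _
  -- Reflection exchanges the right and the left crossing up to bracketing, so this relation and the
  -- next one are their own mirror images.
  | right_left b =>
    exact .trans (.comp_congr (.assoc _ _ _) (.assoc _ _ _)) (.right_left _)
  | left_right b =>
    exact .trans (.comp_congr (.assoc _ _ _) (.assoc _ _ _)) (.left_right _)
  | left_curl b => exact .trans (.assoc _ _ _) (.left_curl _)
  | bubble b => exact .bubble _

/-- Reflection of a morphism in a horizontal line. -/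
def flip (f : HeisHom 𝕜 u v) : HeisHom 𝕜 v u :=
  Quotient.map HeisTerm.flip (fun _ _ h => HeisRel.flip h) f

theorem flip_comp (f : HeisHom 𝕜 u v) (g : HeisHom 𝕜 v w) : flip (f ⬝ g) = flip g ⬝ flip f := by
  induction f using HeisHom.ind; induction g using HeisHom.ind
  rfl

theorem flip_cons (c : Arrow) (f : HeisHom 𝕜 u v) : flip (cons c f) = cons c (flip f) := by
  induction f using HeisHom.ind
  rfl

theorem flip_add (f g : HeisHom 𝕜 u v) : flip (f + g) = flip f + flip g := by
  induction f using HeisHom.ind; induction g using HeisHom.ind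
  rfl

theorem flip_X (b : Word) : flip (X b : HeisHom 𝕜 _ _) = X b := rfl
theorem flip_cR (b : Word) : flip (cR b : HeisHom 𝕜 _ _) = dL b := rfl
theorem flip_dR (b : Word) : flip (dR b : HeisHom 𝕜 _ _) = cL b := rfl
theorem flip_cL (b : Word) : flip (cL b : HeisHom 𝕜 _ _) = dR b := rfl
theorem flip_dL (b : Word) : flip (dL b : HeisHom 𝕜 _ _) = cR b := rfl
theorem flip_zero : flip (0 : HeisHom 𝕜 u v) = 0 := rfl

theorem flip_R (b : Word) : flip (R b : HeisHom 𝕜 _ _) = L b := by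
  rw [R_eq, L_eq]
  simp only [flip_comp, flip_cons, flip_X, flip_cR, flip_dR, comp_assoc]

theorem flip_L (b : Word) : flip (L b : HeisHom 𝕜 _ _) = R b := by
  rw [R_eq, L_eq]
  simp only [flip_comp, flip_cons, flip_X, flip_cL, flip_dL, comp_assoc]

end Flip

section Relations

variable (b : Word)

theorem X_X : X b ⬝ X b = (HeisHom.id _ : HeisHom 𝕜 _ _) := HeisHom.sound (.cross_cross b)
theorem X_braid : X (up :: b) ⬝ U (X b) ⬝ X (up :: b) =
    (U (X b) ⬝ X (up :: b) ⬝ U (X b) : HeisHom 𝕜 _ _) := HeisHom.sound (.braid b)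
theorem zig_upR : U (cR b) ⬝ dR (up :: b) = (HeisHom.id _ : HeisHom 𝕜 _ _) :=
  HeisHom.sound (.zigzag_upR b)
theorem zig_downR : cR (down :: b) ⬝ D (dR b) = (HeisHom.id _ : HeisHom 𝕜 _ _) :=
  HeisHom.sound (.zigzag_downR b)
theorem zig_upL : cL (up :: b) ⬝ U (dL b) = (HeisHom.id _ : HeisHom 𝕜 _ _) :=
  HeisHom.sound (.zigzag_upL b)
theorem zig_downL : D (cL b) ⬝ dL (down :: b) = (HeisHom.id _ : HeisHom 𝕜 _ _) :=
  HeisHom.sound (.zigzag_downL b)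
theorem R_L : R b ⬝ L b = (HeisHom.id _ : HeisHom 𝕜 _ _) := HeisHom.sound (.right_left b)
theorem L_R : L b ⬝ R b = (HeisHom.id _ - dL b ⬝ cR b : HeisHom 𝕜 _ _) := by
  rw [sub_eq_add_neg]
  exact HeisHom.sound (.left_right b)
theorem curl : cR (up :: b) ⬝ D (X b) ⬝ dL (up :: b) = (0 : HeisHom 𝕜 _ _) :=
  HeisHom.sound (.left_curl b)
theorem cR_dL : cR b ⬝ dL b = (HeisHom.id _ : HeisHom 𝕜 _ _) := HeisHom.sound (.bubble b)

/-- Apply `1_c ⊗ -` to an equation between composites of two morphisms. -/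
theorem cons_eq₂ {x : Word} (c : Arrow) {f : HeisHom 𝕜 u v} {g : HeisHom 𝕜 v w}
    {f' : HeisHom 𝕜 u x} {g' : HeisHom 𝕜 x w} (h : f ⬝ g = f' ⬝ g') :
    cons c f ⬝ cons c g = cons c f' ⬝ cons c g' := by
  rw [← cons_comp, h, cons_comp]

/-- Apply `1_c ⊗ -` to an equation between a composite of two morphisms and a morphism. -/
theorem cons_eq₁ (c : Arrow) {f : HeisHom 𝕜 u v} {g : HeisHom 𝕜 v w} {k : HeisHom 𝕜 u w}
    (h : f ⬝ g = k) : cons c f ⬝ cons c g = cons c k := by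
  rw [← cons_comp, h]

/-- Apply `1_c ⊗ -` to an equation between composites of three morphisms. -/
theorem cons_eq₃ {x y z : Word} (c : Arrow) {f : HeisHom 𝕜 u v} {g : HeisHom 𝕜 v w}
    {h : HeisHom 𝕜 w x} {f' : HeisHom 𝕜 u y} {g' : HeisHom 𝕜 y z} {h' : HeisHom 𝕜 z x}
    (e : f ⬝ g ⬝ h = f' ⬝ g' ⬝ h') :
    cons c f ⬝ cons c g ⬝ cons c h = cons c f' ⬝ cons c g' ⬝ cons c h' := by
  rw [← cons_comp, ← cons_comp, e, cons_comp, cons_comp]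

/-- A pitchfork move: a strand is pulled through a cup. Written out, the left crossing contains a
cap that cancels the new cup by a zigzag. The next three lemmas are the same move with other
orientations, the last two by reflection. -/
theorem cL_UL : cL (up :: b) ⬝ U (L b) = (U (cL b) ⬝ X (down :: b) : HeisHom 𝕜 _ _) := by
  rw [L_eq, cons_comp, cons_comp, comp_reassoc (cL_nat (U (cL b))), comp_assoc,
    comp_reassoc (cL_nat _), comp_assoc, zig_upL, comp_id]

theorem L_UdL : L (up :: b) ⬝ U (dL b) = (D (X b) ⬝ dL (up :: b) : HeisHom 𝕜 _ _) := by
  rw [L_eq, comp_assoc, comp_assoc, dL_nat, comp_reassoc (cons_eq₂ _ (X_nat (dL b))), comp_assoc,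
    comp_reassoc (cons_eq₁ _ (cons_eq₁ _ (zig_upL b))), cons_id, cons_id, id_comp]

theorem UR_dR : U (R b) ⬝ dR (up :: b) = (X (down :: b) ⬝ U (dR b) : HeisHom 𝕜 _ _) := by
  simpa only [flip_comp, flip_cons, flip_L, flip_X, flip_cL] using congrArg flip (cL_UL b)

theorem UcR_R : U (cR b) ⬝ R (up :: b) = (cR (up :: b) ⬝ D (X b) : HeisHom 𝕜 _ _) := by
  simpa only [flip_comp, flip_cons, flip_L, flip_X, flip_dL] using congrArg flip (L_UdL b)

/-- The left cap can be moved below the right cap contained in `R b`, and then it closes a left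
curl. -/
theorem R_dL : R b ⬝ dL b = (0 : HeisHom 𝕜 _ _) := by
  rw [R_eq, comp_assoc, comp_assoc, ← dL_nat, comp_reassoc₃ (curl _), zero_comp]

theorem cR_L : cR b ⬝ L b = (0 : HeisHom 𝕜 _ _) := by
  simpa only [flip_comp, flip_R, flip_dL, flip_zero] using congrArg flip (R_dL b)

theorem Y_DdL : Y (up :: b) ⬝ D (dL b) = (D (L b) ⬝ dL (down :: b) : HeisHom 𝕜 _ _) := by
  rw [Y_eq, comp_assoc, comp_assoc, dL_nat, comp_reassoc (cons_eq₂ _ (L_nat (dL b))), comp_assoc,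
    comp_reassoc (cons_eq₁ _ (cons_eq₁ _ (zig_upL b))), cons_id, cons_id, id_comp]

theorem cL_UY : cL (down :: b) ⬝ U (Y b) = (D (cL b) ⬝ L (down :: b) : HeisHom 𝕜 _ _) := by
  rw [Y_eq, cons_comp, cons_comp, comp_reassoc (cL_nat (D (cL b))), comp_assoc,
    comp_reassoc (cL_nat _), comp_assoc, zig_upL, comp_id]

/-- Prepares `flip_Y`. A zigzag recovers a morphism from the one in which a strand has been bent, so
the two sides may be compared after bending. There the downward crossing and the right cap become
`L` followed by `R`, and the correction term of `L_R` produces the second summand. -/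
theorem L_UY_dR : L (down :: b) ⬝ U (Y b) ⬝ dR (down :: b) =
    (D (dR b) - dL (down :: b) : HeisHom 𝕜 _ _) := by
  have h : ∀ f : HeisHom 𝕜 (down :: up :: down :: b) (down :: b),
      D (cL (up :: down :: b) ⬝ U f) ⬝ dL (down :: b) = f := fun f => by
    rw [cons_comp, comp_assoc, ← dL_nat, comp_reassoc (zig_downL _), id_comp]
  refine (h _).symm.trans (Eq.trans ?_ (h _))
  congr 2
  rw [cons_sub, comp_sub, zig_upL, cL_nat, cons_comp, cons_comp, comp_reassoc (cL_UL _),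
    comp_assoc, comp_reassoc (X_nat _), comp_assoc, ← UR_dR,
    comp_reassoc (cons_eq₂ up (cL_UY b)), comp_assoc, comp_reassoc (cons_eq₁ up (L_R _)),
    cons_sub, sub_comp, comp_sub, cons_id, id_comp, ← dR_nat, cons_comp, comp_assoc,
    zig_upR, comp_id, cons_eq₁ up (zig_downL b), cons_id]

/-- The downward crossing is the upward one rotated by left cups and caps, and its mirror image is
the rotation by right ones; the two rotations agree. In `L_UY_dR`, composing with `R` cancels the
left crossing and kills the unwanted cap by `R_dL`. -/
theorem flip_Y : flip (Y b : HeisHom 𝕜 _ _) = Y b := by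
  have h : ∀ f : HeisHom 𝕜 (down :: down :: b) (down :: down :: b),
      cR (down :: down :: b) ⬝ D (U f ⬝ dR (down :: b)) = f := fun f => by
    rw [cons_comp, comp_reassoc (cR_nat _), comp_assoc, zig_downR, comp_id]
  refine (h _).symm.trans (Eq.trans ?_ (h _))
  congr 2
  have h1 := congrArg flip (cL_UY (𝕜 := 𝕜) b)
  simp only [flip_comp, flip_cons, flip_L, flip_cL] at h1
  have h2 := congrArg (fun f => R (down :: b) ⬝ f) (L_UY_dR (𝕜 := 𝕜) b)
  simp only [comp_sub] at h2
  rw [R_dL, sub_zero, comp_reassoc (R_L _), id_comp] at h2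
  rw [h1, h2]

theorem DcR_Y : D (cR b) ⬝ Y (up :: b) = (cR (down :: b) ⬝ D (R b) : HeisHom 𝕜 _ _) := by
  simpa only [flip_comp, flip_cons, flip_L, flip_Y, flip_dL] using congrArg flip (Y_DdL b)

theorem L_UL : L (up :: b) ⬝ U (L b) = (D (U (U (cL b))) ⬝ D (U (X (down :: b))) ⬝
    D (X (up :: down :: b)) ⬝ dL (up :: up :: down :: b) : HeisHom 𝕜 _ _) := by
  rw [L_eq, comp_assoc, comp_assoc, dL_nat, comp_reassoc (cons_eq₂ _ (X_nat (L b))), comp_assoc,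
    comp_reassoc (cons_eq₂ _ (cons_eq₂ _ (cL_UL b))), comp_assoc]

/-- The upward braid relation with one strand turned around. The lemmas `Y_L_L` and `Y_braid` turn
the remaining strands around in the same way, each starting from the previous relation. -/
theorem X_L_L : D (X b) ⬝ L (up :: b) ⬝ U (L b) =
    (L (up :: b) ⬝ U (L b) ⬝ X (down :: b) : HeisHom 𝕜 _ _) := by
  rw [L_UL, comp_reassoc (cons_eq₂ _ (X_nat (cL b))), comp_assoc, ← comp_assoc (L (up :: b)),
    L_UL, comp_assoc, comp_assoc, comp_assoc, dL_nat,
    comp_reassoc₃ (cons_eq₃ down (X_braid _)), comp_assoc, comp_assoc]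

theorem L_UY : L (down :: b) ⬝ U (Y b) = (D (U (D (cL b))) ⬝ D (U (L (down :: b))) ⬝
    D (X (down :: down :: b)) ⬝ dL (up :: down :: down :: b) : HeisHom 𝕜 _ _) := by
  conv_lhs => rw [L_eq]
  rw [comp_assoc, comp_assoc, dL_nat, comp_reassoc (cons_eq₂ _ (X_nat (Y b))), comp_assoc,
    comp_reassoc (cons_eq₂ _ (cons_eq₂ _ (cL_UY b))), comp_assoc]

theorem Y_L_L : Y (up :: b) ⬝ D (L b) ⬝ L (down :: b) =
    (D (L b) ⬝ L (down :: b) ⬝ U (Y b) : HeisHom 𝕜 _ _) := by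
  rw [L_UY, comp_reassoc (cons_eq₂ _ (L_nat (cL b))), comp_assoc, Y_eq, comp_assoc, comp_assoc,
    comp_reassoc (dL_nat _), comp_assoc, comp_reassoc (cons_eq₂ _ (L_nat (L b))), comp_assoc,
    comp_reassoc (cons_eq₂ _ (cons_eq₂ _ (cL_UL b))), comp_assoc, dL_nat,
    comp_reassoc₃ (cons_eq₃ down (X_L_L (down :: b))), comp_assoc, comp_assoc]

theorem Y_DY : Y (down :: b) ⬝ D (Y b) = (D (D (D (cL b))) ⬝ D (D (L (down :: b))) ⬝
    D (L (down :: down :: b)) ⬝ dL (down :: down :: down :: b) : HeisHom 𝕜 _ _) := by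
  conv_lhs => rw [Y_eq]
  rw [comp_assoc, comp_assoc, dL_nat, comp_reassoc (cons_eq₂ _ (L_nat (Y b))), comp_assoc,
    comp_reassoc (cons_eq₂ _ (cons_eq₂ _ (cL_UY b))), comp_assoc]

theorem Y_braid : Y (down :: b) ⬝ D (Y b) ⬝ Y (down :: b) =
    (D (Y b) ⬝ Y (down :: b) ⬝ D (Y b) : HeisHom 𝕜 _ _) := by
  rw [Y_DY, comp_reassoc (cons_eq₂ _ (Y_nat (cL b))), comp_assoc, ← comp_assoc (Y (down :: b)),
    Y_DY, comp_assoc, comp_assoc, comp_assoc, dL_nat,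
    comp_reassoc₃ (cons_eq₃ down (Y_L_L (down :: b))), comp_assoc, comp_assoc]

theorem Y_Y : Y b ⬝ Y b = (HeisHom.id _ : HeisHom 𝕜 _ _) := by
  have h : ∀ f : HeisHom 𝕜 (down :: down :: b) (down :: down :: b),
      D (cL (down :: b) ⬝ U f) ⬝ dL (down :: down :: b) = f := fun f => by
    rw [cons_comp, comp_assoc, ← dL_nat, comp_reassoc (zig_downL _), id_comp]
  refine (h _).symm.trans (Eq.trans ?_ (h _))
  congr 2
  rw [cons_comp, cons_id, comp_id, comp_reassoc (cL_UY b), comp_assoc, L_UY,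
    comp_reassoc (cons_eq₂ down (cL_nat _)), comp_assoc,
    comp_reassoc (cons_eq₂ down (cL_UL _)), comp_assoc, comp_reassoc (cons_eq₁ down (X_X _)),
    cons_id, id_comp, ← dL_nat, comp_reassoc (zig_downL _), id_comp]

/-- Multiply `X_L_L` by right crossings on both sides. Since `L ⬝ R` is not the identity a cap-cup
term arises, but after a pitchfork move it contains a right crossing below a left cap and vanishes.
`R_Y_L` follows from `Y_L_L` by the same argument. -/
theorem R_X_L : R (up :: b) ⬝ D (X b) ⬝ L (up :: b) =
    (U (L b) ⬝ X (down :: b) ⬝ U (R b) : HeisHom 𝕜 _ _) := by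
  have h := congrArg (fun f => R (up :: b) ⬝ f ⬝ U (R b)) (X_L_L (𝕜 := 𝕜) b)
  simp only [comp_assoc] at h
  rw [comp_reassoc (R_L _), id_comp, cons_eq₁ up (L_R b), cons_sub, cons_id, cons_comp, comp_sub,
    comp_sub, comp_sub, comp_id, comp_reassoc (L_UdL b), comp_assoc,
    comp_reassoc (cons_eq₁ down (X_X b)), cons_id, id_comp, comp_reassoc (R_dL _), zero_comp,
    sub_zero] at h
  exact h

theorem R_Y_L : D (R b) ⬝ Y (up :: b) ⬝ D (L b) =
    (L (down :: b) ⬝ U (Y b) ⬝ R (down :: b) : HeisHom 𝕜 _ _) := by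
  have h := congrArg (fun f => D (R b) ⬝ f ⬝ R (down :: b)) (Y_L_L (𝕜 := 𝕜) b)
  simp only [comp_assoc] at h
  rw [comp_reassoc (cons_eq₁ down (R_L b)), cons_id, id_comp, L_R, comp_sub,
    comp_sub, comp_sub, comp_id, comp_reassoc (Y_DdL b).symm, comp_assoc,
    comp_reassoc (Y_Y (up :: b)), id_comp, comp_reassoc (cons_eq₁ down (R_dL _)), cons_zero,
    zero_comp, sub_zero] at h
  exact h

theorem R_R_Y : R (down :: b) ⬝ D (R b) ⬝ Y (up :: b) =
    (U (Y b) ⬝ R (down :: b) ⬝ D (R b) : HeisHom 𝕜 _ _) := by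
  simpa only [flip_comp, flip_cons, flip_L, flip_Y, comp_assoc] using congrArg flip (Y_L_L b)

theorem R_R_X : U (R b) ⬝ R (up :: b) ⬝ D (X b) =
    (X (down :: b) ⬝ U (R b) ⬝ R (up :: b) : HeisHom 𝕜 _ _) := by
  simpa only [flip_comp, flip_cons, flip_L, flip_X, comp_assoc] using congrArg flip (X_L_L b)

end Relations

end HeisHom

end HeisenbergCalculus

end PartHeis

namespace PartHeis

/-! ### The Frobenius algebra ↑↓ in the Heisenberg category and its half-braidings. -/

section HalfBraidings

open Arrow

namespace HeisHom

variable {𝕜 : Type u} [CommRing 𝕜]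

local infixr:80 " ⬝ " => HeisHom.comp
local notation "U" => HeisHom.cons up
local notation "D" => HeisHom.cons down

/-- The multiplication of the Frobenius algebra `↑↓`. -/
def mul (b : Word) : HeisHom 𝕜 (up :: down :: up :: down :: b) (up :: down :: b) :=
  U (dL (down :: b))

/-- The comultiplication of the Frobenius algebra `↑↓`. -/
def comul (b : Word) : HeisHom 𝕜 (up :: down :: b) (up :: down :: up :: down :: b) :=
  U (cR (down :: b))

/-- The first summand of the symmetry of `↑↓`. -/
def crossing (b : Word) :
    HeisHom 𝕜 (up :: down :: up :: down :: b) (up :: down :: up :: down :: b) :=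
  U (L (down :: b)) ⬝ X (down :: down :: b) ⬝ U (U (Y b)) ⬝ U (R (down :: b))

/-- The symmetry of `↑↓`. -/
def swap (b : Word) :
    HeisHom 𝕜 (up :: down :: up :: down :: b) (up :: down :: up :: down :: b) :=
  crossing b + mul b ⬝ comul b

/-- The part of the half-braiding of `↑↓` with `↑` that keeps `↑↓`. -/
def slideUp (b : Word) : HeisHom 𝕜 (up :: down :: up :: b) (up :: up :: down :: b) :=
  U (L b) ⬝ X (down :: b)

/-- The part of the half-braiding of `↑↓` with `↑` that absorbs `↑↓`. -/
def absorbUp (b : Word) : HeisHom 𝕜 (up :: down :: up :: b) (up :: b) := U (dL b)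

/-- The part of the half-braiding of `↑↓` with `↓` that keeps `↑↓`. -/
def slideDown (b : Word) : HeisHom 𝕜 (up :: down :: down :: b) (down :: up :: down :: b) :=
  U (Y b) ⬝ R (down :: b)

/-- The part of the half-braiding of `↑↓` with `↓` that creates `↑↓`. -/
def createDown (b : Word) : HeisHom 𝕜 (down :: b) (down :: up :: down :: b) := cR (down :: b)

variable (b : Word)

theorem flip_mul : flip (mul b : HeisHom 𝕜 _ _) = comul b := rfl
theorem flip_comul : flip (comul b : HeisHom 𝕜 _ _) = mul b := rfl

theorem flip_swap : flip (swap b : HeisHom 𝕜 _ _) = swap b := by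
  simp only [swap, crossing, flip_add, flip_comp, flip_cons, flip_L, flip_X, flip_Y, flip_R,
    flip_mul, flip_comul, comp_assoc]
  rw [comp_reassoc (X_nat (Y b)), comp_assoc]

/-- Passing one generating object at a time: an object `↑↓` moving past `↑` becomes `↑↓ ⊕ 1`, with
components `slideUp` and `absorbUp`, and moving past `↓` turns `↑↓ ⊕ 1` back into `↑↓`, by
`slideDown` and `createDown`. This mirrors the restriction of the permutation module on n points to
a point stabiliser, which has n − 1 points and one fixed point. Relations for `swap` can thus be
proved separately for `↑` and `↓`, component by component. -/
theorem swap_eq : (swap b : HeisHom 𝕜 _ _) =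
    slideUp (down :: b) ⬝ U (slideDown b) + absorbUp (down :: b) ⬝ U (createDown b) := by
  simp only [swap, crossing, slideUp, slideDown, absorbUp, createDown, mul, comul, comp_assoc,
    cons_comp]

theorem swap_mul : swap b ⬝ mul b = (mul b : HeisHom 𝕜 _ _) := by
  rw [swap, crossing, add_comp, mul, comul]
  simp only [comp_assoc]
  rw [cons_eq₁ up (R_dL _), cons_eq₁ up (cR_dL _), cons_id, comp_id, cons_zero]
  simp only [comp_zero, zero_add]

theorem comul_swap : comul b ⬝ swap b = (comul b : HeisHom 𝕜 _ _) := by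
  simpa only [flip_comp, flip_mul, flip_swap] using congrArg flip (swap_mul (𝕜 := 𝕜) b)

theorem comul_mul : comul b ⬝ mul b = (HeisHom.id _ : HeisHom 𝕜 _ _) := by
  rw [mul, comul, cons_eq₁ up (cR_dL _), cons_id]

/-- The square of `crossing` is the identity minus `mul ⬝ comul`, by the correction term of `L_R`.
Both mixed products are controlled by `R_dL` and `comul_swap`, and the second summand of `swap`
restores the missing term. -/
theorem swap_swap : swap b ⬝ swap b = (HeisHom.id _ : HeisHom 𝕜 _ _) := by
  conv_lhs => enter [1]; rw [swap]
  rw [add_comp, comp_assoc, comul_swap, swap, comp_add, crossing]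
  simp only [comp_assoc]
  rw [comp_reassoc (cons_eq₁ up (R_L _)), cons_id, id_comp, comul, mul,
    comp_reassoc (cons_eq₁ up (R_dL _)), cons_zero, zero_comp, comp_reassoc (X_nat (Y b)).symm,
    comp_assoc, comp_reassoc (X_X _), id_comp, comp_reassoc (cons_eq₁ up (cons_eq₁ up (Y_Y b))),
    cons_id, cons_id, id_comp, cons_eq₁ up (L_R _), cons_eq₂ up rfl, cons_sub, cons_comp, cons_id]
  simp only [comp_zero, add_zero, sub_add_cancel]

/-! #### Half-braiding with `↑` -/

/-- Together with `mul_absorbUp`: the half-braiding past `↑` is multiplicative, where `↑↓ ⊕ 1`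
carries the product algebra structure. -/
theorem mul_slideUp : mul (up :: b) ⬝ slideUp b =
    (U (D (slideUp b)) ⬝ slideUp (up :: down :: b) ⬝ U (mul b) : HeisHom 𝕜 _ _) := by
  simp only [mul, slideUp, cons_comp, comp_assoc]
  rw [X_nat, comp_reassoc (cons_eq₂ up (L_UdL _)), comp_assoc,
    comp_reassoc (cons_eq₁ up (cons_eq₁ down (X_X _))), cons_id, cons_id, id_comp,
    comp_reassoc (cons_eq₂ up (dL_nat _)), comp_assoc]

theorem mul_absorbUp : mul (up :: b) ⬝ absorbUp b =
    (U (D (absorbUp b)) ⬝ absorbUp b : HeisHom 𝕜 _ _) := by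
  simp only [mul, absorbUp]
  rw [cons_eq₂ up (dL_nat _)]

theorem comul_slideUp : comul (up :: b) ⬝ U (D (slideUp b)) ⬝ slideUp (up :: down :: b) =
    (slideUp b ⬝ U (comul b) : HeisHom 𝕜 _ _) := by
  simp only [comul, slideUp, cons_comp, comp_assoc]
  rw [comp_reassoc (cons_eq₂ up (cR_nat (L b))), comp_assoc,
    comp_reassoc (cons_eq₂ up (UcR_R (down :: b)).symm), comp_assoc,
    comp_reassoc (cons_eq₁ up (R_L _)), cons_id, id_comp, X_nat]

theorem unit_slideUp : cL (up :: b) ⬝ slideUp b = (U (cL b) : HeisHom 𝕜 _ _) := by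
  rw [slideUp, comp_reassoc (cL_UL b), comp_assoc, X_X, comp_id]

theorem unit_absorbUp : cL (up :: b) ⬝ absorbUp b = (HeisHom.id _ : HeisHom 𝕜 _ _) := zig_upL b

/-- An isotopy without correction terms: all strands of the crossing are moved past `↑` by the braid
relations in their mixed orientations, namely `R_X_L`, `Y_L_L`, `X_braid` and `X_L_L`. -/
theorem crossing_slideUp :
    crossing (up :: b) ⬝ U (D (slideUp b)) ⬝ slideUp (up :: down :: b) =
    (U (D (slideUp b)) ⬝ slideUp (up :: down :: b) ⬝ U (crossing b) : HeisHom 𝕜 _ _) := by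
  simp only [crossing, slideUp, cons_comp, comp_assoc]
  rw [comp_reassoc (cons_eq₂ up (R_nat (L b))), comp_assoc,
    comp_reassoc₃ (cons_eq₃ up (R_X_L (down :: b))), comp_assoc, comp_assoc,
    comp_reassoc₃ (cons_eq₃ up (cons_eq₃ up (Y_L_L b))), comp_assoc, comp_assoc,
    ← X_nat (R (down :: b)), comp_reassoc (cons_eq₂ up (X_nat (Y b)).symm), comp_assoc,
    comp_reassoc (X_nat (U (Y b))).symm, comp_assoc, comp_reassoc (X_nat (D (L b))), comp_assoc,
    comp_reassoc (X_nat (L _)), comp_assoc, comp_reassoc₃ (X_braid _), comp_assoc, comp_assoc,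
    comp_reassoc (cons_eq₂ up (L_nat (L b))), comp_assoc,
    comp_reassoc (X_nat (L _)), comp_assoc, comp_reassoc₃ (cons_eq₃ up (X_L_L _)), comp_assoc,
    comp_assoc]

theorem swap_slideUp :
    swap (up :: b) ⬝ U (D (slideUp b)) ⬝ slideUp (up :: down :: b) =
    (U (D (slideUp b)) ⬝ slideUp (up :: down :: b) ⬝ U (swap b) : HeisHom 𝕜 _ _) := by
  rw [swap, add_comp, crossing_slideUp, comp_assoc, comul_slideUp, comp_reassoc (mul_slideUp b),
    swap, cons_add, comp_add, comp_add, cons_comp]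
  simp only [comp_assoc]

/-- On the mixed components of two copies of `↑↓ ⊕ 1` the symmetry exchanges the roles of the two
copies. Only `crossing` contributes: the term with `comul` contains a left curl. -/
theorem swap_absorbUp_slideUp :
    swap (up :: b) ⬝ U (D (slideUp b)) ⬝ absorbUp (up :: down :: b) =
    (U (D (absorbUp b)) ⬝ slideUp b : HeisHom 𝕜 _ _) := by
  simp only [swap, crossing, slideUp, absorbUp, mul, comul, add_comp, cons_comp, comp_assoc]
  have h : U (cR (up :: down :: b)) ⬝ U (D (X (down :: b))) ⬝ U (dL (up :: down :: b)) =
      (0 : HeisHom 𝕜 _ _) := by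
    rw [← cons_comp, ← cons_comp, curl, cons_zero]
  rw [comp_reassoc (cons_eq₂ up (cR_nat (L b))), comp_assoc, h, comp_zero, comp_zero, add_zero,
    comp_reassoc (cons_eq₂ up (R_nat (L b))), comp_assoc, ← cons_eq₂ up (L_UdL (down :: b)),
    comp_reassoc (cons_eq₁ up (R_L _)), cons_id, id_comp,
    ← cons_eq₂ up (cons_eq₂ up (Y_DdL b)), comp_reassoc (cons_eq₁ up (cons_eq₁ up (Y_Y _))),
    cons_id, cons_id, id_comp, X_nat, comp_reassoc (cons_eq₂ up (L_nat (dL b))), comp_assoc]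

theorem swap_slideUp_absorbUp :
    swap (up :: b) ⬝ U (D (absorbUp b)) ⬝ slideUp b =
    (U (D (slideUp b)) ⬝ absorbUp (up :: down :: b) : HeisHom 𝕜 _ _) := by
  rw [← swap_absorbUp_slideUp, comp_reassoc (swap_swap _), id_comp]

theorem swap_absorbUp : swap (up :: b) ⬝ U (D (absorbUp b)) ⬝ absorbUp b =
    (U (D (absorbUp b)) ⬝ absorbUp b : HeisHom 𝕜 _ _) := by
  rw [← mul_absorbUp, comp_reassoc (swap_mul _)]

/-! #### Half-braiding with `↓` -/

theorem mul_slideDown : mul (down :: b) ⬝ slideDown b =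
    (U (D (slideDown b)) ⬝ slideDown (up :: down :: b) ⬝ D (mul b) : HeisHom 𝕜 _ _) := by
  simp only [mul, slideDown, cons_comp, comp_assoc]
  rw [R_nat (dL (down :: b)), comp_reassoc (cons_eq₂ up (Y_DdL _)), comp_assoc,
    comp_reassoc (cons_eq₁ up (cons_eq₁ down (R_L _))), cons_id, cons_id, id_comp,
    comp_reassoc (cons_eq₂ up (dL_nat (Y b))), comp_assoc]

/-- With `mul_slideDown` and the next two lemmas: multiplication on `↑↓ ⊕ 1` is componentwise, so
products of elements of different components are zero. -/
theorem createDown_createDown_mul : createDown b ⬝ createDown (up :: down :: b) ⬝ D (mul b) =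
    (createDown b : HeisHom 𝕜 _ _) := by
  simp only [mul, createDown]
  rw [cR_nat, comp_reassoc (cR_dL _), id_comp]

theorem createDown_slideDown_mul :
    U (D (createDown b)) ⬝ slideDown (up :: down :: b) ⬝ D (mul b) = (0 : HeisHom 𝕜 _ _) := by
  simp only [mul, slideDown, createDown, comp_assoc]
  rw [R_nat, comp_reassoc (cons_eq₂ up (Y_DdL _)), comp_assoc,
    comp_reassoc (cons_eq₁ up (cons_eq₁ down (cR_L _))), cons_zero, cons_zero, zero_comp]

theorem slideDown_createDown_mul :
    slideDown b ⬝ createDown (up :: down :: b) ⬝ D (mul b) = (0 : HeisHom 𝕜 _ _) := by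
  simp only [mul, slideDown, createDown, comp_assoc]
  rw [cR_nat, comp_reassoc (R_dL _), zero_comp, comp_zero]

theorem comul_slideDown : comul (down :: b) ⬝ U (D (slideDown b)) ⬝ slideDown (up :: down :: b) =
    (slideDown b ⬝ D (comul b) : HeisHom 𝕜 _ _) := by
  simp only [comul, slideDown, cons_comp, comp_assoc]
  rw [comp_reassoc (cons_eq₂ up (cR_nat (Y b))), comp_assoc,
    comp_reassoc (cons_eq₂ up (DcR_Y (down :: b)).symm), comp_assoc,
    comp_reassoc (cons_eq₁ up (Y_Y _)), cons_id, id_comp, R_nat]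

/-- The unit of a product algebra has a component in each factor. The defect of the first one is the
correction term of `L_R`, which a zigzag identifies with the second. -/
theorem unit_slideDown : cL (down :: b) ⬝ slideDown b + createDown b =
    (D (cL b) : HeisHom 𝕜 _ _) := by
  rw [slideDown, createDown, comp_reassoc (cL_UY b), comp_assoc, L_R, comp_sub, comp_id,
    comp_reassoc (zig_downL b), id_comp, sub_add_cancel]

theorem crossing_slideDown :
    crossing (down :: b) ⬝ U (D (slideDown b)) ⬝ slideDown (up :: down :: b) =
    (U (D (slideDown b)) ⬝ slideDown (up :: down :: b) ⬝ D (crossing b) : HeisHom 𝕜 _ _) := by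
  simp only [crossing, slideDown, cons_comp, comp_assoc]
  rw [comp_reassoc (R_nat (L (down :: b))), comp_assoc,
    comp_reassoc₃ (cons_eq₃ up (R_Y_L (down :: b))), comp_assoc, comp_assoc,
    comp_reassoc₃ (R_R_X _), comp_assoc, comp_assoc, comp_reassoc (R_nat (U (Y b))), comp_assoc,
    comp_reassoc (cons_eq₂ up (R_nat (Y b))), comp_assoc, R_nat (R (down :: b)),
    comp_reassoc (cons_eq₂ up (L_nat (Y b))).symm, comp_assoc,
    comp_reassoc (X_nat (Y (down :: b))).symm, comp_assoc,
    comp_reassoc (X_nat (D (Y b))).symm, comp_assoc,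
    comp_reassoc (cons_eq₂ up (R_nat (Y b))), comp_assoc,
    comp_reassoc₃ (cons_eq₃ up (R_R_Y _)), comp_assoc, comp_assoc,
    comp_reassoc₃ (cons_eq₃ up (cons_eq₃ up (Y_braid b))), comp_assoc, comp_assoc]

theorem swap_slideDown :
    swap (down :: b) ⬝ U (D (slideDown b)) ⬝ slideDown (up :: down :: b) =
    (U (D (slideDown b)) ⬝ slideDown (up :: down :: b) ⬝ D (swap b) : HeisHom 𝕜 _ _) := by
  rw [swap, add_comp, crossing_slideDown, comp_assoc, comul_slideDown,
    comp_reassoc (mul_slideDown b), swap, cons_add, comp_add, comp_add, cons_comp]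
  simp only [comp_assoc]

/-- The counterpart of `swap_absorbUp_slideUp` for `↓`. Here the summand `mul ⬝ comul` of the
symmetry drops out because mixed products vanish. -/
theorem slideDown_createDown_swap :
    slideDown b ⬝ createDown (up :: down :: b) ⬝ D (swap b) =
    (U (D (createDown b)) ⬝ slideDown (up :: down :: b) : HeisHom 𝕜 _ _) := by
  rw [swap, cons_add, comp_add, comp_add, cons_comp, comp_reassoc₃ (slideDown_createDown_mul b),
    zero_comp, add_zero]
  simp only [crossing, slideDown, createDown, cons_comp, comp_assoc]
  rw [comp_reassoc (cR_nat (L (down :: b))), comp_assoc, comp_reassoc (R_L _), id_comp,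
    comp_reassoc (UcR_R _).symm, comp_assoc, comp_reassoc (R_nat (U (Y b))), comp_assoc,
    comp_reassoc (cons_eq₂ up (cR_nat (Y b))), comp_assoc, comp_reassoc (cons_eq₁ up (Y_Y _)),
    cons_id, id_comp, R_nat (R (down :: b)), comp_reassoc (cons_eq₂ up (DcR_Y _)).symm, comp_assoc]

theorem createDown_slideDown_swap :
    U (D (createDown b)) ⬝ slideDown (up :: down :: b) ⬝ D (swap b) =
    (slideDown b ⬝ createDown (up :: down :: b) : HeisHom 𝕜 _ _) := by
  rw [← comp_assoc, ← slideDown_createDown_swap, comp_assoc, comp_assoc,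
    cons_eq₁ down (swap_swap b), cons_id, comp_id]

theorem createDown_createDown_swap :
    createDown b ⬝ createDown (up :: down :: b) ⬝ D (swap b) =
    (createDown b ⬝ createDown (up :: down :: b) : HeisHom 𝕜 _ _) := by
  simp only [createDown]
  rw [comp_reassoc (cR_nat (cR (down :: b))).symm, comp_assoc, ← cR_nat]
  exact congrArg _ (cons_eq₁ down (comul_swap b))

/-! #### The relations of the partition category -/

theorem slideUp_nat {b b' : Word} (f : HeisHom 𝕜 b b') :
    U (D (U f)) ⬝ slideUp b' = slideUp b ⬝ U (U (D f)) := by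
  rw [slideUp, slideUp, comp_assoc, X_nat, comp_reassoc (cons_eq₂ up (L_nat f)), comp_assoc]

theorem absorbUp_nat {b b' : Word} (f : HeisHom 𝕜 b b') :
    U (D (U f)) ⬝ absorbUp b' = absorbUp b ⬝ U f := by
  rw [absorbUp, absorbUp, cons_eq₂ up (dL_nat f)]

/-- Two copies of `↑↓` pass a third one, first its `↑` and then its `↓`. Of the four terms each
corresponds to a choice of the component `↑↓` or `1` for each of the two moving copies. -/
theorem cons_swap_swap : U (D (swap b)) ⬝ swap (up :: down :: b) =
    (((U (D (slideUp (down :: b))) ⬝ slideUp (up :: down :: down :: b)) ⬝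
        U (U (D (slideDown b)) ⬝ slideDown (up :: down :: b)) +
      (U (D (slideUp (down :: b))) ⬝ absorbUp (up :: down :: down :: b)) ⬝
        U (slideDown b ⬝ createDown (up :: down :: b))) +
      ((U (D (absorbUp (down :: b))) ⬝ slideUp (down :: b)) ⬝
        U (U (D (createDown b)) ⬝ slideDown (up :: down :: b)) +
      (U (D (absorbUp (down :: b))) ⬝ absorbUp (down :: b)) ⬝
        U (createDown b ⬝ createDown (up :: down :: b))) : HeisHom 𝕜 _ _) := by
  rw [swap_eq, swap_eq]
  simp only [cons_add, cons_comp, add_comp, comp_add, comp_assoc]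
  rw [comp_reassoc (slideUp_nat (slideDown b)), comp_reassoc (absorbUp_nat (slideDown b)),
    comp_reassoc (slideUp_nat (createDown b)), comp_reassoc (absorbUp_nat (createDown b))]
  simp only [comp_assoc]
  rw [add_add_add_comm]

/-- Multiplying the two moving copies at the end kills the two mixed terms of `cons_swap_swap`; what
remains is `swap_eq` with the multiplication moved to the front. -/
theorem mul_swap : mul (up :: down :: b) ⬝ swap b =
    (U (D (swap b)) ⬝ swap (up :: down :: b) ⬝ U (D (mul b)) : HeisHom 𝕜 _ _) := by
  rw [← comp_assoc (U (D (swap b))), cons_swap_swap]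
  simp only [add_comp]
  rw [comp_assoc _ _ (U (D (mul b))), comp_assoc _ _ (U (D (mul b))),
    comp_assoc _ _ (U (D (mul b))), comp_assoc _ _ (U (D (mul b))),
    ← cons_comp, ← cons_comp, ← cons_comp, ← cons_comp, comp_assoc (slideDown b),
    slideDown_createDown_mul, comp_assoc (U (D (createDown b))), createDown_slideDown_mul,
    comp_assoc (createDown b), createDown_createDown_mul, comp_assoc (U (D (slideDown b))),
    ← mul_slideDown, cons_zero, comp_zero, comp_zero, ← mul_absorbUp, swap_eq, comp_add,
    ← comp_assoc, mul_slideUp, zero_add, add_zero]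
  simp only [cons_comp, comp_assoc]

theorem unit_swap : cL (up :: down :: b) ⬝ swap b = (U (D (cL b)) : HeisHom 𝕜 _ _) := by
  rw [swap_eq, comp_add, comp_reassoc (unit_slideUp _), comp_reassoc (unit_absorbUp _), id_comp,
    ← cons_comp, ← cons_add, unit_slideDown]

theorem swap_braid : swap (up :: down :: b) ⬝ U (D (swap b)) ⬝ swap (up :: down :: b) =
    (U (D (swap b)) ⬝ swap (up :: down :: b) ⬝ U (D (swap b)) : HeisHom 𝕜 _ _) := by
  rw [← comp_assoc (U (D (swap b))), cons_swap_swap]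
  simp only [add_comp, comp_add]
  rw [comp_assoc _ _ (U (D (swap b))), comp_assoc _ _ (U (D (swap b))),
    comp_assoc _ _ (U (D (swap b))), comp_assoc _ _ (U (D (swap b))),
    ← cons_comp, ← cons_comp, ← cons_comp, ← cons_comp, comp_assoc (slideDown b),
    slideDown_createDown_swap, comp_assoc (U (D (createDown b))), createDown_slideDown_swap,
    comp_assoc (createDown b), createDown_createDown_swap, comp_assoc (U (D (slideDown b))),
    ← swap_slideDown]
  simp only [comp_assoc]
  rw [comp_reassoc₃ (swap_slideUp _), comp_reassoc₃ (swap_absorbUp_slideUp _),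
    comp_reassoc₃ (swap_slideUp_absorbUp _), comp_reassoc₃ (swap_absorbUp _)]
  simp only [cons_comp, comp_assoc]
  -- The symmetry fixes the two pure terms and exchanges the two mixed ones, on either side, so the
  -- sums differ only in their order.
  abel

theorem comul_swap_swap : U (D (comul b)) ⬝ swap (up :: down :: b) ⬝ U (D (swap b)) =
    (swap b ⬝ comul (up :: down :: b) : HeisHom 𝕜 _ _) := by
  simpa only [flip_comp, flip_cons, flip_mul, flip_swap, comp_assoc] using
    (congrArg flip (mul_swap (𝕜 := 𝕜) b)).symm

theorem swap_counit : swap b ⬝ dR (up :: down :: b) = (U (D (dR b)) : HeisHom 𝕜 _ _) := by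
  simpa only [flip_comp, flip_cons, flip_cL, flip_swap] using congrArg flip (unit_swap (𝕜 := 𝕜) b)

theorem mul_mul : mul (up :: down :: b) ⬝ mul b =
    (U (D (mul b)) ⬝ mul b : HeisHom 𝕜 _ _) := cons_eq₂ up (dL_nat (dL (down :: b)))

theorem unit_mul : cL (up :: down :: b) ⬝ mul b = (HeisHom.id _ : HeisHom 𝕜 _ _) :=
  zig_upL (down :: b)

theorem comul_comul : comul b ⬝ comul (up :: down :: b) =
    (comul b ⬝ U (D (comul b)) : HeisHom 𝕜 _ _) := by
  simpa only [flip_comp, flip_cons, flip_mul] using congrArg flip (mul_mul (𝕜 := 𝕜) b)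

theorem comul_counit : comul b ⬝ dR (up :: down :: b) = (HeisHom.id _ : HeisHom 𝕜 _ _) :=
  zig_upR (down :: b)

theorem comul_cons_mul : comul (up :: down :: b) ⬝ U (D (mul b)) =
    (mul b ⬝ comul b : HeisHom 𝕜 _ _) := cons_eq₂ up (cR_nat (dL (down :: b)))

theorem cons_comul_mul : U (D (comul b)) ⬝ mul (up :: down :: b) =
    (mul b ⬝ comul b : HeisHom 𝕜 _ _) := (cons_eq₂ up (dL_nat (cR (down :: b)))).symm

end HeisHom

end HalfBraidings

end PartHeis

namespace PartHeis

/-! ### Multiplying and copying along functions in a special commutative Frobenius algebra. -/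

section Towers

universe w v

/-- A special commutative Frobenius algebra in a tower of objects `obj 0, obj 1, …`, where `obj k`
is thought of as the `k`-th tensor power and `L` as the functor of tensoring with the identity on
the left. -/
structure FrobeniusTower (C : Type w) [Category.{v} C] where
  obj : ℕ → C
  L {k l : ℕ} : (obj k ⟶ obj l) → (obj (k + 1) ⟶ obj (l + 1))
  mu (k : ℕ) : obj (k + 2) ⟶ obj (k + 1)
  delta (k : ℕ) : obj (k + 1) ⟶ obj (k + 2)
  eta (k : ℕ) : obj k ⟶ obj (k + 1)
  eps (k : ℕ) : obj (k + 1) ⟶ obj k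
  s (k : ℕ) : obj (k + 2) ⟶ obj (k + 2)
  L_id (k : ℕ) : L (𝟙 (obj k)) = 𝟙 _
  L_comp {k l m : ℕ} (f : obj k ⟶ obj l) (g : obj l ⟶ obj m) : L (f ≫ g) = L f ≫ L g
  mu_nat {k l : ℕ} (f : obj k ⟶ obj l) : L (L f) ≫ mu l = mu k ≫ L f
  delta_nat {k l : ℕ} (f : obj k ⟶ obj l) : L f ≫ delta l = delta k ≫ L (L f)
  eta_nat {k l : ℕ} (f : obj k ⟶ obj l) : f ≫ eta l = eta k ≫ L f
  eps_nat {k l : ℕ} (f : obj k ⟶ obj l) : L f ≫ eps l = eps k ≫ f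
  s_nat {k l : ℕ} (f : obj k ⟶ obj l) : L (L f) ≫ s l = s k ≫ L (L f)
  s_s (k : ℕ) : s k ≫ s k = 𝟙 _
  braid (k : ℕ) : s (k + 1) ≫ L (s k) ≫ s (k + 1) = L (s k) ≫ s (k + 1) ≫ L (s k)
  mu_s (k : ℕ) : mu (k + 1) ≫ s k = L (s k) ≫ s (k + 1) ≫ L (mu k)
  s_delta (k : ℕ) : s k ≫ delta (k + 1) = L (delta k) ≫ s (k + 1) ≫ L (s k)
  eta_s (k : ℕ) : eta (k + 1) ≫ s k = L (eta k)
  s_eps (k : ℕ) : s k ≫ eps (k + 1) = L (eps k)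
  s_mu (k : ℕ) : s k ≫ mu k = mu k
  delta_s (k : ℕ) : delta k ≫ s k = delta k
  mu_mu (k : ℕ) : mu (k + 1) ≫ mu k = L (mu k) ≫ mu k
  delta_delta (k : ℕ) : delta k ≫ delta (k + 1) = delta k ≫ L (delta k)
  eta_mu (k : ℕ) : eta (k + 1) ≫ mu k = 𝟙 _
  delta_eps (k : ℕ) : delta k ≫ eps (k + 1) = 𝟙 _
  delta_mu (k : ℕ) : delta k ≫ mu k = 𝟙 _
  delta_L_mu (k : ℕ) : delta (k + 1) ≫ L (mu k) = mu k ≫ delta k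
  L_delta_mu (k : ℕ) : L (delta k) ≫ mu (k + 1) = mu k ≫ delta k

namespace FrobeniusTower

open Opposite

variable {C : Type w} [Category.{v} C] (T : FrobeniusTower C)

/-- The tower in the opposite category. -/
def op : FrobeniusTower Cᵒᵖ where
  obj k := Opposite.op (T.obj k)
  L f := (T.L f.unop).op
  mu k := (T.delta k).op
  delta k := (T.mu k).op
  eta k := (T.eps k).op
  eps k := (T.eta k).op
  s k := (T.s k).op
  L_id k := congrArg Quiver.Hom.op (T.L_id k)
  L_comp _ _ := congrArg Quiver.Hom.op (T.L_comp _ _)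
  mu_nat f := congrArg Quiver.Hom.op (T.delta_nat f.unop).symm
  delta_nat f := congrArg Quiver.Hom.op (T.mu_nat f.unop).symm
  eta_nat f := congrArg Quiver.Hom.op (T.eps_nat f.unop).symm
  eps_nat f := congrArg Quiver.Hom.op (T.eta_nat f.unop).symm
  s_nat f := congrArg Quiver.Hom.op (T.s_nat f.unop).symm
  s_s k := congrArg Quiver.Hom.op (T.s_s k)
  braid k := congrArg Quiver.Hom.op ((Category.assoc _ _ _).trans
    ((T.braid k).trans (Category.assoc _ _ _).symm))
  mu_s k := congrArg Quiver.Hom.op ((T.s_delta k).trans (Category.assoc _ _ _).symm)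
  s_delta k := congrArg Quiver.Hom.op ((T.mu_s k).trans (Category.assoc _ _ _).symm)
  eta_s k := congrArg Quiver.Hom.op (T.s_eps k)
  s_eps k := congrArg Quiver.Hom.op (T.eta_s k)
  s_mu k := congrArg Quiver.Hom.op (T.delta_s k)
  delta_s k := congrArg Quiver.Hom.op (T.s_mu k)
  mu_mu k := congrArg Quiver.Hom.op (T.delta_delta k)
  delta_delta k := congrArg Quiver.Hom.op (T.mu_mu k)
  eta_mu k := congrArg Quiver.Hom.op (T.delta_eps k)
  delta_eps k := congrArg Quiver.Hom.op (T.eta_mu k)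
  delta_mu k := congrArg Quiver.Hom.op (T.delta_mu k)
  delta_L_mu k := congrArg Quiver.Hom.op (T.L_delta_mu k)
  L_delta_mu k := congrArg Quiver.Hom.op (T.delta_L_mu k)

/-- Multiply the first tensor factor into the factor `j` of the remaining ones. -/
def mulInto : (k : ℕ) → Fin k → (T.obj (k + 1) ⟶ T.obj k)
  | 0, j => j.elim0
  | k + 1, j => Fin.cases (T.mu k) (fun j => T.s k ≫ T.L (mulInto k j)) j

/-- Copy the factor `j` to the front. -/
def copyFrom (k : ℕ) (j : Fin k) : T.obj k ⟶ T.obj (k + 1) := (T.op.mulInto k j).unop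

/-- The iterated unit. -/
def units : (k : ℕ) → (T.obj 0 ⟶ T.obj k)
  | 0 => 𝟙 _
  | k + 1 => units k ≫ T.eta k

/-- The iterated counit. -/
def counits (k : ℕ) : T.obj k ⟶ T.obj 0 := (T.op.units k).unop

/-- The morphism multiplying the factors as prescribed by a function. -/
def push : {k m : ℕ} → (Fin k → Fin m) → (T.obj k ⟶ T.obj m)
  | 0, m, _ => T.units m
  | _ + 1, m, f => T.L (push fun i => f i.succ) ≫ T.mulInto m (f 0)

/-- The morphism copying the factors as prescribed by a function. -/
def pull {k m : ℕ} (f : Fin k → Fin m) : T.obj m ⟶ T.obj k := (T.op.push f).unop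

theorem mulInto_zero (k : ℕ) : T.mulInto (k + 1) 0 = T.mu k := rfl
theorem mulInto_succ (k : ℕ) (j : Fin k) :
    T.mulInto (k + 1) j.succ = T.s k ≫ T.L (T.mulInto k j) := rfl
theorem copyFrom_zero (k : ℕ) : T.copyFrom (k + 1) 0 = T.delta k := rfl
theorem copyFrom_succ (k : ℕ) (j : Fin k) :
    T.copyFrom (k + 1) j.succ = T.L (T.copyFrom k j) ≫ T.s k := rfl
theorem push_succ {k m : ℕ} (f : Fin (k + 1) → Fin m) :
    T.push f = T.L (T.push fun i => f i.succ) ≫ T.mulInto m (f 0) := rfl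
theorem pull_succ {k m : ℕ} (f : Fin (k + 1) → Fin m) :
    T.pull f = T.copyFrom m (f 0) ≫ T.L (T.pull fun i => f i.succ) := rfl
-- The axioms of a tower are self-dual, so that a statement on `mulInto` and `push`, read in `T.op`,
-- is one on `copyFrom` and `pull`. This lemma and the next translate between the two readings.
theorem op_mulInto (k : ℕ) (j : Fin k) : T.op.mulInto k j = (T.copyFrom k j).op := rfl
theorem op_copyFrom : ∀ (k : ℕ) (j : Fin k), T.op.copyFrom k j = (T.mulInto k j).op
  | 0, j => j.elim0
  | k + 1, j => by
    refine Fin.cases rfl (fun j => ?_) j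
    rw [copyFrom_succ, op_copyFrom, mulInto_succ]
    rfl
theorem s_L_s_mu (k : ℕ) : T.s (k + 1) ≫ T.L (T.s k) ≫ T.mu (k + 1) = T.L (T.mu k) ≫ T.s k := by
  have h := congrArg (fun f => T.s (k + 1) ≫ T.L (T.s k) ≫ f ≫ T.s k) (T.mu_s k)
  simp only [Category.assoc] at h
  rw [T.s_s, Category.comp_id, ← reassoc_of% (T.L_comp (T.s k)), T.s_s, T.L_id, Category.id_comp,
    reassoc_of% (T.s_s (k + 1))] at h
  exact h

theorem s_L_delta_s (k : ℕ) :
    T.s k ≫ T.L (T.delta k) ≫ T.s (k + 1) = T.delta (k + 1) ≫ T.L (T.s k) := by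
  have h := congrArg (fun f => T.s k ≫ f ≫ T.L (T.s k)) (T.s_delta k)
  simp only [Category.assoc] at h
  rw [← T.L_comp, T.s_s, T.L_id, Category.comp_id, reassoc_of% (T.s_s k)] at h
  exact h.symm

theorem L_eta_mu (k : ℕ) : T.L (T.eta k) ≫ T.mu k = 𝟙 _ := by
  rw [← T.eta_s, Category.assoc, T.s_mu, T.eta_mu]

theorem delta_L_eps (k : ℕ) : T.delta k ≫ T.L (T.eps k) = 𝟙 _ := by
  rw [← T.s_eps, reassoc_of% (T.delta_s k), T.delta_eps]

theorem L_eta_s (k : ℕ) : T.L (T.eta k) ≫ T.s k = T.eta (k + 1) := by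
  rw [← T.eta_s, Category.assoc, T.s_s, Category.comp_id]

theorem s_L_eps (k : ℕ) : T.s k ≫ T.L (T.eps k) = T.eps (k + 1) := by
  rw [← T.s_eps, reassoc_of% (T.s_s k)]

/-- Associativity: the factor `j` is a module under multiplication from the front. -/
theorem L_mulInto_mulInto : ∀ (k : ℕ) (j : Fin (k + 1)),
    T.L (T.mulInto (k + 1) j) ≫ T.mulInto (k + 1) j = T.mu (k + 1) ≫ T.mulInto (k + 1) j := by
  intro k
  induction k with
  | zero => exact Fin.cases (T.mu_mu 0).symm fun j => j.elim0
  | succ k ih =>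
    refine Fin.cases (T.mu_mu _).symm fun j => ?_
    rw [mulInto_succ, L_comp, Category.assoc, reassoc_of% (T.s_nat (T.mulInto (k + 1) j)),
      ← L_comp, ih, L_comp, reassoc_of% (T.mu_s (k + 1))]

/-- Multiplications into two factors commute. For distinct factors this is naturality of the
symmetry and the braid relation; for equal ones it is commutativity of the algebra. -/
theorem s_L_mulInto_mulInto : ∀ (k : ℕ) (i j : Fin k),
    T.s k ≫ T.L (T.mulInto k j) ≫ T.mulInto k i = T.L (T.mulInto k i) ≫ T.mulInto k j := by
  intro k
  induction k with
  | zero => exact fun i => i.elim0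
  | succ k ih =>
    have h : ∀ j : Fin k, T.s (k + 1) ≫ T.L (T.mulInto (k + 1) j.succ) ≫ T.mulInto (k + 1) 0 =
        T.L (T.mulInto (k + 1) 0) ≫ T.mulInto (k + 1) j.succ := fun j => by
      rw [mulInto_succ, mulInto_zero, L_comp, Category.assoc, T.mu_nat,
        reassoc_of% (T.s_L_s_mu k)]
    refine Fin.cases (Fin.cases ?_ h) fun i => Fin.cases ?_ fun j => ?_
    · rw [mulInto_zero, ← T.mu_mu, reassoc_of% (T.s_mu (k + 1))]
    · rw [← h, reassoc_of% (T.s_s (k + 1))]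
    · rw [mulInto_succ, mulInto_succ, L_comp, L_comp, Category.assoc, Category.assoc,
        reassoc_of% (T.s_nat (T.mulInto k j)), reassoc_of% (T.braid k), ← L_comp, ← L_comp, ih,
        L_comp, reassoc_of% (T.s_nat (T.mulInto k i))]

/-- Equivariance of `push`, and the inductive step for its functoriality: a factor multiplied into
`j` ends up in `g j`, whether before or after pushing. -/
theorem mulInto_push : ∀ {k m : ℕ} (g : Fin k → Fin m) (j : Fin k),
    T.mulInto k j ≫ T.push g = T.L (T.push g) ≫ T.mulInto m (g j) := by
  intro k
  induction k with
  | zero => exact fun _ j => j.elim0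
  | succ k ih =>
    intro m g
    refine Fin.cases ?_ fun j => ?_
    -- The value `g 0` shows that the target is not empty, which the associativity lemma needs.
    · obtain ⟨m, rfl⟩ : ∃ m', m = m' + 1 := ⟨m - 1, by have := (g 0).pos; omega⟩
      rw [push_succ, mulInto_zero, ← reassoc_of% (T.mu_nat (T.push fun i => g i.succ)),
        ← L_mulInto_mulInto, L_comp, Category.assoc]
    · rw [push_succ, mulInto_succ, Category.assoc, ← reassoc_of% (T.L_comp (T.mulInto k j)), ih,
        L_comp, Category.assoc, ← reassoc_of% (T.s_nat (T.push fun i => g i.succ)),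
        s_L_mulInto_mulInto, L_comp, Category.assoc]

theorem eta_mulInto : ∀ (k : ℕ) (j : Fin k), T.eta k ≫ T.mulInto k j = 𝟙 _ := by
  intro k
  induction k with
  | zero => exact fun j => j.elim0
  | succ k ih =>
    refine Fin.cases (T.eta_mu k) fun j => ?_
    rw [mulInto_succ, reassoc_of% (T.eta_s k), ← L_comp, ih, L_id]

theorem units_push : ∀ {k m : ℕ} (f : Fin k → Fin m), T.units k ≫ T.push f = T.units m := by
  intro k
  induction k with
  | zero => exact fun f => Category.id_comp _
  | succ k ih =>
    intro m f
    rw [units, push_succ, Category.assoc, ← reassoc_of% (T.eta_nat (T.push fun i => f i.succ)),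
      eta_mulInto, Category.comp_id, ih]

/-- `push` is a functor on finite sets. Only finitely many relations enter, through `mulInto_push`;
no coherence theorem for commutative algebras is needed. -/
theorem push_push : ∀ {k l m : ℕ} (f : Fin k → Fin l) (g : Fin l → Fin m),
    T.push f ≫ T.push g = T.push fun i => g (f i) := by
  intro k
  induction k with
  | zero => exact fun f g => T.units_push g
  | succ k ih =>
    intro l m f g
    rw [push_succ, Category.assoc, mulInto_push, ← reassoc_of% (T.L_comp (T.push _)), ih,
      push_succ (f := fun i => g (f i))]

/-- A factor of the target that is hit by nothing is filled with the unit. -/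
theorem push_succ_comp : ∀ {k m : ℕ} (f : Fin k → Fin m),
    T.push (fun i => (f i).succ) = T.push f ≫ T.eta m := by
  intro k
  induction k with
  | zero => exact fun f => rfl
  | succ k ih =>
    intro m f
    rw [push_succ, ih, mulInto_succ, L_comp, Category.assoc, reassoc_of% (T.L_eta_s m),
      ← T.eta_nat, push_succ, Category.assoc]

theorem push_cons_zero {k m : ℕ} (f : Fin k → Fin m) :
    T.push (Fin.cons 0 fun i => (f i).succ : Fin (k + 1) → Fin (m + 1)) = T.L (T.push f) := by
  rw [push_succ]
  simp only [Fin.cons_succ, Fin.cons_zero]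
  rw [push_succ_comp, mulInto_zero, L_comp, Category.assoc, L_eta_mu, Category.comp_id]

theorem push_id : ∀ k : ℕ, T.push (fun i : Fin k => i) = 𝟙 _ := by
  intro k
  induction k with
  | zero => rfl
  | succ k ih =>
    rw [push_succ, push_succ_comp, ih, Category.id_comp, mulInto_zero, L_eta_mu]

theorem push_cons_id {k : ℕ} (j : Fin k) :
    T.push (Fin.cons j fun i => i : Fin (k + 1) → Fin k) = T.mulInto k j := by
  rw [push_succ]
  simp only [Fin.cons_succ, Fin.cons_zero]
  rw [push_id, L_id, Category.id_comp]

theorem push_fin_succ (k : ℕ) : T.push (Fin.succ : Fin k → Fin (k + 1)) = T.eta k := by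
  have h := T.push_succ_comp (fun i : Fin k => i)
  rwa [push_id, Category.id_comp] at h

theorem push_swap (k : ℕ) : T.push (Fin.cons 1 (Fin.cons 0 fun i => i.succ.succ) :
    Fin (k + 2) → Fin (k + 2)) = T.s k := by
  rw [push_succ, push_succ]
  simp only [Fin.cons_succ, Fin.cons_zero]
  rw [T.push_succ_comp Fin.succ, push_fin_succ, mulInto_zero, T.L_comp (T.eta k), Category.assoc, L_eta_mu,
    Category.comp_id, ← Fin.succ_zero_eq_one, mulInto_succ, mulInto_zero,
    reassoc_of% (T.s_nat (T.eta k)), ← L_comp, L_eta_mu, L_id, Category.comp_id]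

/-! Dual statements. -/

theorem pull_pull {k l m : ℕ} (f : Fin k → Fin l) (g : Fin l → Fin m) :
    T.pull g ≫ T.pull f = T.pull fun i => g (f i) :=
  congrArg Quiver.Hom.unop (T.op.push_push f g)

theorem pull_succ_comp {k m : ℕ} (f : Fin k → Fin m) :
    T.pull (fun i => (f i).succ) = T.eps m ≫ T.pull f :=
  congrArg Quiver.Hom.unop (T.op.push_succ_comp f)

theorem pull_cons_zero {k m : ℕ} (f : Fin k → Fin m) :
    T.pull (Fin.cons 0 fun i => (f i).succ : Fin (k + 1) → Fin (m + 1)) = T.L (T.pull f) :=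
  congrArg Quiver.Hom.unop (T.op.push_cons_zero f)

theorem pull_id (k : ℕ) : T.pull (fun i : Fin k => i) = 𝟙 _ :=
  congrArg Quiver.Hom.unop (T.op.push_id k)

theorem pull_cons_id {k : ℕ} (j : Fin k) :
    T.pull (Fin.cons j fun i => i : Fin (k + 1) → Fin k) = T.copyFrom k j :=
  congrArg Quiver.Hom.unop (T.op.push_cons_id j)

theorem pull_fin_succ (k : ℕ) : T.pull (Fin.succ : Fin k → Fin (k + 1)) = T.eps k :=
  congrArg Quiver.Hom.unop (T.op.push_fin_succ k)

/-! Frobenius relations. -/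

/-- The Frobenius relation with a factor in arbitrary position. The symmetry carries the factor to
the front, where the axiom `delta_L_mu` applies. -/
theorem delta_L_mulInto : ∀ (k : ℕ) (j : Fin (k + 1)),
    T.delta (k + 1) ≫ T.L (T.mulInto (k + 1) j) =
      T.mulInto (k + 1) j ≫ T.copyFrom (k + 1) j := by
  intro k
  induction k with
  | zero => exact Fin.cases (T.delta_L_mu 0) fun j => j.elim0
  | succ k ih =>
    refine Fin.cases (T.delta_L_mu _) fun j => ?_
    rw [mulInto_succ, copyFrom_succ, Category.assoc, ← reassoc_of% (T.L_comp (T.mulInto _ j)), ← ih,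
      L_comp, L_comp, Category.assoc, s_nat, reassoc_of% (T.s_L_delta_s (k + 1))]

theorem L_copyFrom_mu (k : ℕ) (j : Fin (k + 1)) :
    T.L (T.copyFrom (k + 1) j) ≫ T.mu (k + 1) =
      T.mulInto (k + 1) j ≫ T.copyFrom (k + 1) j := by
  have h := congrArg Quiver.Hom.unop (T.op.delta_L_mulInto k j)
  rw [op_copyFrom, op_mulInto] at h
  exact h

/-- Copying from `j` and multiplying into `i` may be done in either order. For `i = j` this is the
Frobenius relation up to symmetry, for `i ≠ j` the two operations concern different factors. -/
theorem L_copyFrom_s_L_mulInto : ∀ (k : ℕ) (i j : Fin k),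
    T.L (T.copyFrom k j) ≫ T.s k ≫ T.L (T.mulInto k i) = T.mulInto k i ≫ T.copyFrom k j := by
  intro k
  induction k with
  | zero => exact fun i => i.elim0
  | succ k ih =>
    refine Fin.cases (Fin.cases ?_ fun j => ?_) fun i => Fin.cases ?_ fun j => ?_
    · rw [mulInto_zero, copyFrom_zero]
      conv_lhs => rw [← T.s_mu, L_comp]
      rw [← reassoc_of% (T.s_delta k), T.delta_L_mu, reassoc_of% (T.s_mu k)]
    · rw [mulInto_zero, copyFrom_succ, L_comp, Category.assoc, ← T.mu_s,
        reassoc_of% (T.mu_nat (T.copyFrom k j))]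
    · rw [mulInto_succ, copyFrom_zero, L_comp, ← reassoc_of% (T.s_delta k), ← T.delta_nat,
        Category.assoc]
    · rw [mulInto_succ, copyFrom_succ, L_comp, L_comp, Category.assoc,
        ← reassoc_of% (T.braid k), ← T.s_nat, reassoc_of% (T.s_nat (T.copyFrom k j)),
        ← reassoc_of% (T.L_comp (T.s k)), ← reassoc_of% (T.L_comp (T.L (T.copyFrom k j))), ih,
        L_comp, Category.assoc, Category.assoc]

/-- A projection formula: copying a factor and pushing the rest equals pushing everything and
copying the factor where it lands. -/
theorem copyFrom_L_push : ∀ {k m : ℕ} (q : Fin k → Fin m) (y : Fin k),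
    T.copyFrom k y ≫ T.L (T.push q) = T.push q ≫ T.copyFrom m (q y) := by
  intro k
  induction k with
  | zero => exact fun _ j => j.elim0
  | succ k ih =>
    intro m q
    refine Fin.cases ?_ fun j => ?_
    · obtain ⟨m, rfl⟩ : ∃ m', m = m' + 1 := ⟨m - 1, by have := (q 0).pos; omega⟩
      rw [push_succ, copyFrom_zero, L_comp, ← reassoc_of% (T.delta_nat (T.push fun i => q i.succ)),
        delta_L_mulInto, Category.assoc]
    · rw [push_succ, copyFrom_succ, L_comp, Category.assoc,
        ← reassoc_of% (T.s_nat (T.push fun i => q i.succ)),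
        ← reassoc_of% (T.L_comp (T.copyFrom k j)), ih, L_comp, Category.assoc,
        L_copyFrom_s_L_mulInto, Category.assoc]

theorem L_pull_mulInto {k m : ℕ} (q : Fin k → Fin m) (y : Fin k) :
    T.L (T.pull q) ≫ T.mulInto k y = T.mulInto m (q y) ≫ T.pull q := by
  have h := congrArg Quiver.Hom.unop (T.op.copyFrom_L_push q y)
  rw [op_copyFrom, op_copyFrom] at h
  exact h

theorem copyFrom_mulInto : ∀ (k : ℕ) (j : Fin k), T.copyFrom k j ≫ T.mulInto k j = 𝟙 _ := by
  intro k
  induction k with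
  | zero => exact fun j => j.elim0
  | succ k ih =>
    refine Fin.cases (T.delta_mu k) fun j => ?_
    rw [mulInto_succ, copyFrom_succ, Category.assoc, reassoc_of% (T.s_s k), ← L_comp, ih, L_id]

end FrobeniusTower

end Towers

end PartHeis

namespace PartHeis

/-! ### Base change along pushouts, and the composition of partition diagrams. -/

section Towers

universe w v

namespace FrobeniusTower

variable {C : Type w} [Category.{v} C] (T : FrobeniusTower C)

/-- Cut the factors at which `S` is false. -/
def cut : {k : ℕ} → (Fin k → Bool) → (T.obj k ⟶ T.obj k)
  | 0, _ => 𝟙 _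
  | k + 1, S => bif S 0 then T.L (cut fun i => S i.succ)
      else T.eps k ≫ (cut fun i => S i.succ) ≫ T.eta k

theorem cut_succ_true {k : ℕ} (S : Fin (k + 1) → Bool) (h : S 0 = true) :
    T.cut S = T.L (T.cut fun i => S i.succ) := by
  rw [cut, h]; rfl

theorem cut_succ_false {k : ℕ} (S : Fin (k + 1) → Bool) (h : S 0 = false) :
    T.cut S = T.eps k ≫ (T.cut fun i => S i.succ) ≫ T.eta k := by
  rw [cut, h]; rfl

/-- A copy of factor `j` bypasses the cut. If `j` was uncut the two strands merge back by
specialness; if it was cut, the counit and unit laws remove the loose ends. -/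
theorem copyFrom_L_cut_mulInto : ∀ {k : ℕ} (S : Fin k → Bool) (j : Fin k),
    T.copyFrom k j ≫ T.L (T.cut S) ≫ T.mulInto k j = T.cut (Function.update S j true) := by
  intro k
  induction k with
  | zero => exact fun _ j => j.elim0
  | succ k ih =>
    intro S
    refine Fin.cases ?_ fun j => ?_
    · rw [T.cut_succ_true (Function.update S 0 true) (Function.update_self _ _ _)]
      simp only [Function.update_of_ne (Fin.succ_ne_zero _)]
      rw [copyFrom_zero, mulInto_zero]
      cases h : S 0 with
      | true =>
        rw [T.cut_succ_true S h, mu_nat, reassoc_of% (T.delta_mu k)]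
      | false =>
        rw [T.cut_succ_false S h, L_comp, L_comp, Category.assoc, Category.assoc, L_eta_mu,
          reassoc_of% (T.delta_L_eps k), Category.comp_id]
    · have h0 : (fun i : Fin k => Function.update S j.succ true i.succ) =
          Function.update (fun i => S i.succ) j true := by
        funext i
        by_cases h : i = j
        · subst h; simp
        · rw [Function.update_of_ne h, Function.update_of_ne (by simpa using h)]
      have h1 : Function.update S j.succ true 0 = S 0 :=
        Function.update_of_ne (Fin.succ_ne_zero j).symm _ _
      rw [copyFrom_succ, mulInto_succ]
      cases h : S 0 with
      | true =>
        rw [T.cut_succ_true S h, T.cut_succ_true _ (h1.trans h), h0, Category.assoc,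
          reassoc_of% (T.s_nat (T.cut fun i => S i.succ)), reassoc_of% (T.s_s k), ← L_comp,
          ← L_comp, ih]
      | false =>
        rw [T.cut_succ_false S h, T.cut_succ_false _ (h1.trans h), h0, L_comp, L_comp,
          Category.assoc, Category.assoc, Category.assoc, reassoc_of% (T.L_eta_s k),
          reassoc_of% (T.s_L_eps k), ← T.eta_nat, reassoc_of% (T.eps_nat (T.copyFrom k j)), ← ih]
        simp only [Category.assoc]

theorem cut_true : ∀ k : ℕ, T.cut (fun _ : Fin k => true) = 𝟙 _ := by
  intro k
  induction k with
  | zero => rfl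
  | succ k ih => rw [T.cut_succ_true _ rfl, ih, L_id]

theorem cut_false : ∀ k : ℕ, T.cut (fun _ : Fin k => false) = T.counits k ≫ T.units k := by
  intro k
  induction k with
  | zero => exact (Category.id_comp _).symm
  | succ k ih =>
    rw [T.cut_succ_false _ rfl, ih, units, Category.assoc, ← Category.assoc (T.eps k)]
    rfl

/-- Over a point with nonempty fibre, copying and multiplying back is the identity; over a point
with empty fibre, a counit is followed by a unit. The induction adds one point of the source at a
time, by `copyFrom_L_cut_mulInto`. -/
theorem pull_push_self : ∀ {b k : ℕ} (f : Fin b → Fin k),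
    ∃ S : Fin k → Bool, (∀ y, S y = true ↔ ∃ i, f i = y) ∧ T.pull f ≫ T.push f = T.cut S := by
  intro b
  induction b with
  | zero => exact fun f => ⟨fun _ => false, by simp, (T.cut_false _).symm⟩
  | succ b ih =>
    intro k f
    obtain ⟨S, h1, h2⟩ := ih fun i => f i.succ
    refine ⟨Function.update S (f 0) true, fun y => ?_, ?_⟩
    · rw [Fin.exists_fin_succ, ← h1]
      by_cases h : y = f 0
      · subst h; simp
      · rw [Function.update_of_ne h]; simp [Ne.symm h]
    · rw [pull_succ, push_succ, Category.assoc, ← reassoc_of% (T.L_comp (T.pull _)), h2,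
        copyFrom_L_cut_mulInto]

theorem pull_push_of_surjective {b k : ℕ} (f : Fin b → Fin k) (hf : Function.Surjective f) :
    T.pull f ≫ T.push f = 𝟙 _ := by
  obtain ⟨S, h1, h2⟩ := T.pull_push_self f
  obtain rfl : S = fun _ => true := funext fun y => (h1 y).2 (hf y)
  rw [h2, cut_true]

theorem push_pull_equiv {k l : ℕ} (e : Fin k ≃ Fin l) : T.push e ≫ T.pull e = 𝟙 _ := by
  have h1 : T.push e ≫ T.push e.symm = 𝟙 _ := by
    rw [push_push]; simpa using T.push_id k
  have h2 := congrArg (fun f => f ≫ T.push e.symm) (T.pull_push_of_surjective e e.surjective)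
  simp only [Category.assoc, h1, Category.comp_id, Category.id_comp] at h2
  rw [h2, h1]

/-- The middle labels may be renamed by a bijection. This makes the morphism of a diagram
independent of the numbering of its blocks. -/
theorem push_pull_comp_equiv {k l y z : ℕ} (e : Fin y ≃ Fin z) (f : Fin k → Fin y)
    (g : Fin l → Fin y) :
    T.push (fun i => e (f i)) ≫ T.pull (fun i => e (g i)) = T.push f ≫ T.pull g := by
  rw [← T.push_push f e, ← T.pull_pull g e, Category.assoc, reassoc_of% (T.push_pull_equiv e)]

/-- Merging two factors. -/
theorem exists_merge : ∀ {z : ℕ} (i j : Fin z), i ≠ j → ∃ (y : ℕ) (c : Fin z → Fin y),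
    Function.Surjective c ∧ c i = c j ∧
    (∀ (Z : Type) (u : Fin z → Z), u i = u j → ∃ v : Fin y → Z, ∀ a, v (c a) = u a) ∧
    T.copyFrom z i ≫ T.mulInto z j = T.push c ≫ T.pull c := by
  intro z
  induction z with
  | zero => exact fun i => i.elim0
  | succ z ih =>
    have key : ∀ j : Fin z, ∃ (y : ℕ) (c : Fin (z + 1) → Fin y),
        Function.Surjective c ∧ c 0 = c j.succ ∧
        (∀ (Z : Type) (u : Fin (z + 1) → Z), u 0 = u j.succ → ∃ v : Fin y → Z, ∀ a, v (c a) = u a) ∧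
        T.mulInto z j ≫ T.copyFrom z j = T.push c ≫ T.pull c := fun j =>
      ⟨z, Fin.cons j fun i => i, fun a => ⟨a.succ, Fin.cons_succ _ _ _⟩, by simp,
        fun Z u hu => ⟨fun i => u i.succ, Fin.cases (by simpa using hu.symm) fun i => by simp⟩,
        by rw [push_cons_id, pull_cons_id]⟩
    -- If one of the two points is `0`, (co)commutativity removes the symmetry and the Frobenius
    -- relation turns copying followed by multiplying into multiplying followed by copying. If
    -- neither is, the two symmetries cancel and the first factor splits off.
    refine Fin.cases (Fin.cases (fun h => (h rfl).elim) fun j _ => ?_)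
      fun i => Fin.cases (fun _ => ?_) fun j hij => ?_
    · obtain ⟨z, rfl⟩ : ∃ z', z = z' + 1 := ⟨z - 1, by have := j.pos; omega⟩
      rw [copyFrom_zero, mulInto_succ, reassoc_of% (T.delta_s (z + 1)), delta_L_mulInto]
      exact key j
    · obtain ⟨z, rfl⟩ : ∃ z', z = z' + 1 := ⟨z - 1, by have := i.pos; omega⟩
      rw [copyFrom_succ, mulInto_zero, Category.assoc, s_mu, L_copyFrom_mu]
      obtain ⟨y, c, h1, h2, h3, h4⟩ := key i
      exact ⟨y, c, h1, h2.symm, fun Z u hu => h3 Z u hu.symm, h4⟩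
    · obtain ⟨y, c, h1, h2, h3, h4⟩ := ih i j fun h => hij (congrArg _ h)
      refine ⟨y + 1, Fin.cons 0 fun i => (c i).succ, ?_, by simp [h2], fun Z u hu => ?_, ?_⟩
      · refine Fin.cases ⟨0, rfl⟩ fun a => ?_
        obtain ⟨b, rfl⟩ := h1 a
        exact ⟨b.succ, rfl⟩
      · obtain ⟨v, hv⟩ := h3 Z (fun i => u i.succ) hu
        exact ⟨Fin.cons (u 0) v, Fin.cases rfl fun a => hv a⟩
      · rw [push_cons_zero, pull_cons_zero, ← L_comp, ← h4, copyFrom_succ, mulInto_succ,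
          Category.assoc, reassoc_of% (T.s_s z), L_comp]

/-- Base change over the empty set. The set of labels is a disjoint union: a label hit only from
below accounts for a counit, one hit only from above for a unit. It is described by its universal
property, which is the form in which the induction of `exists_pushout` continues. -/
theorem exists_coproduct (x y : ℕ) : ∃ (z : ℕ) (p : Fin x → Fin z) (q : Fin y → Fin z),
    (∀ c : Fin z, (∃ i, p i = c) ∨ ∃ j, q j = c) ∧
    (∀ (Z : Type) (a : Fin x → Z) (c : Fin y → Z),
      ∃ u : Fin z → Z, (∀ i, u (p i) = a i) ∧ ∀ j, u (q j) = c j) ∧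
    T.counits x ≫ T.units y = T.push p ≫ T.pull q := by
  induction x with
  | zero =>
    refine ⟨y, Fin.elim0, fun i => i, fun c => .inr ⟨c, rfl⟩,
      fun Z a c => ⟨c, fun i => i.elim0, fun _ => rfl⟩, ?_⟩
    rw [pull_id, Category.comp_id]
    exact Category.id_comp _
  | succ x ih =>
    obtain ⟨z, p, q, h1, h2, h3⟩ := ih
    refine ⟨z + 1, Fin.cons 0 fun i => (p i).succ, fun j => (q j).succ,
      ?_, fun Z a c => ?_, ?_⟩
    · refine Fin.cases (.inl ⟨0, rfl⟩) fun c => ?_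
      rcases h1 c with ⟨i, rfl⟩ | ⟨i, rfl⟩
      · exact .inl ⟨i.succ, rfl⟩
      · exact .inr ⟨i, rfl⟩
    · obtain ⟨u, hu1, hu2⟩ := h2 Z (fun i => a i.succ) c
      exact ⟨Fin.cons (a 0) u, Fin.cases rfl hu1, hu2⟩
    · rw [push_cons_zero, pull_succ_comp, reassoc_of% (T.eps_nat (T.push p)), ← h3,
        ← Category.assoc]
      rfl

/-- Pulling back and pushing forward is pushing forward and pulling back along a pushout. -/
theorem exists_pushout : ∀ {b x y : ℕ} (f : Fin b → Fin x) (h : Fin b → Fin y),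
    ∃ (z : ℕ) (p : Fin x → Fin z) (q : Fin y → Fin z), (∀ i, p (f i) = q (h i)) ∧
      (∀ c : Fin z, (∃ i, p i = c) ∨ ∃ j, q j = c) ∧
      (∀ (Z : Type) (a : Fin x → Z) (c : Fin y → Z), (∀ i, a (f i) = c (h i)) →
        ∃ u : Fin z → Z, (∀ i, u (p i) = a i) ∧ ∀ j, u (q j) = c j) ∧
      T.pull f ≫ T.push h = T.push p ≫ T.pull q := by
  intro b
  induction b with
  | zero =>
    intro x y f h
    obtain ⟨z, p, q, h1, h2, h3⟩ := T.exists_coproduct x y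
    exact ⟨z, p, q, fun i => i.elim0, h1, fun Z a c _ => h2 Z a c, h3⟩
  | succ b ih =>
    intro x y f h
    obtain ⟨z, p, q, h0, h1, h2, h3⟩ := ih (fun i => f i.succ) fun i => h i.succ
    -- Base change is known for the points other than the first. By the projection formulas the
    -- first point adds, in the middle, a copy taken from its left label and multiplied into its
    -- right label.
    have e : T.pull f ≫ T.push h =
        T.push p ≫ (T.copyFrom z (p (f 0)) ≫ T.mulInto z (q (h 0))) ≫ T.pull q := by
      rw [pull_succ, push_succ, Category.assoc, ← reassoc_of% (T.L_comp (T.pull _)), h3, L_comp,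
        Category.assoc, L_pull_mulInto, reassoc_of% (T.copyFrom_L_push p (f 0)), Category.assoc]
    -- If the labels already agree, the extra loop disappears by specialness and the pushout is
    -- unchanged. Otherwise they are merged, and the new set of labels is the quotient by one more
    -- identification.
    by_cases hz : p (f 0) = q (h 0)
    · refine ⟨z, p, q, Fin.cases hz h0, h1, fun Z a c hac => h2 Z a c fun i => hac i.succ, ?_⟩
      rw [e, hz, copyFrom_mulInto, Category.id_comp]
    · obtain ⟨w, m, m1, m2, m3, m4⟩ := T.exists_merge _ _ hz
      refine ⟨w, fun i => m (p i), fun j => m (q j), Fin.cases m2 fun i => congrArg m (h0 i),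
        fun c => ?_, fun Z a c hac => ?_, ?_⟩
      · obtain ⟨c, rfl⟩ := m1 c
        exact (h1 c).imp (fun ⟨i, hi⟩ => ⟨i, congrArg m hi⟩) fun ⟨i, hi⟩ => ⟨i, congrArg m hi⟩
      · obtain ⟨u, hu1, hu2⟩ := h2 Z a c fun i => hac i.succ
        obtain ⟨v, hv⟩ := m3 Z u (by rw [hu1, hu2, hac 0])
        exact ⟨v, fun i => (hv _).trans (hu1 i), fun j => (hv _).trans (hu2 j)⟩
      · rw [e, m4, ← T.push_push p m, ← T.pull_pull q m]
        simp only [Category.assoc]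

/-! ### The morphism of a partition diagram -/

/-- The morphism given by a partition diagram. -/
noncomputable def diagramMap {k l : ℕ} (D : Diagram k l) : T.obj k ⟶ T.obj l :=
  T.push (fun i => Finite.equivFin (Quotient D) (Quotient.mk D (.inl i))) ≫
    T.pull (fun j => Finite.equivFin (Quotient D) (Quotient.mk D (.inr j)))

/-- Any labelling of the vertices that separates the blocks and uses all labels may replace the
chosen numbering. Labels not in use would contribute extra scalars, hence the condition `hs`. -/
theorem diagramMap_eq {k l z : ℕ} (D : Diagram k l) (f : Fin k → Fin z) (g : Fin l → Fin z)
    (hs : ∀ c : Fin z, (∃ i, f i = c) ∨ ∃ j, g j = c)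
    (hD : ∀ x y, D x y ↔ Sum.elim f g x = Sum.elim f g y) :
    T.diagramMap D = T.push f ≫ T.pull g := by
  have hb : Function.Bijective (Quotient.lift (Sum.elim f g) fun x y h => (hD x y).1 h) := by
    constructor
    · rintro ⟨x⟩ ⟨y⟩ h
      exact Quotient.sound ((hD x y).2 h)
    · intro c
      rcases hs c with ⟨i, rfl⟩ | ⟨i, rfl⟩
      · exact ⟨Quotient.mk D (.inl i), rfl⟩
      · exact ⟨Quotient.mk D (.inr i), rfl⟩
  rw [diagramMap, ← T.push_pull_comp_equiv ((Finite.equivFin _).symm.trans (Equiv.ofBijective _ hb))]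
  simp

variable {T}

/-- Each of the first `c` labels is hit from neither side, so it carries a unit followed by a
counit, which is the scalar `t`. -/
theorem push_addNat_pull_addNat {𝕜 : Type u} [CommRing 𝕜] [Preadditive C] [Linear 𝕜 C] {t : 𝕜}
    (ht : ∀ k, T.eta k ≫ T.eps k = t • 𝟙 (T.obj k)) {k l z : ℕ} (f : Fin k → Fin z)
    (g : Fin l → Fin z) (c : ℕ) :
    T.push (fun i => (f i).addNat c) ≫ T.pull (fun j => (g j).addNat c) =
      t ^ c • (T.push f ≫ T.pull g) := by
  induction c with
  | zero => simp
  | succ c ih =>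
    have h := T.push_succ_comp fun i => (f i).addNat c
    have h' := T.pull_succ_comp fun j => (g j).addNat c
    change T.push (fun i => ((f i).addNat c).succ) ≫ T.pull (fun j => ((g j).addNat c).succ) = _
    rw [h, h', Category.assoc, reassoc_of% (ht (z + c)), Linear.smul_comp, Category.id_comp,
      Linear.comp_smul, ih, smul_smul, pow_succ']

/-- Base change moves the copying of the blocks of `D` past the multiplication into the blocks of
`E`. The labels of the pushout are the components of the stacked diagram; those that meet an outer
row are the blocks of `star D E`, the others are floating. -/
theorem diagramMap_comp {𝕜 : Type u} [CommRing 𝕜] [Preadditive C] [Linear 𝕜 C] {t : 𝕜}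
    (ht : ∀ k, T.eta k ≫ T.eps k = t • 𝟙 (T.obj k)) {k l m : ℕ} (D : Diagram k l)
    (E : Diagram l m) :
    T.diagramMap D ≫ T.diagramMap E = t ^ floatingCard D E • T.diagramMap (star D E) := by
  obtain ⟨z, p, q, h0, h1, h2, h3⟩ := T.exists_pushout
    (fun j => Finite.equivFin (Quotient D) (Quotient.mk D (.inr j)))
    (fun j => Finite.equivFin (Quotient E) (Quotient.mk E (.inl j)))
  rw [diagramMap, diagramMap, Category.assoc, reassoc_of% h3, pull_pull, ← Category.assoc,
    push_push]
  -- The label in the pushout of each vertex of the three rows. On the middle row it could be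
  -- computed through either diagram; `hφD` records the agreement.
  let φ : Fin k ⊕ Fin l ⊕ Fin m → Fin z :=
    Sum.elim (fun i => p (Finite.equivFin (Quotient D) (Quotient.mk D (.inl i))))
      (fun x => q (Finite.equivFin (Quotient E) (Quotient.mk E x)))
  have hφD : ∀ x, φ (Sum.map id Sum.inl x) = p (Finite.equivFin (Quotient D) (Quotient.mk D x)) := by
    rintro (x | x)
    · rfl
    · exact (h0 x).symm
  have hφ : ∀ x y, stack D E x y → φ x = φ y := by
    intro x y h
    induction h with
    | rel x y h =>
      cases h with
      | lower h => rw [hφD, hφD, Quotient.sound h]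
      | upper h => exact congrArg (fun e => q (Finite.equivFin _ e)) (Quotient.sound h)
    | refl => rfl
    | symm _ _ _ ih => exact ih.symm
    | trans _ _ _ _ _ ih1 ih2 => exact ih1.trans ih2
  -- The universal property of the pushout, applied to the set of components, gives an inverse to
  -- the labelling: different components have different labels.
  obtain ⟨u, hu1, hu2⟩ := h2 (Quotient (stack D E))
    (fun i => Quotient.lift (fun x => Quotient.mk (stack D E) (Sum.map id Sum.inl x))
      (fun x y h => Quotient.sound (Relation.EqvGen.rel _ _ (StackStep.lower h)))
      ((Finite.equivFin (Quotient D)).symm i))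
    (fun i => Quotient.lift (fun x => Quotient.mk (stack D E) (Sum.inr x))
      (fun x y h => Quotient.sound (Relation.EqvGen.rel _ _ (StackStep.upper h)))
      ((Finite.equivFin (Quotient E)).symm i))
    (fun i => by simp)
  have huφ : ∀ x, u (φ x) = Quotient.mk (stack D E) x := by
    rintro (x | x)
    · exact (hu1 _).trans (by simp)
    · exact (hu2 _).trans (by simp)
  have hb : Function.Bijective (Quotient.lift φ hφ) := by
    constructor
    · rintro ⟨x⟩ ⟨y⟩ h
      exact (huφ x).symm.trans ((congrArg u h).trans (huφ y))
    · intro c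
      rcases h1 c with ⟨i, rfl⟩ | ⟨i, rfl⟩
      · obtain ⟨⟨x⟩, rfl⟩ := (Finite.equivFin (Quotient D)).surjective i
        exact ⟨Quotient.mk _ (Sum.map id Sum.inl x), hφD x⟩
      · obtain ⟨⟨x⟩, rfl⟩ := (Finite.equivFin (Quotient E)).surjective i
        exact ⟨Quotient.mk _ (Sum.inr x), rfl⟩
  let ψ : Quotient (star D E) ⊕ Floating D E → Quotient (stack D E) :=
    Sum.elim (Quotient.lift (fun x => Quotient.mk (stack D E) (Sum.map id Sum.inr x))
      fun x y h => Quotient.sound h) Subtype.val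
  have hψ : Function.Bijective ψ := by
    constructor
    · have aux : ∀ (x : Fin k ⊕ Fin m) (y : Floating D E),
          Quotient.mk (stack D E) (Sum.map id Sum.inr x) ≠ y.1 := by
        intro x y h
        obtain ⟨b, hb⟩ := y.2 _ h
        rcases x with x | x <;> simp at hb
      rintro (⟨⟨x⟩⟩ | x) (⟨⟨y⟩⟩ | y) h
      · have h' : Quotient.mk (stack D E) (Sum.map id Sum.inr x) =
          Quotient.mk (stack D E) (Sum.map id Sum.inr y) := h
        have h'' : stack D E (Sum.map id Sum.inr x) (Sum.map id Sum.inr y) := Quotient.exact h'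
        exact congrArg Sum.inl (Quotient.sound (s := star D E) h'')
      · exact (aux x y h).elim
      · exact (aux y x h.symm).elim
      · exact congrArg Sum.inr (Subtype.ext h)
    · intro c
      by_cases hc : ∃ x : Fin k ⊕ Fin m, Quotient.mk (stack D E) (Sum.map id Sum.inr x) = c
      · obtain ⟨x, rfl⟩ := hc
        exact ⟨.inl (Quotient.mk _ x), rfl⟩
      · refine ⟨.inr ⟨c, fun x hx => ?_⟩, rfl⟩
        rcases x with x | x | x
        · exact (hc ⟨.inl x, hx⟩).elim
        · exact ⟨x, rfl⟩
        · exact (hc ⟨.inr x, hx⟩).elim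
  have : Finite (Floating D E) := Subtype.finite
  -- Floating components are numbered first, so that the numbers of the outer blocks are shifted by
  -- their count, as `push_addNat_pull_addNat` requires.
  let e : Fin z ≃ Fin (Nat.card (Quotient (star D E)) + floatingCard D E) :=
    ((Equiv.ofBijective _ hb).symm.trans (Equiv.ofBijective _ hψ).symm).trans
      (((Finite.equivFin _).sumCongr (Finite.equivFin _)).trans
        ((Equiv.sumComm _ _).trans (finSumFinEquiv.trans (finCongr (Nat.add_comm _ _)))))
  have he : ∀ x : Fin k ⊕ Fin m, e (φ (Sum.map id Sum.inr x)) =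
      (Finite.equivFin _ (Quotient.mk (star D E) x)).addNat (floatingCard D E) := by
    intro x
    have e1 : (Equiv.ofBijective _ hb).symm (φ (Sum.map id Sum.inr x)) =
        Quotient.mk _ (Sum.map id Sum.inr x) := (Equiv.symm_apply_eq _).2 rfl
    have e2 : (Equiv.ofBijective _ hψ).symm (Quotient.mk _ (Sum.map id Sum.inr x)) =
        .inl (Quotient.mk _ x) := (Equiv.symm_apply_eq _).2 rfl
    change finCongr (Nat.add_comm _ _) (finSumFinEquiv (Equiv.sumComm _ _ (((Finite.equivFin _).sumCongr
      (Finite.equivFin _)) ((Equiv.ofBijective _ hψ).symm ((Equiv.ofBijective _ hb).symm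
        (φ (Sum.map id Sum.inr x))))))) = _
    rw [e1, e2]
    ext
    simp [floatingCard, Nat.add_comm]
  rw [diagramMap, ← push_addNat_pull_addNat ht, ← T.push_pull_comp_equiv e]
  exact congrArg₂ (fun f g => T.push f ≫ T.pull g) (funext fun i => he (.inl i))
    (funext fun i => he (.inr i))

end FrobeniusTower

end Towers

end PartHeis

namespace PartHeis

/-! ### Generation of the partition category -/

section Generation

theorem ker_comp_injective {X Y Z : Type} {φ : X → Y} {ι : Y → Z} (hι : Function.Injective ι) :
    Setoid.ker (fun x => ι (φ x)) = Setoid.ker φ :=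
  Setoid.ext fun _ _ => hι.eq_iff

/-- A criterion to compute a composite: a labelling that respects both diagrams bounds the
components from above, `hφ` provides enough connections, and `hB` excludes floating components by
joining each middle vertex to an outer row. -/
theorem star_eq_ker {A B C Z : Type} (D : Setoid (A ⊕ B)) (E : Setoid (B ⊕ C))
    (φ : A ⊕ B ⊕ C → Z)
    (hD : ∀ x y, D x y → φ (Sum.map id Sum.inl x) = φ (Sum.map id Sum.inl y))
    (hE : ∀ x y, E x y → φ (Sum.inr x) = φ (Sum.inr y))
    (hB : ∀ b, ∃ x : A ⊕ C, stack D E (Sum.inr (Sum.inl b)) (Sum.map id Sum.inr x))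
    (hφ : ∀ x y : A ⊕ C, φ (Sum.map id Sum.inr x) = φ (Sum.map id Sum.inr y) →
      stack D E (Sum.map id Sum.inr x) (Sum.map id Sum.inr y)) :
    star D E = Setoid.ker (fun x => φ (Sum.map id Sum.inr x)) ∧ floatingCard D E = 0 := by
  have key : ∀ x y, stack D E x y → φ x = φ y := by
    intro x y h
    induction h with
    | rel x y h =>
      cases h with
      | lower h => exact hD _ _ h
      | upper h => exact hE _ _ h
    | refl => rfl
    | symm _ _ _ ih => exact ih.symm
    | trans _ _ _ _ _ ih1 ih2 => exact ih1.trans ih2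
  refine ⟨Setoid.ext fun x y => ⟨key _ _, hφ x y⟩, ?_⟩
  have : IsEmpty (Floating D E) := by
    refine ⟨fun q => ?_⟩
    obtain ⟨⟨x⟩, hq⟩ := q
    obtain ⟨b, rfl⟩ := hq x rfl
    obtain ⟨y, hy⟩ := hB b
    obtain ⟨b', hb'⟩ := hq (Sum.map id Sum.inr y) (Quotient.sound (Setoid.symm' _ hy))
    rcases y with y | y <;> simp at hb'
  exact Nat.card_of_isEmpty

/-- Composing with the graph of `f` relabels the lower vertices through `f`. The condition `hs` says
that every middle label also occurs on an outer row, without which a floating component would be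
left over. -/
theorem star_ker_left {A B C Z : Type} (f : A → B) (g : B → Z) (h : C → Z)
    (hs : ∀ b, (∃ i, g (f i) = g b) ∨ ∃ j, h j = g b) :
    star (Setoid.ker (Sum.elim f id)) (Setoid.ker (Sum.elim g h)) =
      Setoid.ker (Sum.elim (fun i => g (f i)) h) ∧
    floatingCard (Setoid.ker (Sum.elim f id)) (Setoid.ker (Sum.elim g h)) = 0 := by
  have hl : ∀ i, stack (Setoid.ker (Sum.elim f id)) (Setoid.ker (Sum.elim g h)) (Sum.inl i)
      (Sum.inr (Sum.inl (f i))) := fun i =>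
    Relation.EqvGen.rel _ _ (StackStep.lower (x := .inl i) (y := .inr (f i)) rfl)
  have hu : ∀ x y : B ⊕ C, Sum.elim g h x = Sum.elim g h y →
      stack (Setoid.ker (Sum.elim f id)) (Setoid.ker (Sum.elim g h)) (Sum.inr x) (Sum.inr y) :=
    fun x y e => Relation.EqvGen.rel _ _ (StackStep.upper e)
  have hx : ∀ x : A ⊕ C, ∃ y : B ⊕ C, Sum.elim (fun i => g (f i)) h x = Sum.elim g h y ∧
      stack (Setoid.ker (Sum.elim f id)) (Setoid.ker (Sum.elim g h)) (Sum.map id Sum.inr x)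
        (Sum.inr y) := by
    rintro (i | j)
    · exact ⟨.inl (f i), rfl, hl i⟩
    · exact ⟨.inr j, rfl, Setoid.refl' _ _⟩
  have := star_eq_ker (Setoid.ker (Sum.elim f id)) (Setoid.ker (Sum.elim g h))
    (Sum.elim (fun i => g (f i)) (Sum.elim g h)) ?_ (fun x y e => e) ?_ ?_
  · refine ⟨this.1.trans ?_, this.2⟩
    congr 1
    funext x
    rcases x with x | x <;> rfl
  · rintro (x | x) (y | y) e <;> exact congrArg g e
  · intro b
    rcases hs b with ⟨i, hi⟩ | ⟨j, hj⟩
    · exact ⟨.inl i, Setoid.trans' _ (hu _ (.inl (f i)) hi.symm) (Setoid.symm' _ (hl i))⟩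
    · exact ⟨.inr j, hu _ (.inr j) hj.symm⟩
  · intro x y e
    obtain ⟨x', hx1, hx2⟩ := hx x
    obtain ⟨y', hy1, hy2⟩ := hx y
    refine Setoid.trans' _ hx2 (Setoid.trans' _ (hu _ _ ?_) (Setoid.symm' _ hy2))
    rw [← hx1, ← hy1]
    rcases x with x | x <;> rcases y with y | y <;> exact e

theorem star_ker_right {A B C Z : Type} (f : A → Z) (g : B → Z) (h : C → B)
    (hs : ∀ b, (∃ i, f i = g b) ∨ ∃ j, g (h j) = g b) :
    star (Setoid.ker (Sum.elim f g)) (Setoid.ker (Sum.elim id h)) =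
      Setoid.ker (Sum.elim f fun j => g (h j)) ∧
    floatingCard (Setoid.ker (Sum.elim f g)) (Setoid.ker (Sum.elim id h)) = 0 := by
  have hu : ∀ j, stack (Setoid.ker (Sum.elim f g)) (Setoid.ker (Sum.elim id h))
      (Sum.inr (Sum.inr j)) (Sum.inr (Sum.inl (h j))) := fun j =>
    Relation.EqvGen.rel _ _ (StackStep.upper (x := .inr j) (y := .inl (h j)) rfl)
  have hl : ∀ x y : A ⊕ B, Sum.elim f g x = Sum.elim f g y →
      stack (Setoid.ker (Sum.elim f g)) (Setoid.ker (Sum.elim id h)) (Sum.map id Sum.inl x)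
        (Sum.map id Sum.inl y) :=
    fun x y e => Relation.EqvGen.rel _ _ (StackStep.lower e)
  have hx : ∀ x : A ⊕ C, ∃ y : A ⊕ B, Sum.elim f (fun j => g (h j)) x = Sum.elim f g y ∧
      stack (Setoid.ker (Sum.elim f g)) (Setoid.ker (Sum.elim id h)) (Sum.map id Sum.inr x)
        (Sum.map id Sum.inl y) := by
    rintro (i | j)
    · exact ⟨.inl i, rfl, Setoid.refl' _ _⟩
    · exact ⟨.inr (h j), rfl, hu j⟩
  have := star_eq_ker (Setoid.ker (Sum.elim f g)) (Setoid.ker (Sum.elim id h))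
    (Sum.elim f (Sum.elim g fun j => g (h j))) ?_ ?_ ?_ ?_
  · refine ⟨this.1.trans ?_, this.2⟩
    congr 1
    funext x
    rcases x with x | x <;> rfl
  · rintro (x | x) (y | y) e <;> exact e
  · rintro (x | x) (y | y) e <;> exact congrArg g e
  · intro b
    rcases hs b with ⟨i, hi⟩ | ⟨j, hj⟩
    · exact ⟨.inl i, hl (.inr b) (.inl i) hi.symm⟩
    · exact ⟨.inr j, Setoid.trans' _ (hl (.inr b) (.inr (h j)) hj.symm) (Setoid.symm' _ (hu j))⟩
  · intro x y e
    obtain ⟨x', hx1, hx2⟩ := hx x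
    obtain ⟨y', hy1, hy2⟩ := hx y
    refine Setoid.trans' _ hx2 (Setoid.trans' _ (hl _ _ ?_) (Setoid.symm' _ hy2))
    rw [← hx1, ← hy1]
    rcases x with x | x <;> rcases y with y | y <;> exact e

variable {𝕜 : Type u} [CommRing 𝕜] (t : 𝕜)

/-- The labelling of vertices obtained from a labelling `φ` by adding a new leftmost strand. -/
def consLabel {k l : ℕ} {Z : Type} (φ : Fin k ⊕ Fin l → Z) :
    Fin (k + 1) ⊕ Fin (l + 1) → Option Z :=
  Sum.elim (Fin.cons none fun i => some (φ (.inl i))) (Fin.cons none fun j => some (φ (.inr j)))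

/-- Add a vertical strand on the left of a diagram. -/
@[reducible] def consDiagram {k l : ℕ} (D : Diagram k l) : Diagram (k + 1) (l + 1) :=
  Setoid.ker (consLabel (Quotient.mk D))

theorem consDiagram_ker {k l : ℕ} {Z : Type} (φ : Fin k ⊕ Fin l → Z) :
    consDiagram (Setoid.ker φ) = Setoid.ker (consLabel φ) := by
  have hι : Function.Injective (Option.map (Quotient.lift φ fun _ _ h => h :
      Quotient (Setoid.ker φ) → Z)) :=
    Option.map_injective (by rintro ⟨x⟩ ⟨y⟩ h; exact Quotient.sound h)
  refine (ker_comp_injective hι).symm.trans (congrArg _ (funext fun x => ?_))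
  rcases x with x | x <;> refine Fin.cases ?_ (fun i => ?_) x <;> rfl

/-- `1 ⊗ -` in the partition category. -/
noncomputable def parL {k l : ℕ} : ParHom 𝕜 k l →ₗ[𝕜] ParHom 𝕜 (k + 1) (l + 1) :=
  Finsupp.lmapDomain 𝕜 𝕜 consDiagram

theorem parL_single {k l : ℕ} (D : Diagram k l) (a : 𝕜) :
    parL (Finsupp.single D a) = Finsupp.single (consDiagram D) a :=
  Finsupp.mapDomain_single

/-- The diagram of a function, with the domain at the bottom. -/
@[reducible] def graph {k l : ℕ} (f : Fin k → Fin l) : Diagram k l := Setoid.ker (Sum.elim f id)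

/-- The diagram of a function, with the domain at the top. -/
@[reducible] def cograph {k l : ℕ} (f : Fin k → Fin l) : Diagram l k := Setoid.ker (Sum.elim id f)

/-- The function identifying the first two points. -/
def mulFun (k : ℕ) : Fin (k + 2) → Fin (k + 1) := Fin.cons 0 fun i => i

/-- The transposition of the first two points. -/
def swapFun (k : ℕ) : Fin (k + 2) → Fin (k + 2) := Fin.cons 1 (Fin.cons 0 fun i => i.succ.succ)

theorem swapFun_swapFun (k : ℕ) (i : Fin (k + 2)) : swapFun k (swapFun k i) = i := by
  refine Fin.cases rfl (fun i => Fin.cases rfl (fun i => rfl) i) i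

theorem graph_swapFun (k : ℕ) : graph (swapFun k) = cograph (swapFun k) := by
  have hι : Function.Injective (swapFun k) :=
    (show Function.Involutive (swapFun k) from swapFun_swapFun k).injective
  refine (ker_comp_injective hι).symm.trans (congrArg _ (funext fun x => ?_))
  rcases x with x | x
  · exact swapFun_swapFun k x
  · rfl

theorem consDiagram_graph {k l : ℕ} (f : Fin k → Fin l) :
    consDiagram (graph f) = graph (Fin.cons 0 fun i => (f i).succ) := by
  have hι : Function.Injective (fun o : Option (Fin l) => o.elim 0 Fin.succ) := by
    rintro (_ | x) (_ | y) h
    · rfl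
    · exact ((Fin.succ_ne_zero y) h.symm).elim
    · exact ((Fin.succ_ne_zero x) h).elim
    · exact congrArg some (Fin.succ_injective _ h)
  refine (consDiagram_ker _).trans ((ker_comp_injective hι).symm.trans
    (congrArg _ (funext fun x => ?_)))
  rcases x with x | x <;> refine Fin.cases ?_ (fun i => ?_) x <;> rfl

theorem consDiagram_cograph {k l : ℕ} (f : Fin k → Fin l) :
    consDiagram (cograph f) = cograph (Fin.cons 0 fun i => (f i).succ) := by
  have hι : Function.Injective (fun o : Option (Fin l) => o.elim 0 Fin.succ) := by
    rintro (_ | x) (_ | y) h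
    · rfl
    · exact ((Fin.succ_ne_zero y) h.symm).elim
    · exact ((Fin.succ_ne_zero x) h).elim
    · exact congrArg some (Fin.succ_injective _ h)
  refine (consDiagram_ker _).trans ((ker_comp_injective hι).symm.trans
    (congrArg _ (funext fun x => ?_)))
  rcases x with x | x <;> refine Fin.cases ?_ (fun i => ?_) x <;> rfl

theorem parComp_graph_ker {k l z m : ℕ} (f : Fin k → Fin l) (g : Fin l → Fin z) (h : Fin m → Fin z)
    (hs : ∀ b, (∃ i, g (f i) = g b) ∨ ∃ j, h j = g b) :
    parComp t (Finsupp.single (graph f) 1)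
      (Finsupp.single (Setoid.ker (Sum.elim g h) : Diagram l m) 1) =
        Finsupp.single (Setoid.ker (Sum.elim (fun i => g (f i)) h)) 1 := by
  rw [parComp_single, (star_ker_left f g h hs).1, (star_ker_left f g h hs).2]
  simp

theorem parComp_graph_graph {k l m : ℕ} (f : Fin k → Fin l) (g : Fin l → Fin m) :
    parComp t (Finsupp.single (graph f) 1) (Finsupp.single (graph g) 1) =
        Finsupp.single (graph fun i => g (f i)) 1 :=
  parComp_graph_ker t f g id fun b => .inr ⟨g b, rfl⟩

theorem parComp_cograph_cograph {k l m : ℕ} (f : Fin k → Fin l) (g : Fin l → Fin m) :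
    parComp t (Finsupp.single (cograph g) 1) (Finsupp.single (cograph f) 1) =
        Finsupp.single (cograph fun i => g (f i)) 1 := by
  have h := star_ker_right id g f fun b => .inl ⟨g b, rfl⟩
  rw [parComp_single, h.1, h.2]
  simp

theorem graph_id (k : ℕ) : Finsupp.single (graph fun i : Fin k => i) 1 = parId 𝕜 k := rfl

/-- Every morphism of the partition category is obtained from the generators by linear
combinations, composition, and tensoring with strands. -/
theorem par_induction {P : ∀ k l, ParHom 𝕜 k l → Prop} (zero : ∀ k l, P k l 0)
    (add : ∀ {k l} (f g), P k l f → P k l g → P k l (f + g))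
    (smul : ∀ {k l} (r : 𝕜) (f), P k l f → P k l (r • f)) (id : ∀ k, P k k (parId 𝕜 k))
    (comp : ∀ {k l m} (f g), P k l f → P l m g → P k m (parComp t f g))
    (cons : ∀ {k l} (f), P k l f → P (k + 1) (l + 1) (parL f))
    (mul : ∀ k, P (k + 2) (k + 1) (Finsupp.single (graph (mulFun k)) 1))
    (comul : ∀ k, P (k + 1) (k + 2) (Finsupp.single (cograph (mulFun k)) 1))
    (unit : ∀ k, P k (k + 1) (Finsupp.single (graph Fin.succ) 1))
    (counit : ∀ k, P (k + 1) k (Finsupp.single (cograph Fin.succ) 1))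
    (swap : ∀ k, P (k + 2) (k + 2) (Finsupp.single (graph (swapFun k)) 1))
    {k l : ℕ} (f : ParHom 𝕜 k l) : P k l f := by
  -- Multiplication of the first strand into strand `j`, built from the crossing and the
  -- multiplication by the same recursion as `FrobeniusTower.mulInto`.
  have h1 : ∀ k (j : Fin k), P (k + 1) k (Finsupp.single (graph (Fin.cons j fun i => i)) 1) := by
    intro k
    induction k with
    | zero => exact fun j => j.elim0
    | succ k ih =>
      refine Fin.cases (mul k) fun j => ?_
      have := comp _ _ (swap k) (cons _ (ih j))
      rw [parL_single, consDiagram_graph, parComp_graph_graph] at this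
      convert this using 4 with i
      refine Fin.cases rfl (fun i => Fin.cases rfl (fun i => rfl) i) i
  have h1' : ∀ k (j : Fin k), P k (k + 1) (Finsupp.single (cograph (Fin.cons j fun i => i)) 1) := by
    intro k
    induction k with
    | zero => exact fun j => j.elim0
    | succ k ih =>
      refine Fin.cases (comul k) fun j => ?_
      have := comp _ _ (cons _ (ih j)) (swap k)
      rw [parL_single, consDiagram_cograph, graph_swapFun, parComp_cograph_cograph] at this
      convert this using 4 with i
      refine Fin.cases rfl (fun i => Fin.cases rfl (fun i => rfl) i) i
  have h2 : ∀ m (f : Fin 0 → Fin m), P 0 m (Finsupp.single (graph f) 1) := by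
    intro m
    induction m with
    | zero =>
      intro f
      obtain rfl : f = fun i => i := Subsingleton.elim _ _
      exact id 0
    | succ m ih =>
      intro f
      have := comp _ _ (ih Fin.elim0) (unit m)
      rw [parComp_graph_graph] at this
      convert this using 4
  have h2' : ∀ m (f : Fin 0 → Fin m), P m 0 (Finsupp.single (cograph f) 1) := by
    intro m
    induction m with
    | zero =>
      intro f
      obtain rfl : f = fun i => i := Subsingleton.elim _ _
      exact id 0
    | succ m ih =>
      intro f
      have := comp _ _ (counit m) (ih Fin.elim0)
      rw [parComp_cograph_cograph] at this
      convert this using 4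
  have h3 : ∀ k m (f : Fin k → Fin m), P k m (Finsupp.single (graph f) 1) := by
    intro k
    induction k with
    | zero => exact h2
    | succ k ih =>
      intro m f
      have := comp _ _ (cons _ (ih m fun i => f i.succ)) (h1 m (f 0))
      rw [parL_single, consDiagram_graph, parComp_graph_graph] at this
      convert this using 4 with i
      refine Fin.cases rfl (fun i => rfl) i
  have h3' : ∀ k m (f : Fin k → Fin m), P m k (Finsupp.single (cograph f) 1) := by
    intro k
    induction k with
    | zero => exact h2'
    | succ k ih =>
      intro m f
      have := comp _ _ (h1' m (f 0)) (cons _ (ih m fun i => f i.succ))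
      rw [parL_single, consDiagram_cograph, parComp_cograph_cograph] at this
      convert this using 4 with i
      refine Fin.cases rfl (fun i => rfl) i
  -- A diagram is the graph of the map from lower vertices to blocks, followed by the reversed graph
  -- of the map from upper vertices to blocks. No block is empty, so the composition produces no
  -- scalar.
  have h4 : ∀ D : Diagram k l, P k l (Finsupp.single D 1) := by
    intro D
    let e := Finite.equivFin (Quotient D)
    have := comp _ _ (h3 _ _ fun i => e (Quotient.mk D (.inl i)))
      (h3' _ _ fun j => e (Quotient.mk D (.inr j)))
    rw [parComp_graph_ker] at this
    · convert this using 2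
      refine Setoid.ext fun x y => ?_
      have hx : ∀ x : Fin k ⊕ Fin l, Sum.elim (fun i => e (Quotient.mk D (.inl i)))
          (fun j => e (Quotient.mk D (.inr j))) x = e (Quotient.mk D x) := by
        rintro (x | x) <;> rfl
      rw [Setoid.ker_def]
      refine Iff.trans ?_ (Eq.congr (hx x) (hx y)).symm
      exact Quotient.eq.symm.trans e.injective.eq_iff.symm
    · intro b
      obtain ⟨⟨x | x⟩, rfl⟩ := e.surjective b
      · exact .inl ⟨x, rfl⟩
      · exact .inr ⟨x, rfl⟩
  induction f using Finsupp.induction_linear with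
  | zero => exact zero k l
  | add f g hf hg => exact add f g hf hg
  | single D a =>
    have := smul a _ (h4 D)
    rwa [Finsupp.smul_single, smul_eq_mul, mul_one] at this

end Generation

end PartHeis

namespace PartHeis

/-! ### Tensor products in the partition category -/

section ParTensor

variable {𝕜 : Type u} [CommRing 𝕜]

theorem parTensor_single {k l k' l' : ℕ} (D : Diagram k l) (E : Diagram k' l') (a b : 𝕜) :
    parTensor (Finsupp.single D a) (Finsupp.single E b) =
      Finsupp.single (juxtapose D E) (a * b) := by
  simp [parTensor]

theorem parTensor_add_left {k l k' l' : ℕ} (f f' : ParHom 𝕜 k l) (g : ParHom 𝕜 k' l') :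
    parTensor (f + f') g = parTensor f g + parTensor f' g := by
  classical
  rw [parTensor, Finsupp.sum_add_index']
  · rfl
  · simp
  · intro D a b
    simp [add_mul, Finsupp.sum_add]

theorem parTensor_add_right {k l k' l' : ℕ} (f : ParHom 𝕜 k l) (g g' : ParHom 𝕜 k' l') :
    parTensor f (g + g') = parTensor f g + parTensor f g' := by
  classical
  simp only [parTensor]
  rw [← Finsupp.sum_add]
  refine Finsupp.sum_congr fun D _ => ?_
  rw [Finsupp.sum_add_index']
  · simp
  · intro E a b
    simp [mul_add]

theorem parTensor_zero_left {k l k' l' : ℕ} (g : ParHom 𝕜 k' l') :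
    parTensor (0 : ParHom 𝕜 k l) g = 0 := by
  simp [parTensor]

theorem parTensor_zero_right {k l k' l' : ℕ} (f : ParHom 𝕜 k l) :
    parTensor f (0 : ParHom 𝕜 k' l') = 0 := by
  simp [parTensor]

theorem parTensor_smul_left {k l k' l' : ℕ} (r : 𝕜) (f : ParHom 𝕜 k l) (g : ParHom 𝕜 k' l') :
    parTensor (r • f) g = r • parTensor f g := by
  induction f using Finsupp.induction_linear with
  | zero => simp only [smul_zero, parTensor_zero_left]
  | add f f' hf hf' => simp only [smul_add, parTensor_add_left, hf, hf']
  | single D a =>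
    induction g using Finsupp.induction_linear with
    | zero => simp only [smul_zero, parTensor_zero_right]
    | add g g' hg hg' => simp only [smul_add, parTensor_add_right, hg, hg']
    | single E b => simp only [Finsupp.smul_single, parTensor_single, smul_eq_mul, mul_assoc]

/-- Restriction of a colouring to the first positions of a row. -/
abbrev leftPart {K : Type} {m m' : ℕ} (a : Fin (m + m') → K) : Fin m → K :=
  fun i => a (Fin.castAdd m' i)

/-- Restriction of a colouring to the last positions of a row. -/
abbrev rightPart {K : Type} {m m' : ℕ} (a : Fin (m + m') → K) : Fin m' → K :=
  fun i => a (Fin.natAdd m i)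

theorem leftPart_append {K : Type} {m m' : ℕ} (a : Fin m → K) (b : Fin m' → K) :
    leftPart (Fin.append a b) = a := funext fun i => Fin.append_left a b i

theorem rightPart_append {K : Type} {m m' : ℕ} (a : Fin m → K) (b : Fin m' → K) :
    rightPart (Fin.append a b) = b := funext fun i => Fin.append_right a b i

/-- Formulated for an arbitrary set of colours because it is needed twice: with two colours to
compute components by counting, and with n colours for Φ. -/
theorem juxtapose_le_ker_iff {K : Type} {m l m' l' : ℕ} (D : Diagram m l) (E : Diagram m' l')
    (a : Fin (m + m') → K) (b : Fin (l + l') → K) :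
    (∀ x y, juxtapose D E x y → Sum.elim a b x = Sum.elim a b y) ↔
      (∀ x y, D x y → Sum.elim (leftPart a) (leftPart b) x = Sum.elim (leftPart a) (leftPart b) y) ∧
      (∀ x y, E x y →
        Sum.elim (rightPart a) (rightPart b) x = Sum.elim (rightPart a) (rightPart b) y) := by
  have hl : ∀ x, Sum.elim (leftPart a) (leftPart b) x =
      Sum.elim a b ((splitVertices m l m' l').symm (.inl x)) := by
    rintro (x | x) <;> rfl
  have hr : ∀ x, Sum.elim (rightPart a) (rightPart b) x =
      Sum.elim a b ((splitVertices m l m' l').symm (.inr x)) := by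
    rintro (x | x) <;> rfl
  constructor
  · intro h
    constructor
    · intro x y hxy
      rw [hl, hl]
      refine h _ _ ?_
      rw [Setoid.comap_rel, Equiv.apply_symm_apply, Equiv.apply_symm_apply]
      exact Sum.LiftRel.inl hxy
    · intro x y hxy
      rw [hr, hr]
      refine h _ _ ?_
      rw [Setoid.comap_rel, Equiv.apply_symm_apply, Equiv.apply_symm_apply]
      exact Sum.LiftRel.inr hxy
  · rintro ⟨h1, h2⟩ x y h
    obtain ⟨x, rfl⟩ := (splitVertices m l m' l').symm.surjective x
    obtain ⟨y, rfl⟩ := (splitVertices m l m' l').symm.surjective y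
    rw [Setoid.comap_rel, Equiv.apply_symm_apply, Equiv.apply_symm_apply] at h
    cases h with
    | inl h =>
      rw [← hl, ← hl]
      exact h1 _ _ h
    | inr h =>
      rw [← hr, ← hr]
      exact h2 _ _ h

theorem compat_juxtapose {m l m' l' : ℕ} (D : Diagram m l) (E : Diagram m' l')
    (a : Fin (m + m') → Bool) (b : Fin (l + l') → Bool) :
    Compat (juxtapose D E) a b ↔
      Compat D (leftPart a) (leftPart b) ∧ Compat E (rightPart a) (rightPart b) :=
  juxtapose_le_ker_iff D E a b

/-- Colourings of the middle row of two stacked juxtapositions are pairs of colourings. -/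
def middleJuxtaposeEquiv {k l m k' l' m' : ℕ} (D : Diagram k l) (D' : Diagram l m)
    (E : Diagram k' l') (E' : Diagram l' m') (a : Fin (k + k') → Bool) (c : Fin (m + m') → Bool) :
    {b : Fin (l + l') → Bool // Compat (juxtapose D E) a b ∧ Compat (juxtapose D' E') b c} ≃
      {b : Fin l → Bool // Compat D (leftPart a) b ∧ Compat D' b (leftPart c)} ×
      {b : Fin l' → Bool // Compat E (rightPart a) b ∧ Compat E' b (rightPart c)} where
  toFun b :=
    ⟨⟨leftPart b.1, ((compat_juxtapose _ _ _ _).1 b.2.1).1, ((compat_juxtapose _ _ _ _).1 b.2.2).1⟩,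
      ⟨rightPart b.1, ((compat_juxtapose _ _ _ _).1 b.2.1).2,
        ((compat_juxtapose _ _ _ _).1 b.2.2).2⟩⟩
  invFun p := ⟨Fin.append p.1.1 p.2.1, by
    rw [compat_juxtapose, compat_juxtapose, leftPart_append, rightPart_append]
    exact ⟨⟨p.1.2.1, p.2.2.1⟩, p.1.2.2, p.2.2.2⟩⟩
  left_inv b := by
    refine Subtype.ext (funext fun i => ?_)
    refine Fin.addCases (fun i => ?_) (fun i => ?_) i
    · simp only [Fin.append_left]
    · simp only [Fin.append_right]
  right_inv p := Prod.ext (Subtype.ext (leftPart_append _ _)) (Subtype.ext (rightPart_append _ _))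

/-- Two-colourings of the middle row of a juxtaposition are pairs of such colourings. Their number
detects the compatible outer colourings and equals a power of two with the number of floating
components as exponent; its multiplicativity gives both claims. -/
theorem star_juxtapose {k l m k' l' m' : ℕ} (D : Diagram k l) (D' : Diagram l m)
    (E : Diagram k' l') (E' : Diagram l' m') :
    star (juxtapose D E) (juxtapose D' E') = juxtapose (star D D') (star E E') ∧
      floatingCard (juxtapose D E) (juxtapose D' E') = floatingCard D D' + floatingCard E E' := by
  constructor
  · apply setoid_ext_of_compat
    intro a c
    rw [compat_juxtapose, ← count_iff, ← count_iff, ← count_iff,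
      Nat.card_congr (middleJuxtaposeEquiv D D' E E' a c), Nat.card_prod, mul_ne_zero_iff]
  · have h := Nat.card_congr (middleJuxtaposeEquiv D D' E E' (fun _ => true) (fun _ => true))
    rw [Nat.card_prod, card_middle _ _ _ _ (compat_const _), card_middle _ _ _ _ (compat_const _),
      card_middle _ _ _ _ (compat_const _), ← pow_add] at h
    exact Nat.pow_right_injective (le_refl 2) h

theorem parTensor_comp (t : 𝕜) {k l m k' l' m' : ℕ} (f : ParHom 𝕜 k l) (f' : ParHom 𝕜 l m)
    (g : ParHom 𝕜 k' l') (g' : ParHom 𝕜 l' m') :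
    parTensor (parComp t f f') (parComp t g g') =
      parComp t (parTensor f g) (parTensor f' g') := by
  induction f using Finsupp.induction_linear with
  | zero => simp only [parComp_zero_left, parTensor_zero_left]
  | add f₁ f₂ h₁ h₂ => simp only [parComp_add_left, parTensor_add_left, h₁, h₂]
  | single D a =>
  induction f' using Finsupp.induction_linear with
  | zero => simp only [parComp_zero_right, parTensor_zero_left]
  | add f₁ f₂ h₁ h₂ => simp only [parComp_add_right, parTensor_add_left, h₁, h₂]
  | single D' a' =>
  induction g using Finsupp.induction_linear with
  | zero => simp only [parComp_zero_left, parTensor_zero_right]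
  | add f₁ f₂ h₁ h₂ => simp only [parComp_add_left, parTensor_add_right, h₁, h₂]
  | single E b =>
  induction g' using Finsupp.induction_linear with
  | zero => simp only [parComp_zero_right, parTensor_zero_right]
  | add f₁ f₂ h₁ h₂ => simp only [parComp_add_right, parTensor_add_right, h₁, h₂]
  | single E' b' =>
    simp only [parTensor_single, parComp_single]
    rw [(star_juxtapose D D' E E').1, (star_juxtapose D D' E E').2, pow_add]
    congr 1
    ring

/-- Transport of a morphism along equalities of natural numbers. -/
def parCast {k l k' l' : ℕ} (hk : k = k') (hl : l = l') (f : ParHom 𝕜 k l) : ParHom 𝕜 k' l' :=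
  hk ▸ hl ▸ f

theorem parCast_single_ker {k l k' l' : ℕ} (hk : k = k') (hl : l = l') {Z : Type}
    (φ : Fin k ⊕ Fin l → Z) (a : 𝕜) :
    parCast hk hl (Finsupp.single (Setoid.ker φ : Diagram k l) a) =
      Finsupp.single (Setoid.ker fun x => φ (Sum.map (Fin.cast hk.symm) (Fin.cast hl.symm) x)) a := by
  subst hk hl
  refine congrArg (fun D => Finsupp.single D a) (congrArg Setoid.ker (funext fun x => ?_))
  rcases x with x | x <;> rfl

theorem parCast_add {k l k' l' : ℕ} (hk : k = k') (hl : l = l') (f g : ParHom 𝕜 k l) :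
    parCast hk hl (f + g) = parCast hk hl f + parCast hk hl g := by
  subst hk hl; rfl

theorem parCast_zero {k l k' l' : ℕ} (hk : k = k') (hl : l = l') :
    parCast hk hl (0 : ParHom 𝕜 k l) = 0 := by
  subst hk hl; rfl

theorem juxtapose_ker {m l m' l' : ℕ} {Z W : Type} (φ : Fin m ⊕ Fin l → Z)
    (ψ : Fin m' ⊕ Fin l' → W) :
    (juxtapose (Setoid.ker φ) (Setoid.ker ψ) : Diagram (m + m') (l + l')) =
      Setoid.ker (Sum.elim (Fin.addCases (fun i => .inl (φ (.inl i))) fun i => .inr (ψ (.inl i)))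
        (Fin.addCases (fun i => .inl (φ (.inr i))) fun i => .inr (ψ (.inr i))) :
          Fin (m + m') ⊕ Fin (l + l') → Z ⊕ W) := by
  have h1 : (sumSetoid (Setoid.ker φ) (Setoid.ker ψ)) = Setoid.ker (Sum.map φ ψ) := by
    refine Setoid.ext fun x y => ?_
    rw [Setoid.ker_def]
    rcases x with x | x <;> rcases y with y | y <;> constructor <;> intro h
    · cases h with | inl h => exact congrArg Sum.inl h
    · exact Sum.LiftRel.inl (Sum.inl_injective h)
    · cases h
    · cases h
    · cases h
    · cases h
    · cases h with | inr h => exact congrArg Sum.inr h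
    · exact Sum.LiftRel.inr (Sum.inr_injective h)
  rw [juxtapose, h1]
  refine congrArg Setoid.ker (funext fun x => ?_)
  rcases x with x | x <;> refine Fin.addCases (fun i => ?_) (fun i => ?_) x <;>
    simp [splitVertices]

/-- The disjoint union of two functions. -/
def sumFun {k l k' l' : ℕ} (f : Fin k → Fin l) (g : Fin k' → Fin l') : Fin (k + k') → Fin (l + l') :=
  Fin.addCases (fun i => Fin.castAdd l' (f i)) fun i => Fin.natAdd l (g i)

theorem juxtapose_graph {k l k' l' : ℕ} (f : Fin k → Fin l) (g : Fin k' → Fin l') :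
    juxtapose (graph f) (graph g) = graph (sumFun f g) := by
  rw [juxtapose_ker, ← ker_comp_injective (finSumFinEquiv (m := l) (n := l')).injective]
  refine congrArg Setoid.ker (funext fun x => ?_)
  rcases x with x | x <;> refine Fin.addCases (fun i => ?_) (fun i => ?_) x <;> simp [sumFun]

theorem juxtapose_cograph {k l k' l' : ℕ} (f : Fin k → Fin l) (g : Fin k' → Fin l') :
    juxtapose (cograph f) (cograph g) = cograph (sumFun f g) := by
  rw [juxtapose_ker, ← ker_comp_injective (finSumFinEquiv (m := l) (n := l')).injective]
  refine congrArg Setoid.ker (funext fun x => ?_)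
  rcases x with x | x <;> refine Fin.addCases (fun i => ?_) (fun i => ?_) x <;> simp [sumFun]

/-- The equations `hm` and `hp` absorb the rearrangement of sums of natural numbers: a size like `k
+ 2 + b` is not `k + b + 2` by definition, and the generators tensored with strands are indexed by
the latter form. -/
theorem parTensor_graph {k l k' l' m p : ℕ} (f : Fin k → Fin l) (g : Fin k' → Fin l')
    (h : Fin m → Fin p) (hm : m = k + k') (hp : p = l + l')
    (H : ∀ i, Fin.cast hp (h i) = sumFun f g (Fin.cast hm i)) :
    parTensor (Finsupp.single (graph f) 1) (Finsupp.single (graph g) (1 : 𝕜)) =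
      parCast hm hp (Finsupp.single (graph h) 1) := by
  subst hm hp
  obtain rfl : h = sumFun f g := funext H
  rw [parTensor_single, juxtapose_graph, mul_one]
  rfl

theorem parTensor_cograph {k l k' l' m p : ℕ} (f : Fin k → Fin l) (g : Fin k' → Fin l')
    (h : Fin m → Fin p) (hm : m = k + k') (hp : p = l + l')
    (H : ∀ i, Fin.cast hp (h i) = sumFun f g (Fin.cast hm i)) :
    parTensor (Finsupp.single (cograph f) 1) (Finsupp.single (cograph g) (1 : 𝕜)) =
      parCast hp hm (Finsupp.single (cograph h) 1) := by
  subst hm hp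
  obtain rfl : h = sumFun f g := funext H
  rw [parTensor_single, juxtapose_cograph, mul_one]
  rfl

theorem sumFun_val {k l k' l' : ℕ} (f : Fin k → Fin l) (g : Fin k' → Fin l') (i : Fin (k + k')) :
    (sumFun f g i : ℕ) = if h : (i : ℕ) < k then (f ⟨i, h⟩ : ℕ) else
      l + g ⟨i - k, by omega⟩ := by
  refine Fin.addCases (fun i => ?_) (fun i => ?_) i <;> simp [sumFun]

theorem mulFun_val (k : ℕ) (i : Fin (k + 2)) : (mulFun k i : ℕ) = i - 1 := by
  refine Fin.cases rfl (fun i => ?_) i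
  simp [mulFun]

theorem swapFun_val (k : ℕ) (i : Fin (k + 2)) :
    (swapFun k i : ℕ) = if (i : ℕ) = 0 then (1 : ℕ) else if (i : ℕ) = 1 then (0 : ℕ) else (i : ℕ) := by
  refine Fin.cases rfl (fun i => Fin.cases rfl (fun i => ?_) i) i
  simp [swapFun]

theorem parMul_eq : parMul 𝕜 = Finsupp.single (graph (mulFun 0)) 1 := by
  refine congrArg (fun D => Finsupp.single D 1) (Setoid.ext fun x y => ⟨fun _ => ?_, fun _ => trivial⟩)
  exact Subsingleton.elim (α := Fin 1) _ _

theorem parComul_eq : parComul 𝕜 = Finsupp.single (cograph (mulFun 0)) 1 := by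
  refine congrArg (fun D => Finsupp.single D 1) (Setoid.ext fun x y => ⟨fun _ => ?_, fun _ => trivial⟩)
  exact Subsingleton.elim (α := Fin 1) _ _

theorem parUnit_eq : parUnit 𝕜 = Finsupp.single (graph Fin.succ) 1 := by
  refine congrArg (fun D => Finsupp.single D 1) (Setoid.ext fun x y => ⟨fun _ => ?_, fun _ => trivial⟩)
  exact Subsingleton.elim (α := Fin 1) _ _

theorem parCounit_eq : parCounit 𝕜 = Finsupp.single (cograph Fin.succ) 1 := by
  refine congrArg (fun D => Finsupp.single D 1) (Setoid.ext fun x y => ⟨fun _ => ?_, fun _ => trivial⟩)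
  exact Subsingleton.elim (α := Fin 1) _ _

theorem parSwap_eq : parSwap 𝕜 = Finsupp.single (graph (swapFun 0)) 1 := by
  rw [graph_swapFun]
  refine congrArg (fun D => Finsupp.single D 1) (congrArg Setoid.ker (congrArg (Sum.elim id) ?_))
  decide

theorem parMul_tensor_id (k b : ℕ) :
    parTensor (Finsupp.single (graph (mulFun k)) 1) (parId 𝕜 b) =
      parCast (by omega) (by omega) (Finsupp.single (graph (mulFun (k + b))) 1) := by
  refine parTensor_graph _ (fun i => i) _ (by omega) (by omega) fun i => Fin.ext ?_
  simp only [sumFun_val, mulFun_val, Fin.val_cast]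
  split_ifs <;> omega

theorem parComul_tensor_id (k b : ℕ) :
    parTensor (Finsupp.single (cograph (mulFun k)) 1) (parId 𝕜 b) =
      parCast (by omega) (by omega) (Finsupp.single (cograph (mulFun (k + b))) 1) := by
  refine parTensor_cograph _ (fun i => i) _ (by omega) (by omega) fun i => Fin.ext ?_
  simp only [sumFun_val, mulFun_val, Fin.val_cast]
  split_ifs <;> omega

theorem parUnit_tensor_id (k b : ℕ) :
    parTensor (Finsupp.single (graph (Fin.succ : Fin k → Fin (k + 1))) 1) (parId 𝕜 b) =
      parCast (by omega) (by omega)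
        (Finsupp.single (graph (Fin.succ : Fin (k + b) → Fin (k + b + 1))) 1) := by
  refine parTensor_graph _ (fun i => i) _ (by omega) (by omega) fun i => Fin.ext ?_
  simp only [sumFun_val, Fin.val_succ, Fin.val_cast]
  split_ifs <;> omega

theorem parCounit_tensor_id (k b : ℕ) :
    parTensor (Finsupp.single (cograph (Fin.succ : Fin k → Fin (k + 1))) 1) (parId 𝕜 b) =
      parCast (by omega) (by omega)
        (Finsupp.single (cograph (Fin.succ : Fin (k + b) → Fin (k + b + 1))) 1) := by
  refine parTensor_cograph _ (fun i => i) _ (by omega) (by omega) fun i => Fin.ext ?_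
  simp only [sumFun_val, Fin.val_succ, Fin.val_cast]
  split_ifs <;> omega

theorem parSwap_tensor_id (k b : ℕ) :
    parTensor (Finsupp.single (graph (swapFun k)) 1) (parId 𝕜 b) =
      parCast (by omega) (by omega) (Finsupp.single (graph (swapFun (k + b))) 1) := by
  refine parTensor_graph _ (fun i => i) _ (by omega) (by omega) fun i => Fin.ext ?_
  simp only [sumFun_val, Fin.val_cast]
  split_ifs <;> simp only [swapFun_val] <;> split_ifs <;> omega

theorem setoid_ker_mk {X : Type} (D : Setoid X) : Setoid.ker (Quotient.mk D) = D :=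
  Setoid.ext fun _ _ => Quotient.eq

theorem cast_castAdd_zero {k b : ℕ} (h : k + 1 + b = k + b + 1) :
    Fin.cast h (Fin.castAdd b (0 : Fin (k + 1))) = 0 := rfl

theorem cast_castAdd_succ {k b : ℕ} (h : k + 1 + b = k + b + 1) (i : Fin k) :
    Fin.cast h (Fin.castAdd b i.succ) = (Fin.castAdd b i).succ := rfl

theorem cast_natAdd_succ {k b : ℕ} (h : k + 1 + b = k + b + 1) (i : Fin b) :
    Fin.cast h (Fin.natAdd (k + 1) i) = (Fin.natAdd k i).succ :=
  Fin.ext (Nat.succ_add k i)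

theorem parTensor_parL_single {k l k' l' : ℕ} (D : Diagram k l) (E : Diagram k' l') :
    parTensor (Finsupp.single (consDiagram D) (1 : 𝕜)) (Finsupp.single E 1) =
      parCast (by omega) (by omega) (Finsupp.single (consDiagram (juxtapose D E)) 1) := by
  rw [← setoid_ker_mk D, ← setoid_ker_mk E, consDiagram_ker, juxtapose_ker, consDiagram_ker,
    parTensor_single, parCast_single_ker, juxtapose_ker, mul_one]
  refine congrArg (fun D => Finsupp.single D 1) ?_
  -- The added strand is labelled `none`. It stays the leftmost one whether it is added before or
  -- after the juxtaposition.
  have hι : Function.Injective (fun x : Option (Quotient D) ⊕ Quotient E =>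
      (x.elim (Option.map .inl) fun y => some (.inr y) : Option (Quotient D ⊕ Quotient E))) := by
    rintro ((_ | x) | x) ((_ | y) | y) h <;> simp_all
  refine (ker_comp_injective hι).symm.trans (congrArg _ (funext fun x => ?_))
  rcases x with x | x <;> refine Fin.addCases (fun i => ?_) (fun i => ?_) x
  · refine Fin.cases ?_ (fun i => ?_) i
    · simp [consLabel, cast_castAdd_zero]
    · simp [consLabel, cast_castAdd_succ]
  · simp [consLabel, cast_natAdd_succ]
  · refine Fin.cases ?_ (fun i => ?_) i
    · simp [consLabel, cast_castAdd_zero]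
    · simp [consLabel, cast_castAdd_succ]
  · simp [consLabel, cast_natAdd_succ]

theorem parTensor_parL {k l k' l' : ℕ} (f : ParHom 𝕜 k l) (g : ParHom 𝕜 k' l') :
    parTensor (parL f) g = parCast (by omega) (by omega) (parL (parTensor f g)) := by
  induction f using Finsupp.induction_linear with
  | zero => simp only [map_zero, parTensor_zero_left, parCast_zero]
  | add f f' hf hf' => simp only [map_add, parTensor_add_left, parCast_add, hf, hf']
  | single D a =>
    induction g using Finsupp.induction_linear with
    | zero => simp only [map_zero, parTensor_zero_right, parCast_zero]
    | add g g' hg hg' => simp only [map_add, parTensor_add_right, parCast_add, hg, hg']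
    | single E b =>
      have h := congrArg (fun f => (a * b) • f) (parTensor_parL_single (𝕜 := 𝕜) D E)
      have hc : ∀ {k l k' l' : ℕ} (hk : k = k') (hl : l = l') (f : ParHom 𝕜 k l),
          (a * b) • parCast hk hl f = parCast hk hl ((a * b) • f) := by
        intro k l k' l' hk hl f
        subst hk hl
        rfl
      rw [hc] at h
      simpa only [parL_single, parTensor_single, Finsupp.smul_single, smul_eq_mul, mul_one] using h

theorem parId_zero_tensor {k l : ℕ} (f : ParHom 𝕜 k l) :
    parTensor (parId 𝕜 0) f = parCast (by omega) (by omega) f := by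
  induction f using Finsupp.induction_linear with
  | zero => simp only [parTensor_zero_right, parCast_zero]
  | add f f' hf hf' => simp only [parTensor_add_right, parCast_add, hf, hf']
  | single D a =>
    rw [← setoid_ker_mk D, parId, idDiagram, parTensor_single, parCast_single_ker, juxtapose_ker,
      one_mul, ← ker_comp_injective (Sum.inr_injective : Function.Injective
        (Sum.inr : Quotient D → Fin 0 ⊕ Quotient D))]
    refine congrArg (fun D => Finsupp.single D a) (congrArg Setoid.ker (funext fun x => ?_))
    rcases x with x | x <;> refine Fin.addCases (fun i => i.elim0) (fun i => ?_) x <;>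
      simp only [Sum.elim_inl, Sum.elim_inr, Fin.addCases_right, Sum.map_inl, Sum.map_inr] <;>
      congr 3 <;> exact Fin.ext (by simp)

theorem parL_parId (k : ℕ) : parL (parId 𝕜 k) = parId 𝕜 (k + 1) := by
  rw [← graph_id, parL_single, consDiagram_graph, ← graph_id]
  refine congrArg (fun f => Finsupp.single (graph f) 1) (funext fun i => ?_)
  exact Fin.cases rfl (fun i => rfl) i

/-- A class of morphisms of the partition category that contains the generators and is closed
under linear combinations, composition and tensor products contains every morphism. -/
theorem par_tensor_induction (t : 𝕜) {P : ∀ k l, ParHom 𝕜 k l → Prop} (zero : ∀ k l, P k l 0)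
    (add : ∀ {k l} (f g), P k l f → P k l g → P k l (f + g))
    (smul : ∀ {k l} (r : 𝕜) (f), P k l f → P k l (r • f)) (id : ∀ k, P k k (parId 𝕜 k))
    (comp : ∀ {k l m} (f g), P k l f → P l m g → P k m (parComp t f g))
    (tensor : ∀ {k l k' l'} (f g), P k l f → P k' l' g → P (k + k') (l + l') (parTensor f g))
    (mul : P 2 1 (parMul 𝕜)) (comul : P 1 2 (parComul 𝕜)) (unit : P 0 1 (parUnit 𝕜))
    (counit : P 1 0 (parCounit 𝕜)) (swap : P 2 2 (parSwap 𝕜)) {k l : ℕ} (f : ParHom 𝕜 k l) :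
    P k l f := by
  have hc' : ∀ {k l k' l' : ℕ} (hk : k = k') (hl : l = l') (f : ParHom 𝕜 k l),
      P k' l' (parCast hk hl f) → P k l f := by
    intro k l k' l' hk hl f h
    subst hk hl
    exact h
  refine par_induction t zero add smul id comp (fun {k l} f hf => ?_) (fun k => ?_) (fun k => ?_)
    (fun k => ?_) (fun k => ?_) (fun k => ?_) f
  -- `parL f` is the tensor product of one strand with `f`, up to the transport from `1 + k` to `k +
  -- 1`. The generators with strands to the right are obtained in the same way.
  · have h := tensor _ _ (id 1) hf
    rw [← parL_parId, parTensor_parL, parId_zero_tensor] at h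
    have hd : ∀ {a b : ℕ} (ha : k = a) (hb : l = b), P (a + 1) (b + 1) (parL (parCast ha hb f)) →
        P (k + 1) (l + 1) (parL f) := by
      intro a b ha hb h
      subst ha hb
      exact h
    exact hd (by omega) (by omega) (hc' _ _ _ h)
  · have h := tensor _ _ mul (id k)
    rw [parMul_eq, parMul_tensor_id] at h
    have h := hc' _ _ _ h
    rwa [Nat.zero_add] at h
  · have h := tensor _ _ comul (id k)
    rw [parComul_eq, parComul_tensor_id] at h
    have h := hc' _ _ _ h
    rwa [Nat.zero_add] at h
  · have h := tensor _ _ unit (id k)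
    rw [parUnit_eq, parUnit_tensor_id] at h
    have h := hc' _ _ _ h
    rwa [Nat.zero_add] at h
  · have h := tensor _ _ counit (id k)
    rw [parCounit_eq, parCounit_tensor_id] at h
    have h := hc' _ _ _ h
    rwa [Nat.zero_add] at h
  · have h := tensor _ _ swap (id k)
    rw [parSwap_eq, parSwap_tensor_id] at h
    have h := hc' _ _ _ h
    rwa [Nat.zero_add] at h

end ParTensor

end PartHeis

namespace PartHeis

/-! ### The functor from the partition category given by a Frobenius tower -/

section ParMap

universe w v

namespace FrobeniusTower

variable {𝕜 : Type u} [CommRing 𝕜] {t : 𝕜}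
variable {C : Type w} [Category.{v} C] (T : FrobeniusTower C)

theorem diagramMap_graph {k l : ℕ} (f : Fin k → Fin l) : T.diagramMap (graph f) = T.push f := by
  rw [T.diagramMap_eq _ f (fun j => j) (fun c => .inr ⟨c, rfl⟩) fun x y => Iff.rfl, pull_id,
    Category.comp_id]

theorem diagramMap_cograph {k l : ℕ} (f : Fin k → Fin l) :
    T.diagramMap (cograph f) = T.pull f := by
  rw [T.diagramMap_eq _ (fun j => j) f (fun c => .inl ⟨c, rfl⟩) fun x y => Iff.rfl, push_id,
    Category.id_comp]

/-- Give the new strand the label `0` and shift the other labels; by `push_cons_zero` and its dual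
this is exactly `T.L`. -/
theorem diagramMap_consDiagram {k l : ℕ} (D : Diagram k l) :
    T.diagramMap (consDiagram D) = T.L (T.diagramMap D) := by
  let e := Finite.equivFin (Quotient D)
  let f := fun i => e (Quotient.mk D (.inl i))
  let g := fun i => e (Quotient.mk D (.inr i))
  have hD : D = Setoid.ker (Sum.elim f g) := by
    refine (setoid_ker_mk D).symm.trans ((ker_comp_injective e.injective).symm.trans
      (congrArg Setoid.ker (funext fun x => ?_)))
    rcases x with x | x <;> rfl
  have hι : Function.Injective
      (fun o : Option (Fin (Nat.card (Quotient D))) => o.elim 0 Fin.succ) := by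
    rintro (_ | x) (_ | y) h
    · rfl
    · exact ((Fin.succ_ne_zero y) h.symm).elim
    · exact ((Fin.succ_ne_zero x) h).elim
    · exact congrArg some (Fin.succ_injective _ h)
  have hc : consDiagram D = Setoid.ker (Sum.elim (Fin.cons 0 fun i => (f i).succ)
      (Fin.cons 0 fun j => (g j).succ)) := by
    conv_lhs => rw [hD]
    refine (consDiagram_ker _).trans ((ker_comp_injective hι).symm.trans
      (congrArg Setoid.ker (funext fun x => ?_)))
    rcases x with x | x <;> refine Fin.cases ?_ (fun i => ?_) x <;> rfl
  rw [T.diagramMap_eq _ _ _ _ fun x y => by rw [hc]; exact Iff.rfl, push_cons_zero, pull_cons_zero,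
    ← L_comp]
  · rfl
  · refine Fin.cases (.inl ⟨0, rfl⟩) fun c => ?_
    obtain ⟨⟨x | x⟩, rfl⟩ := e.surjective c
    · exact .inl ⟨x.succ, rfl⟩
    · exact .inr ⟨x.succ, rfl⟩

variable [Preadditive C] [Linear 𝕜 C]

/-- The linear extension of `diagramMap`. -/
noncomputable def parMap (k l : ℕ) : ParHom 𝕜 k l →ₗ[𝕜] (T.obj k ⟶ T.obj l) :=
  Finsupp.linearCombination 𝕜 T.diagramMap

theorem parMap_single {k l : ℕ} (D : Diagram k l) (a : 𝕜) :
    T.parMap k l (Finsupp.single D a) = a • T.diagramMap D :=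
  Finsupp.linearCombination_single 𝕜 a D

theorem parMap_graph {k l : ℕ} (f : Fin k → Fin l) :
    T.parMap k l (Finsupp.single (graph f) (1 : 𝕜)) = T.push f := by
  rw [parMap_single, one_smul, diagramMap_graph]

theorem parMap_cograph {k l : ℕ} (f : Fin k → Fin l) :
    T.parMap l k (Finsupp.single (cograph f) (1 : 𝕜)) = T.pull f := by
  rw [parMap_single, one_smul, diagramMap_cograph]

theorem parMap_id (k : ℕ) : T.parMap k k (parId 𝕜 k) = 𝟙 _ := by
  rw [← graph_id, parMap_graph, push_id]

theorem parMap_comp (ht : ∀ k, T.eta k ≫ T.eps k = t • 𝟙 (T.obj k)) {k l m : ℕ}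
    (f : ParHom 𝕜 k l) (g : ParHom 𝕜 l m) :
    T.parMap k m (parComp t f g) = T.parMap k l f ≫ T.parMap l m g := by
  induction f using Finsupp.induction_linear with
  | zero => rw [parComp_zero_left, map_zero, map_zero, Limits.zero_comp]
  | add f f' hf hf' => rw [parComp_add_left, map_add, map_add, hf, hf', Preadditive.add_comp]
  | single D a =>
    induction g using Finsupp.induction_linear with
    | zero => rw [parComp_zero_right, map_zero, map_zero, Limits.comp_zero]
    | add g g' hg hg' => rw [parComp_add_right, map_add, map_add, hg, hg', Preadditive.comp_add]
    | single E b =>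
      rw [parComp_single, parMap_single, parMap_single, parMap_single, Linear.smul_comp,
        Linear.comp_smul, diagramMap_comp ht, smul_smul, smul_smul, mul_assoc]

theorem parMap_parL (hadd : ∀ {k l : ℕ} (f g : T.obj k ⟶ T.obj l), T.L (f + g) = T.L f + T.L g)
    (hsmul : ∀ {k l : ℕ} (r : 𝕜) (f : T.obj k ⟶ T.obj l), T.L (r • f) = r • T.L f) {k l : ℕ}
    (f : ParHom 𝕜 k l) : T.parMap (k + 1) (l + 1) (parL f) = T.L (T.parMap k l f) := by
  induction f using Finsupp.induction_linear with
  | zero =>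
    have h := hsmul (0 : 𝕜) (0 : T.obj k ⟶ T.obj l)
    rw [zero_smul, zero_smul] at h
    rw [map_zero, map_zero, map_zero, h]
  | add f f' hf hf' => rw [map_add, map_add, map_add, hf, hf', hadd]
  | single D a => rw [parL_single, parMap_single, parMap_single, hsmul, diagramMap_consDiagram]

end FrobeniusTower

end ParMap

/-! ### The existence and uniqueness of `Ψ` -/

section PsiExistence

open Arrow

variable {𝕜 : Type u} [CommRing 𝕜]

namespace HeisHom

theorem whiskerLeft_id (w v : Word) :
    whiskerLeft w (HeisHom.id v : HeisHom 𝕜 v v) = HeisHom.id (w ++ v) := by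
  induction w with
  | nil => rfl
  | cons c w ih => rw [whiskerLeft, ih]; exact cons_id c _

theorem whiskerRight_comp (c : Word) {u v w : Word} (f : HeisHom 𝕜 u v) (g : HeisHom 𝕜 v w) :
    whiskerRight c (comp f g) = comp (whiskerRight c f) (whiskerRight c g) := by
  induction f using HeisHom.ind; induction g using HeisHom.ind
  rfl

theorem whiskerRight_smul (c : Word) {u v : Word} (r : 𝕜) (f : HeisHom 𝕜 u v) :
    whiskerRight c (r • f) = r • whiskerRight c f := by
  induction f using HeisHom.ind
  rfl

theorem whiskerRight_cons (a : Arrow) (c : Word) {u v : Word} (f : HeisHom 𝕜 u v) :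
    whiskerRight c (cons a f) = cons a (whiskerRight c f) := by
  induction f using HeisHom.ind
  rfl

theorem tensor_id {u v : Word} (w : Word) (f : HeisHom 𝕜 u v) :
    tensor f (HeisHom.id w) = whiskerRight w f := by
  rw [tensor, whiskerLeft_id, comp_id]

theorem tensor_comp_left {u v w u' v' : Word} (f : HeisHom 𝕜 u v) (f' : HeisHom 𝕜 v w)
    (g : HeisHom 𝕜 u' v') :
    tensor (comp f f') g = comp (tensor f (HeisHom.id u')) (tensor f' g) := by
  rw [tensor_id, tensor, whiskerRight_comp, comp_assoc]; rfl

theorem tensor_cons (a : Arrow) {u v u' v' : Word} (f : HeisHom 𝕜 u v) (g : HeisHom 𝕜 u' v') :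
    tensor (cons a f) g = cons a (tensor f g) := by
  rw [tensor, whiskerRight_cons, whiskerLeft, tensor]
  exact (cons_comp a _ _).symm

theorem id_nil_tensor {u v : Word} (f : HeisHom 𝕜 u v) : tensor (HeisHom.id []) f = f :=
  id_comp f

theorem tensor_smul_left {u v u' v' : Word} (r : 𝕜) (f : HeisHom 𝕜 u v) (g : HeisHom 𝕜 u' v') :
    tensor (r • f) g = r • tensor f g := by
  rw [tensor, whiskerRight_smul, smul_comp]; rfl

theorem cast_comp {u v w u' v' w' : Word} (hu : u = u') (hv : v = v') (hw : w = w')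
    (f : HeisHom 𝕜 u v) (g : HeisHom 𝕜 v w) :
    cast hu hw (comp f g) = comp (cast hu hv f) (cast hv hw g) := by
  subst hu hv hw; rfl

theorem cast_smul {u v u' v' : Word} (hu : u = u') (hv : v = v') (r : 𝕜) (f : HeisHom 𝕜 u v) :
    cast hu hv (r • f) = r • cast hu hv f := by
  subst hu hv; rfl

theorem cast_cons {u v u' v' : Word} (a : Arrow) (hu : u = u') (hv : v = v')
    (f : HeisHom 𝕜 u v) :
    cast (congrArg (a :: ·) hu) (congrArg (a :: ·) hv) (cons a f) = cons a (cast hu hv f) := by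
  subst hu hv; rfl

/-- Transport of a morphism along equalities of natural numbers. -/
def natCast {k l k' l' : ℕ} (hk : k = k') (hl : l = l') (f : HeisHom 𝕜 (upDown k) (upDown l)) :
    HeisHom 𝕜 (upDown k') (upDown l') :=
  cast (congrArg upDown hk) (congrArg upDown hl) f

/-- Tensoring with the identity of `↑↓` on the left. -/
abbrev consTwo {k l : ℕ} (f : HeisHom 𝕜 (upDown k) (upDown l)) :
    HeisHom 𝕜 (upDown (k + 1)) (upDown (l + 1)) :=
  cons up (cons down f)

theorem cast_trans {u v w u' v' w' : Word} (hu : u = v) (hv : v = w) (hu' : u' = v')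
    (hv' : v' = w') (x : HeisHom 𝕜 u u') :
    cast (hu.trans hv) (hu'.trans hv') x = cast hv hv' (cast hu hu' x) := by
  subst hu hv hu' hv'
  rfl

theorem upDownTensor_consTwo {k l k' l' : ℕ} (f : HeisHom 𝕜 (upDown k) (upDown l))
    (g : HeisHom 𝕜 (upDown k') (upDown l')) :
    upDownTensor (consTwo f) g =
      natCast (Nat.succ_add k k').symm (Nat.succ_add l l').symm (consTwo (upDownTensor f g)) := by
  have h : tensor (consTwo f) g = cons up (cons down (tensor f g)) :=
    (tensor_cons _ _ _).trans (congrArg _ (tensor_cons _ _ _))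
  refine (congrArg (cast _ _) h).trans ?_
  rw [upDownTensor, consTwo, ← cast_cons, ← cast_cons]
  exact cast_trans _ _ _ _ _

/-- Allows the word inside a generator to be replaced by an equal one, such as `upDown k ++ upDown
b` by `upDown (k + b)`, where the equality is a theorem and not a computation. -/
theorem cast_family {s e : Word → Word} (h : ∀ b, HeisHom 𝕜 (s b) (e b)) {b b' u v : Word}
    (hb : b = b') (h1 : s b = u) (h2 : e b = v) (h1' : s b' = u) (h2' : e b' = v) :
    cast h1 h2 (h b) = cast h1' h2' (h b') := by
  subst hb; rfl

theorem id_upDownTensor {k l : ℕ} (f : HeisHom 𝕜 (upDown k) (upDown l)) :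
    upDownTensor (HeisHom.id (upDown 0)) f =
      natCast (Nat.zero_add k).symm (Nat.zero_add l).symm f := by
  exact congrArg (cast _ _) (id_nil_tensor f)

theorem upDownTensor_comp_left {k l m k' l' : ℕ} (f : HeisHom 𝕜 (upDown k) (upDown l))
    (f' : HeisHom 𝕜 (upDown l) (upDown m)) (g : HeisHom 𝕜 (upDown k') (upDown l')) :
    upDownTensor (comp f f') g =
      comp (upDownTensor f (HeisHom.id (upDown k'))) (upDownTensor f' g) := by
  rw [upDownTensor, tensor_comp_left, cast_comp _ (upDown_add l k')]; rfl

theorem upDownTensor_smul_left {k l k' l' : ℕ} (r : 𝕜) (f : HeisHom 𝕜 (upDown k) (upDown l))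
    (g : HeisHom 𝕜 (upDown k') (upDown l')) :
    upDownTensor (r • f) g = r • upDownTensor f g := by
  rw [upDownTensor, tensor_smul_left, cast_smul]; rfl

theorem mul_nat {b b' : Word} (f : HeisHom 𝕜 b b') :
    comp (cons up (cons down (cons up (cons down f)))) (mul b') =
      comp (mul b) (cons up (cons down f)) :=
  (cons_eq₂ up (dL_nat (cons down f))).symm

theorem comul_nat {b b' : Word} (f : HeisHom 𝕜 b b') :
    comp (cons up (cons down f)) (comul b') =
      comp (comul b) (cons up (cons down (cons up (cons down f)))) :=
  (cons_eq₂ up (cR_nat (cons down f))).symm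

theorem swap_nat {b b' : Word} (f : HeisHom 𝕜 b b') :
    comp (cons up (cons down (cons up (cons down f)))) (swap b') =
      comp (swap b) (cons up (cons down (cons up (cons down f)))) := by
  rw [swap, swap, comp_add, add_comp, comp_reassoc (mul_nat f), comp_assoc, comul_nat, comp_assoc,
    crossing, crossing, comp_reassoc (cons_eq₂ up (L_nat (cons down f)).symm), comp_assoc,
    comp_reassoc (X_nat (cons down (cons down f))).symm, comp_assoc,
    comp_reassoc (cons_eq₂ up (cons_eq₂ up (Y_nat f).symm)), comp_assoc,
    cons_eq₂ up (R_nat (cons down f)).symm]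
  simp only [comp_assoc]

theorem mul_upDownTensor_id (k b : ℕ) :
    upDownTensor (k := k + 2) (l := k + 1) (mul (upDown k) : HeisHom 𝕜 _ _)
      (HeisHom.id (upDown b)) = natCast (k := k + b + 2) (l := k + b + 1) (by omega) (by omega)
        (mul (upDown (k + b))) := by
  refine (congrArg (cast _ _) (tensor_id _ _)).trans ?_
  exact cast_family mul (upDown_add k b) _ _ _ _

theorem comul_upDownTensor_id (k b : ℕ) :
    upDownTensor (k := k + 1) (l := k + 2) (comul (upDown k) : HeisHom 𝕜 _ _)
      (HeisHom.id (upDown b)) = natCast (k := k + b + 1) (l := k + b + 2) (by omega) (by omega)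
        (comul (upDown (k + b))) := by
  refine (congrArg (cast _ _) (tensor_id _ _)).trans ?_
  exact cast_family comul (upDown_add k b) _ _ _ _

theorem unit_upDownTensor_id (k b : ℕ) :
    upDownTensor (k := k) (l := k + 1) (cL (upDown k) : HeisHom 𝕜 _ _)
      (HeisHom.id (upDown b)) = natCast (k := k + b) (l := k + b + 1) (by omega) (by omega)
        (cL (upDown (k + b))) := by
  refine (congrArg (cast _ _) (tensor_id _ _)).trans ?_
  exact cast_family (s := fun b => b) cL (upDown_add k b) _ _ _ _

theorem counit_upDownTensor_id (k b : ℕ) :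
    upDownTensor (k := k + 1) (l := k) (dR (upDown k) : HeisHom 𝕜 _ _)
      (HeisHom.id (upDown b)) = natCast (k := k + b + 1) (l := k + b) (by omega) (by omega)
        (dR (upDown (k + b))) := by
  refine (congrArg (cast _ _) (tensor_id _ _)).trans ?_
  exact cast_family (e := fun b => b) dR (upDown_add k b) _ _ _ _

theorem swap_upDownTensor_id (k b : ℕ) :
    upDownTensor (k := k + 2) (l := k + 2) (swap (upDown k) : HeisHom 𝕜 _ _)
      (HeisHom.id (upDown b)) = natCast (k := k + b + 2) (l := k + b + 2) (by omega) (by omega)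
        (swap (upDown (k + b))) := by
  refine (congrArg (cast _ _) (tensor_id _ _)).trans ?_
  exact cast_family swap (upDown_add k b) _ _ _ _

theorem _root_.PartHeis.InBubbleIdeal.natCast {t : 𝕜} {k l k' l' : ℕ} (hk : k = k') (hl : l = l')
    {f : HeisHom 𝕜 (upDown k) (upDown l)} :
    InBubbleIdeal t (natCast hk hl f) ↔ InBubbleIdeal t f := by
  subst hk hl; rfl

/-- Prefixing `↑↓` is the tensor product with an identity, up to transport, so it preserves the
tensor ideal. Hence it descends to `Peis(t)`, where it serves as the shift of the tower. -/
theorem _root_.PartHeis.InBubbleIdeal.consTwo {t : 𝕜} {k l : ℕ}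
    {f : HeisHom 𝕜 (upDown k) (upDown l)} (hf : InBubbleIdeal t f) :
    InBubbleIdeal t (consTwo f) := by
  have h := InBubbleIdeal.tensor_right (HeisHom.id (upDown 1)) hf
  have e : (HeisHom.id (upDown 1) : HeisHom 𝕜 _ _) = HeisHom.consTwo (HeisHom.id (upDown 0)) := by
    rw [HeisHom.consTwo, cons_id, cons_id]; rfl
  rw [e, upDownTensor_consTwo, InBubbleIdeal.natCast, id_upDownTensor] at h
  have : ∀ {k' l' : ℕ} (hk : k = k') (hl : l = l'),
      InBubbleIdeal t (HeisHom.consTwo (HeisHom.natCast hk hl f)) →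
        InBubbleIdeal t (HeisHom.consTwo f) := by
    intro k' l' hk hl h
    subst hk hl
    exact h
  exact this _ _ h

theorem _root_.PartHeis.InBubbleIdeal.bubble_upDown (t : 𝕜) (k : ℕ) :
    InBubbleIdeal t (comp (cL (upDown k)) (dR (upDown k)) - t • HeisHom.id (upDown k)) := by
  have h := InBubbleIdeal.tensor_left (HeisHom.id (upDown k)) (InBubbleIdeal.bubble (t := t))
  rw [upDownTensor, tensor_id] at h
  have : ∀ {j : ℕ} (hj : j = k) (hw : upDown k = upDown j) (x : HeisHom 𝕜 (upDown k) (upDown k)),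
      InBubbleIdeal t (cast hw hw x) → InBubbleIdeal t x := by
    intro j hj hw x h
    subst hj
    exact h
  have h' := this (Nat.zero_add k) (upDown_add 0 k) _ h
  have e : whiskerRight (upDown k) (clockwiseBubble 𝕜 - t • HeisHom.id (upDown 0)) =
      comp (cL (upDown k)) (dR (upDown k)) - t • HeisHom.id (upDown k) := by
    have e1 := whiskerRight_add (upDown k) (clockwiseBubble 𝕜 - t • HeisHom.id (upDown 0))
      (t • HeisHom.id (upDown 0))
    rw [sub_add_cancel] at e1
    exact eq_sub_of_add_eq e1.symm
  exact e ▸ h'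

end HeisHom

namespace PeisHom

variable {t : 𝕜}

/-- Tensoring with the identity of `↑↓` on the left. -/
def consTwo {k l : ℕ} : PeisHom t k l →ₗ[𝕜] PeisHom t (k + 1) (l + 1) :=
  Submodule.mapQ _ _ (HeisHom.consLin up ∘ₗ HeisHom.consLin down) fun _ hf => hf.consTwo

/-- Transport of a morphism along equalities of natural numbers. -/
def cast {k l k' l' : ℕ} (hk : k = k') (hl : l = l') (f : PeisHom t k l) : PeisHom t k' l' :=
  hk ▸ hl ▸ f

theorem cast_mk {k l k' l' : ℕ} (hk : k = k') (hl : l = l')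
    (f : HeisHom 𝕜 (upDown k) (upDown l)) :
    cast hk hl (mk t f) = mk t (HeisHom.natCast hk hl f) := by
  subst hk hl; rfl

theorem tensor_add_left {k l k' l' : ℕ} (f f' : PeisHom t k l) (g : PeisHom t k' l') :
    tensor (f + f') g = tensor f g + tensor f' g := by
  obtain ⟨f⟩ := f; obtain ⟨f'⟩ := f'; obtain ⟨g⟩ := g
  exact congrArg (mk t) (upDownTensor_add_left f f' g)

theorem tensor_smul_left {k l k' l' : ℕ} (r : 𝕜) (f : PeisHom t k l) (g : PeisHom t k' l') :
    tensor (r • f) g = r • tensor f g := by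
  obtain ⟨f⟩ := f; obtain ⟨g⟩ := g
  exact congrArg (mk t) (HeisHom.upDownTensor_smul_left r f g)

theorem tensor_comp_left {k l m k' l' : ℕ} (f : PeisHom t k l) (f' : PeisHom t l m)
    (g : PeisHom t k' l') :
    tensor (comp f f') g = comp (tensor f (mk t (HeisHom.id (upDown k')))) (tensor f' g) := by
  obtain ⟨f⟩ := f; obtain ⟨f'⟩ := f'; obtain ⟨g⟩ := g
  exact congrArg (mk t) (HeisHom.upDownTensor_comp_left f f' g)

theorem tensor_consTwo {k l k' l' : ℕ} (f : PeisHom t k l) (g : PeisHom t k' l') :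
    tensor (consTwo f) g =
      cast (Nat.succ_add k k').symm (Nat.succ_add l l').symm (consTwo (tensor f g)) := by
  obtain ⟨f⟩ := f; obtain ⟨g⟩ := g
  refine (congrArg (mk t) (HeisHom.upDownTensor_consTwo f g)).trans ?_
  exact (cast_mk _ _ _).symm

theorem id_tensor {k l : ℕ} (f : PeisHom t k l) :
    tensor (mk t (HeisHom.id (upDown 0))) f =
      cast (Nat.zero_add k).symm (Nat.zero_add l).symm f := by
  obtain ⟨f⟩ := f
  refine (congrArg (mk t) (HeisHom.id_upDownTensor f)).trans ?_
  exact (cast_mk _ _ _).symm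

theorem comp_id {k l : ℕ} (f : PeisHom t k l) : comp f (mk t (HeisHom.id (upDown l))) = f :=
  Category.comp_id (obj := Peis 𝕜 t) (X := ⟨k⟩) (Y := ⟨l⟩) f

end PeisHom

/-- The Frobenius algebra `↑↓` in `Peis(t)`. -/
def peisTower (t : 𝕜) : FrobeniusTower (Peis 𝕜 t) where
  obj k := ⟨k⟩
  L f := PeisHom.consTwo f
  mu k := PeisHom.mk t (k := k + 2) (l := k + 1) (HeisHom.mul (upDown k))
  delta k := PeisHom.mk t (k := k + 1) (l := k + 2) (HeisHom.comul (upDown k))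
  eta k := PeisHom.mk t (k := k) (l := k + 1) (HeisHom.cL (upDown k))
  eps k := PeisHom.mk t (k := k + 1) (l := k) (HeisHom.dR (upDown k))
  s k := PeisHom.mk t (k := k + 2) (l := k + 2) (HeisHom.swap (upDown k))
  L_id k := congrArg (PeisHom.mk t (k := k + 1) (l := k + 1)) (by
    exact (congrArg _ (HeisHom.cons_id _ _)).trans (HeisHom.cons_id _ _))
  L_comp := by
    rintro k l m ⟨f⟩ ⟨g⟩
    exact congrArg (PeisHom.mk t (k := k + 1) (l := m + 1))
      ((congrArg _ (HeisHom.cons_comp _ _ _)).trans (HeisHom.cons_comp _ _ _))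
  mu_nat := by
    rintro k l ⟨f⟩
    exact congrArg (PeisHom.mk t (k := k + 2) (l := l + 1)) (HeisHom.mul_nat f)
  delta_nat := by
    rintro k l ⟨f⟩
    exact congrArg (PeisHom.mk t (k := k + 1) (l := l + 2)) (HeisHom.comul_nat f)
  eta_nat := by
    rintro k l ⟨f⟩
    exact congrArg (PeisHom.mk t (k := k) (l := l + 1)) (HeisHom.cL_nat f).symm
  eps_nat := by
    rintro k l ⟨f⟩
    exact congrArg (PeisHom.mk t (k := k + 1) (l := l)) (HeisHom.dR_nat f).symm
  s_nat := by
    rintro k l ⟨f⟩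
    exact congrArg (PeisHom.mk t (k := k + 2) (l := l + 2)) (HeisHom.swap_nat f)
  s_s k := congrArg (PeisHom.mk t (k := k + 2) (l := k + 2)) (HeisHom.swap_swap _)
  braid k := congrArg (PeisHom.mk t (k := k + 3) (l := k + 3)) (HeisHom.swap_braid _)
  mu_s k := congrArg (PeisHom.mk t (k := k + 3) (l := k + 2)) (HeisHom.mul_swap _)
  s_delta k := congrArg (PeisHom.mk t (k := k + 2) (l := k + 3)) (HeisHom.comul_swap_swap _).symm
  eta_s k := congrArg (PeisHom.mk t (k := k + 1) (l := k + 2)) (HeisHom.unit_swap _)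
  s_eps k := congrArg (PeisHom.mk t (k := k + 2) (l := k + 1)) (HeisHom.swap_counit _)
  s_mu k := congrArg (PeisHom.mk t (k := k + 2) (l := k + 1)) (HeisHom.swap_mul _)
  delta_s k := congrArg (PeisHom.mk t (k := k + 1) (l := k + 2)) (HeisHom.comul_swap _)
  mu_mu k := congrArg (PeisHom.mk t (k := k + 3) (l := k + 1)) (HeisHom.mul_mul _)
  delta_delta k := congrArg (PeisHom.mk t (k := k + 1) (l := k + 3)) (HeisHom.comul_comul _)
  eta_mu k := congrArg (PeisHom.mk t (k := k + 1) (l := k + 1)) (HeisHom.unit_mul _)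
  delta_eps k := congrArg (PeisHom.mk t (k := k + 1) (l := k + 1)) (HeisHom.comul_counit _)
  delta_mu k := congrArg (PeisHom.mk t (k := k + 1) (l := k + 1)) (HeisHom.comul_mul _)
  delta_L_mu k := congrArg (PeisHom.mk t (k := k + 2) (l := k + 2)) (HeisHom.comul_cons_mul _)
  L_delta_mu k := congrArg (PeisHom.mk t (k := k + 2) (l := k + 2)) (HeisHom.cons_comul_mul _)

/-- Unit followed by counit is the clockwise bubble: this is the one place where the relation
imposed on `Peis(t)` enters. -/
theorem peisTower_eta_eps (t : 𝕜) (k : ℕ) :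
    (peisTower t).eta k ≫ (peisTower t).eps k = t • 𝟙 ((peisTower t).obj k) :=
  (Submodule.Quotient.eq (bubbleIdeal t k k)).2 (InBubbleIdeal.bubble_upDown t k)

/-- The linear maps given by `Ψ`. -/
noncomputable def psiMap (t : 𝕜) (k l : ℕ) : ParHom 𝕜 k l →ₗ[𝕜] PeisHom t k l :=
  (peisTower t).parMap k l

section PsiMap

variable {t : 𝕜}

theorem psiMap_id (k : ℕ) : psiMap t k k (parId 𝕜 k) = PeisHom.mk t (HeisHom.id (upDown k)) :=
  (peisTower t).parMap_id k

theorem psiMap_comp {k l m : ℕ} (f : ParHom 𝕜 k l) (g : ParHom 𝕜 l m) :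
    psiMap t k m (parComp t f g) = PeisHom.comp (psiMap t k l f) (psiMap t l m g) :=
  (peisTower t).parMap_comp (peisTower_eta_eps t) f g

theorem psiMap_parCast {k l k' l' : ℕ} (hk : k = k') (hl : l = l') (f : ParHom 𝕜 k l) :
    psiMap t k' l' (parCast hk hl f) = PeisHom.cast hk hl (psiMap t k l f) := by
  subst hk hl; rfl

theorem psiMap_parL {k l : ℕ} (f : ParHom 𝕜 k l) :
    psiMap t (k + 1) (l + 1) (parL f) = PeisHom.consTwo (psiMap t k l f) :=
  (peisTower t).parMap_parL (fun f g => map_add PeisHom.consTwo f g)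
    (fun r f => map_smul PeisHom.consTwo r f) f

theorem psiMap_mulFun (k : ℕ) : psiMap t (k + 2) (k + 1) (Finsupp.single (graph (mulFun k)) 1) =
    PeisHom.mk t (HeisHom.mul (upDown k)) :=
  ((peisTower t).parMap_graph _).trans ((peisTower t).push_cons_id 0)

theorem psiMap_comulFun (k : ℕ) :
    psiMap t (k + 1) (k + 2) (Finsupp.single (cograph (mulFun k)) 1) =
      PeisHom.mk t (HeisHom.comul (upDown k)) :=
  ((peisTower t).parMap_cograph _).trans ((peisTower t).pull_cons_id 0)

theorem psiMap_unitFun (k : ℕ) : psiMap t k (k + 1) (Finsupp.single (graph Fin.succ) 1) =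
    PeisHom.mk t (HeisHom.cL (upDown k)) :=
  ((peisTower t).parMap_graph _).trans ((peisTower t).push_fin_succ k)

theorem psiMap_counitFun (k : ℕ) : psiMap t (k + 1) k (Finsupp.single (cograph Fin.succ) 1) =
    PeisHom.mk t (HeisHom.dR (upDown k)) :=
  ((peisTower t).parMap_cograph _).trans ((peisTower t).pull_fin_succ k)

theorem psiMap_swapFun (k : ℕ) :
    psiMap t (k + 2) (k + 2) (Finsupp.single (graph (swapFun k)) 1) =
      PeisHom.mk t (HeisHom.swap (upDown k)) :=
  ((peisTower t).parMap_graph _).trans ((peisTower t).push_swap k)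

theorem psiMap_id_tensor (k : ℕ) {k' l' : ℕ} (g : ParHom 𝕜 k' l') :
    psiMap t _ _ (parTensor (parId 𝕜 k) g) =
      PeisHom.tensor (PeisHom.mk t (HeisHom.id (upDown k))) (psiMap t _ _ g) := by
  induction k with
  | zero => rw [parId_zero_tensor, psiMap_parCast, PeisHom.id_tensor]
  | succ k ih =>
    rw [← psiMap_id (k + 1), ← parL_parId, parTensor_parL, psiMap_parCast, psiMap_parL, ih,
      psiMap_parL, PeisHom.tensor_consTwo, psiMap_id]

/-- By the interchange law `f ⊗ g` is `f ⊗ 1` followed by `1 ⊗ g`, and the second is already covered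
by `psiMap_id_tensor`. -/
theorem psiMap_tensor_of_id {k l : ℕ} (f : ParHom 𝕜 k l)
    (hf : ∀ b, psiMap t _ _ (parTensor f (parId 𝕜 b)) =
      PeisHom.tensor (psiMap t _ _ f) (PeisHom.mk t (HeisHom.id (upDown b))))
    {k' l' : ℕ} (g : ParHom 𝕜 k' l') :
    psiMap t _ _ (parTensor f g) = PeisHom.tensor (psiMap t _ _ f) (psiMap t _ _ g) := by
  have h := parTensor_comp t f (parId 𝕜 l) (parId 𝕜 k') g
  rw [parComp_id, parId_comp] at h
  rw [h, psiMap_comp, hf, psiMap_id_tensor, ← PeisHom.tensor_comp_left, PeisHom.comp_id]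

/-- Induction on the left factor only. A generator with identity strands on its right is the same
generator with a larger index, in `Par(t)` as in `Peis(t)`. -/
theorem psiMap_tensor {k l : ℕ} (f : ParHom 𝕜 k l) (k' l' : ℕ) (g : ParHom 𝕜 k' l') :
    psiMap t _ _ (parTensor f g) = PeisHom.tensor (psiMap t _ _ f) (psiMap t _ _ g) := by
  refine par_induction t (P := fun k l f => ∀ (k' l' : ℕ) (g : ParHom 𝕜 k' l'),
    psiMap t _ _ (parTensor f g) = PeisHom.tensor (psiMap t _ _ f) (psiMap t _ _ g))
    (fun k l k' l' g => ?_) (fun f f' hf hf' k' l' g => ?_) (fun r f hf k' l' g => ?_)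
    (fun k k' l' g => ?_) (fun f f' hf hf' k' l' g => ?_) (fun f hf k' l' g => ?_)
    (fun k k' l' g => psiMap_tensor_of_id _ (fun b => ?_) g)
    (fun k k' l' g => psiMap_tensor_of_id _ (fun b => ?_) g)
    (fun k k' l' g => psiMap_tensor_of_id _ (fun b => ?_) g)
    (fun k k' l' g => psiMap_tensor_of_id _ (fun b => ?_) g)
    (fun k k' l' g => psiMap_tensor_of_id _ (fun b => ?_) g) f k' l' g
  · have h := PeisHom.tensor_smul_left (t := t) (0 : 𝕜) (0 : PeisHom t k l) (psiMap t _ _ g)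
    rw [zero_smul, zero_smul] at h
    rw [parTensor_zero_left, map_zero, map_zero, h]
  · rw [parTensor_add_left, map_add, hf, hf', map_add, PeisHom.tensor_add_left]
  · rw [parTensor_smul_left, map_smul, hf, map_smul, PeisHom.tensor_smul_left]
  · rw [psiMap_id_tensor, psiMap_id]
  · have h := parTensor_comp t f f' (parId 𝕜 _) g
    rw [parId_comp] at h
    rw [h, psiMap_comp, hf, hf', psiMap_id, psiMap_comp, PeisHom.tensor_comp_left]
  · rw [parTensor_parL, psiMap_parCast, psiMap_parL, psiMap_parL, hf, PeisHom.tensor_consTwo]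
  · rw [parMul_tensor_id, psiMap_parCast, psiMap_mulFun, psiMap_mulFun]
    exact (PeisHom.cast_mk _ _ _).trans <| congrArg (PeisHom.mk t) (HeisHom.mul_upDownTensor_id k b).symm
  · rw [parComul_tensor_id, psiMap_parCast, psiMap_comulFun, psiMap_comulFun]
    exact (PeisHom.cast_mk _ _ _).trans <| congrArg (PeisHom.mk t) (HeisHom.comul_upDownTensor_id k b).symm
  · rw [parUnit_tensor_id, psiMap_parCast, psiMap_unitFun, psiMap_unitFun]
    exact (PeisHom.cast_mk _ _ _).trans <| congrArg (PeisHom.mk t) (HeisHom.unit_upDownTensor_id k b).symm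
  · rw [parCounit_tensor_id, psiMap_parCast, psiMap_counitFun, psiMap_counitFun]
    exact (PeisHom.cast_mk _ _ _).trans <| congrArg (PeisHom.mk t) (HeisHom.counit_upDownTensor_id k b).symm
  · rw [parSwap_tensor_id, psiMap_parCast, psiMap_swapFun, psiMap_swapFun]
    exact (PeisHom.cast_mk _ _ _).trans <| congrArg (PeisHom.mk t) (HeisHom.swap_upDownTensor_id k b).symm

end PsiMap

theorem mk_swap_nil (t : 𝕜) : PeisHom.mk t (k := 2) (l := 2) (HeisHom.swap []) =
    PeisHom.mk t (HeisHom.mk psiSwapCross) + PeisHom.mk t (HeisHom.mk psiSwapCapCup) := by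
  refine congrArg (PeisHom.mk t (k := 2) (l := 2)) (a₂ := HeisHom.mk psiSwapCross +
    HeisHom.mk psiSwapCapCup) (congrArg₂ (· + ·) ?_ ?_)
  · exact congrArg _ (HeisHom.comp_assoc (HeisHom.X [down, down]) _ _).symm
  · exact (HeisHom.cons_comp _ _ _).symm

/-- The functor `Ψ`. -/
noncomputable def psi (t : 𝕜) : Psi t where
  map := psiMap t
  map_id := psiMap_id
  map_comp := psiMap_comp
  map_tensor f g := psiMap_tensor f _ _ g
  map_mul := by rw [parMul_eq, psiMap_mulFun]; rfl
  map_comul := by rw [parComul_eq, psiMap_comulFun]; rfl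
  map_swap := by rw [parSwap_eq, psiMap_swapFun]; exact mk_swap_nil t
  map_unit := by rw [parUnit_eq, psiMap_unitFun]; rfl
  map_counit := by rw [parCounit_eq, psiMap_counitFun]; rfl

theorem psi_unique {t : 𝕜} (Ψ Ψ' : Psi t) : Ψ = Ψ' := by
  refine Psi.ext (funext fun k => funext fun l => LinearMap.ext fun f => ?_)
  refine par_tensor_induction t (P := fun k l f => Ψ.map k l f = Ψ'.map k l f) (fun k l => ?_)
    (fun f g hf hg => ?_) (fun r f hf => ?_) (fun k => ?_) (fun f g hf hg => ?_)
    (fun f g hf hg => ?_) ?_ ?_ ?_ ?_ ?_ f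
  · rw [map_zero, map_zero]
  · rw [map_add, map_add, hf, hg]
  · rw [map_smul, map_smul, hf]
  · rw [Ψ.map_id, Ψ'.map_id]
  · rw [Ψ.map_comp, Ψ'.map_comp, hf, hg]
  · rw [Ψ.map_tensor, Ψ'.map_tensor, hf, hg]
  · rw [Ψ.map_mul, Ψ'.map_mul]
  · rw [Ψ.map_comul, Ψ'.map_comul]
  · rw [Ψ.map_unit, Ψ'.map_unit]
  · rw [Ψ.map_counit, Ψ'.map_counit]
  · rw [Ψ.map_swap, Ψ'.map_swap]

end PsiExistence

end PartHeis

namespace PartHeis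

/-! ### Colourings with an arbitrary set of colours -/

section Colourings

variable {A B C K : Type}

/-- A colouring of the vertices is constant on the blocks of a diagram. -/
def Colours (D : Setoid (A ⊕ B)) (a : A → K) (b : B → K) : Prop :=
  ∀ x y, D x y → Sum.elim a b x = Sum.elim a b y

theorem colours_stack (D : Setoid (A ⊕ B)) (E : Setoid (B ⊕ C)) (a : A → K) (b : B → K)
    (c : C → K) (h1 : Colours D a b) (h2 : Colours E b c) (x y : A ⊕ B ⊕ C)
    (h : stack D E x y) : Sum.elim a (Sum.elim b c) x = Sum.elim a (Sum.elim b c) y := by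
  induction h with
  | rel x y h =>
    cases h with
    | lower h =>
      rename_i x y
      have := h1 x y h
      rcases x with x | x <;> rcases y with y | y <;> simpa using this
    | upper h => exact h2 _ _ h
  | refl => rfl
  | symm _ _ _ ih => exact ih.symm
  | trans _ _ _ _ _ ih1 ih2 => exact ih1.trans ih2

theorem colours_star (D : Setoid (A ⊕ B)) (E : Setoid (B ⊕ C)) (a : A → K) (b : B → K)
    (c : C → K) (h1 : Colours D a b) (h2 : Colours E b c) : Colours (star D E) a c := by
  intro x y h
  have := colours_stack D E a b c h1 h2 _ _ h
  rcases x with x | x <;> rcases y with y | y <;> simpa using this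

open Classical in
/-- Extend a colouring of the floating components and of the outer rows to the middle row. -/
noncomputable def extendLabel (D : Setoid (A ⊕ B)) (E : Setoid (B ⊕ C)) (a : A → K)
    (c : C → K) (f : Floating D E → K) (q : Quotient (stack D E)) : K :=
  if h : ∃ x : A ⊕ C, Quotient.mk (stack D E) (Sum.map id Sum.inr x) = q then
    Sum.elim a c h.choose
  else f ⟨q, fun x hx => by
    rcases x with x | x | x
    · exact (h ⟨Sum.inl x, hx⟩).elim
    · exact ⟨x, rfl⟩
    · exact (h ⟨Sum.inr x, hx⟩).elim⟩

theorem extendLabel_outer (D : Setoid (A ⊕ B)) (E : Setoid (B ⊕ C)) (a : A → K)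
    (c : C → K) (f : Floating D E → K) (hs : Colours (star D E) a c) (x : A ⊕ C) :
    extendLabel D E a c f (Quotient.mk _ (Sum.map id Sum.inr x)) = Sum.elim a c x := by
  have h : ∃ y : A ⊕ C, Quotient.mk (stack D E) (Sum.map id Sum.inr y) =
    Quotient.mk (stack D E) (Sum.map id Sum.inr x) := ⟨x, rfl⟩
  rw [extendLabel, dif_pos h]
  have h' : stack D E (Sum.map id Sum.inr h.choose) (Sum.map id Sum.inr x) :=
    Quotient.exact h.choose_spec
  exact hs _ _ h'

theorem extendLabel_floating (D : Setoid (A ⊕ B)) (E : Setoid (B ⊕ C)) (a : A → K)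
    (c : C → K) (f : Floating D E → K) (q : Floating D E) :
    extendLabel D E a c f q.1 = f q := by
  have h : ¬ ∃ x : A ⊕ C, Quotient.mk (stack D E) (Sum.map id Sum.inr x) = q.1 := by
    rintro ⟨x, hx⟩
    obtain ⟨b, hb⟩ := q.2 _ hx
    rcases x with x | x <;> simp at hb
  rw [extendLabel, dif_neg h]
  rfl

open Classical in
/-- Colourings of the middle row compatible with given colourings of the outer rows correspond to
arbitrary colourings of the floating components. -/
noncomputable def middleColoursEquiv (D : Setoid (A ⊕ B)) (E : Setoid (B ⊕ C)) (a : A → K)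
    (c : C → K) (hs : Colours (star D E) a c) :
    {b : B → K // Colours D a b ∧ Colours E b c} ≃ (Floating D E → K) where
  toFun b q := Quotient.lift (Sum.elim a (Sum.elim b.1 c))
    (fun x y h => colours_stack D E a b.1 c b.2.1 b.2.2 x y h) q.1
  invFun f := ⟨fun b => extendLabel D E a c f (Quotient.mk _ (Sum.inr (Sum.inl b))), by
    have ha : ∀ x, a x = extendLabel D E a c f (Quotient.mk _ (Sum.inl x)) := fun x =>
      (extendLabel_outer D E a c f hs (Sum.inl x)).symm
    have hc : ∀ x, c x = extendLabel D E a c f (Quotient.mk _ (Sum.inr (Sum.inr x))) :=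
      fun x => (extendLabel_outer D E a c f hs (Sum.inr x)).symm
    constructor
    · intro x y h
      have h' : stack D E (Sum.map id Sum.inl x) (Sum.map id Sum.inl y) :=
        Relation.EqvGen.rel _ _ (StackStep.lower h)
      have h'' := congrArg (extendLabel D E a c f) (Quotient.sound h')
      rcases x with x | x <;> rcases y with y | y <;> simpa [ha] using h''
    · intro x y h
      have h' : stack D E (Sum.inr x) (Sum.inr y) := Relation.EqvGen.rel _ _ (StackStep.upper h)
      have h'' := congrArg (extendLabel D E a c f) (Quotient.sound h')
      rcases x with x | x <;> rcases y with y | y <;> simpa [hc] using h''⟩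
  left_inv b := by
    apply Subtype.ext
    funext x
    by_cases h : ∃ y : A ⊕ C, Quotient.mk (stack D E) (Sum.map id Sum.inr y) =
        Quotient.mk (stack D E) (Sum.inr (Sum.inl x))
    · obtain ⟨y, hy⟩ := h
      have h1 := colours_stack D E a b.1 c b.2.1 b.2.2 _ _ (Quotient.exact hy)
      simp only
      rw [← hy, extendLabel_outer D E a c _ hs]
      rcases y with y | y <;> simpa using h1
    · simp only [extendLabel]
      rw [dif_neg h]
      rfl
  right_inv f := by
    funext q
    obtain ⟨q, hq⟩ := q
    induction q using Quotient.inductionOn with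
    | h x =>
      obtain ⟨b, rfl⟩ := hq x rfl
      exact extendLabel_floating D E a c f ⟨_, hq⟩

-- The source of the scalar in the composition of Φ: a compatible colouring of the middle row is
-- forced on the components that meet an outer row and free on the floating ones.
open Classical in
theorem card_middle_colours [Finite B] [Finite A] [Finite C] [Finite K] (D : Setoid (A ⊕ B))
    (E : Setoid (B ⊕ C)) (a : A → K) (c : C → K) :
    Nat.card {b : B → K // Colours D a b ∧ Colours E b c} =
      if Colours (star D E) a c then Nat.card K ^ floatingCard D E else 0 := by
  split_ifs with hs
  · have : Finite (Floating D E) := Subtype.finite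
    rw [Nat.card_congr (middleColoursEquiv D E a c hs), Nat.card_fun, floatingCard]
  · have : IsEmpty {b : B → K // Colours D a b ∧ Colours E b c} :=
      ⟨fun b => hs (colours_star D E a b.1 c b.2.1 b.2.2)⟩
    exact Nat.card_of_isEmpty

theorem colours_comp_iff (D : Setoid (A ⊕ B)) {K' : Type} (a : A → K) (b : B → K) {g : K → K'}
    (hg : Function.Injective g) : Colours D (fun x => g (a x)) (fun x => g (b x)) ↔ Colours D a b := by
  refine forall_congr' fun x => forall_congr' fun y => imp_congr_right fun _ => ?_
  rcases x with x | x <;> rcases y with y | y <;> exact hg.eq_iff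

theorem colours_graph {k l : ℕ} (f : Fin k → Fin l) (a : Fin k → K) (b : Fin l → K) :
    Colours (graph f) a b ↔ a = fun i => b (f i) := by
  constructor
  · intro h
    funext i
    exact h (.inl i) (.inr (f i)) rfl
  · rintro rfl (x | x) (y | y) h <;> exact congrArg b h

theorem colours_cograph {k l : ℕ} (f : Fin k → Fin l) (a : Fin l → K) (b : Fin k → K) :
    Colours (cograph f) a b ↔ b = fun i => a (f i) := by
  constructor
  · intro h
    funext i
    exact h (.inr i) (.inl (f i)) rfl
  · rintro rfl (x | x) (y | y) h <;> exact congrArg a h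

theorem colours_consDiagram {k l : ℕ} (D : Diagram k l) (a : Fin (k + 1) → K) (b : Fin (l + 1) → K) :
    Colours (consDiagram D) a b ↔
      a 0 = b 0 ∧ Colours D (fun i => a i.succ) (fun i => b i.succ) := by
  constructor
  · intro h
    refine ⟨h (.inl 0) (.inr 0) rfl, fun x y hxy => ?_⟩
    have hq : some (Quotient.mk D x) = some (Quotient.mk D y) := congrArg some (Quotient.sound hxy)
    rcases x with x | x <;> rcases y with y | y
    · exact h (.inl x.succ) (.inl y.succ) hq
    · exact h (.inl x.succ) (.inr y.succ) hq
    · exact h (.inr x.succ) (.inl y.succ) hq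
    · exact h (.inr x.succ) (.inr y.succ) hq
  · rintro ⟨h0, h⟩
    have hφ : Sum.elim a b = fun x => (consLabel (Quotient.mk D) x).elim (a 0)
        (Quotient.lift (Sum.elim (fun i => a i.succ) fun i => b i.succ) h) := by
      funext x
      rcases x with x | x <;> refine Fin.cases ?_ (fun i => ?_) x
      · rfl
      · rfl
      · exact h0.symm
      · rfl
    intro x y hxy
    rw [hφ]
    exact congrArg (fun o => Option.elim o _ _) hxy

end Colourings

/-! ### The existence and uniqueness of `Φ` -/

section PhiExistence

open scoped TensorProduct

variable (𝕜 : Type u) [CommRing 𝕜] (n : ℕ)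

/-- The basis of `V` formed by the basis vectors `v_i`. -/
noncomputable def permBasis : Module.Basis (Fin n) 𝕜 (permRep 𝕜 n) :=
  Module.Basis.ofRepr (MonoidAlgebra.coeffLinearEquiv 𝕜)

/-- The basis of `V^{⊗k}` formed by the pure tensors of basis vectors. -/
noncomputable def tensorBasis (k : ℕ) : Module.Basis (Fin k → Fin n) 𝕜 (tensorPowerRep 𝕜 n k) :=
  Basis.piTensorProduct fun _ : Fin k => permBasis 𝕜 n

theorem tensorBasis_apply {k : ℕ} (i : Fin k → Fin n) :
    tensorBasis 𝕜 n k i = basisTensor 𝕜 n i :=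
  Basis.piTensorProduct_apply _ _

theorem tensorPowerRep_rho {k : ℕ} (g : Equiv.Perm (Fin n)) (i : Fin k → Fin n) :
    (tensorPowerRep 𝕜 n k).ρ g (basisTensor 𝕜 n i) = basisTensor 𝕜 n fun j => g (i j) := by
  refine (PiTensorProduct.map_tprod _ _).trans ?_
  refine congrArg (PiTensorProduct.tprod 𝕜) (funext fun j => ?_)
  exact Representation.ofMulAction_single _ _ _

variable {𝕜 n}

theorem tensorPowerRep_hom_ext {k : ℕ} {M : Rep.{u} 𝕜 (Equiv.Perm (Fin n))}
    {f g : tensorPowerRep 𝕜 n k ⟶ M}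
    (h : ∀ i, f.hom (basisTensor 𝕜 n i) = g.hom (basisTensor 𝕜 n i)) : f = g := by
  refine Rep.hom_ext (Representation.IntertwiningMap.ext ?_)
  refine (tensorBasis 𝕜 n k).ext fun i => ?_
  rw [tensorBasis_apply]
  exact h i

/-- The equivariant map with given values on basis vectors. -/
noncomputable def tensorPowerLift {k : ℕ} {M : Rep.{u} 𝕜 (Equiv.Perm (Fin n))}
    (φ : (Fin k → Fin n) → M) (hφ : ∀ g i, φ (fun j => g (i j)) = M.ρ g (φ i)) :
    tensorPowerRep 𝕜 n k ⟶ M :=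
  Rep.ofHom ⟨(tensorBasis 𝕜 n k).constr 𝕜 φ, fun g => by
    refine (tensorBasis 𝕜 n k).ext fun i => ?_
    rw [LinearMap.comp_apply, LinearMap.comp_apply, Module.Basis.constr_basis, tensorBasis_apply]
    refine (congrArg _ (tensorPowerRep_rho 𝕜 n g i)).trans ?_
    rw [← tensorBasis_apply, Module.Basis.constr_basis, hφ]⟩

theorem tensorPowerLift_basisTensor {k : ℕ} {M : Rep.{u} 𝕜 (Equiv.Perm (Fin n))}
    (φ : (Fin k → Fin n) → M) (hφ : ∀ g i, φ (fun j => g (i j)) = M.ρ g (φ i)) (i : Fin k → Fin n) :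
    (tensorPowerLift φ hφ).hom (basisTensor 𝕜 n i) = φ i := by
  rw [← tensorBasis_apply]
  exact Module.Basis.constr_basis _ _ _ _

open Classical in
/-- The sum of the pure tensors that are compatible with `i` in the sense of `D`. -/
noncomputable def colourSum (𝕜 : Type u) [CommRing 𝕜] {n k l : ℕ} (D : Diagram k l)
    (i : Fin k → Fin n) : tensorPowerRep 𝕜 n l :=
  ∑ j : Fin l → Fin n, if Colours D i j then basisTensor 𝕜 n j else 0

/-- A permutation renames the colours, and compatibility with a diagram does not depend on their
names. -/
theorem colourSum_equivariant {k l : ℕ} (D : Diagram k l) (g : Equiv.Perm (Fin n))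
    (i : Fin k → Fin n) :
    colourSum 𝕜 D (fun j => g (i j)) = (tensorPowerRep 𝕜 n l).ρ g (colourSum 𝕜 D i) := by
  classical
  rw [colourSum, colourSum, map_sum, ← (Equiv.arrowCongr (Equiv.refl (Fin l)) g).sum_comp]
  refine Finset.sum_congr rfl fun j _ => ?_
  have h : Colours D (fun x => g (i x)) (fun x => g (j x)) ↔ Colours D i j :=
    colours_comp_iff D i j g.injective
  by_cases hc : Colours D i j
  · rw [if_pos hc]
    refine (if_pos (h.2 hc)).trans (tensorPowerRep_rho 𝕜 n g j).symm
  · rw [if_neg hc, map_zero]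
    exact if_neg fun h' => hc (h.1 h')

/-- The linear maps given by `Φ`. -/
noncomputable def phiMap (𝕜 : Type u) [CommRing 𝕜] (n k l : ℕ) :
    ParHom 𝕜 k l →ₗ[𝕜] (tensorPowerRep 𝕜 n k ⟶ tensorPowerRep 𝕜 n l) :=
  Finsupp.linearCombination 𝕜 fun D =>
    tensorPowerLift (colourSum 𝕜 D) (colourSum_equivariant D)

theorem phiMap_single {k l : ℕ} (D : Diagram k l) (r : 𝕜) (i : Fin k → Fin n) :
    (phiMap 𝕜 n k l (Finsupp.single D r)).hom (basisTensor 𝕜 n i) = r • colourSum 𝕜 D i := by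
  rw [phiMap, Finsupp.linearCombination_single]
  exact congrArg (fun x : tensorPowerRep 𝕜 n l => r • x) (tensorPowerLift_basisTensor _ _ i)

theorem colourSum_graph {k l : ℕ} (f : Fin k → Fin l) (i : Fin k → Fin n) :
    colourSum 𝕜 (graph f) i =
      ∑ j : Fin l → Fin n, if i = (fun x => j (f x)) then basisTensor 𝕜 n j else 0 := by
  classical
  exact Finset.sum_congr rfl fun j _ => if_congr (colours_graph f i j) rfl rfl

theorem colourSum_cograph {k l : ℕ} (f : Fin k → Fin l) (i : Fin l → Fin n) :
    colourSum 𝕜 (cograph f) i = basisTensor 𝕜 n fun x => i (f x) := by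
  classical
  rw [colourSum, Finset.sum_congr rfl fun j _ => if_congr (colours_cograph f i j) rfl rfl]
  exact (Fintype.sum_ite_eq' _ _).trans rfl

theorem colourSum_mulFun {k : ℕ} (i j : Fin n) (a : Fin k → Fin n) :
    colourSum 𝕜 (graph (mulFun k)) (Fin.cons i (Fin.cons j a) : Fin (k + 2) → Fin n) =
      if i = j then basisTensor 𝕜 n (Fin.cons i a : Fin (k + 1) → Fin n) else 0 := by
  rw [colourSum_graph]
  have h : ∀ b : Fin (k + 1) → Fin n, (Fin.cons i (Fin.cons j a) : Fin (k + 2) → Fin n) =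
      (fun x => b (mulFun k x)) ↔ (Fin.cons i a : Fin (k + 1) → Fin n) = b ∧ i = j := by
    intro b
    constructor
    · intro h
      have h0 : i = b 0 := congrFun h 0
      have h1 : (Fin.cons j a : Fin (k + 1) → Fin n) = b :=
        funext fun x => congrFun h x.succ
      have h2 : j = b 0 := congrFun h1 0
      exact ⟨by rw [h0, ← h2, h1], h0.trans h2.symm⟩
    · rintro ⟨rfl, rfl⟩
      funext x
      refine Fin.cases rfl (fun x => rfl) x
  split_ifs with hij
  · rw [Finset.sum_congr rfl fun b _ => if_congr ((h b).trans (and_iff_left hij)) rfl rfl]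
    exact Fintype.sum_ite_eq _ _
  · exact Finset.sum_eq_zero fun b _ => if_neg fun hb => hij ((h b).1 hb).2

theorem colourSum_unitFun {k : ℕ} (a : Fin k → Fin n) :
    colourSum 𝕜 (graph (Fin.succ : Fin k → Fin (k + 1))) a =
      ∑ i : Fin n, basisTensor 𝕜 n (Fin.cons i a : Fin (k + 1) → Fin n) := by
  classical
  rw [colourSum_graph, ← (Fin.consEquiv fun _ : Fin (k + 1) => Fin n).sum_comp,
    Fintype.sum_prod_type]
  refine Finset.sum_congr rfl fun i _ => ?_
  exact Fintype.sum_ite_eq a _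

/-- The colour of the vertical strand is carried along unchanged, so of the sum over its upper
colour only one term is left. -/
theorem colourSum_consDiagram {k l : ℕ} (D : Diagram k l) (i : Fin n) (a : Fin k → Fin n) :
    colourSum 𝕜 (consDiagram D) (Fin.cons i a : Fin (k + 1) → Fin n) =
      (tensorBasis 𝕜 n l).constr 𝕜 (fun b => basisTensor 𝕜 n (Fin.cons i b : Fin (l + 1) → Fin n))
        (colourSum 𝕜 D a) := by
  classical
  rw [colourSum, ← (Fin.consEquiv fun _ : Fin (l + 1) => Fin n).sum_comp, Fintype.sum_prod_type,
    Finset.sum_eq_single i]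
  · rw [colourSum, map_sum]
    refine Finset.sum_congr rfl fun b _ => ?_
    rw [apply_ite ((tensorBasis 𝕜 n l).constr 𝕜 _), map_zero, ← tensorBasis_apply 𝕜 n b,
      Module.Basis.constr_basis]
    refine if_congr ((colours_consDiagram _ _ _).trans (and_iff_right rfl)) rfl rfl
  · intro j _ hj
    exact Finset.sum_eq_zero fun b _ => if_neg fun h =>
      hj ((colours_consDiagram _ _ _).1 h).1.symm
  · exact fun h => (h (Finset.mem_univ i)).elim

theorem phiMap_graph {k l : ℕ} (f : Fin k → Fin l) (i : Fin k → Fin n) :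
    (phiMap 𝕜 n k l (Finsupp.single (graph f) 1)).hom (basisTensor 𝕜 n i) =
      colourSum 𝕜 (graph f) i := by
  rw [phiMap_single, one_smul]

theorem phiMap_cograph {k l : ℕ} (f : Fin k → Fin l) (i : Fin l → Fin n) :
    (phiMap 𝕜 n l k (Finsupp.single (cograph f) 1)).hom (basisTensor 𝕜 n i) =
      basisTensor 𝕜 n fun x => i (f x) := by
  rw [phiMap_single, one_smul, colourSum_cograph]

theorem phiMap_id (k : ℕ) : phiMap 𝕜 n k k (parId 𝕜 k) = 𝟙 _ :=
  tensorPowerRep_hom_ext fun i => phiMap_cograph (fun j => j) i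

/-- Exchanging the sums over the middle and upper rows, the coefficient of an upper colouring is the
number of intermediate colourings. -/
theorem phiMap_colourSum {k l m : ℕ} (D : Diagram k l) (E : Diagram l m) (i : Fin k → Fin n) :
    (phiMap 𝕜 n l m (Finsupp.single E 1)).hom (colourSum 𝕜 D i) =
      (n : 𝕜) ^ floatingCard D E • colourSum 𝕜 (star D E) i := by
  classical
  rw [colourSum, map_sum]
  have h1 : ∀ j : Fin l → Fin n, (phiMap 𝕜 n l m (Finsupp.single E 1)).hom
      (if Colours D i j then basisTensor 𝕜 n j else 0) =
        ∑ c : Fin m → Fin n, if Colours D i j ∧ Colours E j c then basisTensor 𝕜 n c else 0 := by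
    intro j
    split_ifs with h
    · rw [phiMap_single, one_smul, colourSum]
      exact Finset.sum_congr rfl fun c _ => if_congr (and_iff_right h).symm rfl rfl
    · rw [map_zero, Finset.sum_eq_zero fun c _ => if_neg fun h' => h h'.1]
  rw [Finset.sum_congr rfl fun j _ => h1 j, Finset.sum_comm, colourSum, Finset.smul_sum]
  refine Finset.sum_congr rfl fun c _ => ?_
  rw [← Finset.sum_filter, Finset.sum_const]
  have h2 := card_middle_colours D E i c
  rw [Nat.card_eq_fintype_card, Fintype.card_subtype, Nat.card_eq_fintype_card,
    Fintype.card_fin] at h2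
  rw [h2]
  split_ifs
  · rw [← Nat.cast_smul_eq_nsmul 𝕜, Nat.cast_pow]
  · rw [zero_smul, smul_zero]

theorem phiMap_comp {k l m : ℕ} (f : ParHom 𝕜 k l) (g : ParHom 𝕜 l m) :
    phiMap 𝕜 n k m (parComp (n : 𝕜) f g) = phiMap 𝕜 n k l f ≫ phiMap 𝕜 n l m g := by
  induction f using Finsupp.induction_linear with
  | zero => rw [parComp_zero_left, map_zero, map_zero, Limits.zero_comp]
  | add f f' hf hf' => rw [parComp_add_left, map_add, map_add, hf, hf', Preadditive.add_comp]
  | single D a =>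
    induction g using Finsupp.induction_linear with
    | zero => rw [parComp_zero_right, map_zero, map_zero, Limits.comp_zero]
    | add g g' hg hg' => rw [parComp_add_right, map_add, map_add, hg, hg', Preadditive.comp_add]
    | single E b =>
      refine tensorPowerRep_hom_ext fun i => ?_
      rw [parComp_single, phiMap_single, Rep.hom_comp]
      have h1 : (phiMap 𝕜 n l m (Finsupp.single E b)).hom
          ((phiMap 𝕜 n k l (Finsupp.single D a)).hom (basisTensor 𝕜 n i)) =
            a • b • (phiMap 𝕜 n l m (Finsupp.single E 1)).hom (colourSum 𝕜 D i) := by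
        have hb : (Finsupp.single E b : ParHom 𝕜 l m) = b • Finsupp.single E 1 := by
          rw [Finsupp.smul_single, smul_eq_mul, mul_one]
        rw [phiMap_single, hb, map_smul, map_smul]
        rfl
      refine Eq.trans ?_ h1.symm
      rw [phiMap_colourSum, smul_smul, smul_smul, mul_assoc]

theorem basisTensor_append {k l : ℕ} (i : Fin k → Fin n) (j : Fin l → Fin n) :
    TensorPower.mulEquiv (basisTensor 𝕜 n i ⊗ₜ[𝕜] basisTensor 𝕜 n j) =
      basisTensor 𝕜 n (Fin.append i j) := by
  refine (TensorPower.tprod_mul_tprod 𝕜 (M := permRep 𝕜 n) _ _).trans ?_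
  refine congrArg (PiTensorProduct.tprod 𝕜) (funext fun x => ?_)
  refine Fin.addCases (fun x => ?_) (fun x => ?_) x
  · rw [Fin.append_left, Fin.append_left]
  · rw [Fin.append_right, Fin.append_right]

theorem colourSum_juxtapose {k l k' l' : ℕ} (D : Diagram k l) (E : Diagram k' l')
    (i : Fin k → Fin n) (i' : Fin k' → Fin n) :
    colourSum 𝕜 (juxtapose D E) (Fin.append i i') =
      TensorPower.mulEquiv (colourSum 𝕜 D i ⊗ₜ[𝕜] colourSum 𝕜 E i') := by
  classical
  rw [colourSum, ← (Fin.appendEquiv l l').sum_comp, Fintype.sum_prod_type, colourSum, colourSum,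
    TensorProduct.sum_tmul, map_sum]
  refine Finset.sum_congr rfl fun j _ => ?_
  rw [TensorProduct.tmul_sum, map_sum]
  refine Finset.sum_congr rfl fun j' _ => ?_
  have h : Colours (juxtapose D E) (Fin.append i i') (Fin.append j j') ↔
      Colours D i j ∧ Colours E i' j' := by
    refine (juxtapose_le_ker_iff D E _ _).trans ?_
    rw [leftPart_append, leftPart_append, rightPart_append, rightPart_append]
    rfl
  refine (if_congr h rfl rfl).trans ?_
  by_cases h1 : Colours D i j
  · by_cases h2 : Colours E i' j'
    · rw [if_pos h1, if_pos h2, if_pos ⟨h1, h2⟩]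
      exact (basisTensor_append j j').symm
    · rw [if_neg h2, if_neg fun h => h2 h.2, TensorProduct.tmul_zero, map_zero]
  · rw [if_neg h1, if_neg fun h => h1 h.1, TensorProduct.zero_tmul, map_zero]

theorem phiMap_tensor_basisTensor {k l k' l' : ℕ} (f : ParHom 𝕜 k l) (g : ParHom 𝕜 k' l')
    (i : Fin k → Fin n) (i' : Fin k' → Fin n) :
    (phiMap 𝕜 n _ _ (parTensor f g)).hom (basisTensor 𝕜 n (Fin.append i i')) =
      TensorPower.mulEquiv ((phiMap 𝕜 n k l f).hom (basisTensor 𝕜 n i) ⊗ₜ[𝕜]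
        (phiMap 𝕜 n k' l' g).hom (basisTensor 𝕜 n i')) := by
  induction f using Finsupp.induction_linear with
  | zero =>
    rw [parTensor_zero_left, map_zero, map_zero]
    exact (map_zero _).symm.trans (congrArg _ (TensorProduct.zero_tmul _ _).symm)
  | add f f' hf hf' =>
    rw [parTensor_add_left, map_add, map_add]
    refine (congrArg₂ (· + ·) hf hf').trans ((map_add _ _ _).symm.trans ?_)
    exact congrArg _ (TensorProduct.add_tmul _ _ _).symm
  | single D a =>
    induction g using Finsupp.induction_linear with
    | zero =>
      rw [parTensor_zero_right, map_zero, map_zero]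
      exact (map_zero _).symm.trans (congrArg _ (TensorProduct.tmul_zero _ _).symm)
    | add g g' hg hg' =>
      rw [parTensor_add_right, map_add, map_add]
      refine (congrArg₂ (· + ·) hg hg').trans ((map_add _ _ _).symm.trans ?_)
      exact congrArg _ (TensorProduct.tmul_add _ _ _).symm
    | single E b =>
      rw [parTensor_single, phiMap_single, phiMap_single, phiMap_single, colourSum_juxtapose,
        TensorProduct.smul_tmul_smul, map_smul]

theorem phiMap_tensor {k l k' l' : ℕ} (f : ParHom 𝕜 k l) (g : ParHom 𝕜 k' l')
    (x : tensorPowerRep 𝕜 n k) (y : tensorPowerRep 𝕜 n k') :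
    (phiMap 𝕜 n _ _ (parTensor f g)).hom (TensorPower.mulEquiv (x ⊗ₜ[𝕜] y)) =
      TensorPower.mulEquiv ((phiMap 𝕜 n k l f).hom x ⊗ₜ[𝕜] (phiMap 𝕜 n k' l' g).hom y) := by
  have h : (phiMap 𝕜 n _ _ (parTensor f g)).hom.toLinearMap ∘ₗ
      TensorPower.mulEquiv.toLinearMap = TensorPower.mulEquiv.toLinearMap ∘ₗ
        TensorProduct.map (phiMap 𝕜 n k l f).hom.toLinearMap
          (phiMap 𝕜 n k' l' g).hom.toLinearMap := by
    refine ((tensorBasis 𝕜 n k).tensorProduct (tensorBasis 𝕜 n k')).ext fun ⟨i, i'⟩ => ?_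
    rw [Module.Basis.tensorProduct_apply, tensorBasis_apply, tensorBasis_apply]
    refine (congrArg _ (basisTensor_append i i')).trans ?_
    exact phiMap_tensor_basisTensor f g i i'
  exact LinearMap.congr_fun h (x ⊗ₜ[𝕜] y)

theorem phiMap_mulFun {k : ℕ} (i j : Fin n) (a : Fin k → Fin n) :
    (phiMap 𝕜 n (k + 2) (k + 1) (Finsupp.single (graph (mulFun k)) 1)).hom
      (basisTensor 𝕜 n (Fin.cons i (Fin.cons j a) : Fin (k + 2) → Fin n)) =
        if i = j then basisTensor 𝕜 n (Fin.cons i a : Fin (k + 1) → Fin n) else 0 := by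
  rw [phiMap_graph, colourSum_mulFun]

theorem phiMap_unitFun {k : ℕ} (a : Fin k → Fin n) :
    (phiMap 𝕜 n k (k + 1) (Finsupp.single (graph Fin.succ) 1)).hom (basisTensor 𝕜 n a) =
      ∑ i : Fin n, basisTensor 𝕜 n (Fin.cons i a : Fin (k + 1) → Fin n) := by
  rw [phiMap_graph, colourSum_unitFun]

theorem phiMap_comulFun {k : ℕ} (i : Fin n) (a : Fin k → Fin n) :
    (phiMap 𝕜 n (k + 1) (k + 2) (Finsupp.single (cograph (mulFun k)) 1)).hom
      (basisTensor 𝕜 n (Fin.cons i a : Fin (k + 1) → Fin n)) =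
        basisTensor 𝕜 n (Fin.cons i (Fin.cons i a) : Fin (k + 2) → Fin n) := by
  rw [phiMap_cograph]
  exact congrArg (basisTensor 𝕜 n) (funext fun x => Fin.cases rfl (fun x => rfl) x)

theorem phiMap_counitFun {k : ℕ} (i : Fin n) (a : Fin k → Fin n) :
    (phiMap 𝕜 n (k + 1) k (Finsupp.single (cograph Fin.succ) 1)).hom
      (basisTensor 𝕜 n (Fin.cons i a : Fin (k + 1) → Fin n)) = basisTensor 𝕜 n a :=
  phiMap_cograph _ _

theorem phiMap_swapFun {k : ℕ} (i j : Fin n) (a : Fin k → Fin n) :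
    (phiMap 𝕜 n (k + 2) (k + 2) (Finsupp.single (graph (swapFun k)) 1)).hom
      (basisTensor 𝕜 n (Fin.cons i (Fin.cons j a) : Fin (k + 2) → Fin n)) =
        basisTensor 𝕜 n (Fin.cons j (Fin.cons i a) : Fin (k + 2) → Fin n) := by
  rw [graph_swapFun, phiMap_cograph]
  exact congrArg (basisTensor 𝕜 n)
    (funext fun x => Fin.cases rfl (fun x => Fin.cases rfl (fun x => rfl) x) x)

theorem phiMap_parL {k l : ℕ} (f : ParHom 𝕜 k l) (i : Fin n) (a : Fin k → Fin n) :
    (phiMap 𝕜 n (k + 1) (l + 1) (parL f)).hom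
      (basisTensor 𝕜 n (Fin.cons i a : Fin (k + 1) → Fin n)) =
        (tensorBasis 𝕜 n l).constr 𝕜
          (fun b => basisTensor 𝕜 n (Fin.cons i b : Fin (l + 1) → Fin n))
            ((phiMap 𝕜 n k l f).hom (basisTensor 𝕜 n a)) := by
  induction f using Finsupp.induction_linear with
  | zero =>
    rw [map_zero, map_zero, map_zero]
    exact (map_zero _).symm
  | add f f' hf hf' =>
    rw [map_add, map_add, map_add]
    exact (congrArg₂ (· + ·) hf hf').trans (map_add _ _ _).symm
  | single D r =>
    rw [parL_single, phiMap_single, phiMap_single, colourSum_consDiagram, map_smul]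

variable (𝕜 n)

/-- The functor `Φ`. -/
noncomputable def phi : Phi 𝕜 n where
  map := phiMap 𝕜 n
  map_id := phiMap_id
  map_comp := phiMap_comp
  map_tensor := phiMap_tensor
  map_mul i j := by rw [parMul_eq]; exact phiMap_mulFun i j _
  map_unit := by rw [parUnit_eq]; exact phiMap_unitFun _
  map_comul i := by rw [parComul_eq]; exact phiMap_comulFun i _
  map_counit i := by rw [parCounit_eq]; exact phiMap_counitFun i _
  map_swap i j := by rw [parSwap_eq]; exact phiMap_swapFun i j _

variable {𝕜 n}

theorem phi_unique (Φ Φ' : Phi 𝕜 n) : Φ = Φ' := by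
  have h2 : ∀ a : Fin 2 → Fin n, a = ![a 0, a 1] := fun a => by
    funext x; fin_cases x <;> rfl
  have h1 : ∀ a : Fin 1 → Fin n, a = ![a 0] := fun a => by
    funext x; fin_cases x; rfl
  have h0 : ∀ a : Fin 0 → Fin n, a = ![] := fun a => Subsingleton.elim _ _
  refine Phi.ext (funext fun k => funext fun l => LinearMap.ext fun f => ?_)
  refine par_tensor_induction (n : 𝕜) (P := fun k l f => Φ.map k l f = Φ'.map k l f)
    (fun k l => ?_)
    (fun f g hf hg => ?_) (fun r f hf => ?_) (fun k => ?_) (fun f g hf hg => ?_)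
    (fun {k l k' l'} f g hf hg => ?_) ?_ ?_ ?_ ?_ ?_ f
  · rw [map_zero, map_zero]
  · rw [map_add, map_add, hf, hg]
  · rw [map_smul, map_smul, hf]
  · rw [Φ.map_id, Φ'.map_id]
  · rw [Φ.map_comp, Φ'.map_comp, hf, hg]
  · refine tensorPowerRep_hom_ext fun i => ?_
    obtain ⟨⟨a, b⟩, rfl⟩ := (Fin.appendEquiv k k').surjective i
    have hab : basisTensor 𝕜 n (Fin.appendEquiv k k' (a, b)) =
      TensorPower.mulEquiv (basisTensor 𝕜 n a ⊗ₜ[𝕜] basisTensor 𝕜 n b) :=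
      (basisTensor_append a b).symm
    rw [hab, Φ.map_tensor, Φ'.map_tensor, hf, hg]
  · refine tensorPowerRep_hom_ext fun i => ?_
    rw [h2 i, Φ.map_mul, Φ'.map_mul]
  · refine tensorPowerRep_hom_ext fun i => ?_
    rw [h1 i, Φ.map_comul, Φ'.map_comul]
  · refine tensorPowerRep_hom_ext fun i => ?_
    rw [h0 i, Φ.map_unit, Φ'.map_unit]
  · refine tensorPowerRep_hom_ext fun i => ?_
    rw [h1 i, Φ.map_counit, Φ'.map_counit]
  · refine tensorPowerRep_hom_ext fun i => ?_
    rw [h2 i, Φ.map_swap, Φ'.map_swap]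

end PhiExistence

end PartHeis

namespace PartHeis

/-! ### Induction and restriction along `S_n ⊂ S_{n+1}` -/

section Cosets

theorem permEmb_apply_castSucc {n : ℕ} (p : Equiv.Perm (Fin n)) (i : Fin n) :
    permEmb n p i.castSucc = (p i).castSucc :=
  Equiv.Perm.viaEmbedding_apply p Fin.castSuccEmb i

theorem permEmb_apply_last {n : ℕ} (p : Equiv.Perm (Fin n)) :
    permEmb n p (Fin.last n) = Fin.last n :=
  Equiv.Perm.viaEmbedding_apply_of_notMem p Fin.castSuccEmb _ (by
    rintro ⟨i, hi⟩
    exact (Fin.castSucc_lt_last i).ne hi)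

theorem permEmb_injective (n : ℕ) : Function.Injective (permEmb n) :=
  Equiv.Perm.viaEmbeddingHom_injective _

theorem mem_range_permEmb {n : ℕ} (g : Equiv.Perm (Fin (n + 1))) :
    g ∈ (permEmb n).range ↔ g (Fin.last n) = Fin.last n := by
  constructor
  · rintro ⟨p, rfl⟩
    exact permEmb_apply_last p
  · intro h
    have h' : ∀ {g : Equiv.Perm (Fin (n + 1))}, g (Fin.last n) = Fin.last n → ∀ i : Fin n,
        g i.castSucc ≠ Fin.last n := by
      intro g h i hi
      exact (Fin.castSucc_lt_last i).ne (g.injective (hi.trans h.symm))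
    have hs : g.symm (Fin.last n) = Fin.last n := (Equiv.symm_apply_eq g).2 h.symm
    refine ⟨⟨fun i => (g i.castSucc).castPred (h' h i), fun i =>
      (g.symm i.castSucc).castPred (h' hs i), fun i => ?_, fun i => ?_⟩, ?_⟩
    · apply Fin.castSucc_injective
      simp
    · apply Fin.castSucc_injective
      simp
    · ext i
      refine congrArg Fin.val ?_
      refine Fin.lastCases ?_ (fun i => ?_) i
      · rw [permEmb_apply_last, h]
      · rw [permEmb_apply_castSucc]
        simp

theorem cosetRep_last (m : ℕ) : cosetRep (Fin.last m) = 1 := by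
  have h : ((List.finRange m).filter fun j => Fin.last m ≤ j.castSucc) = [] := by
    rw [List.filter_eq_nil_iff]
    intro j _ h
    simp only [decide_eq_true_eq] at h
    exact absurd h (not_le.2 (Fin.castSucc_lt_last j))
  rw [cosetRep, h]
  rfl

theorem swap_prod_apply_castSucc {m : ℕ} (l : List (Fin m)) (x : Fin (m + 1)) :
    (l.map fun j => Equiv.swap j.castSucc.castSucc j.castSucc.succ).prod x.castSucc =
      ((l.map fun j => Equiv.swap j.castSucc j.succ).prod x).castSucc := by
  induction l with
  | nil => rfl
  | cons a l ih =>
    rw [List.map_cons, List.prod_cons, List.map_cons, List.prod_cons, Equiv.Perm.mul_apply, ih,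
      Equiv.Perm.mul_apply]
    exact (Fin.castSucc_injective (m + 1)).swap_apply a.castSucc a.succ _

/-- The last transposition in the product acts first and lowers the last point by one; the others
form the representative of one rank less. Hence g_i represents the coset of permutations that send
the last point to i. -/
theorem cosetRep_apply_last {m : ℕ} (i : Fin (m + 1)) : cosetRep i (Fin.last m) = i := by
  induction m with
  | zero => exact Subsingleton.elim (α := Fin 1) _ _
  | succ m ih =>
    refine Fin.lastCases ?_ (fun i => ?_) i
    · rw [cosetRep_last]
      rfl
    · rw [cosetRep, List.finRange_succ_last, List.filter_append, List.filter_map,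
        List.filter_singleton, decide_eq_true (Fin.castSucc_le_castSucc_iff.2 (Fin.le_last i)),
        List.map_append, List.map_map, List.prod_append, Equiv.Perm.mul_apply]
      refine Eq.trans (congrArg _ (?_ : _ = (Fin.last m).castSucc)) ?_
      · rw [cond_true, List.map_singleton, List.prod_singleton]
        exact Equiv.swap_apply_right _ _
      · exact (swap_prod_apply_castSucc _ _).trans (congrArg Fin.castSucc (ih i))

theorem cosetRep_inv_apply {m : ℕ} (i : Fin (m + 1)) : (cosetRep i)⁻¹ i = Fin.last m := by
  rw [Equiv.Perm.inv_eq_iff_eq, cosetRep_apply_last]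

theorem exists_mul_cosetRep {m : ℕ} (g : Equiv.Perm (Fin (m + 1))) :
    ∃ p, g = cosetRep (g (Fin.last m)) * permEmb m p := by
  have h : (cosetRep (g (Fin.last m)))⁻¹ * g ∈ (permEmb m).range := by
    rw [mem_range_permEmb, Equiv.Perm.mul_apply, cosetRep_inv_apply]
  obtain ⟨p, hp⟩ := h
  exact ⟨p, by rw [hp, mul_inv_cancel_left]⟩

/-- A function on the cosets can be summed over any system of representatives. Left translation by
`h` permutes the cosets, and the coset of g_i goes to that of index `h i`. It is used for the
equivariance of the left cup. -/
theorem sum_mul_cosetRep {m : ℕ} {M : Type*} [AddCommMonoid M] (F : Equiv.Perm (Fin (m + 1)) → M)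
    (hF : ∀ g p, F (g * permEmb m p) = F g) (h : Equiv.Perm (Fin (m + 1))) :
    ∑ i, F (h * cosetRep i) = ∑ i, F (cosetRep i) := by
  refine Eq.trans ?_ (Equiv.sum_comp h fun i => F (cosetRep i))
  refine Finset.sum_congr rfl fun i _ => ?_
  obtain ⟨p, hp⟩ := exists_mul_cosetRep (h * cosetRep i)
  rw [hp, hF, Equiv.Perm.mul_apply, cosetRep_apply_last]

theorem lastSwap_mul_lastSwap (n : ℕ) : lastSwap n * lastSwap n = 1 := Equiv.swap_mul_self _ _

theorem lastSwap_apply_last (n : ℕ) :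
    lastSwap n (Fin.last (n + 1)) = (Fin.last n).castSucc := Equiv.swap_apply_right _ _

theorem lastSwap_apply_castSucc_last (n : ℕ) :
    lastSwap n (Fin.last n).castSucc = Fin.last (n + 1) := Equiv.swap_apply_left _ _

theorem lastSwap_apply_castSucc_castSucc {n : ℕ} (i : Fin n) :
    lastSwap n i.castSucc.castSucc = i.castSucc.castSucc :=
  Equiv.swap_apply_of_ne_of_ne
    (fun h => (Fin.castSucc_lt_last i).ne (Fin.castSucc_injective _ h))
    (Fin.castSucc_lt_last i.castSucc).ne

/-- The two permutations move disjoint sets of points. This makes the upward crossing well defined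
on the tensor product over the smaller group. -/
theorem lastSwap_mul_permEmb_permEmb {n : ℕ} (p : Equiv.Perm (Fin n)) :
    lastSwap n * permEmb (n + 1) (permEmb n p) = permEmb (n + 1) (permEmb n p) * lastSwap n := by
  refine Equiv.ext fun i => ?_
  rw [Equiv.Perm.mul_apply, Equiv.Perm.mul_apply]
  refine Fin.lastCases ?_ (fun i => Fin.lastCases ?_ (fun i => ?_) i) i
  · rw [permEmb_apply_last, lastSwap_apply_last, permEmb_apply_castSucc, permEmb_apply_last]
  · rw [permEmb_apply_castSucc, permEmb_apply_last, lastSwap_apply_castSucc_last,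
      permEmb_apply_last]
  · rw [permEmb_apply_castSucc, permEmb_apply_castSucc, lastSwap_apply_castSucc_castSucc,
      lastSwap_apply_castSucc_castSucc, permEmb_apply_castSucc, permEmb_apply_castSucc]

theorem lastSwap_braid (n : ℕ) :
    lastSwap (n + 1) * permEmb (n + 2) (lastSwap n) * lastSwap (n + 1) =
      permEmb (n + 2) (lastSwap n) * lastSwap (n + 1) * permEmb (n + 2) (lastSwap n) := by
  refine Equiv.ext fun i => ?_
  simp only [Equiv.Perm.mul_apply]
  refine Fin.lastCases ?_ (fun i => Fin.lastCases ?_ (fun i => Fin.lastCases ?_ (fun i => ?_) i) i) i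
  · simp only [lastSwap_apply_last, permEmb_apply_castSucc, permEmb_apply_last,
      lastSwap_apply_castSucc_castSucc]
  · simp only [permEmb_apply_castSucc, permEmb_apply_last, lastSwap_apply_last,
      lastSwap_apply_castSucc_last, lastSwap_apply_castSucc_castSucc]
  · simp only [permEmb_apply_castSucc, permEmb_apply_last, lastSwap_apply_castSucc_last,
      lastSwap_apply_castSucc_castSucc]
  · simp only [permEmb_apply_castSucc, lastSwap_apply_castSucc_castSucc]

end Cosets

section IndRes

variable {𝕜 : Type u} [CommRing 𝕜] {n : ℕ}

/-- Induction from `S_n` to `S_{n+1}`. -/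
noncomputable abbrev Ind (A : Rep.{u} 𝕜 (Equiv.Perm (Fin n))) :
    Rep.{u} 𝕜 (Equiv.Perm (Fin (n + 1))) := Rep.ind (permEmb n) A

/-- Restriction from `S_{n+1}` to `S_n`. -/
noncomputable abbrev Res (B : Rep.{u} 𝕜 (Equiv.Perm (Fin (n + 1)))) : Rep.{u} 𝕜 (Equiv.Perm (Fin n)) :=
  Rep.res (permEmb n) B

section Tmul

variable {A A' : Rep.{u} 𝕜 (Equiv.Perm (Fin n))}

/-- The tensor product is balanced. Coinvariants identify a vector with its translate under the
smaller group, and the inverse in `indTmul` converts the left translation into a right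
multiplication. -/
theorem indTmul_mul (g : Equiv.Perm (Fin (n + 1))) (p : Equiv.Perm (Fin n)) (x : A) :
    indTmul (g * permEmb n p) x = indTmul g (A.ρ p x) := by
  have h := Representation.Coinvariants.mk_self_apply
    (Representation.tprod ((Representation.leftRegular 𝕜 (Equiv.Perm (Fin (n + 1)))).comp
      (permEmb n)) A.ρ) p
    (TensorProduct.tmul 𝕜 (MonoidAlgebra.single (g * permEmb n p)⁻¹ (1 : 𝕜)) x)
  refine h.symm.trans ?_
  rw [Representation.tprod_apply, TensorProduct.map_tmul, MonoidHom.comp_apply,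
    Representation.ofMulAction_single, smul_eq_mul, mul_inv_rev, mul_inv_cancel_left]
  rfl

theorem indTmul_permEmb (p : Equiv.Perm (Fin n)) (x : A) :
    indTmul (permEmb n p) x = indTmul 1 (A.ρ p x) := by
  rw [← indTmul_mul, one_mul]

theorem ind_rho (h g : Equiv.Perm (Fin (n + 1))) (x : A) :
    (Ind A).ρ h (indTmul g x) = indTmul (h * g) x := by
  refine (Representation.ind_mk (permEmb n) A.ρ h g⁻¹ x).trans ?_
  rw [indTmul, mul_inv_rev]

theorem indTmul_eq_rho (g : Equiv.Perm (Fin (n + 1))) (x : A) :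
    indTmul g x = (Ind A).ρ g (indTmul 1 x) := by
  rw [ind_rho, mul_one]

theorem indTmul_zero (g : Equiv.Perm (Fin (n + 1))) : indTmul g (0 : A) = 0 := map_zero _

theorem indTmul_sum {ι : Type*} (s : Finset ι) (g : Equiv.Perm (Fin (n + 1))) (x : ι → A) :
    indTmul g (∑ i ∈ s, x i) = ∑ i ∈ s, indTmul g (x i) := map_sum _ _ _

theorem ind_linear_ext {M : Type*} [AddCommGroup M] [Module 𝕜 M] {f f' : Ind A →ₗ[𝕜] M}
    (h : ∀ g x, f (indTmul g x) = f' (indTmul g x)) : f = f' := by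
  refine Representation.IndV.hom_ext (permEmb n) A.ρ fun g => LinearMap.ext fun x => ?_
  have := h g⁻¹ x
  rwa [indTmul, inv_inv] at this

/-- One half of Frobenius reciprocity, with `indDesc` as the other: an induced module is generated
by the vectors 1 ⊗ x. -/
theorem ind_hom_ext {B : Rep.{u} 𝕜 (Equiv.Perm (Fin (n + 1)))} {f f' : Ind A ⟶ B}
    (h : ∀ x, f.hom (indTmul 1 x) = f'.hom (indTmul 1 x)) : f = f' := by
  refine Rep.hom_ext (Representation.IntertwiningMap.ext (ind_linear_ext fun g x => ?_))
  rw [indTmul_eq_rho]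
  refine (Rep.hom_comm_apply f g _).trans (Eq.trans ?_ (Rep.hom_comm_apply f' g _).symm)
  rw [h]

/-- A linear map out of an induced module. -/
noncomputable def indLift {M : Type u} [AddCommGroup M] [Module 𝕜 M]
    (F : Equiv.Perm (Fin (n + 1)) → A →ₗ[𝕜] M)
    (hF : ∀ g p, F (g * permEmb n p) = F g ∘ₗ A.ρ p) : Ind A →ₗ[𝕜] M :=
  Representation.Coinvariants.lift _
    (TensorProduct.lift <| (Finsupp.lift _ _ _ fun h => F h⁻¹) ∘ₗ
      (MonoidAlgebra.coeffLinearEquiv 𝕜).toLinearMap)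
    fun p => by
      ext h x
      have := LinearMap.congr_fun (hF (permEmb n p * h)⁻¹ p) x
      rw [mul_inv_rev, inv_mul_cancel_right] at this
      simp [Representation.ofMulAction_single, this]

theorem indLift_indTmul {M : Type u} [AddCommGroup M] [Module 𝕜 M]
    (F : Equiv.Perm (Fin (n + 1)) → A →ₗ[𝕜] M)
    (hF : ∀ g p, F (g * permEmb n p) = F g ∘ₗ A.ρ p) (g : Equiv.Perm (Fin (n + 1))) (x : A) :
    indLift F hF (indTmul g x) = F g x := by
  simp [indLift, indTmul]

/-- The linear map underlying `indDesc`. -/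
noncomputable def indDescLinear {B : Rep.{u} 𝕜 (Equiv.Perm (Fin (n + 1)))} (f : A ⟶ Res B) :
    Ind A →ₗ[𝕜] B :=
  indLift (M := B.V) (fun g => B.ρ g ∘ₗ f.hom.toLinearMap) (fun g p => by
    refine LinearMap.ext fun x => ?_
    rw [map_mul]
    exact congrArg (B.ρ g) (Rep.hom_comm_apply f p x).symm)

theorem indDescLinear_indTmul {B : Rep.{u} 𝕜 (Equiv.Perm (Fin (n + 1)))} (f : A ⟶ Res B)
    (g : Equiv.Perm (Fin (n + 1))) (x : A) : indDescLinear f (indTmul g x) = B.ρ g (f.hom x) := by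
  rw [indDescLinear, indLift_indTmul]
  rfl

/-- An equivariant map out of an induced module. -/
noncomputable def indDesc {B : Rep.{u} 𝕜 (Equiv.Perm (Fin (n + 1)))} (f : A ⟶ Res B) : Ind A ⟶ B :=
  Rep.ofHom ⟨indDescLinear f, fun h => by
    refine ind_linear_ext fun g x => ?_
    have h1 : indDescLinear f ((Ind A).ρ h (indTmul g x)) =
        B.ρ h (indDescLinear f (indTmul g x)) := by
      rw [ind_rho, indDescLinear_indTmul, indDescLinear_indTmul, map_mul]
      rfl
    exact h1⟩

theorem indDesc_indTmul {B : Rep.{u} 𝕜 (Equiv.Perm (Fin (n + 1)))} (f : A ⟶ Res B)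
    (g : Equiv.Perm (Fin (n + 1))) (x : A) : (indDesc f).hom (indTmul g x) = B.ρ g (f.hom x) :=
  indDescLinear_indTmul f g x

end Tmul

end IndRes

end PartHeis

namespace PartHeis

/-! ### The generating natural transformations of the action, and the Heisenberg relations between
them. -/

section Generators

variable {𝕜 : Type u} [CommRing 𝕜]

/-- The morphism of representations given by an equivariant linear map. -/
noncomputable def repHomMk {G : Type*} [Monoid G] {A B : Rep.{u} 𝕜 G} (f : A →ₗ[𝕜] B)
    (hf : ∀ g x, f (A.ρ g x) = B.ρ g (f x)) : A ⟶ B :=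
  Rep.ofHom (X := A.V) (Y := B.V) ⟨f, fun g => LinearMap.ext fun x => hf g x⟩

theorem rep_hom_ext {G : Type*} [Monoid G] {A B : Rep.{u} 𝕜 G} {f f' : A ⟶ B}
    (h : ∀ x, f.hom x = f'.hom x) : f = f' :=
  Rep.hom_ext (Representation.IntertwiningMap.ext (LinearMap.ext h))

theorem rep_comp_apply {G : Type*} [Monoid G] {A B C : Rep.{u} 𝕜 G} (f : A ⟶ B) (g : B ⟶ C)
    (x : A) : (f ≫ g).hom x = g.hom (f.hom x) := rfl

theorem rep_id_apply {G : Type*} [Monoid G] {A : Rep.{u} 𝕜 G} (x : A) :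
    (𝟙 A : A ⟶ A).hom x = x := rfl

variable {n : ℕ} {A A' : Rep.{u} 𝕜 (Equiv.Perm (Fin n))}
  {B B' : Rep.{u} 𝕜 (Equiv.Perm (Fin (n + 1)))}

/-- The functor `Ind` on morphisms. -/
noncomputable abbrev IndMap (f : A ⟶ A') : Ind A ⟶ Ind A' :=
  (Rep.indFunctor 𝕜 (permEmb n)).map f

/-- The functor `Res` on morphisms. -/
noncomputable abbrev ResMap (f : B ⟶ B') : Res B ⟶ Res B' :=
  (Rep.resFunctor (permEmb n)).map f

theorem IndMap_indTmul (f : A ⟶ A') (g : Equiv.Perm (Fin (n + 1))) (x : A) :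
    (IndMap f).hom (indTmul g x) = indTmul g (f.hom x) := rfl

theorem ResMap_apply (f : B ⟶ B') (x : B) : (ResMap f).hom x = f.hom x := rfl

theorem hom_rho {G : Type*} [Monoid G] {A B : Rep.{u} 𝕜 G} (f : A ⟶ B) (g : G) (x : A) :
    f.hom (A.ρ g x) = B.ρ g (f.hom x) := Rep.hom_comm_apply f g x

/-- The linear map `x ↦ g ⊗ x`. -/
noncomputable def indTmulLinear (A : Rep.{u} 𝕜 (Equiv.Perm (Fin n)))
    (g : Equiv.Perm (Fin (n + 1))) : A →ₗ[𝕜] Ind A :=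
  Representation.IndV.mk (permEmb n) A.ρ g⁻¹

variable (A) in
/-- The endomorphism `g ⊗ h ⊗ y ↦ g h s ⊗ 1 ⊗ y` of a twice induced module. -/
noncomputable def crossHom : Ind (Ind A) ⟶ Ind (Ind A) :=
  indDesc (indDesc (repHomMk (B := Res (Res (Ind (Ind A))))
    (indTmulLinear (Ind A) (lastSwap n) ∘ₗ indTmulLinear A 1) fun p x => by
      change indTmul (lastSwap n) (indTmul 1 (A.ρ p x)) = (Ind (Ind A)).ρ (permEmb _ (permEmb _ p))
        (indTmul (lastSwap n) (indTmul 1 x))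
      rw [← indTmul_permEmb, ind_rho, ← lastSwap_mul_permEmb_permEmb, indTmul_mul, ind_rho, mul_one]))

theorem crossHom_indTmul (g : Equiv.Perm (Fin (n + 2))) (h : Equiv.Perm (Fin (n + 1))) (x : A) :
    (crossHom A).hom (indTmul g (indTmul h x)) =
      indTmul (g * permEmb (n + 1) h * lastSwap n) (indTmul 1 x) := by
  rw [crossHom, indDesc_indTmul, indDesc_indTmul]
  change (Ind (Ind A)).ρ g ((Ind (Ind A)).ρ (permEmb (n + 1) h)
    (indTmul (lastSwap n) (indTmul 1 x))) = _
  rw [ind_rho, ind_rho, mul_assoc]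

variable (A) in
/-- The unit of the adjunction between induction and restriction. -/
noncomputable def cupRHom : A ⟶ Res (Ind A) :=
  repHomMk (B := Res (Ind A)) (indTmulLinear A 1) fun p x => by
    change indTmul 1 (A.ρ p x) = (Ind A).ρ (permEmb _ p) (indTmul 1 x)
    rw [ind_rho, mul_one, indTmul_permEmb]

theorem cupRHom_apply (x : A) : (cupRHom A).hom x = indTmul 1 x := rfl

variable (B) in
/-- The counit of the adjunction between induction and restriction. -/
noncomputable def capRHom : Ind (Res B) ⟶ B := indDesc (𝟙 (Res B))

theorem capRHom_indTmul (g : Equiv.Perm (Fin (n + 1))) (x : B) :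
    (capRHom B).hom (indTmul (M := Res B) g x) = B.ρ g x :=
  indDesc_indTmul (𝟙 (Res B)) g x

/-- The vector g ⊗ g⁻¹ x depends only on the coset of g. -/
theorem indTmul_mul_rho_inv (g : Equiv.Perm (Fin (n + 1))) (p : Equiv.Perm (Fin n)) (x : B) :
    indTmul (M := Res B) (g * permEmb n p) (B.ρ (g * permEmb n p)⁻¹ x) =
      indTmul (M := Res B) g (B.ρ g⁻¹ x) := by
  refine (indTmul_mul (A := Res B) g p _).trans (congrArg _ ?_)
  change B.ρ (permEmb n p) (B.ρ (g * permEmb n p)⁻¹ x) = _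
  rw [← Module.End.mul_apply, ← map_mul, mul_inv_rev, mul_inv_cancel_left]

variable (B) in
/-- The unit of the adjunction between restriction and induction. -/
noncomputable def cupLHom : B ⟶ Ind (Res B) :=
  repHomMk (B := Ind (Res B))
    (∑ i : Fin (n + 1), indTmulLinear (Res B) (cosetRep i) ∘ₗ B.ρ (cosetRep i)⁻¹) fun h x => by
    rw [LinearMap.sum_apply, LinearMap.sum_apply, map_sum]
    refine ((sum_mul_cosetRep (fun g => indTmul (M := Res B) g (B.ρ g⁻¹ (B.ρ h x)))
      (fun g p => indTmul_mul_rho_inv g p _) h).symm.trans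
      (Finset.sum_congr rfl fun i _ => ?_))
    refine Eq.trans ?_ (ind_rho (A := Res B) h (cosetRep i) _).symm
    rw [← Module.End.mul_apply, ← map_mul, mul_inv_rev, inv_mul_cancel_right]

theorem cupLHom_apply (x : B) : (cupLHom B).hom x =
    ∑ i : Fin (n + 1), indTmul (M := Res B) (cosetRep i) (B.ρ (cosetRep i)⁻¹ x) :=
  LinearMap.sum_apply _ _ _

open Classical in
variable (A) in
/-- The action of a permutation that fixes the last point; zero for all others. -/
noncomputable def rhoOrZero (g : Equiv.Perm (Fin (n + 1))) : A →ₗ[𝕜] A :=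
  if h : ∃ p, permEmb n p = g then A.ρ h.choose else 0

theorem rhoOrZero_permEmb (p : Equiv.Perm (Fin n)) : rhoOrZero A (permEmb n p) = A.ρ p := by
  have h : ∃ q, permEmb n q = permEmb n p := ⟨p, rfl⟩
  rw [rhoOrZero, dif_pos h, permEmb_injective n h.choose_spec]

theorem rhoOrZero_of_notMem {g : Equiv.Perm (Fin (n + 1))} (hg : g ∉ (permEmb n).range) :
    rhoOrZero A g = 0 := dif_neg hg

/-- Multiplication by an element of the subgroup does not change membership in it. With the
left-handed version below this makes the map balanced and equivariant under the smaller group. -/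
theorem rhoOrZero_mul (g : Equiv.Perm (Fin (n + 1))) (p : Equiv.Perm (Fin n)) :
    rhoOrZero A (g * permEmb n p) = rhoOrZero A g ∘ₗ A.ρ p := by
  by_cases hg : g ∈ (permEmb n).range
  · obtain ⟨q, rfl⟩ := hg
    rw [← map_mul, rhoOrZero_permEmb, rhoOrZero_permEmb, map_mul]
    rfl
  · rw [rhoOrZero_of_notMem hg, rhoOrZero_of_notMem, LinearMap.zero_comp]
    exact fun h => hg ((Subgroup.mul_mem_cancel_right _ (MonoidHom.mem_range.2 ⟨p, rfl⟩)).1 h)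

theorem rhoOrZero_mul_left (g : Equiv.Perm (Fin (n + 1))) (p : Equiv.Perm (Fin n)) :
    rhoOrZero A (permEmb n p * g) = A.ρ p ∘ₗ rhoOrZero A g := by
  by_cases hg : g ∈ (permEmb n).range
  · obtain ⟨q, rfl⟩ := hg
    rw [← map_mul, rhoOrZero_permEmb, rhoOrZero_permEmb, map_mul]
    rfl
  · rw [rhoOrZero_of_notMem hg, rhoOrZero_of_notMem, LinearMap.comp_zero]
    exact fun h => hg ((Subgroup.mul_mem_cancel_left _ (MonoidHom.mem_range.2 ⟨p, rfl⟩)).1 h)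

variable (A) in
/-- The counit of the adjunction between restriction and induction. -/
noncomputable def capLHom : Res (Ind A) ⟶ A :=
  repHomMk (A := Res (Ind A)) (indLift (M := A.V) (rhoOrZero A) rhoOrZero_mul) fun p x => by
    refine LinearMap.congr_fun (f := indLift (M := A.V) (rhoOrZero A) rhoOrZero_mul ∘ₗ
      (Ind A).ρ (permEmb n p))
      (g := A.ρ p ∘ₗ indLift (M := A.V) (rhoOrZero A) rhoOrZero_mul) (ind_linear_ext fun g x => ?_) x
    rw [LinearMap.comp_apply, LinearMap.comp_apply, ind_rho, indLift_indTmul, indLift_indTmul,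
      rhoOrZero_mul_left, LinearMap.comp_apply]

theorem capLHom_indTmul (g : Equiv.Perm (Fin (n + 1))) (x : A) :
    (capLHom A).hom (indTmul g x) = rhoOrZero A g x :=
  indLift_indTmul (M := A.V) _ rhoOrZero_mul _ _

theorem capLHom_permEmb (p : Equiv.Perm (Fin n)) (x : A) :
    (capLHom A).hom (indTmul (permEmb n p) x) = A.ρ p x := by
  rw [capLHom_indTmul, rhoOrZero_permEmb]

theorem capLHom_one (x : A) : (capLHom A).hom (indTmul 1 x) = x := by
  rw [← map_one (permEmb n), capLHom_permEmb, map_one]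
  rfl

theorem capLHom_of_notMem {g : Equiv.Perm (Fin (n + 1))} (hg : g ∉ (permEmb n).range) (x : A) :
    (capLHom A).hom (indTmul g x) = 0 := by
  rw [capLHom_indTmul, rhoOrZero_of_notMem hg]
  rfl

theorem capLHom_of_ne {g : Equiv.Perm (Fin (n + 1))} (hg : g (Fin.last n) ≠ Fin.last n) (x : A) :
    (capLHom A).hom (indTmul g x) = 0 :=
  capLHom_of_notMem (fun h => hg ((mem_range_permEmb g).1 h)) x

theorem indTmul_capLHom {g : Equiv.Perm (Fin (n + 1))} (hg : g (Fin.last n) = Fin.last n) (x : A) :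
    indTmul 1 ((capLHom A).hom (indTmul g x)) = indTmul g x := by
  obtain ⟨p, rfl⟩ := (mem_range_permEmb g).2 hg
  rw [capLHom_permEmb, indTmul_permEmb]

theorem res_ind_hom_ext {f f' : Res (Ind A) ⟶ A'}
    (h : ∀ g x, f.hom (indTmul g x) = f'.hom (indTmul g x)) : f = f' :=
  rep_hom_ext fun x => LinearMap.congr_fun (f := (show Ind A →ₗ[𝕜] A' from f.hom.toLinearMap))
    (g := (show Ind A →ₗ[𝕜] A' from f'.hom.toLinearMap)) (ind_linear_ext h) x

theorem ind_ind_hom_ext {C : Rep.{u} 𝕜 (Equiv.Perm (Fin (n + 2)))} {f f' : Ind (Ind A) ⟶ C}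
    (h : ∀ x : A, f.hom (indTmul 1 (indTmul 1 x)) = f'.hom (indTmul 1 (indTmul 1 x))) :
    f = f' := by
  refine ind_hom_ext fun x => LinearMap.congr_fun (f := f.hom.toLinearMap ∘ₗ indTmulLinear (Ind A) 1)
    (g := f'.hom.toLinearMap ∘ₗ indTmulLinear (Ind A) 1) (ind_linear_ext fun g x => ?_) x
  change f.hom (indTmul 1 (indTmul g x)) = f'.hom (indTmul 1 (indTmul g x))
  rw [indTmul_eq_rho g, ← indTmul_permEmb, indTmul_eq_rho (permEmb _ g), hom_rho, hom_rho, h]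

/-! #### Naturality -/

theorem crossHom_naturality (f : A ⟶ A') :
    crossHom A ≫ IndMap (IndMap f) = IndMap (IndMap f) ≫ crossHom A' := by
  refine ind_ind_hom_ext fun x => ?_
  rw [rep_comp_apply, rep_comp_apply, crossHom_indTmul, IndMap_indTmul, IndMap_indTmul,
    IndMap_indTmul, IndMap_indTmul, crossHom_indTmul]

theorem cupRHom_naturality (f : A ⟶ A') :
    cupRHom A ≫ ResMap (IndMap f) = f ≫ cupRHom A' := rfl

theorem capRHom_naturality (f : B ⟶ B') :
    capRHom B ≫ f = IndMap (ResMap f) ≫ capRHom B' := by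
  refine ind_hom_ext fun x => ?_
  rw [rep_comp_apply, rep_comp_apply, capRHom_indTmul, IndMap_indTmul, capRHom_indTmul, hom_rho]
  rfl

theorem cupLHom_naturality (f : B ⟶ B') :
    cupLHom B ≫ IndMap (ResMap f) = f ≫ cupLHom B' := by
  refine rep_hom_ext fun x => ?_
  rw [rep_comp_apply, rep_comp_apply, cupLHom_apply, cupLHom_apply, map_sum]
  refine Finset.sum_congr rfl fun i _ => ?_
  rw [IndMap_indTmul, ← hom_rho]
  rfl

theorem capLHom_naturality (f : A ⟶ A') :
    capLHom A ≫ f = ResMap (IndMap f) ≫ capLHom A' := by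
  refine res_ind_hom_ext fun g x => ?_
  rw [rep_comp_apply, rep_comp_apply, ResMap_apply, IndMap_indTmul]
  by_cases hg : g ∈ (permEmb n).range
  · obtain ⟨p, rfl⟩ := hg
    rw [capLHom_permEmb, capLHom_permEmb, hom_rho]
  · rw [capLHom_of_notMem hg, capLHom_of_notMem hg, map_zero]

/-! #### Relations -/

variable (A B)

theorem crossHom_crossHom : crossHom A ≫ crossHom A = 𝟙 _ := by
  refine ind_ind_hom_ext fun x => ?_
  rw [rep_comp_apply, crossHom_indTmul, crossHom_indTmul, map_one, mul_one, mul_one, one_mul,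
    lastSwap_mul_lastSwap, rep_id_apply]

/-- On a pure tensor either side moves all group elements into the first factor, and the two
resulting elements agree by the braid relation of the last two transpositions. -/
theorem crossHom_braid :
    crossHom (Ind A) ≫ IndMap (crossHom A) ≫ crossHom (Ind A) =
      IndMap (crossHom A) ≫ crossHom (Ind A) ≫ IndMap (crossHom A) := by
  have h1 : ∀ (g : Equiv.Perm (Fin (n + 3))) (h : Equiv.Perm (Fin (n + 2)))
      (p : Equiv.Perm (Fin (n + 1))) (x : A),
      (crossHom (Ind A)).hom (indTmul g (indTmul h (indTmul p x))) =
        indTmul (g * permEmb _ h * lastSwap _ * permEmb _ (permEmb _ p)) (indTmul 1 (indTmul 1 x)) := by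
    intro g h p x
    rw [crossHom_indTmul, indTmul_eq_rho p, ← indTmul_permEmb, indTmul_eq_rho (permEmb _ p),
      ← indTmul_mul]
  have h2 : ∀ (g : Equiv.Perm (Fin (n + 3))) (h : Equiv.Perm (Fin (n + 2)))
      (p : Equiv.Perm (Fin (n + 1))) (x : A),
      (IndMap (crossHom A)).hom (indTmul g (indTmul h (indTmul p x))) =
        indTmul (g * permEmb _ h * permEmb _ (permEmb _ p) * permEmb _ (lastSwap _))
          (indTmul 1 (indTmul 1 x)) := by
    intro g h p x
    rw [IndMap_indTmul, crossHom_indTmul, indTmul_eq_rho (_ * lastSwap n), ← indTmul_mul, map_mul,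
      map_mul, mul_assoc, mul_assoc, mul_assoc]
  refine ind_hom_ext fun x => LinearMap.congr_fun
    (f := (crossHom (Ind A) ≫ IndMap (crossHom A) ≫ crossHom (Ind A)).hom.toLinearMap ∘ₗ
      indTmulLinear (Ind (Ind A)) 1)
    (g := (IndMap (crossHom A) ≫ crossHom (Ind A) ≫ IndMap (crossHom A)).hom.toLinearMap ∘ₗ
      indTmulLinear (Ind (Ind A)) 1) (ind_linear_ext fun h x => LinearMap.congr_fun
    (f := (crossHom (Ind A) ≫ IndMap (crossHom A) ≫ crossHom (Ind A)).hom.toLinearMap ∘ₗ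
      indTmulLinear (Ind (Ind A)) 1 ∘ₗ indTmulLinear (Ind A) h)
    (g := (IndMap (crossHom A) ≫ crossHom (Ind A) ≫ IndMap (crossHom A)).hom.toLinearMap ∘ₗ
      indTmulLinear (Ind (Ind A)) 1 ∘ₗ indTmulLinear (Ind A) h)
      (ind_linear_ext fun p x => ?_) x) x
  change (crossHom (Ind A)).hom ((IndMap (crossHom A)).hom ((crossHom (Ind A)).hom
      (indTmul 1 (indTmul h (indTmul p x))))) =
    (IndMap (crossHom A)).hom ((crossHom (Ind A)).hom ((IndMap (crossHom A)).hom
      (indTmul 1 (indTmul h (indTmul p x)))))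
  rw [h1, h2, h1, h2, h1, h2]
  simp only [map_one, mul_one, one_mul]
  refine congrArg (fun g => indTmul g _) ?_
  rw [mul_assoc (permEmb _ h), lastSwap_mul_permEmb_permEmb, mul_assoc, mul_assoc, mul_assoc,
    mul_assoc, mul_assoc, mul_assoc, ← mul_assoc (lastSwap _), lastSwap_braid]
  simp only [mul_assoc]

theorem ind_cupRHom_capRHom : IndMap (cupRHom A) ≫ capRHom (Ind A) = 𝟙 (Ind A) := by
  refine ind_hom_ext fun x => ?_
  rw [rep_comp_apply, IndMap_indTmul, capRHom_indTmul, map_one]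
  rfl

theorem cupRHom_res_capRHom : cupRHom (Res B) ≫ ResMap (capRHom B) = 𝟙 (Res B) := by
  refine rep_hom_ext fun x => ?_
  rw [rep_comp_apply, ResMap_apply, cupRHom_apply, capRHom_indTmul, map_one]
  rfl

/-- Among the summands of the cup, indexed by cosets, the cap keeps only that of the subgroup
itself. The other left zigzag below works in the same way. -/
theorem cupLHom_ind_capLHom : cupLHom (Ind A) ≫ IndMap (capLHom A) = 𝟙 (Ind A) := by
  refine ind_hom_ext fun x => ?_
  rw [rep_comp_apply, cupLHom_apply, map_sum, rep_id_apply, Finset.sum_eq_single (Fin.last n)]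
  · rw [IndMap_indTmul, cosetRep_last, inv_one, map_one]
    exact congrArg _ (capLHom_one x)
  · intro i _ hi
    rw [IndMap_indTmul, ind_rho, mul_one, capLHom_of_ne, indTmul_zero]
    intro h
    rw [Equiv.Perm.inv_eq_iff_eq, cosetRep_apply_last] at h
    exact hi h.symm
  · intro h
    exact (h (Finset.mem_univ _)).elim

theorem res_cupLHom_capLHom : ResMap (cupLHom B) ≫ capLHom (Res B) = 𝟙 (Res B) := by
  refine rep_hom_ext fun x => ?_
  rw [rep_comp_apply, ResMap_apply, cupLHom_apply, map_sum, rep_id_apply,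
    Finset.sum_eq_single (Fin.last n)]
  · rw [cosetRep_last, capLHom_one, inv_one, map_one]
    rfl
  · intro i _ hi
    rw [capLHom_of_ne]
    rwa [cosetRep_apply_last]
  · intro h
    exact (h (Finset.mem_univ _)).elim

theorem cupRHom_capLHom : cupRHom A ≫ capLHom A = 𝟙 A := by
  refine rep_hom_ext fun x => ?_
  rw [rep_comp_apply, cupRHom_apply, capLHom_one, rep_id_apply]

/-- In degree zero the group S_1 is trivial, so Res Ind A is A. The relation `L ⬝ R = 1 - c d'`
needs this case on its own, because there the left crossing is zero. -/
theorem capLHom_cupRHom_zero (A : Rep.{u} 𝕜 (Equiv.Perm (Fin 0))) :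
    capLHom A ≫ cupRHom A = 𝟙 (Res (Ind A)) := by
  refine res_ind_hom_ext fun g x => ?_
  rw [rep_comp_apply, cupRHom_apply, indTmul_capLHom (Subsingleton.elim (α := Fin 1) _ _)]
  rfl

/-- The crossing inserts a transposition that moves the last point, and the cap annihilates such
elements. -/
theorem left_curl_hom :
    cupRHom (Ind A) ≫ ResMap (crossHom A) ≫ capLHom (Ind A) = 0 := by
  refine ind_hom_ext fun x => ?_
  rw [rep_comp_apply, rep_comp_apply, cupRHom_apply, ResMap_apply, crossHom_indTmul, capLHom_of_ne]
  · rfl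
  · rw [map_one, one_mul, one_mul, lastSwap_apply_last]
    exact (Fin.castSucc_lt_last _).ne

/-- The right crossing. -/
noncomputable def rightCrossHom : Ind (Res B) ⟶ Res (Ind B) :=
  cupRHom (Ind (Res B)) ≫ ResMap (crossHom (Res B)) ≫ ResMap (IndMap (capRHom B))

/-- The left crossing. -/
noncomputable def leftCrossHom : Res (Ind B) ⟶ Ind (Res B) :=
  ResMap (IndMap (cupLHom B)) ≫ ResMap (crossHom (Res B)) ≫ capLHom (Ind (Res B))

variable {B}

theorem rightCrossHom_indTmul (g : Equiv.Perm (Fin (n + 1))) (x : B) :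
    (rightCrossHom B).hom (indTmul (M := Res B) g x) =
      indTmul (permEmb (n + 1) g * lastSwap n) x := by
  rw [rightCrossHom, rep_comp_apply, rep_comp_apply, cupRHom_apply, ResMap_apply, ResMap_apply,
    crossHom_indTmul, IndMap_indTmul, capRHom_indTmul, one_mul, map_one]
  rfl

theorem leftCrossHom_indTmul (g : Equiv.Perm (Fin (n + 2))) (x : B) :
    (leftCrossHom B).hom (indTmul g x) = ∑ i : Fin (n + 1),
      (capLHom (Ind (Res B))).hom (indTmul (g * permEmb (n + 1) (cosetRep i) * lastSwap n)
        (indTmul (M := Res B) 1 (B.ρ (cosetRep i)⁻¹ x))) := by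
  rw [leftCrossHom, rep_comp_apply, rep_comp_apply, ResMap_apply, ResMap_apply, IndMap_indTmul,
    cupLHom_apply, indTmul_sum, map_sum, map_sum]
  refine Finset.sum_congr rfl fun i _ => ?_
  rw [crossHom_indTmul]

/-- Decides which summand of `leftCrossHom_indTmul` survives: the cap keeps the one whose index, as
a point, is sent to the last point by `g`. -/
theorem cross_apply_last (g : Equiv.Perm (Fin (n + 2))) (i : Fin (n + 1)) :
    (g * permEmb (n + 1) (cosetRep i) * lastSwap n) (Fin.last (n + 1)) = g i.castSucc := by
  rw [Equiv.Perm.mul_apply, Equiv.Perm.mul_apply, lastSwap_apply_last, permEmb_apply_castSucc,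
    cosetRep_apply_last]

variable (B)

theorem rightCrossHom_leftCrossHom : rightCrossHom B ≫ leftCrossHom B = 𝟙 _ := by
  refine ind_hom_ext fun x => ?_
  rw [rep_comp_apply, rightCrossHom_indTmul, leftCrossHom_indTmul, map_one, one_mul,
    Finset.sum_eq_single (Fin.last n)]
  · rw [cosetRep_last, inv_one, map_one, mul_one, lastSwap_mul_lastSwap, capLHom_one, map_one]
    rfl
  · intro i _ hi
    rw [capLHom_of_ne]
    rw [cross_apply_last]
    intro h
    rw [← lastSwap_apply_castSucc_last] at h
    exact hi (Fin.castSucc_injective _ ((lastSwap n).injective h))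
  · intro h
    exact (h (Finset.mem_univ _)).elim

theorem rightCrossHom_capLHom {g : Equiv.Perm (Fin (n + 2))}
    (hg : g (Fin.last (n + 1)) = Fin.last (n + 1)) (x : B) :
    (rightCrossHom B).hom ((capLHom (Ind (Res B))).hom (indTmul g (indTmul (M := Res B) 1 x))) =
      indTmul (g * lastSwap n) x := by
  obtain ⟨p, rfl⟩ := (mem_range_permEmb g).2 hg
  rw [capLHom_permEmb, ind_rho, mul_one, rightCrossHom_indTmul]

/-- Mackey's formula. There are two double cosets: on the elements that fix the last point the left
crossing is zero and the cap and cup recover the vector; on the others the cap is zero and the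
crossings recover it. -/
theorem leftCrossHom_rightCrossHom :
    leftCrossHom B ≫ rightCrossHom B = 𝟙 _ - capLHom B ≫ cupRHom B := by
  refine eq_sub_of_add_eq (res_ind_hom_ext fun g x => ?_)
  change (leftCrossHom B ≫ rightCrossHom B).hom (indTmul g x) +
    indTmul 1 ((capLHom B).hom (indTmul g x)) = indTmul g x
  rw [rep_comp_apply, leftCrossHom_indTmul, map_sum]
  by_cases hg : g (Fin.last (n + 1)) = Fin.last (n + 1)
  · rw [indTmul_capLHom hg, Finset.sum_eq_zero, zero_add]
    intro i _
    rw [capLHom_of_ne, map_zero]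
    rw [cross_apply_last]
    intro h
    exact (Fin.castSucc_lt_last i).ne (g.injective (h.trans hg.symm))
  -- The single nonzero summand is indexed by the preimage of the last point, which is different
  -- from the last point in this case.
  · have hj : g.symm (Fin.last (n + 1)) ≠ Fin.last (n + 1) := fun h =>
      hg ((Equiv.symm_apply_eq g).1 h).symm
    have hj' := (Equiv.symm_apply_eq g).1 (Fin.castSucc_castPred _ hj).symm
    rw [capLHom_of_ne hg, indTmul_zero, add_zero,
      Finset.sum_eq_single ((g.symm (Fin.last (n + 1))).castPred hj)]
    · rw [rightCrossHom_capLHom _ ((cross_apply_last _ _).trans hj'.symm), mul_assoc, mul_assoc,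
        lastSwap_mul_lastSwap, mul_one, indTmul_mul]
      refine congrArg _ ?_
      rw [← Module.End.mul_apply, ← map_mul, mul_inv_cancel, map_one]
      rfl
    · intro i _ hi
      rw [capLHom_of_ne, map_zero]
      rw [cross_apply_last]
      intro h
      exact hi (Fin.castSucc_injective _ (g.injective (h.trans hj')))
    · intro h
      exact (h (Finset.mem_univ _)).elim

/-- Each of the n + 1 cosets contributes g g⁻¹ x = x. This is the value of the clockwise bubble in
degree n + 1. -/
theorem cupLHom_capRHom (x : B) :
    (capRHom B).hom ((cupLHom B).hom x) = ((n + 1 : ℕ) : 𝕜) • x := by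
  rw [cupLHom_apply, map_sum, Finset.sum_congr rfl fun i _ => ((capRHom_indTmul (cosetRep i) _).trans
    (?_ : _ = x))]
  · rw [Finset.sum_const, Finset.card_univ, Fintype.card_fin, Nat.cast_smul_eq_nsmul]
  · rw [← Module.End.mul_apply, ← map_mul, mul_inv_cancel, map_one]
    rfl

end Generators

end PartHeis

namespace PartHeis

/-! ### The action on families of modules -/

section Families

variable {𝕜 : Type u} [CommRing 𝕜]

theorem rep_hom_eq_of_subsingleton_source {G : Type*} [Monoid G] {A B : Rep.{u} 𝕜 G}
    (h : Subsingleton A) (f f' : A ⟶ B) : f = f' :=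
  rep_hom_ext fun x => by rw [Subsingleton.elim x 0, map_zero, map_zero]

theorem rep_hom_eq_of_subsingleton_target {G : Type*} [Monoid G] {A B : Rep.{u} 𝕜 G}
    (h : Subsingleton B) (f f' : A ⟶ B) : f = f' :=
  rep_hom_ext fun _ => Subsingleton.elim _ _

theorem subsingleton_ind {n : ℕ} {A : Rep.{u} 𝕜 (Equiv.Perm (Fin n))} (h : Subsingleton A) :
    Subsingleton (Ind A) := by
  have h0 : (LinearMap.id : Ind A →ₗ[𝕜] Ind A) = 0 := ind_linear_ext fun g x => by
    rw [Subsingleton.elim x 0, indTmul_zero, map_zero, map_zero]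
  exact ⟨fun x y => (LinearMap.congr_fun h0 x).trans (LinearMap.congr_fun h0 y).symm⟩

theorem subsingleton_indFam_zero (M : Family 𝕜) : Subsingleton ((indFam 𝕜).obj M 0) :=
  inferInstanceAs (Subsingleton PUnit)

theorem subsingleton_indFam_indFam_one (M : Family 𝕜) :
    Subsingleton ((indFam 𝕜).obj ((indFam 𝕜).obj M) 1) :=
  subsingleton_ind (subsingleton_indFam_zero M)

theorem fam_hom_ext {M N : Family 𝕜} {f f' : M ⟶ N} (h : ∀ n, f n = f' n) : f = f' := funext h

/-- The crossing on families of modules. -/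
noncomputable def crossFam (M : Family 𝕜) :
    (indFam 𝕜).obj ((indFam 𝕜).obj M) ⟶ (indFam 𝕜).obj ((indFam 𝕜).obj M)
  | 0 => 𝟙 _
  | 1 => 𝟙 _
  | n + 2 => crossHom (M n)

/-- The cup `1 → ↓↑` on families of modules. -/
noncomputable def cupRFam (M : Family 𝕜) : M ⟶ (resFam 𝕜).obj ((indFam 𝕜).obj M) :=
  fun n => cupRHom (M n)

/-- The cap `↑↓ → 1` on families of modules. -/
noncomputable def capRFam (M : Family 𝕜) : (indFam 𝕜).obj ((resFam 𝕜).obj M) ⟶ M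
  | 0 => 0
  | n + 1 => capRHom (M (n + 1))

/-- The cup `1 → ↑↓` on families of modules. -/
noncomputable def cupLFam (M : Family 𝕜) : M ⟶ (indFam 𝕜).obj ((resFam 𝕜).obj M)
  | 0 => 0
  | n + 1 => cupLHom (M (n + 1))

/-- The cap `↓↑ → 1` on families of modules. -/
noncomputable def capLFam (M : Family 𝕜) : (resFam 𝕜).obj ((indFam 𝕜).obj M) ⟶ M :=
  fun n => capLHom (M n)

variable {M N : Family 𝕜} (f : M ⟶ N)

theorem crossFam_naturality : crossFam M ≫ (indFam 𝕜).map ((indFam 𝕜).map f) =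
    (indFam 𝕜).map ((indFam 𝕜).map f) ≫ crossFam N :=
  fam_hom_ext fun n => match n with
    | 0 => rep_hom_eq_of_subsingleton_source (subsingleton_indFam_zero _) _ _
    | 1 => rep_hom_eq_of_subsingleton_source (subsingleton_indFam_indFam_one _) _ _
    | n + 2 => crossHom_naturality (f n)

theorem cupRFam_naturality :
    cupRFam M ≫ (resFam 𝕜).map ((indFam 𝕜).map f) = f ≫ cupRFam N :=
  fam_hom_ext fun n => cupRHom_naturality (f n)

theorem capRFam_naturality :
    capRFam M ≫ f = (indFam 𝕜).map ((resFam 𝕜).map f) ≫ capRFam N :=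
  fam_hom_ext fun n => match n with
    | 0 => rep_hom_eq_of_subsingleton_source (subsingleton_indFam_zero _) _ _
    | n + 1 => capRHom_naturality (f (n + 1))

theorem cupLFam_naturality :
    cupLFam M ≫ (indFam 𝕜).map ((resFam 𝕜).map f) = f ≫ cupLFam N :=
  fam_hom_ext fun n => match n with
    | 0 => rep_hom_eq_of_subsingleton_target (subsingleton_indFam_zero _) _ _
    | n + 1 => cupLHom_naturality (f (n + 1))

theorem capLFam_naturality :
    capLFam M ≫ f = (resFam 𝕜).map ((indFam 𝕜).map f) ≫ capLFam N :=
  fam_hom_ext fun n => capLHom_naturality (f n)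

theorem letter_map_add (c : Arrow) (f f' : M ⟶ N) :
    (letter 𝕜 c).map (f + f') = (letter 𝕜 c).map f + (letter 𝕜 c).map f' := by
  cases c with
  | up => exact fam_hom_ext fun n => match n with
    | 0 => rep_hom_eq_of_subsingleton_source (subsingleton_indFam_zero _) _ _
    | n + 1 => ind_hom_ext fun x => (indTmulLinear (N n) 1).map_add ((f n).hom x) ((f' n).hom x)
  | down => rfl

theorem letter_map_smul (c : Arrow) (r : 𝕜) (f : M ⟶ N) :
    (letter 𝕜 c).map (r • f) = r • (letter 𝕜 c).map f := by
  cases c with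
  | up => exact fam_hom_ext fun n => match n with
    | 0 => rep_hom_eq_of_subsingleton_source (subsingleton_indFam_zero _) _ _
    | n + 1 => ind_hom_ext fun x => (indTmulLinear (N n) 1).map_smul r ((f n).hom x)
  | down => rfl

variable (M)

theorem crossFam_crossFam : crossFam M ≫ crossFam M = 𝟙 _ :=
  fam_hom_ext fun n => match n with
    | 0 => rep_hom_eq_of_subsingleton_source (subsingleton_indFam_zero _) _ _
    | 1 => rep_hom_eq_of_subsingleton_source (subsingleton_indFam_indFam_one _) _ _
    | n + 2 => crossHom_crossHom (M n)

theorem crossFam_braid :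
    crossFam ((indFam 𝕜).obj M) ≫ (indFam 𝕜).map (crossFam M) ≫ crossFam ((indFam 𝕜).obj M) =
      (indFam 𝕜).map (crossFam M) ≫ crossFam ((indFam 𝕜).obj M) ≫ (indFam 𝕜).map (crossFam M) :=
  fam_hom_ext fun n => match n with
    | 0 => rep_hom_eq_of_subsingleton_source (subsingleton_indFam_zero _) _ _
    | 1 => rep_hom_eq_of_subsingleton_source (subsingleton_indFam_indFam_one _) _ _
    | 2 => rep_hom_eq_of_subsingleton_source
        (subsingleton_ind (subsingleton_indFam_indFam_one M)) _ _
    | n + 3 => crossHom_braid (M n)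

theorem indFam_cupRFam_capRFam :
    (indFam 𝕜).map (cupRFam M) ≫ capRFam ((indFam 𝕜).obj M) = 𝟙 _ :=
  fam_hom_ext fun n => match n with
    | 0 => rep_hom_eq_of_subsingleton_source (subsingleton_indFam_zero _) _ _
    | n + 1 => ind_cupRHom_capRHom (M n)

theorem cupRFam_resFam_capRFam :
    cupRFam ((resFam 𝕜).obj M) ≫ (resFam 𝕜).map (capRFam M) = 𝟙 _ :=
  fam_hom_ext fun n => cupRHom_res_capRHom (M (n + 1))

theorem cupLFam_indFam_capLFam :
    cupLFam ((indFam 𝕜).obj M) ≫ (indFam 𝕜).map (capLFam M) = 𝟙 _ :=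
  fam_hom_ext fun n => match n with
    | 0 => rep_hom_eq_of_subsingleton_source (subsingleton_indFam_zero _) _ _
    | n + 1 => cupLHom_ind_capLHom (M n)

theorem resFam_cupLFam_capLFam :
    (resFam 𝕜).map (cupLFam M) ≫ capLFam ((resFam 𝕜).obj M) = 𝟙 _ :=
  fam_hom_ext fun n => res_cupLHom_capLHom (M (n + 1))

/-- The right crossing on families of modules. -/
noncomputable def rightCrossFam :
    (indFam 𝕜).obj ((resFam 𝕜).obj M) ⟶ (resFam 𝕜).obj ((indFam 𝕜).obj M) :=
  cupRFam ((indFam 𝕜).obj ((resFam 𝕜).obj M)) ≫ (resFam 𝕜).map (crossFam ((resFam 𝕜).obj M)) ≫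
    (resFam 𝕜).map ((indFam 𝕜).map (capRFam M))

/-- The left crossing on families of modules. -/
noncomputable def leftCrossFam :
    (resFam 𝕜).obj ((indFam 𝕜).obj M) ⟶ (indFam 𝕜).obj ((resFam 𝕜).obj M) :=
  (resFam 𝕜).map ((indFam 𝕜).map (cupLFam M)) ≫ (resFam 𝕜).map (crossFam ((resFam 𝕜).obj M)) ≫
    capLFam ((indFam 𝕜).obj ((resFam 𝕜).obj M))

theorem rightCrossFam_leftCrossFam : rightCrossFam M ≫ leftCrossFam M = 𝟙 _ :=
  fam_hom_ext fun n => match n with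
    | 0 => rep_hom_eq_of_subsingleton_source (subsingleton_indFam_zero _) _ _
    | n + 1 => rightCrossHom_leftCrossHom (M (n + 1))

theorem leftCrossFam_rightCrossFam :
    leftCrossFam M ≫ rightCrossFam M = 𝟙 _ - capLFam M ≫ cupRFam M :=
  fam_hom_ext fun n => match n with
    -- The left crossing has the zero module as target in degree zero, so the claim is that cap
    -- followed by cup is the identity there.
    | 0 => by
      have h : (leftCrossFam M) 0 = 0 :=
        rep_hom_eq_of_subsingleton_target (subsingleton_indFam_zero _) _ _
      refine (congrArg (· ≫ (rightCrossFam M) 0) h).trans (Limits.zero_comp.trans ?_)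
      exact (sub_eq_zero.2 (capLHom_cupRHom_zero (M 0)).symm).symm
    | n + 1 => leftCrossHom_rightCrossHom (M (n + 1))

theorem left_curl_fam :
    cupRFam ((indFam 𝕜).obj M) ≫ (resFam 𝕜).map (crossFam M) ≫ capLFam ((indFam 𝕜).obj M) = 0 :=
  fam_hom_ext fun n => match n with
    | 0 => rep_hom_eq_of_subsingleton_source (subsingleton_indFam_zero _) _ _
    | n + 1 => left_curl_hom (M n)

theorem cupRFam_capLFam : cupRFam M ≫ capLFam M = 𝟙 _ :=
  fam_hom_ext fun n => cupRHom_capLHom (M n)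

end Families

section Theta

variable {𝕜 : Type u} [CommRing 𝕜]

/-- The natural transformation of an expression for a morphism of the Heisenberg category. -/
noncomputable def thetaTerm : {u v : Word} → HeisTerm 𝕜 u v → (act 𝕜 u ⟶ act 𝕜 v)
  | _, _, .id _ => 𝟙 _
  | _, _, .comp f g => thetaTerm f ≫ thetaTerm g
  | _, _, .cross b =>
    { app M := crossFam ((act 𝕜 b).obj M)
      naturality _ _ f := (crossFam_naturality ((act 𝕜 b).map f)).symm }
  | _, _, .cupR b =>
    { app M := cupRFam ((act 𝕜 b).obj M)
      naturality _ _ f := (cupRFam_naturality ((act 𝕜 b).map f)).symm }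
  | _, _, .capR b =>
    { app M := capRFam ((act 𝕜 b).obj M)
      naturality _ _ f := (capRFam_naturality ((act 𝕜 b).map f)).symm }
  | _, _, .cupL b =>
    { app M := cupLFam ((act 𝕜 b).obj M)
      naturality _ _ f := (cupLFam_naturality ((act 𝕜 b).map f)).symm }
  | _, _, .capL b =>
    { app M := capLFam ((act 𝕜 b).obj M)
      naturality _ _ f := (capLFam_naturality ((act 𝕜 b).map f)).symm }
  | _, _, .cons c f => Functor.whiskerRight (thetaTerm f) (letter 𝕜 c)
  | _, _, .zero _ _ => 0
  | _, _, .add f g => thetaTerm f + thetaTerm g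
  | _, _, .smul r f => r • thetaTerm f

theorem nat_hom_ext {u v : Word} {α β : act 𝕜 u ⟶ act 𝕜 v} (h : ∀ M, α.app M = β.app M) : α = β :=
  NatTrans.ext (funext h)

theorem thetaTerm_congr {u v : Word} {f g : HeisTerm 𝕜 u v} (h : HeisRel 𝕜 f g) :
    thetaTerm f = thetaTerm g := by
  induction h with
  | refl f => rfl
  | symm _ ih => exact ih.symm
  | trans _ _ ih ih' => exact ih.trans ih'
  | comp_congr _ _ ih ih' => exact congrArg₂ (· ≫ ·) ih ih'
  | cons_congr c _ ih => exact congrArg (fun α => Functor.whiskerRight α (letter 𝕜 c)) ih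
  | add_congr _ _ ih ih' => exact congrArg₂ (· + ·) ih ih'
  | smul_congr r _ ih => exact congrArg (r • ·) ih
  | id_comp f => exact Category.id_comp _
  | comp_id f => exact Category.comp_id _
  | assoc f g h => exact Category.assoc _ _ _
  | add_assoc f g h => exact add_assoc _ _ _
  | add_comm f g => exact add_comm _ _
  | zero_add f => exact zero_add _
  | add_neg f =>
    exact (congrArg (thetaTerm f + ·) (neg_one_smul 𝕜 _)).trans (add_neg_cancel (thetaTerm f))
  | smul_add r f g => exact smul_add _ _ _
  | add_smul r r' f => exact add_smul _ _ _
  | mul_smul r r' f => exact mul_smul _ _ _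
  | one_smul f => exact one_smul _ _
  | add_comp f f' g => exact Preadditive.add_comp _ _ _ _ _ _
  | comp_add f g g' => exact Preadditive.comp_add _ _ _ _ _ _
  | smul_comp r f g => exact Linear.smul_comp _ _ _ _ _ _
  | comp_smul r f g => exact Linear.comp_smul _ _ _ _ _ _
  | cons_id c w => exact Functor.whiskerRight_id' _
  | cons_comp c f g => exact Functor.whiskerRight_comp _ _ _
  | cons_add c f g => exact nat_hom_ext fun M => letter_map_add c _ _
  | cons_smul c r f => exact nat_hom_ext fun M => letter_map_smul c r _
  | cross_naturality f => exact nat_hom_ext fun M => crossFam_naturality _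
  | cupR_naturality f => exact nat_hom_ext fun M => cupRFam_naturality _
  | capR_naturality f => exact nat_hom_ext fun M => capRFam_naturality _
  | cupL_naturality f => exact nat_hom_ext fun M => cupLFam_naturality _
  | capL_naturality f => exact nat_hom_ext fun M => capLFam_naturality _
  | cross_cross b => exact nat_hom_ext fun M => crossFam_crossFam _
  | braid b => exact nat_hom_ext fun M => crossFam_braid _
  | zigzag_upR b => exact nat_hom_ext fun M => indFam_cupRFam_capRFam _
  | zigzag_downR b => exact nat_hom_ext fun M => cupRFam_resFam_capRFam _
  | zigzag_upL b => exact nat_hom_ext fun M => cupLFam_indFam_capLFam _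
  | zigzag_downL b => exact nat_hom_ext fun M => resFam_cupLFam_capLFam _
  | right_left b => exact nat_hom_ext fun M => rightCrossFam_leftCrossFam ((act 𝕜 b).obj M)
  | left_right b =>
    refine nat_hom_ext fun M => (leftCrossFam_rightCrossFam ((act 𝕜 b).obj M)).trans ?_
    rw [sub_eq_add_neg, ← neg_one_smul 𝕜]
    rfl
  | left_curl b => exact nat_hom_ext fun M => left_curl_fam ((act 𝕜 b).obj M)
  | bubble b => exact nat_hom_ext fun M => cupRFam_capLFam ((act 𝕜 b).obj M)

variable (𝕜) in
/-- Khovanov's action of the Heisenberg category. -/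
noncomputable def theta : Theta 𝕜 where
  map u v :=
    { toFun := Quotient.lift thetaTerm fun _ _ h => thetaTerm_congr h
      map_add' f g := by
        induction f using HeisHom.ind; induction g using HeisHom.ind
        rfl
      map_smul' r f := by
        induction f using HeisHom.ind
        rfl }
  map_id w := rfl
  map_comp f g := by
    induction f using HeisHom.ind; induction g using HeisHom.ind
    rfl
  map_cons c u v f := by
    induction f using HeisHom.ind
    rfl
  map_cross b M n g h x := crossHom_indTmul g h x
  map_cupR b M n x := rfl
  map_capR b M n g x := capRHom_indTmul g x
  map_cupL b M n x := cupLHom_apply x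
  map_capL_of_mem b M n g x := capLHom_permEmb g x
  map_capL_of_notMem b M n g hg x := capLHom_of_notMem hg x

/-- The data prescribe the values on the generators, and an expression is built from these by
operations that `Θ` respects. In degree zero, and for the crossing also in degree one, nothing is
prescribed, but there the source or the target is a zero module. -/
theorem Theta.map_mk (Θ : Theta 𝕜) {u v : Word} (f : HeisTerm 𝕜 u v) :
    Θ.map u v (HeisHom.mk f) = thetaTerm f := by
  induction f with
  | id w => exact Θ.map_id w
  | comp f g ihf ihg =>
    exact (Θ.map_comp (HeisHom.mk f) (HeisHom.mk g)).trans (congrArg₂ (· ≫ ·) ihf ihg)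
  | cross b =>
    refine nat_hom_ext fun M => fam_hom_ext fun n => match n with
      | 0 => rep_hom_eq_of_subsingleton_source
          (subsingleton_indFam_zero ((indFam 𝕜).obj ((act 𝕜 b).obj M))) _ _
      | 1 => rep_hom_eq_of_subsingleton_source
          (subsingleton_indFam_indFam_one ((act 𝕜 b).obj M)) _ _
      | n + 2 => ind_ind_hom_ext fun x =>
        (Θ.map_cross b M n 1 1 x).trans (crossHom_indTmul 1 1 x).symm
  | cupR b => exact nat_hom_ext fun M => fam_hom_ext fun n => rep_hom_ext (Θ.map_cupR b M n)
  | capR b =>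
    refine nat_hom_ext fun M => fam_hom_ext fun n => match n with
      | 0 => rep_hom_eq_of_subsingleton_source
          (subsingleton_indFam_zero ((resFam 𝕜).obj ((act 𝕜 b).obj M))) _ _
      | n + 1 => ind_hom_ext fun x => (Θ.map_capR b M n 1 x).trans (capRHom_indTmul 1 x).symm
  | cupL b =>
    refine nat_hom_ext fun M => fam_hom_ext fun n => match n with
      | 0 => rep_hom_eq_of_subsingleton_target
          (subsingleton_indFam_zero ((resFam 𝕜).obj ((act 𝕜 b).obj M))) _ _
      | n + 1 => rep_hom_ext fun x => (Θ.map_cupL b M n x).trans (cupLHom_apply x).symm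
  | capL b =>
    refine nat_hom_ext fun M => fam_hom_ext fun n => res_ind_hom_ext fun g x => ?_
    by_cases hg : g ∈ (permEmb n).range
    · obtain ⟨p, rfl⟩ := hg
      exact (Θ.map_capL_of_mem b M n p x).trans (capLHom_permEmb p x).symm
    · exact (Θ.map_capL_of_notMem b M n g hg x).trans (capLHom_of_notMem hg x).symm
  | cons c f ih =>
    exact (Θ.map_cons c (HeisHom.mk f)).trans
      (congrArg (fun α => Functor.whiskerRight α (letter 𝕜 c)) ih)
  | zero u v => exact (Θ.map u v).map_zero
  | add f g ihf ihg =>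
    exact ((Θ.map _ _).map_add (HeisHom.mk f) (HeisHom.mk g)).trans (congrArg₂ (· + ·) ihf ihg)
  | smul r f ih => exact ((Θ.map _ _).map_smul r (HeisHom.mk f)).trans (congrArg (r • ·) ih)

theorem theta_unique (Θ Θ' : Theta 𝕜) : Θ = Θ' := by
  refine Theta.ext (funext fun u => funext fun v => LinearMap.ext fun f => ?_)
  induction f using HeisHom.ind with
  | h f => rw [Theta.map_mk, Theta.map_mk]

end Theta

end PartHeis

namespace PartHeis

/-! ### The functor `Ω_n` -/

section Omega

variable {𝕜 : Type u} [CommRing 𝕜]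

variable (𝕜) in
/-- A concatenation of words acts by the composite of the two actions. -/
noncomputable def actAppend (c : Word) : (u : Word) → (act 𝕜 (u ++ c) ≅ act 𝕜 c ⋙ act 𝕜 u)
  | [] => Iso.refl (act 𝕜 c)
  | a :: u => Functor.isoWhiskerRight (actAppend c u) (letter 𝕜 a)

/-- Tensoring with `1_c` on the right means acting on the family to which `c` has been applied. The
isomorphism `actAppend` is needed because a word ending in `c` is bracketed differently from the
composite of the two actions. -/
theorem thetaTerm_whiskerRight (c : Word) {u v : Word} (f : HeisTerm 𝕜 u v) (M : Family 𝕜) :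
    (thetaTerm (f.whiskerRight c)).app M ≫ (actAppend 𝕜 c v).hom.app M =
      (actAppend 𝕜 c u).hom.app M ≫ (thetaTerm f).app ((act 𝕜 c).obj M) := by
  induction f with
  | id w => exact (Category.id_comp _).trans (Category.comp_id _).symm
  | comp f g ihf ihg =>
    refine (Category.assoc _ _ _).trans ((congrArg _ ihg).trans ?_)
    exact (Category.assoc _ _ _).symm.trans
      ((congrArg (· ≫ (thetaTerm g).app _) ihf).trans (Category.assoc _ _ _))
  | cross b => exact crossFam_naturality _
  | cupR b => exact cupRFam_naturality _
  | capR b => exact capRFam_naturality _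
  | cupL b => exact cupLFam_naturality _
  | capL b => exact capLFam_naturality _
  | cons a f ih =>
    exact ((letter 𝕜 a).map_comp _ _).symm.trans
      ((congrArg (letter 𝕜 a).map ih).trans ((letter 𝕜 a).map_comp _ _))
  | zero u v => exact Limits.zero_comp.trans Limits.comp_zero.symm
  | add f g ihf ihg =>
    exact (Preadditive.add_comp _ _ _ _ _ _).trans
      ((congrArg₂ (· + ·) ihf ihg).trans (Preadditive.comp_add _ _ _ _ _ _).symm)
  | smul r f ih =>
    exact (Linear.smul_comp _ _ _ _ _ _).trans
      ((congrArg (r • ·) ih).trans (Linear.comp_smul _ _ _ _ _ _).symm)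

/-- The action of a morphism of the Heisenberg category on a family of modules, in a given
degree. -/
noncomputable def evalLinear (n : ℕ) (M : Family 𝕜) (u v : Word) :
    HeisHom 𝕜 u v →ₗ[𝕜] ((act 𝕜 u).obj M n ⟶ (act 𝕜 v).obj M n) where
  toFun f := ((theta 𝕜).map u v f).app M n
  map_add' f g := by rw [map_add]; rfl
  map_smul' r f := by rw [map_smul]; rfl

variable (n : ℕ) {u v w : Word}

theorem evalLinear_comp (M : Family 𝕜) (f : HeisHom 𝕜 u v) (g : HeisHom 𝕜 v w) :
    evalLinear n M u w (f.comp g) = evalLinear n M u v f ≫ evalLinear n M v w g := by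
  induction f using HeisHom.ind; induction g using HeisHom.ind
  rfl

theorem evalLinear_cons_cons (M : Family 𝕜) (f : HeisHom 𝕜 u v) :
    evalLinear (n + 1) M (.up :: .down :: u) (.up :: .down :: v) ((f.cons .down).cons .up) =
      IndMap (ResMap (evalLinear (n + 1) M u v f)) := by
  induction f using HeisHom.ind
  rfl

theorem evalLinear_cast {u' v' : Word} (hu : u = u') (hv : v = v') {M : Family 𝕜}
    {f : HeisHom 𝕜 u v} (h : evalLinear n M u v f = 0) :
    evalLinear n M u' v' (f.cast hu hv) = 0 := by
  subst hu hv
  exact h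

theorem evalLinear_whiskerRight (c : Word) {M : Family 𝕜} {f : HeisHom 𝕜 u v}
    (h : evalLinear n ((act 𝕜 c).obj M) u v f = 0) :
    evalLinear n M (u ++ c) (v ++ c) (f.whiskerRight c) = 0 := by
  induction f using HeisHom.ind with
  | h f =>
    have h1 := congrFun (thetaTerm_whiskerRight c f M) n
    have h2 : (thetaTerm (f.whiskerRight c)).app M n ≫ (actAppend 𝕜 c v).hom.app M n = 0 :=
      h1.trans ((congrArg ((actAppend 𝕜 c u).hom.app M n ≫ ·) h).trans Limits.comp_zero)
    have h3 : (actAppend 𝕜 c v).hom.app M n ≫ (actAppend 𝕜 c v).inv.app M n = 𝟙 _ :=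
      congrFun ((actAppend 𝕜 c v).hom_inv_id_app M) n
    refine (Category.comp_id _).symm.trans ((congrArg (_ ≫ ·) h3.symm).trans ?_)
    exact (Category.assoc _ _ _).symm.trans ((congrArg (· ≫ _) h2).trans Limits.zero_comp)

/-- Since `↑↓` acts in each degree by itself, through Ind Res, a morphism that vanishes in degree n
still does so after prefixing copies of `↑↓`. -/
theorem evalLinear_whiskerLeft (k : ℕ) {M : Family 𝕜} {f : HeisHom 𝕜 u v}
    (h : evalLinear n M u v f = 0) :
    evalLinear n M (upDown k ++ u) (upDown k ++ v) (f.whiskerLeft (upDown k)) = 0 := by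
  induction k with
  | zero => exact h
  | succ k ih =>
    match n with
    | 0 =>
      exact rep_hom_eq_of_subsingleton_source
        (subsingleton_indFam_zero ((act 𝕜 (.down :: (upDown k ++ u))).obj M)) _ _
    | n + 1 =>
      refine (evalLinear_cons_cons n M _).trans
        ((congrArg (fun f => IndMap (ResMap f)) ih).trans (ind_hom_ext fun x => ?_))
      exact indTmul_zero (A := Res ((act 𝕜 (upDown k ++ v)).obj M (n + 1))) 1

theorem evalLinear_bubble (M : Family 𝕜) :
    evalLinear n M _ _ (clockwiseBubble 𝕜 - (n : 𝕜) • HeisHom.id (upDown 0)) = 0 := by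
  rw [map_sub, map_smul, sub_eq_zero]
  refine rep_hom_ext fun x => ?_
  match n with
  | 0 => rw [Nat.cast_zero, zero_smul]; rfl
  | n + 1 => exact cupLHom_capRHom (M (n + 1)) x

theorem evalLinear_eq_zero {k l : ℕ} {f : HeisHom 𝕜 (upDown k) (upDown l)}
    (h : InBubbleIdeal (n : 𝕜) f) (M : Family 𝕜) : evalLinear n M _ _ f = 0 := by
  -- For `f ⊗ 1` the hypothesis is used at a family other than `M`, so vanishing must be proved for
  -- all families at once and not just for the trivial modules.
  induction h generalizing M with
  | bubble => exact evalLinear_bubble n M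
  | zero k l => exact map_zero _
  | add _ _ ih ih' => rw [map_add, ih, ih', add_zero]
  | smul r _ ih => rw [map_smul, ih, smul_zero]
  | comp_left g _ ih => rw [evalLinear_comp, ih, Limits.zero_comp]
  | comp_right f _ ih => rw [evalLinear_comp, ih, Limits.comp_zero]
  | tensor_left g _ ih =>
    refine evalLinear_cast n _ _ ?_
    rw [HeisHom.tensor, evalLinear_comp, evalLinear_whiskerRight n _ (ih _), Limits.zero_comp]
  | tensor_right f _ ih =>
    refine evalLinear_cast n _ _ ?_
    rw [HeisHom.tensor, evalLinear_comp, evalLinear_whiskerLeft n _ (ih _), Limits.comp_zero]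

variable (𝕜) in
/-- The functor `Peis(n) → S_n-mod` induced by the action on the trivial module. -/
noncomputable def omega : Omega (theta 𝕜) n where
  map k l := (bubbleIdeal (n : 𝕜) k l).liftQ (evalLinear n (trivFam 𝕜) (upDown k) (upDown l))
    fun _ h => evalLinear_eq_zero n h _
  map_mk _ := rfl

theorem omega_unique {Θ : Theta 𝕜} {n : ℕ} (Ω Ω' : Omega Θ n) : Ω = Ω' := by
  refine Omega.ext (funext fun k => funext fun l => LinearMap.ext fun f => ?_)
  induction f using Quotient.ind with
  | _ f => exact (Ω.map_mk f).trans (Ω'.map_mk f).symm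

end Omega

end PartHeis

namespace PartHeis

/-! ### Coset decomposition of induced modules -/

section CosetTmul

variable {𝕜 : Type u} [CommRing 𝕜] {n : ℕ} (B : Rep.{u} 𝕜 (Equiv.Perm (Fin (n + 1))))

/-- The map `y ↦ g_i ⊗ g_i⁻¹ y`. -/
noncomputable def cosetTmul (i : Fin (n + 1)) : B →ₗ[𝕜] Ind (Res B) :=
  indTmulLinear (Res B) (cosetRep i) ∘ₗ B.ρ (cosetRep i)⁻¹

variable {B}

theorem cosetTmul_apply (i : Fin (n + 1)) (y : B) :
    cosetTmul B i y = indTmul (M := Res B) (cosetRep i) (B.ρ (cosetRep i)⁻¹ y) := rfl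

theorem perm_apply_inv_apply {α : Type*} (g : Equiv.Perm α) (x : α) : g (g⁻¹ x) = x :=
  g.apply_symm_apply x

theorem rho_inv_rho (g : Equiv.Perm (Fin (n + 1))) (y : B) : B.ρ g⁻¹ (B.ρ g y) = y := by
  rw [← Module.End.mul_apply, ← map_mul, inv_mul_cancel, map_one]
  rfl

theorem rho_rho_inv (g : Equiv.Perm (Fin (n + 1))) (y : B) : B.ρ g (B.ρ g⁻¹ y) = y := by
  rw [← Module.End.mul_apply, ← map_mul, mul_inv_cancel, map_one]
  rfl

/-- The coset of `g` is named by the image of the last point, so `cosetTmul` does not depend on the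
particular representatives. -/
theorem indTmul_rho_inv (g : Equiv.Perm (Fin (n + 1))) (y : B) :
    indTmul (M := Res B) g (B.ρ g⁻¹ y) = cosetTmul B (g (Fin.last n)) y := by
  obtain ⟨p, hp⟩ := exists_mul_cosetRep g
  have h := indTmul_mul_rho_inv (cosetRep (g (Fin.last n))) p y
  rwa [← hp] at h

theorem indTmul_eq_cosetTmul (g : Equiv.Perm (Fin (n + 1))) (y : B) :
    indTmul (M := Res B) g y = cosetTmul B (g (Fin.last n)) (B.ρ g y) := by
  rw [← indTmul_rho_inv, rho_inv_rho]

theorem cosetTmul_last (y : B) : cosetTmul B (Fin.last n) y = indTmul (M := Res B) 1 y := by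
  rw [indTmul_eq_cosetTmul, map_one]
  rfl

/-- This identifies Ind Res B with V ⊗ B under the diagonal action, `cosetTmul B i y` being v_i ⊗ y.
-/
theorem rho_cosetTmul (h : Equiv.Perm (Fin (n + 1))) (i : Fin (n + 1)) (y : B) :
    (Ind (Res B)).ρ h (cosetTmul B i y) = cosetTmul B (h i) (B.ρ h y) := by
  rw [cosetTmul_apply, ind_rho, indTmul_eq_cosetTmul, map_mul, Module.End.mul_apply, rho_rho_inv,
    Equiv.Perm.mul_apply, cosetRep_apply_last]

theorem ind_res_linear_ext {M : Type*} [AddCommGroup M] [Module 𝕜 M] {f f' : Ind (Res B) →ₗ[𝕜] M}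
    (h : ∀ i y, f (cosetTmul B i y) = f' (cosetTmul B i y)) : f = f' :=
  ind_linear_ext fun g y => by rw [indTmul_eq_cosetTmul, h]

theorem cupLHom_eq_sum (y : B) : (cupLHom B).hom y = ∑ i, cosetTmul B i y := cupLHom_apply y

theorem capRHom_cosetTmul (i : Fin (n + 1)) (y : B) : (capRHom B).hom (cosetTmul B i y) = y :=
  (capRHom_indTmul _ _).trans (rho_rho_inv _ _)

theorem capLHom_cosetTmul (i : Fin (n + 1)) (y : B) :
    (capLHom (Res B)).hom (cosetTmul B i y) = if i = Fin.last n then y else 0 := by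
  split_ifs with h
  · rw [h, cosetTmul_last, capLHom_one]
  · refine capLHom_of_ne ?_ _
    rwa [cosetRep_apply_last]

theorem IndMap_ResMap_cosetTmul {B' : Rep.{u} 𝕜 (Equiv.Perm (Fin (n + 1)))} (f : B ⟶ B')
    (i : Fin (n + 1)) (y : B) :
    (IndMap (ResMap f)).hom (cosetTmul B i y) = cosetTmul B' i (f.hom y) := by
  rw [cosetTmul_apply, IndMap_indTmul, ResMap_apply, hom_rho]
  rfl

variable (B) in
/-- The multiplication `↑↓↑↓ → ↑↓`. -/
noncomputable def mulHom : Ind (Res (Ind (Res B))) ⟶ Ind (Res B) := IndMap (capLHom (Res B))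

variable (B) in
/-- The comultiplication `↑↓ → ↑↓↑↓`. -/
noncomputable def comulHom : Ind (Res B) ⟶ Ind (Res (Ind (Res B))) := IndMap (cupRHom (Res B))

/-- Translating by g_i⁻¹ moves i to the last point and j to the last point exactly if i = j, which
is the condition under which the cap is nonzero. -/
theorem mulHom_cosetTmul (i j : Fin (n + 1)) (y : B) :
    (mulHom B).hom (cosetTmul (Ind (Res B)) i (cosetTmul B j y)) =
      if i = j then cosetTmul B i y else 0 := by
  rw [mulHom, cosetTmul_apply, IndMap_indTmul, rho_cosetTmul, capLHom_cosetTmul]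
  have h : (cosetRep i)⁻¹ j = Fin.last n ↔ i = j := by
    rw [Equiv.Perm.inv_eq_iff_eq, cosetRep_apply_last, eq_comm]
  by_cases hij : i = j
  · rw [if_pos (h.2 hij), if_pos hij]
    rfl
  · rw [if_neg (mt h.1 hij), if_neg hij, indTmul_zero]

theorem comulHom_cosetTmul (i : Fin (n + 1)) (y : B) :
    (comulHom B).hom (cosetTmul B i y) = cosetTmul (Ind (Res B)) i (cosetTmul B i y) := by
  rw [comulHom, cosetTmul_apply, IndMap_indTmul, cupRHom_apply, cosetTmul_apply, ind_rho,
    inv_mul_cancel]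

end CosetTmul

section Crossing

variable {𝕜 : Type u} [CommRing 𝕜] {n : ℕ} {B : Rep.{u} 𝕜 (Equiv.Perm (Fin (n + 1)))}

theorem leftCrossHom_cross (p : Equiv.Perm (Fin (n + 1))) (y : B) :
    (leftCrossHom B).hom (indTmul (permEmb (n + 1) p * lastSwap n) y) =
      indTmul (M := Res B) p y := by
  rw [← rightCrossHom_indTmul, ← rep_comp_apply, rightCrossHom_leftCrossHom, rep_id_apply]

theorem leftCrossHom_one (y : B) : (leftCrossHom B).hom (indTmul 1 y) = 0 := by
  rw [leftCrossHom_indTmul]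
  refine Finset.sum_eq_zero fun i _ => capLHom_of_ne ?_ _
  rw [cross_apply_last]
  exact (Fin.castSucc_lt_last i).ne

variable {C : Rep.{u} 𝕜 (Equiv.Perm (Fin (n + 2)))}

theorem leftCrossHom_cosetTmul_last (y : C) :
    (leftCrossHom (Res C)).hom (cosetTmul C (Fin.last (n + 1)) y) = 0 := by
  rw [cosetTmul_last, leftCrossHom_one]

/-- A representative adapted to the left crossing: it factors through the smaller group and the last
transposition, the form in which `leftCrossHom_cross` applies. -/
theorem cosetTmul_castSucc (j : Fin (n + 1)) (y : C) :
    cosetTmul C j.castSucc y = indTmul (M := Res C) (permEmb (n + 1) (cosetRep j) * lastSwap n)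
      (C.ρ (permEmb (n + 1) (cosetRep j) * lastSwap n)⁻¹ y) := by
  rw [indTmul_rho_inv, Equiv.Perm.mul_apply, lastSwap_apply_last, permEmb_apply_castSucc,
    cosetRep_apply_last]

theorem leftCrossHom_cosetTmul_castSucc (j : Fin (n + 1)) (y : C) :
    (leftCrossHom (Res C)).hom (cosetTmul C j.castSucc y) =
      indTmul (M := Res (Res C)) (cosetRep j)
        (C.ρ (permEmb (n + 1) (cosetRep j) * lastSwap n)⁻¹ y) := by
  rw [cosetTmul_castSucc, leftCrossHom_cross]

variable (C) in
/-- The downward crossing. -/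
noncomputable def downCrossHom : Res (Res C) ⟶ Res (Res C) :=
  ResMap (ResMap (cupLHom C)) ≫ ResMap (leftCrossHom (Res C)) ≫ capLHom (Res (Res C))

/-- Of the sum over points created by the cup, the left crossing kills the last point and the cap
all but the last of the remaining ones. What is left is the transposition of the two points removed
by the two restrictions. -/
theorem downCrossHom_apply (y : C) : (downCrossHom C).hom y = C.ρ (lastSwap n) y := by
  rw [downCrossHom, rep_comp_apply, rep_comp_apply, ResMap_apply, ResMap_apply, ResMap_apply,
    cupLHom_eq_sum, Fin.sum_univ_castSucc, map_add, leftCrossHom_cosetTmul_last, add_zero, map_sum,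
    map_sum, Finset.sum_eq_single (Fin.last n)]
  · rw [leftCrossHom_cosetTmul_castSucc, cosetRep_last, map_one, one_mul, capLHom_one]
    rfl
  · intro j _ hj
    rw [leftCrossHom_cosetTmul_castSucc, capLHom_of_ne]
    rwa [cosetRep_apply_last]
  · intro h
    exact (h (Finset.mem_univ _)).elim

variable (C) in
/-- The first summand of the symmetry of `↑↓`. -/
noncomputable def crossingHom : Ind (Res (Ind (Res C))) ⟶ Ind (Res (Ind (Res C))) :=
  IndMap (leftCrossHom (Res C)) ≫ crossHom (Res (Res C)) ≫ IndMap (IndMap (downCrossHom C)) ≫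
    IndMap (rightCrossHom (Res C))

theorem crossingHom_last_last (y : C) :
    (crossingHom C).hom (cosetTmul (Ind (Res C)) (Fin.last _) (cosetTmul C (Fin.last _) y)) =
      0 := by
  rw [crossingHom, cosetTmul_last, rep_comp_apply, IndMap_indTmul, leftCrossHom_cosetTmul_last,
    indTmul_zero, map_zero]

theorem crossingHom_last_castSucc (j : Fin (n + 1)) (y : C) :
    (crossingHom C).hom (cosetTmul (Ind (Res C)) (Fin.last _) (cosetTmul C j.castSucc y)) =
      cosetTmul (Ind (Res C)) j.castSucc (cosetTmul C (Fin.last _) y) := by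
  rw [crossingHom, cosetTmul_last, rep_comp_apply, rep_comp_apply, rep_comp_apply, IndMap_indTmul,
    leftCrossHom_cosetTmul_castSucc, crossHom_indTmul, IndMap_indTmul, IndMap_indTmul,
    IndMap_indTmul, downCrossHom_apply, rightCrossHom_indTmul, cosetTmul_castSucc, cosetTmul_last,
    ind_rho, mul_one, map_one, one_mul, one_mul]
  refine congrArg _ ?_
  rw [mul_inv_rev, ← map_inv, indTmul_mul, map_mul, Module.End.mul_apply, rho_rho_inv]
  rfl

theorem crossingHom_cosetTmul (i j : Fin (n + 2)) (y : C) :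
    (crossingHom C).hom (cosetTmul (Ind (Res C)) i (cosetTmul C j y)) =
      if i = j then 0 else cosetTmul (Ind (Res C)) j (cosetTmul C i y) := by
  -- The group permutes the indices transitively, so by equivariance the first index may be taken to
  -- be the last point.
  have key : ∀ (j : Fin (n + 2)) (y : C),
      (crossingHom C).hom (cosetTmul (Ind (Res C)) (Fin.last _) (cosetTmul C j y)) =
        if Fin.last _ = j then 0 else cosetTmul (Ind (Res C)) j (cosetTmul C (Fin.last _) y) := by
    intro j y
    refine Fin.lastCases ?_ (fun j => ?_) j
    · rw [crossingHom_last_last, if_pos rfl]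
    · rw [crossingHom_last_castSucc, if_neg (Fin.castSucc_lt_last j).ne']
  have h := congrArg ((Ind (Res (Ind (Res C)))).ρ (cosetRep i))
    (key ((cosetRep i)⁻¹ j) (C.ρ (cosetRep i)⁻¹ y))
  rw [← hom_rho, rho_cosetTmul, rho_cosetTmul, rho_rho_inv, cosetRep_apply_last,
    perm_apply_inv_apply] at h
  refine h.trans ?_
  have h' : Fin.last (n + 1) = (cosetRep i)⁻¹ j ↔ i = j := by
    rw [eq_comm, Equiv.Perm.inv_eq_iff_eq, cosetRep_apply_last, eq_comm]
  by_cases hij : i = j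
  · rw [if_pos (h'.2 hij), if_pos hij, map_zero]
  · rw [if_neg (mt h'.1 hij), if_neg hij, rho_cosetTmul, rho_cosetTmul, rho_rho_inv,
      cosetRep_apply_last, perm_apply_inv_apply]

end Crossing

end PartHeis

namespace PartHeis

/-! ### The isomorphisms `β_k` -/

section Beta

variable {𝕜 : Type u} [CommRing 𝕜] {n : ℕ}

/-- The isomorphism of representations given by an equivariant map and its inverse. -/
noncomputable def repIsoMk {G : Type*} [Group G] {A B : Rep.{u} 𝕜 G} (f : A ⟶ B) (g : B →ₗ[𝕜] A)
    (hfg : ∀ x, g (f.hom x) = x) (hgf : ∀ y, f.hom (g y) = y) : A ≅ B where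
  hom := f
  inv := repHomMk g fun h y => by rw [← hgf y, ← hom_rho, hfg, hfg]
  hom_inv_id := rep_hom_ext hfg
  inv_hom_id := rep_hom_ext hgf

/-- The parameter `p` only translates the first tensor factor, by p⁻¹; it is there to carry g_i⁻¹
into the next factor during the recursion. -/
theorem betaAux_eq_rho (n k : ℕ) (p : Equiv.Perm (Fin n)) (i : Fin k → Fin n) :
    betaAux (𝕜 := 𝕜) n k p i = (actTriv 𝕜 n k).ρ p⁻¹ (beta n k i) :=
  match n, k with
  | 0, 0 => rfl
  | _ + 1, 0 => rfl
  | 0, _ + 1 => (i 0).elim0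
  | m + 1, k + 1 => by
    refine Eq.trans ?_ (ind_rho (A := Res (actTriv 𝕜 (m + 1) k)) p⁻¹ _ _).symm
    rw [inv_one, one_mul]
    rfl

/-- The factor g_i⁻¹ at the start of the remaining tensor is the action of g_i⁻¹ on it. Thus β takes
v_i ⊗ x to `cosetTmul` of i and the image of x, and all properties of β follow by induction on k. -/
theorem beta_cons (m k : ℕ) (i : Fin (m + 1)) (a : Fin k → Fin (m + 1)) :
    beta (𝕜 := 𝕜) (m + 1) (k + 1) (Fin.cons i a : Fin (k + 1) → Fin (m + 1)) =
      cosetTmul (actTriv 𝕜 (m + 1) k) i (beta (m + 1) k a) := by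
  refine Eq.trans ?_ (congrArg (indTmul (M := Res (actTriv 𝕜 (m + 1) k)) (cosetRep i))
    (betaAux_eq_rho (m + 1) k (cosetRep i) a))
  change indTmul (M := Res (actTriv 𝕜 (m + 1) k)) (1⁻¹ * cosetRep i) _ = _
  rw [inv_one, one_mul]
  rfl

theorem exists_eq_cons {α : Type*} {k : ℕ} (i : Fin (k + 1) → α) :
    ∃ (x : α) (a : Fin k → α), i = Fin.cons x a :=
  ⟨i 0, Fin.tail i, (Fin.cons_self_tail i).symm⟩

theorem comp_cons {α β : Type*} (f : α → β) {k : ℕ} (i : α) (a : Fin k → α) :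
    (fun j => f ((Fin.cons i a : Fin (k + 1) → α) j)) =
      (Fin.cons (f i) (fun j => f (a j)) : Fin (k + 1) → β) :=
  funext fun j => Fin.cases rfl (fun _ => rfl) j

theorem beta_equivariant {k : ℕ} (g : Equiv.Perm (Fin n)) (i : Fin k → Fin n) :
    beta (𝕜 := 𝕜) n k (fun j => g (i j)) = (actTriv 𝕜 n k).ρ g (beta n k i) := by
  induction k with
  | zero => rfl
  | succ k ih =>
    match n with
    | 0 => exact (i 0).elim0
    | m + 1 =>
      obtain ⟨i, a, rfl⟩ := exists_eq_cons i
      rw [comp_cons, beta_cons, beta_cons, ih]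
      exact (rho_cosetTmul g i _).symm

variable (𝕜 n) in
/-- The map `β_k`. -/
noncomputable def betaHom (k : ℕ) : tensorPowerRep 𝕜 n k ⟶ actTriv 𝕜 n k :=
  tensorPowerLift (beta n k) beta_equivariant

theorem betaHom_basisTensor {k : ℕ} (i : Fin k → Fin n) :
    (betaHom 𝕜 n k).hom (basisTensor 𝕜 n i) = beta n k i :=
  tensorPowerLift_basisTensor _ _ _

variable (𝕜) in
/-- Tensoring with `v_i` on the left. -/
noncomputable def consTensor (k : ℕ) (i : Fin n) :
    tensorPowerRep 𝕜 n k →ₗ[𝕜] tensorPowerRep 𝕜 n (k + 1) :=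
  (tensorBasis 𝕜 n k).constr 𝕜 fun b => basisTensor 𝕜 n (Fin.cons i b : Fin (k + 1) → Fin n)

theorem consTensor_basisTensor {k : ℕ} (i : Fin n) (a : Fin k → Fin n) :
    consTensor 𝕜 k i (basisTensor 𝕜 n a) =
      basisTensor 𝕜 n (Fin.cons i a : Fin (k + 1) → Fin n) := by
  rw [consTensor, ← tensorBasis_apply, Module.Basis.constr_basis]

theorem betaHom_consTensor (m k : ℕ) (i : Fin (m + 1)) (x : tensorPowerRep 𝕜 (m + 1) k) :
    (betaHom 𝕜 (m + 1) (k + 1)).hom (consTensor 𝕜 k i x) =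
      cosetTmul (actTriv 𝕜 (m + 1) k) i ((betaHom 𝕜 (m + 1) k).hom x) := by
  refine LinearMap.congr_fun (f := (betaHom 𝕜 (m + 1) (k + 1)).hom.toLinearMap ∘ₗ consTensor 𝕜 k i)
    (g := cosetTmul (actTriv 𝕜 (m + 1) k) i ∘ₗ (betaHom 𝕜 (m + 1) k).hom.toLinearMap)
    ((tensorBasis 𝕜 (m + 1) k).ext fun a => ?_) x
  rw [tensorBasis_apply]
  exact (congrArg _ (consTensor_basisTensor i a)).trans <| (betaHom_basisTensor _).trans ((beta_cons m k i a).trans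
    (congrArg _ (betaHom_basisTensor a).symm))

variable (𝕜) in
/-- The inverse of `β_k`. -/
noncomputable def betaInv : (n k : ℕ) → actTriv 𝕜 n k →ₗ[𝕜] tensorPowerRep 𝕜 n k
  | n, 0 => LinearMap.toSpanSingleton 𝕜 (tensorPowerRep 𝕜 n 0) (basisTensor 𝕜 n Fin.elim0)
  | 0, _ + 1 => 0
  | m + 1, k + 1 =>
    indLift (A := Res (actTriv 𝕜 (m + 1) k)) (M := (tensorPowerRep 𝕜 (m + 1) (k + 1)).V)
      (fun g => consTensor 𝕜 k (g (Fin.last m)) ∘ₗ betaInv (m + 1) k ∘ₗ (actTriv 𝕜 (m + 1) k).ρ g)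
      fun g p => LinearMap.ext fun x => by
        rw [Equiv.Perm.mul_apply, permEmb_apply_last, map_mul]
        rfl

theorem betaInv_zero (n : ℕ) : betaInv 𝕜 n 0 (1 : 𝕜) = basisTensor 𝕜 n Fin.elim0 :=
  one_smul 𝕜 (basisTensor 𝕜 n Fin.elim0)

theorem betaInv_cosetTmul (m k : ℕ) (i : Fin (m + 1)) (y : actTriv 𝕜 (m + 1) k) :
    betaInv 𝕜 (m + 1) (k + 1) (cosetTmul (actTriv 𝕜 (m + 1) k) i y) =
      consTensor 𝕜 k i (betaInv 𝕜 (m + 1) k y) := by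
  rw [cosetTmul_apply, betaInv]
  refine (indLift_indTmul (A := Res (actTriv 𝕜 (m + 1) k)) _ _ _ _).trans ?_
  rw [LinearMap.comp_apply, LinearMap.comp_apply, cosetRep_apply_last]
  exact congrArg (fun z => consTensor 𝕜 k i (betaInv 𝕜 (m + 1) k z)) (rho_rho_inv _ _)

/-- Both β and its inverse replace one factor v_i ⊗ _ by `cosetTmul i _` or conversely, so the check
on basis tensors is an induction on their length. -/
theorem betaInv_betaHom (n k : ℕ) (x : tensorPowerRep 𝕜 n k) :
    betaInv 𝕜 n k ((betaHom 𝕜 n k).hom x) = x := by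
  refine LinearMap.congr_fun (f := betaInv 𝕜 n k ∘ₗ (betaHom 𝕜 n k).hom.toLinearMap)
    (g := LinearMap.id) ((tensorBasis 𝕜 n k).ext fun a => ?_) x
  rw [tensorBasis_apply, LinearMap.id_apply]
  refine (congrArg (betaInv 𝕜 n k) (betaHom_basisTensor a)).trans ?_
  induction k with
  | zero => exact (betaInv_zero n).trans (congrArg _ (Subsingleton.elim _ _))
  | succ k ih =>
    match n with
    | 0 => exact (a 0).elim0
    | m + 1 =>
      obtain ⟨i, a, rfl⟩ := exists_eq_cons a
      rw [beta_cons, betaInv_cosetTmul, ih 0, consTensor_basisTensor]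

theorem betaHom_betaInv (n k : ℕ) (y : actTriv 𝕜 n k) :
    (betaHom 𝕜 n k).hom (betaInv 𝕜 n k y) = y := by
  induction k with
  | zero =>
    refine LinearMap.congr_fun (f := (betaHom 𝕜 n 0).hom.toLinearMap ∘ₗ betaInv 𝕜 n 0)
      (g := LinearMap.id) (LinearMap.ext_ring ?_) y
    exact (congrArg (betaHom 𝕜 n 0).hom (betaInv_zero n)).trans (betaHom_basisTensor Fin.elim0)
  | succ k ih =>
    match n with
    | 0 =>
      have := subsingleton_indFam_zero ((act 𝕜 (.down :: upDown k)).obj (trivFam 𝕜))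
      exact this.elim _ _
    | m + 1 =>
      refine LinearMap.congr_fun (f := (betaHom 𝕜 (m + 1) (k + 1)).hom.toLinearMap ∘ₗ
        betaInv 𝕜 (m + 1) (k + 1)) (g := LinearMap.id) (ind_res_linear_ext fun i y => ?_) y
      refine (congrArg _ (betaInv_cosetTmul m k i y)).trans ((betaHom_consTensor m k i _).trans ?_)
      exact congrArg (cosetTmul (actTriv 𝕜 (m + 1) k) i) (ih y)

variable (𝕜 n) in
/-- The isomorphism `β_k`. -/
noncomputable def betaIso (k : ℕ) : tensorPowerRep 𝕜 n k ≅ actTriv 𝕜 n k :=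
  repIsoMk (betaHom 𝕜 n k) (betaInv 𝕜 n k) (betaInv_betaHom n k) (betaHom_betaInv n k)

end Beta

/-! ### Naturality of β at the generators of the partition category. -/

section Naturality

variable {𝕜 : Type u} [CommRing 𝕜]

theorem subsingleton_actTriv_zero (k : ℕ) : Subsingleton (actTriv 𝕜 0 (k + 1)) :=
  subsingleton_indFam_zero ((act 𝕜 (.down :: upDown k)).obj (trivFam 𝕜))

theorem tensorPowerRep_hom_ext_cons {m k : ℕ} {M : Rep.{u} 𝕜 (Equiv.Perm (Fin m))}
    {f g : tensorPowerRep 𝕜 m (k + 1) ⟶ M}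
    (h : ∀ i (a : Fin k → Fin m),
      f.hom (basisTensor 𝕜 m (Fin.cons i a : Fin (k + 1) → Fin m)) =
        g.hom (basisTensor 𝕜 m (Fin.cons i a : Fin (k + 1) → Fin m))) : f = g :=
  tensorPowerRep_hom_ext fun i => by
    obtain ⟨i, a, rfl⟩ := exists_eq_cons i
    exact h i a

theorem omega_comp {n k l j : ℕ} (f : PeisHom (n : 𝕜) k l) (g : PeisHom (n : 𝕜) l j) :
    (omega 𝕜 n).map k j (f.comp g) = (omega 𝕜 n).map k l f ≫ (omega 𝕜 n).map l j g := by
  obtain ⟨f⟩ := f; obtain ⟨g⟩ := g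
  exact evalLinear_comp n (trivFam 𝕜) f g

theorem omega_consTwo {m k l : ℕ} (f : PeisHom ((m + 1 : ℕ) : 𝕜) k l) :
    (omega 𝕜 (m + 1)).map (k + 1) (l + 1) (PeisHom.consTwo f) =
      IndMap (ResMap ((omega 𝕜 (m + 1)).map k l f)) := by
  obtain ⟨f⟩ := f
  exact evalLinear_cons_cons m (trivFam 𝕜) f

variable (m k : ℕ)

/-- The formula for the crossing requires two points to exchange. In degree one the morphism factors
through `↑↑`, which vanishes there, and this agrees with the formula since the two indices coincide.
-/
theorem crossing_one (b : Word) (M : Family 𝕜) :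
    evalLinear 1 M _ _ (HeisHom.crossing b) = 0 := by
  rw [HeisHom.crossing, evalLinear_comp]
  have h : evalLinear 1 M _ _ ((HeisHom.L (.down :: b)).cons .up) = 0 :=
    rep_hom_eq_of_subsingleton_target
      (subsingleton_indFam_indFam_one ((act 𝕜 (.down :: .down :: b)).obj M)) _ _
  rw [h, Limits.zero_comp]

theorem crossing_apply (b : Word) (M : Family 𝕜) (i j : Fin (m + 1)) (y : (act 𝕜 b).obj M (m + 1)) :
    (evalLinear (m + 1) M _ _ (HeisHom.crossing b)).hom
      (cosetTmul (Ind (Res ((act 𝕜 b).obj M (m + 1)))) i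
        (cosetTmul ((act 𝕜 b).obj M (m + 1)) j y)) =
      if i = j then 0 else (cosetTmul (Ind (Res ((act 𝕜 b).obj M (m + 1)))) j
        (cosetTmul ((act 𝕜 b).obj M (m + 1)) i y)) :=
  match m with
  | 0 => by
    rw [crossing_one, if_pos (Subsingleton.elim (α := Fin 1) _ _)]
    rfl
  | m + 1 => crossingHom_cosetTmul i j y

theorem rep_add_apply {G : Type*} [Monoid G] {A B : Rep.{u} 𝕜 G} {f g : A ⟶ B} {x : A} {y z : B}
    (hf : f.hom x = y) (hg : g.hom x = z) : (f + g).hom x = y + z :=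
  congrArg₂ (· + ·) hf hg

/-- The two summands of the symmetry have complementary supports: the crossing exchanges distinct
indices and kills equal ones, while multiplication followed by comultiplication fixes equal indices
and kills distinct ones. -/
theorem omega_swap_apply (i j : Fin (m + 1)) (y : actTriv 𝕜 (m + 1) k) :
    ((omega 𝕜 (m + 1)).map (k + 2) (k + 2) (PeisHom.mk _ (HeisHom.swap (upDown k)))).hom
      (cosetTmul (actTriv 𝕜 (m + 1) (k + 1)) i (cosetTmul (actTriv 𝕜 (m + 1) k) j y)) =
        cosetTmul (actTriv 𝕜 (m + 1) (k + 1)) j (cosetTmul (actTriv 𝕜 (m + 1) k) i y) := by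
  refine (rep_add_apply (A := Ind (Res (Ind (Res (actTriv 𝕜 (m + 1) k)))))
    (B := Ind (Res (Ind (Res (actTriv 𝕜 (m + 1) k)))))
    (g := mulHom (actTriv 𝕜 (m + 1) k) ≫ comulHom (actTriv 𝕜 (m + 1) k))
    (crossing_apply m (upDown k) (trivFam 𝕜) i j y) (congrArg (comulHom (actTriv 𝕜 (m + 1) k)).hom (mulHom_cosetTmul i j y))).trans ?_
  by_cases hij : i = j
  · subst hij
    rw [if_pos rfl, if_pos rfl, comulHom_cosetTmul, zero_add]
    rfl
  · rw [if_neg hij, if_neg hij, map_zero, add_zero]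
    rfl

/-- The naturality square of `β` at a morphism of the partition category. -/
def BetaNatural (n k l : ℕ) (f : ParHom 𝕜 k l) : Prop :=
  phiMap 𝕜 n k l f ≫ betaHom 𝕜 n l =
    betaHom 𝕜 n k ≫ (omega 𝕜 n).map k l (psiMap (n : 𝕜) k l f)

/-- For n = 0 all modules are zero except those of the object 0. Every generator, as well as every
morphism with an added strand, has an end different from 0, so the hypothesis costs nothing. -/
theorem betaNatural_zero {k l : ℕ} (f : ParHom 𝕜 k l) (h : k ≠ 0 ∨ l ≠ 0) :
    BetaNatural 0 k l f := by
  match k, l with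
  | k + 1, _ => exact tensorPowerRep_hom_ext fun i => (i 0).elim0
  | 0, l + 1 => exact rep_hom_eq_of_subsingleton_target (subsingleton_actTriv_zero l) _ _
  | 0, 0 => exact (h.elim (fun h => h rfl) (fun h => h rfl)).elim

theorem betaNatural_parL {n k l : ℕ} (f : ParHom 𝕜 k l) (h : BetaNatural n k l f) :
    BetaNatural n (k + 1) (l + 1) (parL f) := by
  match n with
  | 0 => exact betaNatural_zero _ (Or.inl k.succ_ne_zero)
  | m + 1 =>
    refine tensorPowerRep_hom_ext_cons fun i a => ?_
    rw [rep_comp_apply, rep_comp_apply, phiMap_parL, psiMap_parL, betaHom_basisTensor, beta_cons]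
    refine (betaHom_consTensor m l i _).trans ?_
    rw [omega_consTwo]
    refine Eq.trans ?_ (IndMap_ResMap_cosetTmul _ i _).symm
    refine congrArg (cosetTmul (actTriv 𝕜 (m + 1) l) i) ?_
    rw [← betaHom_basisTensor]
    exact congrArg (fun f => f.hom (basisTensor 𝕜 (m + 1) a)) h

theorem betaNatural_mul (n k : ℕ) :
    BetaNatural n (k + 2) (k + 1) (Finsupp.single (graph (mulFun k)) (1 : 𝕜)) := by
  match n with
  | 0 => exact betaNatural_zero _ (Or.inl (Nat.succ_ne_zero _))
  | m + 1 =>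
    refine tensorPowerRep_hom_ext_cons fun i a => ?_
    obtain ⟨j, a, rfl⟩ := exists_eq_cons a
    rw [rep_comp_apply, rep_comp_apply, phiMap_mulFun, psiMap_mulFun, betaHom_basisTensor,
      beta_cons, beta_cons, apply_ite (betaHom 𝕜 (m + 1) (k + 1)).hom, betaHom_basisTensor,
      beta_cons, map_zero]
    exact (mulHom_cosetTmul i j _).symm

theorem betaNatural_comul (n k : ℕ) :
    BetaNatural n (k + 1) (k + 2) (Finsupp.single (cograph (mulFun k)) (1 : 𝕜)) := by
  match n with
  | 0 => exact betaNatural_zero _ (Or.inl (Nat.succ_ne_zero _))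
  | m + 1 =>
    refine tensorPowerRep_hom_ext_cons fun i a => ?_
    rw [rep_comp_apply, rep_comp_apply, phiMap_comulFun, psiMap_comulFun, betaHom_basisTensor,
      betaHom_basisTensor, beta_cons, beta_cons]
    exact (comulHom_cosetTmul i _).symm

theorem betaNatural_unit (n k : ℕ) :
    BetaNatural n k (k + 1) (Finsupp.single (graph Fin.succ) (1 : 𝕜)) := by
  match n with
  | 0 => exact betaNatural_zero _ (Or.inr (Nat.succ_ne_zero _))
  | m + 1 =>
    refine tensorPowerRep_hom_ext fun a => ?_
    rw [rep_comp_apply, rep_comp_apply, phiMap_unitFun, psiMap_unitFun, betaHom_basisTensor,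
      map_sum]
    refine Eq.trans (Finset.sum_congr rfl fun i _ => ?_) (cupLHom_eq_sum _).symm
    rw [betaHom_basisTensor, beta_cons]
    rfl

theorem betaNatural_counit (n k : ℕ) :
    BetaNatural n (k + 1) k (Finsupp.single (cograph Fin.succ) (1 : 𝕜)) := by
  match n with
  | 0 => exact betaNatural_zero _ (Or.inl (Nat.succ_ne_zero _))
  | m + 1 =>
    refine tensorPowerRep_hom_ext_cons fun i a => ?_
    rw [rep_comp_apply, rep_comp_apply, phiMap_counitFun, psiMap_counitFun, betaHom_basisTensor,
      betaHom_basisTensor, beta_cons]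
    exact (capRHom_cosetTmul i _).symm

theorem betaNatural_swap (n k : ℕ) :
    BetaNatural n (k + 2) (k + 2) (Finsupp.single (graph (swapFun k)) (1 : 𝕜)) := by
  match n with
  | 0 => exact betaNatural_zero _ (Or.inl (Nat.succ_ne_zero _))
  | m + 1 =>
    refine tensorPowerRep_hom_ext_cons fun i a => ?_
    obtain ⟨j, a, rfl⟩ := exists_eq_cons a
    rw [rep_comp_apply, rep_comp_apply, phiMap_swapFun, psiMap_swapFun, betaHom_basisTensor,
      betaHom_basisTensor, beta_cons, beta_cons, beta_cons, beta_cons]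
    exact (omega_swap_apply m k i j (beta (m + 1) k a)).symm

theorem betaNatural {n k l : ℕ} (f : ParHom 𝕜 k l) : BetaNatural n k l f := by
  refine par_induction (n : 𝕜) (P := fun k l f => BetaNatural n k l f) (fun k l => ?_)
    (fun f g hf hg => ?_) (fun r f hf => ?_) (fun k => ?_) (fun f g hf hg => ?_)
    (fun f hf => betaNatural_parL f hf) (betaNatural_mul n) (betaNatural_comul n)
    (betaNatural_unit n) (betaNatural_counit n) (betaNatural_swap n) f
  · rw [BetaNatural, LinearMap.map_zero, LinearMap.map_zero, LinearMap.map_zero, Limits.zero_comp, Limits.comp_zero]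
  · rw [BetaNatural, LinearMap.map_add, LinearMap.map_add, LinearMap.map_add, Preadditive.add_comp, Preadditive.comp_add, hf, hg]
  · rw [BetaNatural, LinearMap.map_smul, LinearMap.map_smul, LinearMap.map_smul, Linear.smul_comp, Linear.comp_smul, hf]
  · rw [BetaNatural, phiMap_id, psiMap_id, Category.id_comp]
    exact (Category.comp_id _).symm
  · rw [BetaNatural, phiMap_comp, psiMap_comp, omega_comp, Category.assoc, hg,
      ← Category.assoc, hf, Category.assoc]

end Naturality

end PartHeis

theorem mainTheorem4 (𝕜 : Type u) [CommRing 𝕜] (n : ℕ) :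
    Nonempty (Unique (PartHeis.Phi 𝕜 n)) ∧
    Nonempty (Unique (PartHeis.Psi (n : 𝕜))) ∧
    Nonempty (Unique (PartHeis.Theta 𝕜)) ∧
    (∀ Θ : PartHeis.Theta 𝕜, Nonempty (Unique (PartHeis.Omega Θ n))) ∧
    ∀ (Φ : PartHeis.Phi 𝕜 n) (Ψ : PartHeis.Psi (n : 𝕜)) (Θ : PartHeis.Theta 𝕜)
      (Ω : PartHeis.Omega Θ n),
      ∃ e : Φ.functor ≅ Ψ.functor ⋙ Ω.functor, ∀ (k : ℕ) (i : Fin k → Fin n),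
        (e.hom.app ⟨k⟩).hom (PartHeis.basisTensor 𝕜 n i) = PartHeis.beta n k i := by
  refine ⟨⟨⟨⟨PartHeis.phi 𝕜 n⟩, fun Φ => PartHeis.phi_unique _ _⟩⟩,
    ⟨⟨⟨PartHeis.psi _⟩, fun Ψ => PartHeis.psi_unique _ _⟩⟩,
    ⟨⟨⟨PartHeis.theta 𝕜⟩, fun Θ => PartHeis.theta_unique _ _⟩⟩, fun Θ => ?_, fun Φ Ψ Θ Ω => ?_⟩
  · obtain rfl := PartHeis.theta_unique (PartHeis.theta 𝕜) Θ
    exact ⟨⟨⟨PartHeis.omega 𝕜 n⟩, fun Ω => PartHeis.omega_unique _ _⟩⟩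
  -- By uniqueness the given functors are the constructed ones, for which the naturality squares
  -- have been checked.
  · obtain rfl := PartHeis.phi_unique (PartHeis.phi 𝕜 n) Φ
    obtain rfl := PartHeis.psi_unique (PartHeis.psi (n : 𝕜)) Ψ
    obtain rfl := PartHeis.theta_unique (PartHeis.theta 𝕜) Θ
    obtain rfl := PartHeis.omega_unique (PartHeis.omega 𝕜 n) Ω
    exact ⟨NatIso.ofComponents (fun X => PartHeis.betaIso 𝕜 n X.size)
      fun f => PartHeis.betaNatural f, fun k i => PartHeis.betaHom_basisTensor i⟩
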